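/- Let $k$ be a field of characteristic $0$ and let $\mathbf m=(m_\gamma)_{\gamma\in\Gamma}$, $\mathbf n=(n_\gamma)_{\gamma\in\Gamma}$ be families of integers $\ge 0$ indexed by an arbitrary (possibly infinite) set $\Gamma$. Let $\mathrm M_{m|n}$ be the super monoid over $k$ whose points in a commutative super $k$-algebra $A$ are the $A$-endomorphisms (of degree $0$) of $k^{m|n}\otimes_k A$, i.e. the $(m+n)\times(m+n)$ matrices with entries in $A_0$ in the diagonal blocks and in $A_1$ in the off-diagonal blocks, and let $\mathrm{GL}_{m|n}$ be the super group of its invertible points. Put $\mathrm M_{\mathbf m|\mathbf n}=\prod_{\gamma}\mathrm M_{m_\gamma|n_\gamma}$ and $\mathrm{GL}_{\mathbf m|\mathbf n}=\prod_{\gamma}\mathrm{GL}_{m_\gamma|n_\gamma}$, and let $\varepsilon$ be the $k$-point of $\mathrm{GL}_{\mathbf m|\mathbf n}\subset \mathrm M_{\mathbf m|\mathbf n}$ whose component at each $\gamma$ is $1$ on the even block and $-1$ on the odd block. For $G$ either of $\mathrm M_{\mathbf m|\mathbf n}$, $\mathrm{GL}_{\mathbf m|\mathbf n}$, a representation of $(G,\varepsilon)$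 is a finite-dimensional super $k$-vector space $V$ with an action of $G$ (a homomorphism from $G(A)$ to the monoid of $A$-endomorphisms of $V\otimes_kA$, natural in $A$) for which $\varepsilon$ acts as $(-1)^i$ on the degree $i$ part $V_i$. Write $E_\gamma$ for the standard representation on $k^{m_\gamma|n_\gamma}$, on which $\mathrm M_{\mathbf m|\mathbf n}$ acts through its factor $\mathrm M_{m_\gamma|n_\gamma}$. Let $V$ be a representation of $(\mathrm{GL}_{\mathbf m|\mathbf n},\varepsilon)$. Then: 1. There exists a representation $W\neq 0$ of $(\mathrm M_{\mathbf m|\mathbf n},\varepsilon)$ such that $V\otimes_k W$ is a representation of $(\mathrm M_{\mathbf m|\mathbf n},\varepsilon)$, i.e. the action of $\mathrm{GL}_{\mathbf m|\mathbf n}$ on $V\otimes_kW$ is the restriction of an action of $\mathrm M_{\mathbf m|\mathbf n}$ making $V\otimes_k W$ a representation of $(\mathrm M_{\mathbf m|\mathbf n},\varepsilon)$. 2. $V$ is a subrepresentation of a finite direct sum of representations of $(\mathrm{GL}_{\mathbf m|\mathbf n},\varepsilon)$ of the form $\bigotimes_{i=1}^{r}E_{\gamma_i}\otimes_k\bigotimes_{j=1}^{s}E_{\gamma'_j}^{\vee}$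 with $r,s\ge 0$ and $\gamma_i,\gamma'_j\in\Gamma$; and $V$ is also a quotient representation of a finite direct sum of representations of this form. -/

import Mathlib

open scoped TensorProduct

universe u v w w' a b b'

namespace SuperGL

/-! ## Super vector spaces -/

/-- The sign `(-1) ^ i` of a parity `i : ZMod 2`, as an element of `k`. -/
def sgn (k : Type u) [Field k] (i : ZMod 2) : k := if i = 0 then 1 else -1

/-- A super `k`-vector space: a `k`-vector space which is the direct sum of its summands
`gr 0` (even elements) and `gr 1` (odd elements). -/
structure SuperSpace (k : Type u) [Field k] where
  carrier : Type w
  [addCommGroup : AddCommGroup carrier]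
  [module : Module k carrier]
  gr : ZMod 2 → Submodule k carrier
  isCompl : IsCompl (gr 0) (gr 1)

instance {k : Type u} [Field k] : CoeSort (SuperSpace.{u, w} k) (Type w) :=
  ⟨SuperSpace.carrier⟩

attribute [instance] SuperSpace.addCommGroup SuperSpace.module

/-- A commutative super `k`-algebra: homogeneous elements of degrees `i` and `j` commute up to
the sign `(-1) ^ (i * j)`. -/
structure SCommAlg (k : Type u) [Field k] where
  carrier : Type a
  [ring : Ring carrier]
  [algebra : Algebra k carrier]
  gr : ZMod 2 → Submodule k carrier
  isCompl : IsCompl (gr 0) (gr 1)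
  one_mem : (1 : carrier) ∈ gr 0
  mul_mem : ∀ {i j : ZMod 2} {x y : carrier}, x ∈ gr i → y ∈ gr j → x * y ∈ gr (i + j)
  super_comm : ∀ {i j : ZMod 2} {x y : carrier}, x ∈ gr i → y ∈ gr j →
    x * y = sgn k (i * j) • (y * x)

instance {k : Type u} [Field k] : CoeSort (SCommAlg.{u, a} k) (Type a) :=
  ⟨SCommAlg.carrier⟩

attribute [instance] SCommAlg.ring SCommAlg.algebra

/-- The underlying super vector space of a commutative super algebra. -/
abbrev SCommAlg.toSuperSpace {k : Type u} [Field k] (A : SCommAlg.{u, a} k) :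
    SuperSpace.{u, a} k where
  carrier := A
  gr := A.gr
  isCompl := A.isCompl

/-- Homomorphisms of commutative super algebras: algebra homomorphisms of degree `0`. -/
structure SCommAlg.Hom {k : Type u} [Field k] (A B : SCommAlg.{u, a} k) where
  toAlgHom : A →ₐ[k] B
  map_gr : ∀ (i : ZMod 2) (x : A), x ∈ A.gr i → toAlgHom x ∈ B.gr i

/-- The identity homomorphism. -/
def SCommAlg.Hom.id {k : Type u} [Field k] (A : SCommAlg.{u, a} k) : A.Hom A :=
  ⟨AlgHom.id k A, fun _ _ h => h⟩

/-- Composition of homomorphisms. -/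
def SCommAlg.Hom.comp {k : Type u} [Field k] {A B C : SCommAlg.{u, a} k}
    (g : B.Hom C) (f : A.Hom B) : A.Hom C :=
  ⟨g.toAlgHom.comp f.toAlgHom, fun i x h => g.map_gr i _ (f.map_gr i x h)⟩

section gradings

variable {k : Type u} [Field k]

theorem sgn_zero : sgn k 0 = 1 := by simp [sgn]

theorem sgn_one : sgn k 1 = -1 := by simp [sgn]

theorem zmod2_cases (i : ZMod 2) : i = 0 ∨ i = 1 := by
  revert i; decide

theorem zmod2_succ {i j : ZMod 2} (h : ¬ j = i) : j + 1 = i := by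
  revert i j; decide

theorem zmod2_eq_of_add {i j : ZMod 2} (h : i + j = 0) : i = j := by
  revert i j; decide

theorem sgn_add (i j : ZMod 2) : sgn k (i + j) = sgn k i * sgn k j := by
  have h : (1 + 1 : ZMod 2) = 0 := by decide
  rcases zmod2_cases i with rfl | rfl <;> rcases zmod2_cases j with rfl | rfl <;>
    simp [sgn, h]

theorem sgn_mul_self (i : ZMod 2) : sgn k i * sgn k i = 1 := by
  rcases zmod2_cases i with rfl | rfl <;> simp [sgn]

theorem isCompl_of_proj {X : Type w} [AddCommGroup X] [Module k X] {S T : Submodule k X}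
    (P : X →ₗ[k] X) (hS : ∀ x ∈ S, P x = x) (hT : ∀ x ∈ T, P x = 0) (h : ⊤ ≤ S ⊔ T) :
    IsCompl S T := by
  refine ⟨?_, codisjoint_iff_le_sup.2 h⟩
  rw [Submodule.disjoint_def]
  intro x h1 h2
  rw [← hS x h1, hT x h2]

theorem SuperSpace.isCompl' (V : SuperSpace.{u, w} k) (i : ZMod 2) :
    IsCompl (V.gr i) (V.gr (i + 1)) := by
  rcases zmod2_cases i with rfl | rfl
  · exact V.isCompl
  · exact V.isCompl.symm

/-- The projection of a super vector space onto its summand of degree `i`. -/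
noncomputable def SuperSpace.pr (V : SuperSpace.{u, w} k) (i : ZMod 2) : V →ₗ[k] V :=
  (V.gr i).projection (V.gr (i + 1)) (V.isCompl' i)

theorem SuperSpace.pr_mem (V : SuperSpace.{u, w} k) (i : ZMod 2) (x : V) : V.pr i x ∈ V.gr i :=
  Submodule.projection_apply_mem _ _

theorem SuperSpace.pr_of_mem (V : SuperSpace.{u, w} k) {i : ZMod 2} (j : ZMod 2) {x : V}
    (h : x ∈ V.gr i) : V.pr j x = if j = i then x else 0 := by
  split_ifs with hji
  · subst hji
    exact Submodule.projection_apply_of_mem_left _ h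
  · refine Submodule.projection_apply_of_mem_right _ ?_
    rwa [zmod2_succ hji]

theorem SuperSpace.pr_add_pr (V : SuperSpace.{u, w} k) (x : V) : V.pr 0 x + V.pr 1 x = x := by
  have hx : x ∈ V.gr 0 ⊔ V.gr 1 := by rw [V.isCompl.sup_eq_top]; trivial
  obtain ⟨y, hy, z, hz, rfl⟩ := Submodule.mem_sup.1 hx
  rw [map_add, map_add, V.pr_of_mem 0 hy, V.pr_of_mem 0 hz, V.pr_of_mem 1 hy, V.pr_of_mem 1 hz]
  simp

theorem SuperSpace.mem_of_pr (V : SuperSpace.{u, w} k) (i : ZMod 2) (x : V)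
    (h : V.pr (i + 1) x = 0) : x ∈ V.gr i := by
  have h1 := V.pr_add_pr x
  rcases zmod2_cases i with rfl | rfl
  · rw [zero_add] at h
    rw [h, add_zero] at h1
    rw [← h1]; exact V.pr_mem 0 x
  · have h2 : (1 + 1 : ZMod 2) = 0 := by decide
    rw [h2] at h
    rw [h, zero_add] at h1
    rw [← h1]; exact V.pr_mem 1 x

/-- The parity involution, acting as `(-1) ^ i` in degree `i`. -/
noncomputable def SuperSpace.parity (V : SuperSpace.{u, w} k) : V →ₗ[k] V := V.pr 0 - V.pr 1

theorem SuperSpace.parity_of_mem (V : SuperSpace.{u, w} k) {i : ZMod 2} {x : V}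
    (h : x ∈ V.gr i) : V.parity x = sgn k i • x := by
  rw [SuperSpace.parity, LinearMap.sub_apply, V.pr_of_mem 0 h, V.pr_of_mem 1 h]
  rcases zmod2_cases i with rfl | rfl <;> simp [sgn]

theorem SuperSpace.hom_ext (V : SuperSpace.{u, w} k) {X : Type w'} [AddCommGroup X] [Module k X]
    {f g : V →ₗ[k] X} (h : ∀ i, ∀ x ∈ V.gr i, f x = g x) : f = g := by
  ext x
  rw [← V.pr_add_pr x, map_add, map_add, h 0 _ (V.pr_mem 0 x), h 1 _ (V.pr_mem 1 x)]

theorem SuperSpace.parity_parity (V : SuperSpace.{u, w} k) (x : V) :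
    V.parity (V.parity x) = x := by
  have : V.parity ∘ₗ V.parity = LinearMap.id := V.hom_ext fun i x hx => by
    rw [LinearMap.comp_apply, V.parity_of_mem hx, map_smul, V.parity_of_mem hx, smul_smul,
      sgn_mul_self, one_smul, LinearMap.id_apply]
  exact LinearMap.congr_fun this x

/-- The tensor product of super vector spaces: the summand of degree `n` is spanned by the
`x ⊗ y` with `x`, `y` homogeneous of degrees adding up to `n`. -/
def tensorGr (V : SuperSpace.{u, w} k) (W : SuperSpace.{u, w'} k) (n : ZMod 2) :
    Submodule k (V ⊗[k] W) :=
  Submodule.span k {z | ∃ i j, i + j = n ∧ ∃ x ∈ V.gr i, ∃ y ∈ W.gr j, z = x ⊗ₜ[k] y}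

theorem tmul_mem {V : SuperSpace.{u, w} k} {W : SuperSpace.{u, w'} k} {i j : ZMod 2} {x : V}
    {y : W} (hx : x ∈ V.gr i) (hy : y ∈ W.gr j) : x ⊗ₜ[k] y ∈ tensorGr V W (i + j) :=
  Submodule.subset_span ⟨i, j, rfl, x, hx, y, hy, rfl⟩

theorem tmul_mem_zero {V : SuperSpace.{u, w} k} {W : SuperSpace.{u, w'} k} {i : ZMod 2} {x : V}
    {y : W} (hx : x ∈ V.gr i) (hy : y ∈ W.gr 0) : x ⊗ₜ[k] y ∈ tensorGr V W i := by
  simpa using tmul_mem hx hy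

theorem tensorGr_isCompl (V : SuperSpace.{u, w} k) (W : SuperSpace.{u, w'} k) :
    IsCompl (tensorGr V W 0) (tensorGr V W 1) := by
  refine isCompl_of_proj (TensorProduct.map (V.pr 0) (W.pr 0) + TensorProduct.map (V.pr 1) (W.pr 1))
    ?_ ?_ ?_
  · intro z hz
    induction hz using Submodule.span_induction with
    | mem z hz =>
      obtain ⟨i, j, hij, x, hx, y, hy, rfl⟩ := hz
      have : i = j := zmod2_eq_of_add hij
      subst this
      rw [LinearMap.add_apply, TensorProduct.map_tmul, TensorProduct.map_tmul, V.pr_of_mem 0 hx,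
        V.pr_of_mem 1 hx, W.pr_of_mem 0 hy, W.pr_of_mem 1 hy]
      rcases zmod2_cases i with rfl | rfl <;> simp
    | zero => simp
    | add x y _ _ hx hy => rw [map_add, hx, hy]
    | smul c x _ hx => rw [map_smul, hx]
  · intro z hz
    induction hz using Submodule.span_induction with
    | mem z hz =>
      obtain ⟨i, j, hij, x, hx, y, hy, rfl⟩ := hz
      rw [LinearMap.add_apply, TensorProduct.map_tmul, TensorProduct.map_tmul, V.pr_of_mem 0 hx,
        V.pr_of_mem 1 hx, W.pr_of_mem 0 hy, W.pr_of_mem 1 hy]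
      rcases zmod2_cases i with rfl | rfl <;> rcases zmod2_cases j with rfl | rfl <;> simp_all
    | zero => simp
    | add x y _ _ hx hy => rw [map_add, hx, hy, add_zero]
    | smul c x _ hx => rw [map_smul, hx, smul_zero]
  · intro z _
    induction z using TensorProduct.induction_on with
    | zero => exact Submodule.zero_mem _
    | add x y hx hy => exact Submodule.add_mem _ (hx trivial) (hy trivial)
    | tmul x y =>
      have key : ∀ i j, V.pr i x ⊗ₜ[k] W.pr j y ∈ tensorGr V W 0 ⊔ tensorGr V W 1 := by
        intro i j
        have h := tmul_mem (V.pr_mem i x) (W.pr_mem j y)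
        rcases zmod2_cases (i + j) with h0 | h0 <;> rw [h0] at h
        · exact Submodule.mem_sup_left h
        · exact Submodule.mem_sup_right h
      rw [← V.pr_add_pr x, ← W.pr_add_pr y, TensorProduct.add_tmul, TensorProduct.tmul_add,
        TensorProduct.tmul_add]
      exact Submodule.add_mem _ (Submodule.add_mem _ (key 0 0) (key 0 1))
        (Submodule.add_mem _ (key 1 0) (key 1 1))

/-- The tensor product `V ⊗ W` of super vector spaces. -/
abbrev SuperSpace.tensor (V : SuperSpace.{u, w} k) (W : SuperSpace.{u, w'} k) :
    SuperSpace.{u, max w w'} k where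
  carrier := V ⊗[k] W
  gr := tensorGr V W
  isCompl := tensorGr_isCompl V W

/-- The unit super vector space: `k` in degree `0`. -/
abbrev SuperSpace.unit (k : Type u) [Field k] : SuperSpace.{u, u} k where
  carrier := k
  gr i := if i = 0 then ⊤ else ⊥
  isCompl := by simpa using isCompl_top_bot

/-- The dual super vector space: the summand of degree `i` consists of the linear forms that
vanish on the summand of `V` of the other degree. -/
abbrev SuperSpace.dual (V : SuperSpace.{u, w} k) : SuperSpace.{u, max u w} k where
  carrier := Module.Dual k V
  gr i := (V.gr (i + 1)).dualAnnihilator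
  isCompl := by
    refine isCompl_of_proj ((V.pr 0).dualMap) ?_ ?_ ?_
    · intro f hf
      refine V.hom_ext fun i x hx => ?_
      rw [LinearMap.dualMap_apply, V.pr_of_mem 0 hx]
      rcases zmod2_cases i with rfl | rfl
      · simp
      · simpa using ((Submodule.mem_dualAnnihilator f).1 hf x hx).symm
    · intro f hf
      refine V.hom_ext fun i x hx => ?_
      rw [LinearMap.dualMap_apply, V.pr_of_mem 0 hx]
      have h2 : (1 + 1 : ZMod 2) = 0 := by decide
      rw [h2] at hf
      rcases zmod2_cases i with rfl | rfl
      · simpa using (Submodule.mem_dualAnnihilator f).1 hf x hx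
      · simp
    · intro f _
      refine Submodule.mem_sup.2 ⟨f ∘ₗ V.pr 0, ?_, f ∘ₗ V.pr 1, ?_, ?_⟩
      · rw [Submodule.mem_dualAnnihilator]
        intro x hx
        rw [LinearMap.comp_apply, V.pr_of_mem 0 hx]
        simp
      · rw [Submodule.mem_dualAnnihilator]
        intro x hx
        rw [LinearMap.comp_apply, V.pr_of_mem 1 hx]
        have h2 : (1 + 1 : ZMod 2) = 0 := by decide
        simp [h2]
      · ext x
        rw [LinearMap.add_apply, LinearMap.comp_apply, LinearMap.comp_apply, ← map_add,
          V.pr_add_pr]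

/-- The direct sum of a finite family of super vector spaces. -/
abbrev SuperSpace.directSum {N : ℕ} (X : Fin N → SuperSpace.{u, w} k) : SuperSpace.{u, w} k where
  carrier := ∀ i, X i
  gr d := Submodule.pi Set.univ fun i => (X i).gr d
  isCompl := by
    refine isCompl_of_proj (LinearMap.pi fun i => (X i).pr 0 ∘ₗ LinearMap.proj i) ?_ ?_ ?_
    · intro x hx
      ext i
      simpa using (X i).pr_of_mem 0 (hx i trivial)
    · intro x hx
      ext i
      simpa using (X i).pr_of_mem 0 (hx i trivial)
    · intro x _
      exact Submodule.mem_sup.2 ⟨fun i => (X i).pr 0 (x i), fun i _ => (X i).pr_mem 0 _,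
        fun i => (X i).pr 1 (x i), fun i _ => (X i).pr_mem 1 _,
        funext fun i => (X i).pr_add_pr _⟩

/-- The super vector space with basis the finite set `ι`, where the basis element `s` has
degree `p s`. -/
abbrev SuperSpace.free (k : Type u) [Field k] {ι : Type} (p : ι → ZMod 2) :
    SuperSpace.{u, u} k where
  carrier := ι → k
  gr d :=
    { carrier := {x | ∀ s, p s ≠ d → x s = 0}
      add_mem' := fun hx hy s h => by simp [hx s h, hy s h]
      zero_mem' := fun _ _ => rfl
      smul_mem' := fun c x hx s h => by simp [hx s h] }
  isCompl := by
    refine isCompl_of_proj (LinearMap.pi fun s => (if p s = 0 then 1 else 0 : k) •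
      LinearMap.proj s) ?_ ?_ ?_
    · intro x hx
      ext s
      by_cases h : p s = 0
      · simp [h]
      · simp [h, hx s h]
    · intro x hx
      ext s
      by_cases h : p s = 0
      · simp [h, hx s (by rw [h]; decide)]
      · simp [h]
    · intro x _
      refine Submodule.mem_sup.2 ⟨fun s => if p s = 0 then x s else 0, fun s h => by simp [h],
        fun s => if p s = 0 then 0 else x s, fun s h => ?_, ?_⟩
      · have : p s = 0 := (zmod2_cases (p s)).resolve_right h
        simp [this]
      · ext s
        by_cases h : p s = 0 <;> simp [h]

end gradings

/-! ## Endomorphisms over a commutative super algebra -/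

section ends

variable {k : Type u} [Field k]

/-- Right multiplication by `x` on the right `A`-module `V ⊗ A`. -/
noncomputable def rmul (V : SuperSpace.{u, w} k) (A : SCommAlg.{u, a} k) (x : A) :
    V ⊗[k] A →ₗ[k] V ⊗[k] A :=
  LinearMap.lTensor V (LinearMap.mulRight k x)

theorem rmul_tmul (V : SuperSpace.{u, w} k) (A : SCommAlg.{u, a} k) (x : A) (v : V) (y : A) :
    rmul V A x (v ⊗ₜ[k] y) = v ⊗ₜ[k] (y * x) := rfl

theorem rmul_rmul (V : SuperSpace.{u, w} k) (A : SCommAlg.{u, a} k) (x y : A) (z : V ⊗[k] A) :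
    rmul V A x (rmul V A y z) = rmul V A (y * x) z := by
  induction z using TensorProduct.induction_on with
  | zero => simp
  | add z t hz ht => simp only [map_add, hz, ht]
  | tmul v c => simp only [rmul_tmul, mul_assoc]

/-- The monoid of `A`-endomorphisms of the super `A`-module `V ⊗ A`: the endomorphisms of degree
`0` of the right `A`-module `V ⊗ A`. -/
def AEnd (V : SuperSpace.{u, w} k) (A : SCommAlg.{u, a} k) :
    Submonoid (Module.End k (V ⊗[k] A)) where
  carrier := {φ | (∀ (x : A) (z : V ⊗[k] A), φ (rmul V A x z) = rmul V A x (φ z)) ∧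
    ∀ i, ∀ z ∈ tensorGr V A.toSuperSpace i, φ z ∈ tensorGr V A.toSuperSpace i}
  one_mem' := ⟨fun _ _ => rfl, fun _ _ h => h⟩
  mul_mem' := fun {φ ψ} hφ hψ =>
    ⟨fun x z => by rw [Module.End.mul_apply, hψ.1, hφ.1, Module.End.mul_apply],
      fun i z hz => hφ.2 i _ (hψ.2 i z hz)⟩

theorem tensor_hom_ext {V : SuperSpace.{u, w} k} {W : SuperSpace.{u, w'} k} {X : Type b}
    [AddCommGroup X] [Module k X] {f g : V ⊗[k] W →ₗ[k] X}
    (h : ∀ i j, ∀ x ∈ V.gr i, ∀ y ∈ W.gr j, f (x ⊗ₜ[k] y) = g (x ⊗ₜ[k] y)) : f = g := by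
  refine TensorProduct.ext (V.hom_ext fun i x hx => W.hom_ext fun j y hy => ?_)
  exact h i j x hx y hy

/-- The identification of `(V ⊗ A) ⊗_A (W ⊗ A)` with `(V ⊗ W) ⊗ A`, composed with the projection
from `(V ⊗ A) ⊗ (W ⊗ A)`. It sends `(v ⊗ x) ⊗ (w ⊗ y)` to `(-1) ^ (i * j) (v ⊗ w) ⊗ x y` for `x` of
degree `i` and `w` of degree `j`. -/
noncomputable def superMul (V : SuperSpace.{u, w} k) (W : SuperSpace.{u, w'} k)
    (A : SCommAlg.{u, a} k) : (V ⊗[k] A) ⊗[k] (W ⊗[k] A) →ₗ[k] (V ⊗[k] W) ⊗[k] A :=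
  LinearMap.lTensor (V ⊗[k] W) (LinearMap.mul' k A) ∘ₗ
    (TensorProduct.tensorTensorTensorComm k V A W A).toLinearMap ∘ₗ
    (TensorProduct.map LinearMap.id (LinearMap.rTensor A (W.pr 0)) +
      TensorProduct.map (LinearMap.lTensor V A.toSuperSpace.parity)
        (LinearMap.rTensor A (W.pr 1)))

theorem superMul_tmul (V : SuperSpace.{u, w} k) (W : SuperSpace.{u, w'} k)
    (A : SCommAlg.{u, a} k) {i j : ZMod 2} (v : V) {x : A} (hx : x ∈ A.gr i) {t : W}
    (ht : t ∈ W.gr j) (y : A) :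
    superMul V W A ((v ⊗ₜ[k] x) ⊗ₜ[k] (t ⊗ₜ[k] y)) =
      sgn k (i * j) • ((v ⊗ₜ[k] t) ⊗ₜ[k] (x * y)) := by
  have hp := A.toSuperSpace.parity_of_mem hx
  simp only [superMul, LinearMap.comp_apply, LinearMap.add_apply, TensorProduct.map_tmul,
    LinearMap.rTensor_tmul, LinearMap.lTensor_tmul, W.pr_of_mem 0 ht, W.pr_of_mem 1 ht, hp]
  rcases zmod2_cases j with rfl | rfl
  · simp [sgn_zero]
  · simp [← TensorProduct.smul_tmul']

theorem superMul_one (V : SuperSpace.{u, w} k) (W : SuperSpace.{u, w'} k)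
    (A : SCommAlg.{u, a} k) (v : V) (t : W) (y : A) :
    superMul V W A ((v ⊗ₜ[k] 1) ⊗ₜ[k] (t ⊗ₜ[k] y)) = (v ⊗ₜ[k] t) ⊗ₜ[k] y := by
  have key : ∀ j, ∀ t ∈ W.gr j,
      superMul V W A ((v ⊗ₜ[k] 1) ⊗ₜ[k] (t ⊗ₜ[k] y)) = (v ⊗ₜ[k] t) ⊗ₜ[k] y := by
    intro j t ht
    rw [superMul_tmul V W A v A.one_mem ht, zero_mul, sgn_zero, one_smul, one_mul]
  rw [← W.pr_add_pr t]
  simp only [TensorProduct.add_tmul, TensorProduct.tmul_add, map_add, key 0 _ (W.pr_mem 0 t),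
    key 1 _ (W.pr_mem 1 t)]

theorem superMul_rmul (V : SuperSpace.{u, w} k) (W : SuperSpace.{u, w'} k)
    (A : SCommAlg.{u, a} k) (z : V ⊗[k] A) (t : W ⊗[k] A) (x : A) :
    superMul V W A (z ⊗ₜ[k] rmul W A x t) =
      rmul (V.tensor W) A x (superMul V W A (z ⊗ₜ[k] t)) := by
  have h : (superMul V W A) ∘ₗ LinearMap.lTensor _ (rmul W A x) =
      rmul (V.tensor W) A x ∘ₗ superMul V W A := by
    refine TensorProduct.ext (tensor_hom_ext (W := A.toSuperSpace) fun i j v hv c hc =>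
      tensor_hom_ext (W := A.toSuperSpace) fun l m t ht d hd => ?_)
    simp only [LinearMap.compr₂ₛₗ_apply, TensorProduct.mk_apply, LinearMap.comp_apply,
      LinearMap.lTensor_tmul, rmul_tmul]
    rw [superMul_tmul V W A v hc ht, superMul_tmul V W A v hc ht, map_smul]
    erw [rmul_tmul]
    rw [mul_assoc]
  exact LinearMap.congr_fun h (z ⊗ₜ[k] t)

theorem superMul_mem (V : SuperSpace.{u, w} k) (W : SuperSpace.{u, w'} k)
    (A : SCommAlg.{u, a} k) {i j : ZMod 2} {z : V ⊗[k] A} {t : W ⊗[k] A}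
    (hz : z ∈ tensorGr V A.toSuperSpace i) (ht : t ∈ tensorGr W A.toSuperSpace j) :
    superMul V W A (z ⊗ₜ[k] t) ∈ tensorGr (V.tensor W) A.toSuperSpace (i + j) := by
  induction hz using Submodule.span_induction with
  | zero => simp
  | add x y _ _ hx hy => rw [TensorProduct.add_tmul, map_add]; exact Submodule.add_mem _ hx hy
  | smul c x _ hx =>
    rw [← TensorProduct.smul_tmul', map_smul]; exact Submodule.smul_mem _ _ hx
  | mem z hz =>
    obtain ⟨i1, i2, rfl, v, hv, x, hx, rfl⟩ := hz
    induction ht using Submodule.span_induction with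
    | zero => simp
    | add x y _ _ hx hy => rw [TensorProduct.tmul_add, map_add]; exact Submodule.add_mem _ hx hy
    | smul c x _ hx =>
      rw [TensorProduct.tmul_smul, map_smul]; exact Submodule.smul_mem _ _ hx
    | mem t ht =>
      obtain ⟨j1, j2, rfl, s, hs, y, hy, rfl⟩ := ht
      rw [superMul_tmul V W A v hx hs]
      refine Submodule.smul_mem _ _ ?_
      have h := tmul_mem (V := V.tensor W) (W := A.toSuperSpace) (tmul_mem hv hs)
        (A.mul_mem hx hy)
      rwa [add_add_add_comm] at h

theorem rmul_superMul (V : SuperSpace.{u, w} k) (W : SuperSpace.{u, w'} k)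
    (A : SCommAlg.{u, a} k) {i j : ZMod 2} {x : A} (hx : x ∈ A.gr i) (z : V ⊗[k] A)
    {t : W ⊗[k] A} (ht : t ∈ tensorGr W A.toSuperSpace j) :
    superMul V W A (rmul V A x z ⊗ₜ[k] t) =
      sgn k (i * j) • superMul V W A (z ⊗ₜ[k] rmul W A x t) := by
  induction ht using Submodule.span_induction with
  | zero => simp
  | add p q _ _ hp hq => simp only [TensorProduct.tmul_add, map_add, hp, hq, smul_add]
  | smul c p _ hp => simp only [TensorProduct.tmul_smul, map_smul, hp, smul_comm c]
  | mem t ht =>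
    obtain ⟨j1, j2, rfl, s, hs, y, hy, rfl⟩ := ht
    have h : (superMul V W A) ∘ₗ (TensorProduct.mk k _ _).flip (s ⊗ₜ[k] y) ∘ₗ rmul V A x =
        sgn k (i * (j1 + j2)) • (superMul V W A) ∘ₗ
          (TensorProduct.mk k _ _).flip (s ⊗ₜ[k] (y * x)) := by
      refine tensor_hom_ext (W := A.toSuperSpace) fun l m v hv c hc => ?_
      simp only [LinearMap.comp_apply, rmul_tmul, LinearMap.flip_apply, TensorProduct.mk_apply,
        LinearMap.smul_apply]
      rw [superMul_tmul V W A v (A.mul_mem hc hx) hs, superMul_tmul V W A v hc hs, mul_assoc,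
        A.super_comm hx hy, mul_smul_comm, TensorProduct.tmul_smul, smul_smul, smul_smul,
        ← sgn_add, ← sgn_add, ← mul_assoc]
      congr 2
      ring
    exact LinearMap.congr_fun h z

theorem superMul_gr_ext (V : SuperSpace.{u, w} k) (A : SCommAlg.{u, a} k) {X : Type b}
    [AddCommGroup X] [Module k X] {f g : V ⊗[k] A →ₗ[k] X}
    (h : ∀ i j, ∀ v ∈ V.gr i, ∀ x ∈ A.gr j, f (v ⊗ₜ[k] x) = g (v ⊗ₜ[k] x)) : f = g :=
  tensor_hom_ext (W := A.toSuperSpace) h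

/-- The section `(v ⊗ t) ⊗ y ↦ (v ⊗ 1) ⊗ (t ⊗ y)` of `superMul`. -/
noncomputable def superSec (V : SuperSpace.{u, w} k) (W : SuperSpace.{u, w'} k)
    (A : SCommAlg.{u, a} k) : (V ⊗[k] W) ⊗[k] A →ₗ[k] (V ⊗[k] A) ⊗[k] (W ⊗[k] A) :=
  LinearMap.rTensor (W ⊗[k] A) ((TensorProduct.mk k V A).flip 1) ∘ₗ
    (TensorProduct.assoc k V W A).toLinearMap

theorem superSec_tmul (V : SuperSpace.{u, w} k) (W : SuperSpace.{u, w'} k)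
    (A : SCommAlg.{u, a} k) (v : V) (t : W) (y : A) :
    superSec V W A ((v ⊗ₜ[k] t) ⊗ₜ[k] y) = (v ⊗ₜ[k] 1) ⊗ₜ[k] (t ⊗ₜ[k] y) := rfl

theorem superMul_superSec (V : SuperSpace.{u, w} k) (W : SuperSpace.{u, w'} k)
    (A : SCommAlg.{u, a} k) (z : (V ⊗[k] W) ⊗[k] A) :
    superMul V W A (superSec V W A z) = z := by
  have h : superMul V W A ∘ₗ superSec V W A = LinearMap.id := by
    refine TensorProduct.ext_threefold fun v t y => ?_
    rw [LinearMap.comp_apply, superSec_tmul, superMul_one, LinearMap.id_apply]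
  exact LinearMap.congr_fun h z

/-- The tensor product over `A` of `A`-endomorphisms `φ` of `V ⊗ A` and `ψ` of `W ⊗ A`, as an
endomorphism of `(V ⊗ W) ⊗ A`. -/
noncomputable def tensorEnd (V : SuperSpace.{u, w} k) (W : SuperSpace.{u, w'} k)
    (A : SCommAlg.{u, a} k) (φ : Module.End k (V ⊗[k] A)) (ψ : Module.End k (W ⊗[k] A)) :
    Module.End k ((V ⊗[k] W) ⊗[k] A) :=
  superMul V W A ∘ₗ TensorProduct.map φ ψ ∘ₗ superSec V W A

theorem tensorEnd_superMul {V : SuperSpace.{u, w} k} {W : SuperSpace.{u, w'} k}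
    {A : SCommAlg.{u, a} k} (φ : AEnd V A) (ψ : AEnd W A) (z : V ⊗[k] A) (t : W ⊗[k] A) :
    tensorEnd V W A φ ψ (superMul V W A (z ⊗ₜ[k] t)) =
      superMul V W A (φ.1 z ⊗ₜ[k] ψ.1 t) := by
  have h : tensorEnd V W A φ ψ ∘ₗ superMul V W A =
      superMul V W A ∘ₗ TensorProduct.map φ.1 ψ.1 := by
    refine TensorProduct.ext (superMul_gr_ext V A fun i j v hv x hx =>
      superMul_gr_ext W A fun l m t ht y hy => ?_)
    simp only [LinearMap.compr₂ₛₗ_apply, TensorProduct.mk_apply, LinearMap.comp_apply,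
      TensorProduct.map_tmul]
    rw [superMul_tmul V W A v hx ht, map_smul]
    have h1 : v ⊗ₜ[k] x = rmul V A x (v ⊗ₜ[k] 1) := by rw [rmul_tmul, one_mul]
    have h2 : t ⊗ₜ[k] y = rmul W A y (t ⊗ₜ[k] 1) := by rw [rmul_tmul, one_mul]
    have h3 : t ⊗ₜ[k] (x * y) = rmul W A (x * y) (t ⊗ₜ[k] 1) := by rw [rmul_tmul, one_mul]
    have h4 : t ⊗ₜ[k] (1 : A) ∈ tensorGr W A.toSuperSpace l := tmul_mem_zero ht A.one_mem
    rw [h1, h2, φ.2.1, ψ.2.1, superMul_rmul, rmul_superMul V W A hx _ (ψ.2.2 l _ h4), map_smul,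
      superMul_rmul, rmul_rmul]
    congr 1
    simp only [tensorEnd, LinearMap.comp_apply, superSec_tmul, TensorProduct.map_tmul]
    rw [h3, ψ.2.1, superMul_rmul]
  exact LinearMap.congr_fun h (z ⊗ₜ[k] t)

theorem superMul_ext {V : SuperSpace.{u, w} k} {W : SuperSpace.{u, w'} k}
    {A : SCommAlg.{u, a} k} {X : Type b} [AddCommGroup X] [Module k X]
    {f g : (V ⊗[k] W) ⊗[k] A →ₗ[k] X}
    (h : ∀ z t, f (superMul V W A (z ⊗ₜ[k] t)) = g (superMul V W A (z ⊗ₜ[k] t))) : f = g := by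
  refine TensorProduct.ext_threefold fun v t y => ?_
  rw [← superMul_one]
  exact h _ _

theorem tensorEnd_mem {V : SuperSpace.{u, w} k} {W : SuperSpace.{u, w'} k}
    {A : SCommAlg.{u, a} k} (φ : AEnd V A) (ψ : AEnd W A) :
    tensorEnd V W A φ ψ ∈ AEnd (V.tensor W) A := by
  refine ⟨fun x z => ?_, fun n z hz => ?_⟩
  · have h : tensorEnd V W A φ ψ ∘ₗ rmul (V.tensor W) A x =
        rmul (V.tensor W) A x ∘ₗ tensorEnd V W A φ ψ := by
      refine superMul_ext fun z t => ?_
      rw [LinearMap.comp_apply, LinearMap.comp_apply, ← superMul_rmul, tensorEnd_superMul,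
        tensorEnd_superMul, ψ.2.1, superMul_rmul]
    exact LinearMap.congr_fun h z
  · induction hz using Submodule.span_induction with
    | zero => simp
    | add x y _ _ hx hy => rw [map_add]; exact Submodule.add_mem _ hx hy
    | smul c x _ hx => rw [map_smul]; exact Submodule.smul_mem _ _ hx
    | mem z hz =>
      obtain ⟨i, j, rfl, z, hz, y, hy, rfl⟩ := hz
      induction hz using Submodule.span_induction with
      | zero => simp
      | add x y _ _ hx hy =>
        rw [TensorProduct.add_tmul, map_add]; exact Submodule.add_mem _ hx hy
      | smul c x _ hx =>
        rw [← TensorProduct.smul_tmul', map_smul]; exact Submodule.smul_mem _ _ hx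
      | mem z hz =>
        obtain ⟨i1, i2, rfl, v, hv, t, ht, rfl⟩ := hz
        rw [← superMul_one, tensorEnd_superMul, add_assoc]
        exact superMul_mem V W A (φ.2.2 _ _ (tmul_mem_zero hv A.one_mem))
          (ψ.2.2 _ _ (tmul_mem (W := A.toSuperSpace) ht hy))

theorem tensorEnd_one (V : SuperSpace.{u, w} k) (W : SuperSpace.{u, w'} k)
    (A : SCommAlg.{u, a} k) : tensorEnd V W A 1 1 = 1 := by
  refine superMul_ext fun z t => ?_
  exact tensorEnd_superMul (1 : AEnd V A) (1 : AEnd W A) z t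

theorem tensorEnd_mul {V : SuperSpace.{u, w} k} {W : SuperSpace.{u, w'} k}
    {A : SCommAlg.{u, a} k} (φ φ' : AEnd V A) (ψ ψ' : AEnd W A) :
    tensorEnd V W A (φ * φ' : AEnd V A) (ψ * ψ' : AEnd W A) =
      tensorEnd V W A φ ψ * tensorEnd V W A φ' ψ' := by
  refine superMul_ext fun z t => ?_
  rw [Module.End.mul_apply, tensorEnd_superMul, tensorEnd_superMul, tensorEnd_superMul]
  rfl

end ends

/-! ## Duals -/

section duals

variable {k : Type u} [Field k]

/-- The `A`-bilinear extension of the pairing of `V` with its dual. It sends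
`(ξ ⊗ x) ⊗ (v ⊗ y)` to `(-1) ^ (i * j) ξ(v) x y` for `x` of degree `i` and `v` of degree `j`. -/
noncomputable def superPair (V : SuperSpace.{u, w} k) (A : SCommAlg.{u, a} k) :
    (V.dual ⊗[k] A) ⊗[k] (V ⊗[k] A) →ₗ[k] A :=
  (TensorProduct.lid k A).toLinearMap ∘ₗ LinearMap.rTensor A (contractLeft k V) ∘ₗ
    superMul V.dual V A

theorem superPair_tmul (V : SuperSpace.{u, w} k) (A : SCommAlg.{u, a} k) {i j : ZMod 2}
    (ξ : V.dual) {x : A} (hx : x ∈ A.gr i) {v : V} (hv : v ∈ V.gr j) (y : A) :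
    superPair V A ((ξ ⊗ₜ[k] x) ⊗ₜ[k] (v ⊗ₜ[k] y)) = sgn k (i * j) • ξ v • (x * y) := by
  simp only [superPair, LinearMap.comp_apply]
  rw [superMul_tmul V.dual V A ξ hx hv]
  simp

theorem superPair_rmul (V : SuperSpace.{u, w} k) (A : SCommAlg.{u, a} k)
    (z : V.dual ⊗[k] A) (t : V ⊗[k] A) (x : A) :
    superPair V A (z ⊗ₜ[k] rmul V A x t) = superPair V A (z ⊗ₜ[k] t) * x := by
  simp only [superPair, LinearMap.comp_apply]
  rw [superMul_rmul]
  generalize superMul V.dual V A (z ⊗ₜ[k] t) = s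
  have h : (TensorProduct.lid k A).toLinearMap ∘ₗ LinearMap.rTensor A (contractLeft k V) ∘ₗ
      rmul (V.dual.tensor V) A x = LinearMap.mulRight k x ∘ₗ
      (TensorProduct.lid k A).toLinearMap ∘ₗ LinearMap.rTensor A (contractLeft k V) := by
    refine TensorProduct.ext_threefold fun ξ v y => ?_
    simp only [LinearMap.comp_apply]
    rw [rmul_tmul]
    simp
  exact LinearMap.congr_fun h s

theorem rmul_superPair (V : SuperSpace.{u, w} k) (A : SCommAlg.{u, a} k) {i j : ZMod 2} {x : A}
    (hx : x ∈ A.gr i) (z : V.dual ⊗[k] A) {t : V ⊗[k] A} (ht : t ∈ tensorGr V A.toSuperSpace j) :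
    superPair V A (rmul V.dual A x z ⊗ₜ[k] t) =
      sgn k (i * j) • superPair V A (z ⊗ₜ[k] rmul V A x t) := by
  simp only [superPair, LinearMap.comp_apply]
  rw [rmul_superMul V.dual V A hx z ht, map_smul, map_smul]

theorem superPair_mem (V : SuperSpace.{u, w} k) (A : SCommAlg.{u, a} k) {i j : ZMod 2}
    {z : V.dual ⊗[k] A} (hz : z ∈ tensorGr V.dual A.toSuperSpace i) {t : V ⊗[k] A}
    (ht : t ∈ tensorGr V A.toSuperSpace j) : superPair V A (z ⊗ₜ[k] t) ∈ A.gr (i + j) := by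
  induction hz using Submodule.span_induction with
  | zero => simp
  | add x y _ _ hx hy => rw [TensorProduct.add_tmul, map_add]; exact Submodule.add_mem _ hx hy
  | smul c x _ hx =>
    rw [← TensorProduct.smul_tmul', map_smul]; exact Submodule.smul_mem _ _ hx
  | mem z hz =>
    obtain ⟨i1, i2, rfl, ξ, hξ, x, hx, rfl⟩ := hz
    induction ht using Submodule.span_induction with
    | zero => simp
    | add x y _ _ hx hy => rw [TensorProduct.tmul_add, map_add]; exact Submodule.add_mem _ hx hy
    | smul c x _ hx =>
      rw [TensorProduct.tmul_smul, map_smul]; exact Submodule.smul_mem _ _ hx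
    | mem t ht =>
      obtain ⟨j1, j2, rfl, v, hv, y, hy, rfl⟩ := ht
      rw [superPair_tmul V A ξ hx hv]
      refine Submodule.smul_mem _ _ ?_
      by_cases h : j1 = i1
      · subst h
        have h2 : ∀ p q r : ZMod 2, p + q + (p + r) = q + r := by decide
        rw [h2]
        exact Submodule.smul_mem _ _ (A.mul_mem hx hy)
      · have h3 : i1 + 1 = j1 := zmod2_succ (fun h' => h h'.symm)
        have h4 : ξ v = 0 := (Submodule.mem_dualAnnihilator ξ).1 hξ v (by rwa [h3])
        rw [h4, zero_smul]
        exact Submodule.zero_mem _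

/-- The sign twist `ξ ⊗ x ↦ (-1) ^ (i * j) ξ ⊗ x` for `ξ` of degree `i` and `x` of degree `j`. -/
noncomputable def signTwist (V : SuperSpace.{u, w} k) (A : SCommAlg.{u, a} k) :
    V ⊗[k] A →ₗ[k] V ⊗[k] A :=
  LinearMap.rTensor A (V.pr 0) + TensorProduct.map (V.pr 1) A.toSuperSpace.parity

theorem signTwist_tmul (V : SuperSpace.{u, w} k) (A : SCommAlg.{u, a} k) {i j : ZMod 2} {v : V}
    (hv : v ∈ V.gr i) {x : A} (hx : x ∈ A.gr j) :
    signTwist V A (v ⊗ₜ[k] x) = sgn k (i * j) • (v ⊗ₜ[k] x) := by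
  have hp := A.toSuperSpace.parity_of_mem hx
  simp only [signTwist, LinearMap.add_apply, TensorProduct.map_tmul,
    LinearMap.rTensor_tmul, V.pr_of_mem 0 hv, V.pr_of_mem 1 hv, hp]
  rcases zmod2_cases i with rfl | rfl
  · simp [sgn_zero]
  · simp

theorem signTwist_signTwist (V : SuperSpace.{u, w} k) (A : SCommAlg.{u, a} k) (z : V ⊗[k] A) :
    signTwist V A (signTwist V A z) = z := by
  have h : signTwist V A ∘ₗ signTwist V A = LinearMap.id := by
    refine superMul_gr_ext V A fun i j v hv x hx => ?_
    rw [LinearMap.comp_apply, signTwist_tmul V A hv hx, map_smul, signTwist_tmul V A hv hx,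
      smul_smul, sgn_mul_self, one_smul, LinearMap.id_apply]
  exact LinearMap.congr_fun h z

theorem superPair_signTwist (V : SuperSpace.{u, w} k) (A : SCommAlg.{u, a} k)
    (z : V.dual ⊗[k] A) (v : V) :
    superPair V A (signTwist V.dual A z ⊗ₜ[k] (v ⊗ₜ[k] 1)) = dualTensorHom k V A z v := by
  have h : ∀ l, ∀ v ∈ V.gr l, superPair V A ∘ₗ (TensorProduct.mk k _ _).flip (v ⊗ₜ[k] 1) ∘ₗ
      signTwist V.dual A = LinearMap.applyₗ v ∘ₗ dualTensorHom k V A := by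
    intro l v hv
    refine superMul_gr_ext V.dual A fun i j ξ hξ x hx => ?_
    simp only [LinearMap.comp_apply, LinearMap.flip_apply, TensorProduct.mk_apply]
    rw [signTwist_tmul V.dual A hξ hx, ← TensorProduct.smul_tmul', map_smul,
      superPair_tmul V A ξ hx hv]
    simp only [LinearMap.applyₗ_apply_apply, dualTensorHom_apply, mul_one]
    by_cases h : l = i
    · subst h
      rw [smul_smul, mul_comm j l, sgn_mul_self, one_smul]
    · have h3 : i + 1 = l := zmod2_succ (fun h' => h h'.symm)
      have h4 : ξ v = 0 := (Submodule.mem_dualAnnihilator ξ).1 hξ v (by rwa [h3])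
      rw [h4]; simp
  have h2 : ∀ l, ∀ v ∈ V.gr l,
      superPair V A (signTwist V.dual A z ⊗ₜ[k] (v ⊗ₜ[k] 1)) = dualTensorHom k V A z v :=
    fun l v hv => LinearMap.congr_fun (h l v hv) z
  rw [← V.pr_add_pr v]
  simp only [TensorProduct.add_tmul, TensorProduct.tmul_add, map_add, h2 0 _ (V.pr_mem 0 v),
    h2 1 _ (V.pr_mem 1 v)]

theorem superPair_sub {V : SuperSpace.{u, w} k} {A : SCommAlg.{u, a} k} (z z' : V.dual ⊗[k] A) (t : V ⊗[k] A) :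
    superPair V A ((z - z') ⊗ₜ[k] t) = superPair V A (z ⊗ₜ[k] t) - superPair V A (z' ⊗ₜ[k] t) :=
  (superPair V A ∘ₗ (TensorProduct.mk k (V.dual ⊗[k] A) (V ⊗[k] A)).flip t).map_sub z z'

variable (V : SuperSpace.{u, w} k) [Module.Finite k V] (A : SCommAlg.{u, a} k)

theorem superPair_nondeg {z : V.dual ⊗[k] A}
    (h : ∀ v : V, superPair V A (z ⊗ₜ[k] (v ⊗ₜ[k] 1)) = 0) : z = 0 := by
  have h1 : dualTensorHomEquiv k V A (signTwist V.dual A z) = 0 := by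
    ext v
    rw [dualTensorHomEquiv_eq_dualTensorHomEquivOfBasis (Module.finBasis k V),
      dualTensorHomEquivOfBasis_apply, ← superPair_signTwist, signTwist_signTwist, h]
    rfl
  rw [← signTwist_signTwist _ _ z, (LinearEquiv.map_eq_zero_iff _).1 h1, map_zero]

/-- The element of `V^∨ ⊗ A` whose pairing with each `v ⊗ 1` is `h v`. -/
noncomputable def dualElt : (V →ₗ[k] A) →ₗ[k] V.dual ⊗[k] A :=
  signTwist V.dual A ∘ₗ (dualTensorHomEquiv k V A).symm.toLinearMap

theorem superPair_dualElt (h : V →ₗ[k] A) (v : V) :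
    superPair V A (dualElt V A h ⊗ₜ[k] (v ⊗ₜ[k] 1)) = h v := by
  rw [dualElt, LinearMap.comp_apply, superPair_signTwist]
  have h1 : dualTensorHom k V A ((dualTensorHomEquiv k V A).symm h) = h := by
    have h2 := (dualTensorHomEquiv k V A).apply_symm_apply h
    conv_lhs at h2 => rw [dualTensorHomEquiv_eq_dualTensorHomEquivOfBasis (Module.finBasis k V)]
    rw [dualTensorHomEquivOfBasis_apply] at h2
    rw [dualTensorHomEquiv_eq_dualTensorHomEquivOfBasis (Module.finBasis k V)]
    exact h2
  exact LinearMap.congr_fun h1 v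

/-- The map sending `ξ` to the element of `V^∨ ⊗ A` whose pairing with each `v ⊗ 1` is the pairing
of `ξ ⊗ 1` with `φ (v ⊗ 1)`. -/
noncomputable def dualEndAux (φ : Module.End k (V ⊗[k] A)) : V.dual →ₗ[k] V.dual ⊗[k] A :=
  dualElt V A ∘ₗ LinearMap.lcomp k A (φ ∘ₗ (TensorProduct.mk k V A).flip 1) ∘ₗ
    TensorProduct.curry (superPair V A) ∘ₗ (TensorProduct.mk k V.dual A).flip 1

/-- The transpose of an `A`-endomorphism `φ` of `V ⊗ A`: the endomorphism of the right `A`-module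
`V^∨ ⊗ A` that is adjoint to `φ` for the pairing `superPair`. -/
noncomputable def dualEnd (φ : Module.End k (V ⊗[k] A)) : Module.End k (V.dual ⊗[k] A) :=
  LinearMap.lTensor V.dual (LinearMap.mul' k A) ∘ₗ
    (TensorProduct.assoc k V.dual A A).toLinearMap ∘ₗ LinearMap.rTensor A (dualEndAux V A φ)

theorem dualEnd_tmul (φ : Module.End k (V ⊗[k] A)) (ξ : V.dual) (x : A) :
    dualEnd V A φ (ξ ⊗ₜ[k] x) = rmul V.dual A x (dualEndAux V A φ ξ) := by
  simp only [dualEnd, LinearMap.comp_apply, LinearMap.rTensor_tmul]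
  generalize dualEndAux V A φ ξ = z
  induction z using TensorProduct.induction_on with
  | zero => simp
  | add z t hz ht => simp only [TensorProduct.add_tmul, map_add, hz, ht]
  | tmul v c => rfl

variable {V A}

theorem dualEnd_rmul (φ : Module.End k (V ⊗[k] A)) (x : A) (z : V.dual ⊗[k] A) :
    dualEnd V A φ (rmul V.dual A x z) = rmul V.dual A x (dualEnd V A φ z) := by
  induction z using TensorProduct.induction_on with
  | zero => simp
  | add z t hz ht => simp only [map_add, hz, ht]
  | tmul ξ y => rw [rmul_tmul, dualEnd_tmul, dualEnd_tmul, rmul_rmul]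

theorem superPair_dualEnd (φ : AEnd V A) (z : V.dual ⊗[k] A) (t : V ⊗[k] A) :
    superPair V A (dualEnd V A φ z ⊗ₜ[k] t) = superPair V A (z ⊗ₜ[k] φ.1 t) := by
  have h1 : ∀ (ξ : V.dual) (t : V ⊗[k] A),
      superPair V A (dualEndAux V A φ ξ ⊗ₜ[k] t) = superPair V A ((ξ ⊗ₜ[k] 1) ⊗ₜ[k] φ.1 t) := by
    intro ξ t
    induction t using TensorProduct.induction_on with
    | zero => simp
    | add z t hz ht => simp only [TensorProduct.tmul_add, map_add, hz, ht]
    | tmul v y =>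
      have h2 : v ⊗ₜ[k] y = rmul V A y (v ⊗ₜ[k] 1) := by rw [rmul_tmul, one_mul]
      rw [h2, φ.2.1, superPair_rmul, superPair_rmul]
      congr 1
      rw [dualEndAux, LinearMap.comp_apply, superPair_dualElt]
      rfl
  have h3 : superPair V A ∘ₗ LinearMap.rTensor _ (dualEnd V A φ) =
      superPair V A ∘ₗ LinearMap.lTensor _ φ.1 := by
    refine TensorProduct.ext (superMul_gr_ext V.dual A fun i j ξ hξ x hx =>
      superMul_gr_ext V A fun l m v hv y hy => ?_)
    simp only [LinearMap.compr₂ₛₗ_apply, TensorProduct.mk_apply, LinearMap.comp_apply,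
      LinearMap.rTensor_tmul, LinearMap.lTensor_tmul]
    have h4 : v ⊗ₜ[k] y ∈ tensorGr V A.toSuperSpace (l + m) :=
      tmul_mem (W := A.toSuperSpace) hv hy
    have h2 : ξ ⊗ₜ[k] x = rmul V.dual A x (ξ ⊗ₜ[k] 1) := by rw [rmul_tmul, one_mul]
    rw [dualEnd_tmul, rmul_superPair V A hx _ h4, h1, h2, rmul_superPair V A hx _ (φ.2.2 _ _ h4),
      φ.2.1]
  exact LinearMap.congr_fun h3 (z ⊗ₜ[k] t)

theorem superPair_ext {z z' : V.dual ⊗[k] A}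
    (h : ∀ t : V ⊗[k] A, superPair V A (z ⊗ₜ[k] t) = superPair V A (z' ⊗ₜ[k] t)) : z = z' := by
  rw [← sub_eq_zero]
  refine superPair_nondeg V A fun v => ?_
  rw [superPair_sub, h, sub_self]

theorem dualEnd_mem (φ : AEnd V A) : dualEnd V A φ ∈ AEnd V.dual A := by
  refine ⟨fun x z => dualEnd_rmul _ x z, fun i z hz => ?_⟩
  refine (V.dual.tensor A.toSuperSpace).mem_of_pr i _ ?_
  refine superPair_nondeg V A fun v => ?_
  have key : ∀ l, ∀ v ∈ V.gr l, superPair V A ((V.dual.tensor A.toSuperSpace).pr (i + 1)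
      (dualEnd V A φ z) ⊗ₜ[k] (v ⊗ₜ[k] 1)) = 0 := by
    intro l v hv
    set s := dualEnd V A φ z with hs
    have hv1 : v ⊗ₜ[k] (1 : A) ∈ tensorGr V A.toSuperSpace l := tmul_mem_zero hv A.one_mem
    have h1 : superPair V A (s ⊗ₜ[k] (v ⊗ₜ[k] 1)) ∈ A.gr (i + l) := by
      rw [hs, superPair_dualEnd]
      exact superPair_mem V A hz (φ.2.2 _ _ hv1)
    have hm : ∀ j, superPair V A ((V.dual.tensor A.toSuperSpace).pr j s ⊗ₜ[k] (v ⊗ₜ[k] 1)) ∈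
        A.gr (j + l) := fun j =>
      superPair_mem V A ((V.dual.tensor A.toSuperSpace).pr_mem j s) hv1
    have hsum : (V.dual.tensor A.toSuperSpace).pr i s +
        (V.dual.tensor A.toSuperSpace).pr (i + 1) s = s := by
      have h0 := (V.dual.tensor A.toSuperSpace).pr_add_pr s
      have h2 : (1 + 1 : ZMod 2) = 0 := by decide
      rcases zmod2_cases i with rfl | rfl
      · rw [zero_add]; exact h0
      · rw [h2, add_comm]; exact h0
    have h5 : superPair V A ((V.dual.tensor A.toSuperSpace).pr (i + 1) s ⊗ₜ[k] (v ⊗ₜ[k] 1)) ∈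
        A.gr (i + l) := by
      have h6 : (V.dual.tensor A.toSuperSpace).pr (i + 1) s =
          s - (V.dual.tensor A.toSuperSpace).pr i s := by rw [eq_sub_iff_add_eq, add_comm, hsum]
      rw [h6, superPair_sub]
      exact Submodule.sub_mem _ h1 (hm i)
    have h7 := hm (i + 1)
    rw [add_right_comm] at h7
    exact (Submodule.disjoint_def.1 (A.toSuperSpace.isCompl' (i + l)).disjoint) _ h5 h7
  rw [← V.pr_add_pr v]
  simp only [TensorProduct.add_tmul, TensorProduct.tmul_add, map_add, key 0 _ (V.pr_mem 0 v),
    key 1 _ (V.pr_mem 1 v), add_zero]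

theorem dualEnd_one : dualEnd V A 1 = 1 := by
  refine LinearMap.ext fun z => superPair_ext fun t => ?_
  exact superPair_dualEnd (1 : AEnd V A) z t

theorem dualEnd_mul (φ ψ : AEnd V A) :
    dualEnd V A (φ * ψ : AEnd V A) = dualEnd V A ψ * dualEnd V A φ := by
  refine LinearMap.ext fun z => superPair_ext fun t => ?_
  rw [Module.End.mul_apply, superPair_dualEnd, superPair_dualEnd, superPair_dualEnd]
  rfl

end duals

/-! ## Super monoids with involution and their representations -/

section monoids

variable {k : Type u} [Field k]

theorem SCommAlg.parity_mul (A : SCommAlg.{u, a} k) (x y : A) :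
    A.toSuperSpace.parity (x * y) = A.toSuperSpace.parity x * A.toSuperSpace.parity y := by
  have h : (LinearMap.mul k A).compr₂ A.toSuperSpace.parity =
      (LinearMap.mul k A).compl₁₂ A.toSuperSpace.parity A.toSuperSpace.parity := by
    refine A.toSuperSpace.hom_ext fun i x hx => A.toSuperSpace.hom_ext fun j y hy => ?_
    have h1 := A.toSuperSpace.parity_of_mem (A.mul_mem hx hy)
    have h2 := A.toSuperSpace.parity_of_mem hx
    have h3 := A.toSuperSpace.parity_of_mem hy
    simp only [LinearMap.compr₂_apply, LinearMap.mul_apply', LinearMap.compl₁₂_apply]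
    rw [h1, h2, h3, smul_mul_smul_comm, sgn_add]
  exact LinearMap.congr_fun (LinearMap.congr_fun h x) y

/-- The canonical involution `ι` of a commutative super algebra, acting as `(-1) ^ i` in
degree `i`. -/
noncomputable def SCommAlg.parityHom (A : SCommAlg.{u, a} k) : A.Hom A where
  toAlgHom := AlgHom.ofLinearMap A.toSuperSpace.parity
    (by rw [A.toSuperSpace.parity_of_mem A.one_mem, sgn_zero, one_smul]) A.parity_mul
  map_gr i x hx := by
    rw [AlgHom.ofLinearMap_apply, A.toSuperSpace.parity_of_mem hx]
    exact Submodule.smul_mem _ _ hx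

theorem SCommAlg.parityHom_of_mem (A : SCommAlg.{u, a} k) {i : ZMod 2} {x : A}
    (hx : x ∈ A.gr i) : A.parityHom.toAlgHom x = sgn k i • x :=
  A.toSuperSpace.parity_of_mem hx

end monoids

set_option linter.checkUnivs false in
/-- A super `k`-monoid with involution `(M, ε)`, given by its functor of points on commutative
super `k`-algebras. The `k`-point `ε` is given by its images `eps A` in the `M(A)`; it satisfies
`ε ^ 2 = 1` and conjugation by `ε` is the canonical involution of `M`. -/
structure SuperMonoid (k : Type u) [Field k] where
  pts : SCommAlg.{u, a} k → Type b
  [monoid : ∀ A, Monoid (pts A)]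
  map : ∀ {A B : SCommAlg.{u, a} k}, A.Hom B → pts A →* pts B
  map_id : ∀ (A : SCommAlg.{u, a} k) (g : pts A), map (SCommAlg.Hom.id A) g = g
  map_comp : ∀ {A B C : SCommAlg.{u, a} k} (h : B.Hom C) (f : A.Hom B) (g : pts A),
    map (h.comp f) g = map h (map f g)
  eps : ∀ A : SCommAlg.{u, a} k, pts A
  map_eps : ∀ {A B : SCommAlg.{u, a} k} (f : A.Hom B), map f (eps A) = eps B
  eps_mul_eps : ∀ A : SCommAlg.{u, a} k, eps A * eps A = 1
  eps_conj : ∀ (A : SCommAlg.{u, a} k) (g : pts A),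
    eps A * g * eps A = map A.parityHom g

attribute [instance] SuperMonoid.monoid

/-- A super monoid is a super group when all its points are invertible. -/
def SuperMonoid.IsGroup {k : Type u} [Field k] (M : SuperMonoid.{u, a, b} k) : Prop :=
  ∀ (A : SCommAlg.{u, a} k) (g : M.pts A), IsUnit g

/-- Homomorphisms of super monoids with involution. -/
structure SuperMonoid.Hom {k : Type u} [Field k] (M : SuperMonoid.{u, a, b} k)
    (M' : SuperMonoid.{u, a, b'} k) where
  app : ∀ A : SCommAlg.{u, a} k, M.pts A →* M'.pts A
  app_map : ∀ {A B : SCommAlg.{u, a} k} (f : A.Hom B) (g : M.pts A),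
    app B (M.map f g) = M'.map f (app A g)
  app_eps : ∀ A : SCommAlg.{u, a} k, app A (M.eps A) = M'.eps A

/-- The map `V ⊗ A → V ⊗ B` induced by `f : A → B`. -/
noncomputable def baseMap {k : Type u} [Field k] (V : SuperSpace.{u, w} k)
    {A B : SCommAlg.{u, a} k} (f : A.Hom B) : V ⊗[k] A →ₗ[k] V ⊗[k] B :=
  LinearMap.lTensor V f.toAlgHom.toLinearMap

/-- A structure of representation of `(M, ε)` on the super vector space `V`: `V` is
finite-dimensional, each `M(A)` acts by `A`-endomorphisms on `V ⊗ A`, naturally in `A`, and `ε` acts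
as `(-1) ^ i` on the summand of `V` of degree `i`. -/
structure Rep {k : Type u} [Field k] (M : SuperMonoid.{u, a, b} k) (V : SuperSpace.{u, w} k) where
  finite : Module.Finite k V
  act : ∀ A : SCommAlg.{u, a} k, M.pts A →* AEnd V A
  act_map : ∀ {A B : SCommAlg.{u, a} k} (f : A.Hom B) (g : M.pts A) (z : V ⊗[k] A),
    baseMap V f ((act A g).1 z) = (act B (M.map f g)).1 (baseMap V f z)
  act_eps : ∀ (A : SCommAlg.{u, a} k) (i : ZMod 2), ∀ v ∈ V.gr i, ∀ x : A,
    (act A (M.eps A)).1 (v ⊗ₜ[k] x) = sgn k i • (v ⊗ₜ[k] x)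

/-- Homomorphisms of representations: linear maps of degree `0` compatible with the actions. -/
structure Rep.Hom {k : Type u} [Field k] {M : SuperMonoid.{u, a, b} k} {V : SuperSpace.{u, w} k}
    {W : SuperSpace.{u, w'} k} (ρ : Rep M V) (σ : Rep M W) where
  toLinearMap : V →ₗ[k] W
  map_gr : ∀ i, ∀ v ∈ V.gr i, toLinearMap v ∈ W.gr i
  map_act : ∀ (A : SCommAlg.{u, a} k) (g : M.pts A) (z : V ⊗[k] A),
    LinearMap.rTensor A toLinearMap ((ρ.act A g).1 z) =
      (σ.act A g).1 (LinearMap.rTensor A toLinearMap z)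

/-- The restriction of a representation along a homomorphism of super monoids with involution. -/
def Rep.res {k : Type u} [Field k] {M : SuperMonoid.{u, a, b} k} {M' : SuperMonoid.{u, a, b'} k}
    {V : SuperSpace.{u, w} k} (σ : Rep M' V) (h : M.Hom M') : Rep M V where
  finite := σ.finite
  act A := (σ.act A).comp (h.app A)
  act_map f g z := by
    rw [MonoidHom.comp_apply, MonoidHom.comp_apply, h.app_map]
    exact σ.act_map f _ z
  act_eps A i v hv x := by
    rw [MonoidHom.comp_apply, h.app_eps]
    exact σ.act_eps A i v hv x

/-- The trivial representation on `k`, the unit for the tensor product. -/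
def Rep.unit {k : Type u} [Field k] (M : SuperMonoid.{u, a, b} k) :
    Rep M (SuperSpace.unit k) where
  finite := inferInstanceAs (Module.Finite k k)
  act A := 1
  act_map f g z := rfl
  act_eps A i v hv x := by
    change v ⊗ₜ[k] x = _
    rcases zmod2_cases i with rfl | rfl
    · rw [sgn_zero, one_smul]
    · have h : v = 0 := by simpa using hv
      subst h
      simp

section constructions

variable {k : Type u} [Field k] {M : SuperMonoid.{u, a, b} k}

theorem baseMap_tmul (V : SuperSpace.{u, w} k) {A B : SCommAlg.{u, a} k} (f : A.Hom B) (v : V)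
    (x : A) : baseMap V f (v ⊗ₜ[k] x) = v ⊗ₜ[k] f.toAlgHom x := rfl

theorem baseMap_superMul (V : SuperSpace.{u, w} k) (W : SuperSpace.{u, w'} k)
    {A B : SCommAlg.{u, a} k} (f : A.Hom B) (z : V ⊗[k] A) (t : W ⊗[k] A) :
    baseMap (V.tensor W) f (superMul V W A (z ⊗ₜ[k] t)) =
      superMul V W B (baseMap V f z ⊗ₜ[k] baseMap W f t) := by
  have h : baseMap (V.tensor W) f ∘ₗ superMul V W A =
      superMul V W B ∘ₗ TensorProduct.map (baseMap V f) (baseMap W f) := by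
    refine TensorProduct.ext (superMul_gr_ext V A fun i j v hv x hx =>
      superMul_gr_ext W A fun l m t ht y hy => ?_)
    simp only [LinearMap.compr₂ₛₗ_apply, TensorProduct.mk_apply, LinearMap.comp_apply,
      TensorProduct.map_tmul, baseMap_tmul]
    rw [superMul_tmul V W A v hx ht, superMul_tmul V W B v (f.map_gr _ _ hx) ht, map_smul]
    erw [baseMap_tmul]
    rw [map_mul]
  exact LinearMap.congr_fun h (z ⊗ₜ[k] t)

/-- The tensor product of representations: a point `g` of `M` acts as the tensor product over `A` of
its actions on `V ⊗ A` and `W ⊗ A`. -/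
noncomputable def Rep.tensor {V : SuperSpace.{u, w} k} {W : SuperSpace.{u, w'} k} (ρ : Rep M V)
    (σ : Rep M W) : Rep M (V.tensor W) where
  finite :=
    haveI := ρ.finite
    haveI := σ.finite
    inferInstanceAs (Module.Finite k (V ⊗[k] W))
  act A :=
    { toFun := fun g => ⟨tensorEnd V W A (ρ.act A g) (σ.act A g), tensorEnd_mem _ _⟩
      map_one' := by
        refine Subtype.ext ?_
        simp only [map_one]
        exact tensorEnd_one V W A
      map_mul' := fun g h => by
        refine Subtype.ext ?_
        simp only [map_mul]
        exact tensorEnd_mul _ _ _ _ }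
  act_map {A B} f g z := by
    have h : baseMap (V.tensor W) f ∘ₗ tensorEnd V W A (ρ.act A g) (σ.act A g) =
        tensorEnd V W B (ρ.act B (M.map f g)) (σ.act B (M.map f g)) ∘ₗ
          baseMap (V.tensor W) f := by
      refine superMul_ext fun z t => ?_
      rw [LinearMap.comp_apply, LinearMap.comp_apply, tensorEnd_superMul, baseMap_superMul,
        baseMap_superMul, tensorEnd_superMul, ρ.act_map, σ.act_map]
    exact LinearMap.congr_fun h z
  act_eps A n z hz x := by
    change tensorEnd V W A (ρ.act A (M.eps A)) (σ.act A (M.eps A)) (z ⊗ₜ[k] x) = _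
    induction hz using Submodule.span_induction with
    | zero => simp
    | add p q _ _ hp hq => rw [TensorProduct.add_tmul, map_add, hp, hq, smul_add]
    | smul c p _ hp =>
      rw [← TensorProduct.smul_tmul', map_smul, hp, smul_comm]
    | mem z hz =>
      obtain ⟨i, j, rfl, v, hv, t, ht, rfl⟩ := hz
      rw [← superMul_one, tensorEnd_superMul, ρ.act_eps A i v hv, σ.act_eps A j t ht,
        ← TensorProduct.smul_tmul', TensorProduct.tmul_smul, smul_smul, map_smul, sgn_add]

theorem map_superPair (V : SuperSpace.{u, w} k) {A B : SCommAlg.{u, a} k} (f : A.Hom B)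
    (z : V.dual ⊗[k] A) (t : V ⊗[k] A) :
    f.toAlgHom (superPair V A (z ⊗ₜ[k] t)) =
      superPair V B (baseMap V.dual f z ⊗ₜ[k] baseMap V f t) := by
  simp only [superPair, LinearMap.comp_apply]
  rw [← baseMap_superMul]
  generalize superMul V.dual V A (z ⊗ₜ[k] t) = s
  have h : f.toAlgHom.toLinearMap ∘ₗ (TensorProduct.lid k A).toLinearMap ∘ₗ
      LinearMap.rTensor A (contractLeft k V) = (TensorProduct.lid k B).toLinearMap ∘ₗ
      LinearMap.rTensor B (contractLeft k V) ∘ₗ baseMap (V.dual.tensor V) f := by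
    refine TensorProduct.ext_threefold fun ξ v y => ?_
    simp only [LinearMap.comp_apply]
    rw [baseMap_tmul]
    simp
  exact LinearMap.congr_fun h s

/-- The inverse of a point of a super group. -/
noncomputable def SuperMonoid.IsGroup.inv (hM : M.IsGroup) {A : SCommAlg.{u, a} k}
    (g : M.pts A) : M.pts A :=
  ((hM A g).unit⁻¹ : (M.pts A)ˣ)

theorem SuperMonoid.IsGroup.inv_eq (hM : M.IsGroup) {A : SCommAlg.{u, a} k}
    {g h : M.pts A} (hgh : g * h = 1) : hM.inv g = h := by
  have h1 : hM.inv g * g = 1 := IsUnit.val_inv_mul (hM A g)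
  exact left_inv_eq_right_inv h1 hgh

theorem SuperMonoid.IsGroup.mul_inv (hM : M.IsGroup) {A : SCommAlg.{u, a} k}
    (g : M.pts A) : g * hM.inv g = 1 :=
  IsUnit.mul_val_inv (hM A g)

/-- The dual of a representation of a super group: a point `g` acts as the transpose of the action of
its inverse, so that the pairing of the dual of `V` with `V` is invariant. -/
noncomputable def Rep.dual {V : SuperSpace.{u, w} k} (hM : M.IsGroup) (ρ : Rep M V) :
    Rep M V.dual :=
  haveI := ρ.finite
  { finite := inferInstanceAs (Module.Finite k (Module.Dual k V))
    act := fun A =>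
      { toFun := fun g => ⟨dualEnd V A (ρ.act A (hM.inv g)), dualEnd_mem _⟩
        map_one' := by
          refine Subtype.ext ?_
          simp only [hM.inv_eq (one_mul (1 : M.pts A)), map_one]
          exact dualEnd_one
        map_mul' := fun g h => by
          have h1 : hM.inv (g * h) = hM.inv h * hM.inv g := hM.inv_eq <| by
            rw [mul_assoc, ← mul_assoc h, hM.mul_inv, one_mul, hM.mul_inv]
          refine Subtype.ext ?_
          simp only [h1, map_mul]
          exact dualEnd_mul _ _ }
    act_map := fun {A B} f g z => by
      have h1 : hM.inv (M.map f g) = M.map f (hM.inv g) := hM.inv_eq <| by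
        rw [← map_mul, hM.mul_inv, map_one]
      change baseMap V.dual f (dualEnd V A (ρ.act A (hM.inv g)) z) =
        dualEnd V B (ρ.act B (hM.inv (M.map f g))) (baseMap V.dual f z)
      rw [← sub_eq_zero]
      refine superPair_nondeg V B fun v => ?_
      have h2 : v ⊗ₜ[k] (1 : B) = baseMap V f (v ⊗ₜ[k] 1) := by rw [baseMap_tmul, map_one]
      rw [superPair_sub, superPair_dualEnd, h1, h2, ← ρ.act_map, ← map_superPair,
        ← map_superPair, superPair_dualEnd, sub_self]
    act_eps := fun A i ξ hξ x => by
      change dualEnd V A (ρ.act A (hM.inv (M.eps A))) (ξ ⊗ₜ[k] x) = _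
      rw [hM.inv_eq (M.eps_mul_eps A)]
      have h1 : dualEnd V A (ρ.act A (M.eps A)) (ξ ⊗ₜ[k] 1) = sgn k i • (ξ ⊗ₜ[k] 1) := by
        refine superPair_ext fun t => ?_
        rw [superPair_dualEnd]
        have h2 : superPair V A ∘ₗ (TensorProduct.mk k (V.dual ⊗[k] A) (V ⊗[k] A)) (ξ ⊗ₜ[k] 1) ∘ₗ
            (ρ.act A (M.eps A)).1 = superPair V A ∘ₗ
            (TensorProduct.mk k (V.dual ⊗[k] A) (V ⊗[k] A)) (sgn k i • (ξ ⊗ₜ[k] 1)) := by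
          refine superMul_gr_ext V A fun l m v hv y hy => ?_
          simp only [LinearMap.comp_apply, TensorProduct.mk_apply]
          rw [ρ.act_eps A l v hv, TensorProduct.tmul_smul, ← TensorProduct.smul_tmul', map_smul,
            map_smul]
          by_cases h : l = i
          · rw [h]
          · have h3 : i + 1 = l := zmod2_succ (fun h' => h h'.symm)
            have h4 : ξ v = 0 := (Submodule.mem_dualAnnihilator ξ).1 hξ v (by rwa [h3])
            rw [superPair_tmul V A ξ A.one_mem hv, h4, zero_smul, smul_zero, smul_zero, smul_zero]
        exact LinearMap.congr_fun h2 t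
      have h2 : ξ ⊗ₜ[k] x = rmul V.dual A x (ξ ⊗ₜ[k] 1) := by rw [rmul_tmul, one_mul]
      rw [h2, dualEnd_rmul, h1, map_smul] }

/-- The `A`-endomorphism of the direct sum with components `φ i`. -/
noncomputable def sumEnd {N : ℕ} (X : Fin N → SuperSpace.{u, w} k) (A : SCommAlg.{u, a} k)
    (φ : ∀ i, Module.End k (X i ⊗[k] A)) : Module.End k (SuperSpace.directSum X ⊗[k] A) :=
  ∑ i, LinearMap.rTensor A (LinearMap.single k (fun i => (X i : Type w)) i) ∘ₗ φ i ∘ₗ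
    LinearMap.rTensor A (LinearMap.proj i : (∀ i, X i) →ₗ[k] X i)

theorem sumEnd_single {N : ℕ} (X : Fin N → SuperSpace.{u, w} k) (A : SCommAlg.{u, a} k)
    (φ : ∀ i, Module.End k (X i ⊗[k] A)) (i : Fin N) (z : X i ⊗[k] A) :
    sumEnd X A φ (LinearMap.rTensor A (LinearMap.single k (fun i => (X i : Type w)) i) z) =
      LinearMap.rTensor A (LinearMap.single k (fun i => (X i : Type w)) i) (φ i z) := by
  rw [sumEnd, LinearMap.sum_apply, Finset.sum_eq_single i]
  · rw [LinearMap.comp_apply, LinearMap.comp_apply, ← LinearMap.rTensor_comp_apply,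
      LinearMap.proj_comp_single_same, LinearMap.rTensor_id_apply]
  · intro j _ hj
    rw [LinearMap.comp_apply, LinearMap.comp_apply, ← LinearMap.rTensor_comp_apply,
      LinearMap.proj_comp_single_ne k _ _ _ hj, LinearMap.rTensor_zero,
      LinearMap.zero_apply, map_zero, map_zero]
  · intro h
    exact absurd (Finset.mem_univ i) h

theorem sum_hom_ext {N : ℕ} {X : Fin N → SuperSpace.{u, w} k} {A : SCommAlg.{u, a} k} {Y : Type b'}
    [AddCommGroup Y] [Module k Y] {f g : SuperSpace.directSum X ⊗[k] A →ₗ[k] Y}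
    (h : ∀ (i : Fin N) (z : X i ⊗[k] A),
      f (LinearMap.rTensor A (LinearMap.single k (fun i => (X i : Type w)) i) z) =
      g (LinearMap.rTensor A (LinearMap.single k (fun i => (X i : Type w)) i) z)) : f = g := by
  refine TensorProduct.ext (LinearMap.pi_ext fun i x => LinearMap.ext fun y => ?_)
  exact h i (x ⊗ₜ[k] y)

theorem single_mem {N : ℕ} (X : Fin N → SuperSpace.{u, w} k) (i : Fin N) {d : ZMod 2} {x : X i}
    (hx : x ∈ (X i).gr d) : Pi.single i x ∈ (SuperSpace.directSum X).gr d := by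
  intro j _
  by_cases h : j = i
  · subst h
    simpa using hx
  · simp [Pi.single_eq_of_ne h]

theorem rTensor_mem {V : SuperSpace.{u, w} k} {W : SuperSpace.{u, w'} k} (f : V →ₗ[k] W)
    (hf : ∀ i, ∀ v ∈ V.gr i, f v ∈ W.gr i) (A : SuperSpace.{u, a} k) {i : ZMod 2} {z : V ⊗[k] A}
    (hz : z ∈ tensorGr V A i) : LinearMap.rTensor A f z ∈ tensorGr W A i := by
  induction hz using Submodule.span_induction with
  | zero => simp
  | add p q _ _ hp hq => rw [map_add]; exact Submodule.add_mem _ hp hq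
  | smul c p _ hp => rw [map_smul]; exact Submodule.smul_mem _ _ hp
  | mem z hz =>
    obtain ⟨i, j, rfl, v, hv, x, hx, rfl⟩ := hz
    exact tmul_mem (hf _ _ hv) hx

theorem rTensor_rmul {V : SuperSpace.{u, w} k} {W : SuperSpace.{u, w'} k} (f : V →ₗ[k] W)
    (A : SCommAlg.{u, a} k) (x : A) (z : V ⊗[k] A) :
    LinearMap.rTensor A f (rmul V A x z) = rmul W A x (LinearMap.rTensor A f z) := by
  induction z using TensorProduct.induction_on with
  | zero => simp
  | add z t hz ht => simp only [map_add, hz, ht]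
  | tmul v y => rfl

theorem rTensor_baseMap {V : SuperSpace.{u, w} k} {W : SuperSpace.{u, w'} k} (f : V →ₗ[k] W)
    {A B : SCommAlg.{u, a} k} (h : A.Hom B) (z : V ⊗[k] A) :
    LinearMap.rTensor B f (baseMap V h z) = baseMap W h (LinearMap.rTensor A f z) := by
  induction z using TensorProduct.induction_on with
  | zero => simp
  | add z t hz ht => simp only [map_add, hz, ht]
  | tmul v y => rfl

theorem sumEnd_mem {N : ℕ} {X : Fin N → SuperSpace.{u, w} k} {A : SCommAlg.{u, a} k}
    (φ : ∀ i, AEnd (X i) A) :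
    sumEnd X A (fun i => φ i) ∈ AEnd (SuperSpace.directSum X) A := by
  refine ⟨fun x z => ?_, fun d z hz => ?_⟩
  · have h : sumEnd X A (fun i => φ i) ∘ₗ rmul (SuperSpace.directSum X) A x =
        rmul (SuperSpace.directSum X) A x ∘ₗ sumEnd X A (fun i => φ i) := by
      refine sum_hom_ext fun i z => ?_
      have h0 := fun z => (rTensor_rmul (V := X i) (W := SuperSpace.directSum X)
        (LinearMap.single k (fun i => (X i : Type w)) i) A x z)
      rw [LinearMap.comp_apply, LinearMap.comp_apply, ← h0, sumEnd_single, sumEnd_single,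
        (φ i).2.1, h0]
    exact LinearMap.congr_fun h z
  · rw [sumEnd, LinearMap.sum_apply]
    refine Submodule.sum_mem _ fun i _ => ?_
    rw [LinearMap.comp_apply, LinearMap.comp_apply]
    refine rTensor_mem (V := X i) (W := SuperSpace.directSum X) _ ?_ A.toSuperSpace
      ((φ i).2.2 d _ (rTensor_mem (V := SuperSpace.directSum X) (W := X i) _ ?_
        A.toSuperSpace hz))
    · exact fun d v hv => single_mem X i hv
    · exact fun d v hv => hv i trivial

/-- The direct sum of a finite family of representations. -/
noncomputable def Rep.directSum {N : ℕ} {X : Fin N → SuperSpace.{u, w} k}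
    (ρ : ∀ i, Rep M (X i)) : Rep M (SuperSpace.directSum X) where
  finite :=
    haveI := fun i => (ρ i).finite
    inferInstanceAs (Module.Finite k (∀ i, X i))
  act A :=
    { toFun := fun g => ⟨sumEnd X A fun i => (ρ i).act A g, sumEnd_mem _⟩
      map_one' := by
        refine Subtype.ext (sum_hom_ext fun i z => ?_)
        rw [sumEnd_single, map_one]
        rfl
      map_mul' := fun g h => by
        refine Subtype.ext (sum_hom_ext fun i z => ?_)
        rw [sumEnd_single, map_mul]
        change _ = sumEnd X A _ (sumEnd X A _ _)
        rw [sumEnd_single, sumEnd_single]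
        rfl }
  act_map {A B} f g z := by
    have h : baseMap (SuperSpace.directSum X) f ∘ₗ sumEnd X A (fun i => (ρ i).act A g) =
        sumEnd X B (fun i => (ρ i).act B (M.map f g)) ∘ₗ baseMap (SuperSpace.directSum X) f := by
      refine sum_hom_ext fun i z => ?_
      have h0 := fun z => (rTensor_baseMap (V := X i) (W := SuperSpace.directSum X)
        (LinearMap.single k (fun i => (X i : Type w)) i) f z)
      rw [LinearMap.comp_apply, LinearMap.comp_apply, ← h0, sumEnd_single, sumEnd_single,
        ← h0, (ρ i).act_map]
    exact LinearMap.congr_fun h z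
  act_eps A d v hv x := by
    have h : v = ∑ i, Pi.single i (v i) := (Finset.univ_sum_single v).symm
    change sumEnd X A (fun i => (ρ i).act A (M.eps A)) (v ⊗ₜ[k] x) = _
    rw [h, TensorProduct.sum_tmul, map_sum, Finset.smul_sum]
    refine Finset.sum_congr rfl fun i _ => ?_
    have h1 := sumEnd_single X A (fun i => (ρ i).act A (M.eps A)) i (v i ⊗ₜ[k] x)
    rw [(ρ i).act_eps A d _ (hv i trivial), map_smul] at h1
    exact h1

/-- The tensor product of the super vector spaces `X γ` for `γ` in a list. -/
abbrev SuperSpace.tensorList {Γ : Type v} (X : Γ → SuperSpace.{u, u} k) :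
    List Γ → SuperSpace.{u, u} k
  | [] => SuperSpace.unit k
  | γ :: l => (X γ).tensor (SuperSpace.tensorList X l)

/-- The tensor product of the representations `ρ γ` for `γ` in a list. -/
noncomputable def Rep.tensorList {Γ : Type v} {X : Γ → SuperSpace.{u, u} k}
    (ρ : ∀ γ, Rep M (X γ)) : ∀ l : List Γ, Rep M (SuperSpace.tensorList X l)
  | [] => Rep.unit M
  | γ :: l => (ρ γ).tensor (Rep.tensorList ρ l)

end constructions

/-! ## The super monoids `M_{m|n}` and the super groups `GL_{m|n}` -/

section matrices

variable {k : Type u} [Field k] {ι : Type} [Fintype ι] [DecidableEq ι]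

/-- The monoid of square matrices with rows and columns indexed by `ι` whose entry at `(s, t)` has
degree `p s + p t`: the points in `A` of the super monoid of endomorphisms of the super vector space
with homogeneous basis `ι`. -/
def superMat (p : ι → ZMod 2) (A : SCommAlg.{u, a} k) : Submonoid (Matrix ι ι A) where
  carrier := {X | ∀ s t, X s t ∈ A.gr (p s + p t)}
  one_mem' s t := by
    have h2 : ∀ q : ZMod 2, q + q = 0 := by decide
    by_cases h : s = t
    · subst h
      rw [Matrix.one_apply_eq, h2]
      exact A.one_mem
    · rw [Matrix.one_apply_ne h]
      exact Submodule.zero_mem _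
  mul_mem' {X Y} hX hY s t := by
    have h2 : ∀ q r l : ZMod 2, q + r + (r + l) = q + l := by decide
    rw [Matrix.mul_apply]
    refine Submodule.sum_mem _ fun r _ => ?_
    have h := A.mul_mem (hX s r) (hY r t)
    rwa [h2] at h

/-- The map on matrices induced by a homomorphism of commutative super algebras. -/
def superMat.map (p : ι → ZMod 2) {A B : SCommAlg.{u, a} k} (f : A.Hom B) :
    superMat p A →* superMat p B where
  toFun X := ⟨X.1.map f.toAlgHom, fun s t => f.map_gr _ _ (X.2 s t)⟩
  map_one' := Subtype.ext (Matrix.map_one _ (map_zero _) (map_one _))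
  map_mul' _ _ := Subtype.ext (Matrix.map_mul)

/-- The diagonal matrix with entries `(-1) ^ p s`. -/
def superMat.eps (p : ι → ZMod 2) (A : SCommAlg.{u, a} k) : superMat p A :=
  ⟨Matrix.diagonal fun s => sgn k (p s) • (1 : A), fun s t => by
    have h2 : ∀ q : ZMod 2, q + q = 0 := by decide
    by_cases h : s = t
    · subst h
      rw [Matrix.diagonal_apply_eq, h2]
      exact Submodule.smul_mem _ _ A.one_mem
    · rw [Matrix.diagonal_apply_ne _ h]
      exact Submodule.zero_mem _⟩

theorem superMat.map_eps (p : ι → ZMod 2) {A B : SCommAlg.{u, a} k} (f : A.Hom B) :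
    superMat.map p f (superMat.eps p A) = superMat.eps p B := by
  refine Subtype.ext ?_
  simp only [superMat.map, superMat.eps, MonoidHom.coe_mk, OneHom.coe_mk]
  rw [Matrix.diagonal_map (map_zero _)]
  congr 1
  funext s
  rw [map_smul, map_one]

theorem superMat.eps_mul_eps (p : ι → ZMod 2) (A : SCommAlg.{u, a} k) :
    superMat.eps p A * superMat.eps p A = 1 := by
  refine Subtype.ext ?_
  change Matrix.diagonal _ * Matrix.diagonal _ = 1
  rw [Matrix.diagonal_mul_diagonal, ← Matrix.diagonal_one]
  congr 1
  funext s
  rw [smul_mul_smul_comm, sgn_mul_self, one_smul, one_mul]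

theorem superMat.eps_conj (p : ι → ZMod 2) (A : SCommAlg.{u, a} k) (X : superMat p A) :
    superMat.eps p A * X * superMat.eps p A = superMat.map p A.parityHom X := by
  refine Subtype.ext (Matrix.ext fun s t => ?_)
  change ((Matrix.diagonal fun s => sgn k (p s) • (1 : A)) * X.1 *
    Matrix.diagonal fun s => sgn k (p s) • (1 : A)) s t = A.parityHom.toAlgHom (X.1 s t)
  rw [A.parityHom_of_mem (X.2 s t), Matrix.mul_diagonal, Matrix.diagonal_mul, sgn_add]
  simp [smul_smul, mul_comm]

/-- The matrix `superMat.eps` as an invertible matrix, equal to its own inverse. -/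
def superMat.epsUnit (p : ι → ZMod 2) (A : SCommAlg.{u, a} k) : (superMat p A)ˣ :=
  ⟨superMat.eps p A, superMat.eps p A, superMat.eps_mul_eps p A, superMat.eps_mul_eps p A⟩

theorem superMat.map_epsUnit (p : ι → ZMod 2) {A B : SCommAlg.{u, a} k} (f : A.Hom B) :
    Units.map (superMat.map p f) (superMat.epsUnit p A) = superMat.epsUnit p B :=
  Units.ext (superMat.map_eps p f)

theorem superMat.epsUnit_mul_epsUnit (p : ι → ZMod 2) (A : SCommAlg.{u, a} k) :
    superMat.epsUnit p A * superMat.epsUnit p A = 1 :=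
  Units.ext (superMat.eps_mul_eps p A)

theorem superMat.epsUnit_conj (p : ι → ZMod 2) (A : SCommAlg.{u, a} k) (X : (superMat p A)ˣ) :
    superMat.epsUnit p A * X * superMat.epsUnit p A = Units.map (superMat.map p A.parityHom) X :=
  Units.ext (superMat.eps_conj p A X.1)

/-- The endomorphism `∑ e_{st} ⊗ X_{st}` of the right `A`-module with basis `ι` defined by the
matrix `X`. -/
noncomputable def matEnd (p : ι → ZMod 2) (A : SCommAlg.{u, a} k) (X : Matrix ι ι A) :
    Module.End k (SuperSpace.free k p ⊗[k] A) :=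
  ∑ s, ∑ t, TensorProduct.map (LinearMap.single k (fun _ : ι => k) s ∘ₗ LinearMap.proj t)
    (LinearMap.mulLeft k (X s t))

theorem matEnd_single (p : ι → ZMod 2) (A : SCommAlg.{u, a} k) (X : Matrix ι ι A) (t : ι) (x : A) :
    matEnd p A X ((Pi.single t 1 : ι → k) ⊗ₜ[k] x) =
      ∑ s, (Pi.single s 1 : ι → k) ⊗ₜ[k] (X s t * x) := by
  rw [matEnd, LinearMap.sum_apply]
  refine Finset.sum_congr rfl fun s _ => ?_
  rw [LinearMap.sum_apply, Finset.sum_eq_single t]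
  · simp
  · intro r _ hr
    simp [hr]
  · intro h
    exact absurd (Finset.mem_univ t) h

theorem free_ext (p : ι → ZMod 2) {A : SCommAlg.{u, a} k} {Y : Type b'} [AddCommGroup Y]
    [Module k Y] {f g : SuperSpace.free k p ⊗[k] A →ₗ[k] Y}
    (h : ∀ (t : ι) (x : A), f ((Pi.single t 1 : ι → k) ⊗ₜ[k] x) =
      g ((Pi.single t 1 : ι → k) ⊗ₜ[k] x)) : f = g := by
  refine TensorProduct.ext (LinearMap.pi_ext' fun t => LinearMap.ext_ring ?_)
  exact LinearMap.ext fun x => h t x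

theorem single_mem_free {ι : Type} [DecidableEq ι] (p : ι → ZMod 2) (s : ι) :
    (Pi.single s 1 : ι → k) ∈ (SuperSpace.free k p).gr (p s) := by
  intro t ht
  exact Pi.single_eq_of_ne (fun h => ht (by rw [h])) _

theorem matEnd_mem (p : ι → ZMod 2) (A : SCommAlg.{u, a} k) (X : superMat p A) :
    matEnd p A X.1 ∈ AEnd (SuperSpace.free k p) A := by
  refine ⟨fun x z => ?_, fun d z hz => ?_⟩
  · have h : matEnd p A X.1 ∘ₗ rmul (SuperSpace.free k p) A x =
        rmul (SuperSpace.free k p) A x ∘ₗ matEnd p A X.1 := by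
      refine free_ext p fun t y => ?_
      simp only [LinearMap.comp_apply]
      rw [rmul_tmul, matEnd_single, matEnd_single, map_sum]
      exact Finset.sum_congr rfl fun s _ => by rw [rmul_tmul, mul_assoc]
    exact LinearMap.congr_fun h z
  · induction hz using Submodule.span_induction with
    | zero => simp
    | add p q _ _ hp hq => rw [map_add]; exact Submodule.add_mem _ hp hq
    | smul c p _ hp => rw [map_smul]; exact Submodule.smul_mem _ _ hp
    | mem z hz =>
      obtain ⟨i, j, rfl, v, hv, x, hx, rfl⟩ := hz
      have hv1 : v = ∑ t, v t • (Pi.single t 1 : ι → k) := by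
        rw [← Finset.univ_sum_single v]
        simp [← Pi.single_smul]
      rw [hv1, TensorProduct.sum_tmul, map_sum]
      refine Submodule.sum_mem _ fun t _ => ?_
      rw [← TensorProduct.smul_tmul', map_smul]
      by_cases h : p t = i
      · subst h
        refine Submodule.smul_mem _ _ ?_
        rw [matEnd_single]
        refine Submodule.sum_mem _ fun s _ => ?_
        have h3 := tmul_mem (W := A.toSuperSpace) (single_mem_free (k := k) p s)
          (A.mul_mem (X.2 s t) hx)
        have h2 : ∀ q r l : ZMod 2, q + (q + r + l) = r + l := by decide
        rwa [h2] at h3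
      · rw [hv t h, zero_smul]
        exact Submodule.zero_mem _

/-- The action of matrices on the free module with basis `ι`. -/
noncomputable def matAct (p : ι → ZMod 2) (A : SCommAlg.{u, a} k) :
    superMat p A →* AEnd (SuperSpace.free k p) A where
  toFun X := ⟨matEnd p A X.1, matEnd_mem p A X⟩
  map_one' := by
    refine Subtype.ext (free_ext p fun t x => ?_)
    rw [matEnd_single, Finset.sum_eq_single t]
    · simp
    · intro s _ hs
      simp [Matrix.one_apply_ne hs]
    · intro h
      exact absurd (Finset.mem_univ t) h
  map_mul' X Y := by
    refine Subtype.ext (free_ext p fun t x => ?_)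
    change matEnd p A (X.1 * Y.1) _ = matEnd p A X.1 (matEnd p A Y.1 _)
    rw [matEnd_single, matEnd_single, map_sum]
    simp only [Matrix.mul_apply, Finset.sum_mul, TensorProduct.tmul_sum, mul_assoc]
    rw [Finset.sum_comm]
    exact Finset.sum_congr rfl fun r _ => (matEnd_single p A X.1 r _).symm

end matrices

section families

/-- The parities of the standard basis of `k^{m|n}`: `m` even and `n` odd elements. -/
def par (m n : ℕ) : Fin m ⊕ Fin n → ZMod 2 := Sum.elim (fun _ => 0) (fun _ => 1)

/-- The super monoid with involution `(M_{m|n}, ε)` for families `m`, `n` of natural numbers indexed by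
`Γ`: the product over `γ` of the super monoids of endomorphisms of `k^{m γ|n γ}`. -/
noncomputable def superM (k : Type u) [Field k] {Γ : Type v} (m n : Γ → ℕ) :
    SuperMonoid.{u, a, max v a} k where
  pts A := ∀ γ, superMat (par (m γ) (n γ)) A
  monoid _ := inferInstance
  map f :=
    { toFun := fun g γ => superMat.map (par (m γ) (n γ)) f (g γ)
      map_one' := funext fun _ => map_one _
      map_mul' := fun _ _ => funext fun _ => map_mul _ _ _ }
  map_id _ _ := rfl
  map_comp _ _ _ := rfl
  eps A γ := superMat.eps (par (m γ) (n γ)) A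
  map_eps f := funext fun _ => superMat.map_eps _ f
  eps_mul_eps A := funext fun _ => superMat.eps_mul_eps _ A
  eps_conj A g := funext fun _ => superMat.eps_conj _ A (g _)

/-- The super group with involution `(GL_{m|n}, ε)` for families `m`, `n` indexed by `Γ`: the product
over `γ` of the super groups of invertible elements of the `M_{m γ|n γ}`. -/
noncomputable def superGL (k : Type u) [Field k] {Γ : Type v} (m n : Γ → ℕ) :
    SuperMonoid.{u, a, max v a} k where
  pts A := ∀ γ, (superMat (par (m γ) (n γ)) A)ˣ
  monoid _ := inferInstance
  map f :=
    { toFun := fun g γ => Units.map (superMat.map (par (m γ) (n γ)) f) (g γ)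
      map_one' := funext fun _ => map_one _
      map_mul' := fun _ _ => funext fun _ => map_mul _ _ _ }
  map_id _ _ := funext fun _ => Units.ext rfl
  map_comp _ _ _ := funext fun _ => Units.ext rfl
  eps A γ := superMat.epsUnit (par (m γ) (n γ)) A
  map_eps f := funext fun _ => superMat.map_epsUnit _ f
  eps_mul_eps A := funext fun _ => superMat.epsUnit_mul_epsUnit _ A
  eps_conj A g := funext fun _ => superMat.epsUnit_conj _ A (g _)

theorem superGL_isGroup (k : Type u) [Field k] {Γ : Type v} (m n : Γ → ℕ) :
    (superGL.{u, v, a} k m n).IsGroup := by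
  intro A (g : ∀ γ, (superMat (par (m γ) (n γ)) A)ˣ)
  have h : IsUnit g := ⟨⟨g, g⁻¹, mul_inv_cancel g, inv_mul_cancel g⟩, rfl⟩
  exact h

/-- The embedding of `GL_{m|n}` into `M_{m|n}`. -/
noncomputable def superGL.toM (k : Type u) [Field k] {Γ : Type v} (m n : Γ → ℕ) :
    (superGL.{u, v, a} k m n).Hom (superM.{u, v, a} k m n) where
  app A :=
    { toFun := fun g γ => (g γ).1
      map_one' := rfl
      map_mul' := fun _ _ => rfl }
  app_map _ _ := rfl
  app_eps _ := rfl

/-- The standard representation `E_γ` of `(M_{m|n}, ε)`, on `k^{m γ|n γ}`. -/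
noncomputable def stdRep (k : Type u) [Field k] {Γ : Type v} (m n : Γ → ℕ) (γ : Γ) :
    Rep (superM.{u, v, a} k m n) (SuperSpace.free k (par (m γ) (n γ))) where
  finite := inferInstanceAs (Module.Finite k (Fin (m γ) ⊕ Fin (n γ) → k))
  act A := (matAct (par (m γ) (n γ)) A).comp
    (Pi.evalMonoidHom (fun γ => superMat (par (m γ) (n γ)) A) γ)
  act_map {_ B} f g z := by
    have h : baseMap (SuperSpace.free k (par (m γ) (n γ))) f ∘ₗ matEnd _ _ (g γ).1 =
        matEnd _ B (superMat.map _ f (g γ)).1 ∘ₗ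
          baseMap (SuperSpace.free k (par (m γ) (n γ))) f := by
      refine free_ext _ fun t x => ?_
      rw [LinearMap.comp_apply, LinearMap.comp_apply, baseMap_tmul, matEnd_single, matEnd_single,
        map_sum]
      refine Finset.sum_congr rfl fun s _ => ?_
      rw [baseMap_tmul, map_mul]
      rfl
    exact LinearMap.congr_fun h z
  act_eps A d v hv x := by
    change matEnd _ A (superMat.eps (par (m γ) (n γ)) A).1 _ = _
    have hv1 : v = ∑ t, v t • (Pi.single t 1 : Fin (m γ) ⊕ Fin (n γ) → k) := by
      rw [← Finset.univ_sum_single v]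
      simp [← Pi.single_smul]
    rw [hv1, TensorProduct.sum_tmul, map_sum, Finset.smul_sum]
    refine Finset.sum_congr rfl fun t _ => ?_
    rw [← TensorProduct.smul_tmul', map_smul, smul_comm]
    by_cases h : par (m γ) (n γ) t = d
    · rw [matEnd_single, Finset.sum_eq_single t]
      · simp only [superMat.eps, Matrix.diagonal_apply_eq, smul_mul_assoc, one_mul,
          TensorProduct.tmul_smul, h]
      · intro s _ hs
        simp [superMat.eps, Matrix.diagonal_apply_ne _ hs]
      · intro h
        exact absurd (Finset.mem_univ t) h
    · rw [hv t h, zero_smul, zero_smul]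

/-- The restriction of `E_γ` to a representation of `(GL_{m|n}, ε)`. -/
noncomputable def stdRepGL (k : Type u) [Field k] {Γ : Type v} (m n : Γ → ℕ) (γ : Γ) :
    Rep (superGL.{u, v, a} k m n) (SuperSpace.free k (par (m γ) (n γ))) :=
  (stdRep k m n γ).res (superGL.toM k m n)

/-- The super vector space underlying the mixed tensor representation `mixedRep k m n r s`. -/
abbrev mixedSpace (k : Type u) [Field k] {Γ : Type v} (m n : Γ → ℕ) (r s : List Γ) :
    SuperSpace.{u, u} k :=
  (SuperSpace.tensorList (fun γ => SuperSpace.free k (par (m γ) (n γ))) r).tensor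
    (SuperSpace.tensorList (fun γ => (SuperSpace.free k (par (m γ) (n γ))).dual) s)

/-- The mixed tensor representation of `(GL_{m|n}, ε)`: the tensor product of the `E_γ` for `γ` in `r`
and of the duals of the `E_γ` for `γ` in `s`. -/
noncomputable def mixedRep (k : Type u) [Field k] {Γ : Type v} (m n : Γ → ℕ) (r s : List Γ) :
    Rep (superGL.{u, v, a} k m n) (mixedSpace k m n r s) :=
  (Rep.tensorList (stdRepGL k m n) r).tensor
    (Rep.tensorList (fun γ => (stdRepGL k m n γ).dual (superGL_isGroup k m n)) s)

end families

end SuperGL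

/-!
A function on `M_{m|n}` is a family of maps `M_{m|n}(A) → A` natural in `A`. By the Yoneda lemma,
applied to the algebra generated by the entries of a generic point, such a function is a polynomial
in the entries of the matrices (`superM_natFn_le`); a function on `GL_{m|n}` is a polynomial in the
entries of the matrices and of their inverses (`superGL_natFn_le`). The matrix coefficients of a
representation are functions of this kind.

*Extension to `M`.* The representation `W` has to clear the denominators of the matrix coefficients
of `V`, that is, of the entries of the inverses `X⁻¹`. Let `E` be a standard representation. For
`d` large, the permutations of `d + 1` letters act on `E^{⊗(d+1)}` by linearly dependent
endomorphisms, as `(d + 1)!` outgrows the dimension of the space of matrices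
(`exists_relation`). Let `d` be minimal and compose the relation with `Q ⊗ X ⊗ ⋯ ⊗ X`, where `Q` is
`X⁻¹` times an elementary matrix, and take the partial supertrace over the first factor. The
permutations fixing the first letter contribute an entry of `X⁻¹` times
`X ⊗ ⋯ ⊗ X` times a combination `c` of permutations of `d` letters, which is nonzero by the
minimality of `d`; in the other terms `X⁻¹` only appears multiplied by `X`. Hence the image of `c`
on `E^{⊗d}` is a nonzero representation of `M` whose matrix coefficients multiply the entries of
`X⁻¹` into polynomials (`exists_clearing`, `exists_clears_inv`). Tensor products of such
representations clear the denominators of finitely many functions (`Clears.mul`,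
`exists_clears_finset`), so the matrix coefficients of `V ⊗ W` extend to `M` for a suitable `W`. The
extension satisfies the laws of a representation because `GL` is dense in `M`: any point `X` of `M`
is the value at `t = 1` of `1 + t (X - 1)`, which is invertible over the power series in `t`
(`exists_path`, `exists_extension`). This is `exists_tensor_extension`.

*Mixed tensors.* The condition of being a subrepresentation and a quotient of finite direct sums of
members of a family is used in the form `Rep.DetectedBy`, which asks for enough homomorphisms to and
from the members; it is transitive and compatible with tensor products, duals and restriction.
A representation of `M` is detected by tensor products of standard representations
(`superM_detectedBy`). Indeed, its matrix coefficients involve finitely many of the factors of `M`,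
so they are combinations of entries of tensor powers of block diagonal matrices
(`BlockHom.exists_expands`). In `ρ (z * g) = ρ z * ρ g`, let `z` be a sum of `d` matrix units whose
coefficients are new variables of square zero, even or odd, and compare the coefficients of the
product of these variables: by `polarization`, the symmetrizations of the coefficients of degree `d`
are the components of homomorphisms between `ρ` and the `d`-th tensor power
(`wordSym_mul_right`, `wordSym_mul_left`). In characteristic `0` these symmetrizations, divided by
`d!`, add up to the identity of `ρ` (`BlockHom.Expands.sum_self`), so the homomorphisms detect `ρ`
(`BlockHom.Expands.detectedBy`).

If `V` is a representation of `GL` and `V ⊗ W` extends to `M`, with `W ≠ 0` a representation of `M`,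
then `V ⊗ W` and `W` are detected by tensor products of standard representations, hence
`V ⊗ W ⊗ W^∨` is detected by the mixed tensor representations. Coevaluation and evaluation make `V` a
subrepresentation and a quotient of `V ⊗ W ⊗ W^∨` (`Rep.detectedBy_tensor_dual`), which gives
`superGL_detectedBy`.
-/

namespace SuperGL

/-! ### Polynomials, power series and odd variables over a commutative super algebra -/

section algebras

variable {k : Type u} [Field k]

theorem two_eq_zero_zmod2 : (1 + 1 : ZMod 2) = 0 := by decide

theorem SCommAlg.mem_sup (A : SCommAlg.{u, a} k) (x : A) : x ∈ A.gr 0 ⊔ A.gr 1 := by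
  rw [A.isCompl.sup_eq_top]; trivial

theorem SCommAlg.eq_zero_of_mem (A : SCommAlg.{u, a} k) {x : A} (h0 : x ∈ A.gr 0)
    (h1 : x ∈ A.gr 1) : x = 0 :=
  (Submodule.disjoint_def.1 A.isCompl.disjoint) x h0 h1

theorem SCommAlg.Hom.map_parity {A B : SCommAlg.{u, a} k} (f : A.Hom B) (x : A) :
    f.toAlgHom (A.parityHom.toAlgHom x) = B.parityHom.toAlgHom (f.toAlgHom x) := by
  have h : f.toAlgHom.toLinearMap ∘ₗ A.parityHom.toAlgHom.toLinearMap =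
      B.parityHom.toAlgHom.toLinearMap ∘ₗ f.toAlgHom.toLinearMap := by
    refine A.toSuperSpace.hom_ext fun i x hx => ?_
    simp only [LinearMap.comp_apply, AlgHom.toLinearMap_apply]
    rw [A.parityHom_of_mem hx, B.parityHom_of_mem (f.map_gr _ _ hx), map_smul]
  exact LinearMap.congr_fun h x

theorem SCommAlg.parity_parity (A : SCommAlg.{u, a} k) (x : A) :
    A.parityHom.toAlgHom (A.parityHom.toAlgHom x) = x :=
  A.toSuperSpace.parity_parity x

/-- The commutative super algebra `A[t]`, with `t` even. -/
noncomputable abbrev SCommAlg.poly (A : SCommAlg.{u, a} k) : SCommAlg.{u, a} k where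
  carrier := Polynomial A
  gr i :=
    { carrier := {f | ∀ n, f.coeff n ∈ A.gr i}
      add_mem' := fun hf hg n => by
        rw [Polynomial.coeff_add]; exact Submodule.add_mem _ (hf n) (hg n)
      zero_mem' := fun n => by rw [Polynomial.coeff_zero]; exact Submodule.zero_mem _
      smul_mem' := fun c f hf n => by
        rw [Polynomial.coeff_smul]; exact Submodule.smul_mem _ _ (hf n) }
  isCompl := by
    refine ⟨?_, codisjoint_iff_le_sup.2 fun f _ => ?_⟩
    · rw [Submodule.disjoint_def]
      intro f h0 h1
      ext n
      exact A.eq_zero_of_mem (h0 n) (h1 n)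
    · induction f using Polynomial.induction_on' with
      | add p q hp hq => exact Submodule.add_mem _ (hp trivial) (hq trivial)
      | monomial n x =>
        obtain ⟨y, hy, z, hz, rfl⟩ := Submodule.mem_sup.1 (A.mem_sup x)
        refine Submodule.mem_sup.2 ⟨Polynomial.monomial n y, fun l => ?_,
          Polynomial.monomial n z, fun l => ?_, (map_add _ _ _).symm⟩ <;>
        · rw [Polynomial.coeff_monomial]
          split_ifs
          · assumption
          · exact Submodule.zero_mem _
  one_mem n := by
    rw [Polynomial.coeff_one]
    split_ifs
    · exact A.one_mem
    · exact Submodule.zero_mem _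
  mul_mem hf hg n := by
    rw [Polynomial.coeff_mul]
    exact Submodule.sum_mem _ fun x _ => A.mul_mem (hf _) (hg _)
  super_comm hf hg := by
    ext n
    rw [Polynomial.coeff_smul, Polynomial.coeff_mul, Polynomial.coeff_mul, Finset.smul_sum,
      ← Finset.Nat.sum_antidiagonal_swap]
    exact Finset.sum_congr rfl fun x _ => A.super_comm (hf _) (hg _)

/-- The commutative super algebra `A⟦t⟧`, with `t` even. -/
noncomputable abbrev SCommAlg.series (A : SCommAlg.{u, a} k) : SCommAlg.{u, a} k where
  carrier := PowerSeries A
  gr i :=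
    { carrier := {f | ∀ n, PowerSeries.coeff n f ∈ A.gr i}
      add_mem' := fun hf hg n => by
        rw [map_add]; exact Submodule.add_mem _ (hf n) (hg n)
      zero_mem' := fun n => by rw [map_zero]; exact Submodule.zero_mem _
      smul_mem' := fun c f hf n => by
        have h : PowerSeries.coeff n (c • f) = c • PowerSeries.coeff n f := rfl
        rw [h]; exact Submodule.smul_mem _ _ (hf n) }
  isCompl := by
    refine ⟨?_, codisjoint_iff_le_sup.2 fun f _ => ?_⟩
    · rw [Submodule.disjoint_def]
      intro f h0 h1
      ext n
      exact A.eq_zero_of_mem (h0 n) (h1 n)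
    · refine Submodule.mem_sup.2 ⟨PowerSeries.mk fun n => A.toSuperSpace.pr 0 (PowerSeries.coeff n f),
        fun n => ?_, PowerSeries.mk fun n => A.toSuperSpace.pr 1 (PowerSeries.coeff n f),
        fun n => ?_, ?_⟩
      · rw [PowerSeries.coeff_mk]; exact A.toSuperSpace.pr_mem 0 _
      · rw [PowerSeries.coeff_mk]; exact A.toSuperSpace.pr_mem 1 _
      · ext n
        rw [map_add, PowerSeries.coeff_mk, PowerSeries.coeff_mk]
        exact A.toSuperSpace.pr_add_pr _
  one_mem n := by
    rw [PowerSeries.coeff_one]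
    split_ifs
    · exact A.one_mem
    · exact Submodule.zero_mem _
  mul_mem hf hg n := by
    rw [PowerSeries.coeff_mul]
    exact Submodule.sum_mem _ fun x _ => A.mul_mem (hf _) (hg _)
  super_comm {i j f g} hf hg := by
    ext n
    have h : PowerSeries.coeff n (sgn k (i * j) • (g * f)) =
      sgn k (i * j) • PowerSeries.coeff n (g * f) := rfl
    rw [h, PowerSeries.coeff_mul, PowerSeries.coeff_mul, Finset.smul_sum,
      ← Finset.Nat.sum_antidiagonal_swap]
    exact Finset.sum_congr rfl fun x _ => A.super_comm (hf _) (hg _)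

/-- The evaluation `A[t] → A` at `t = 1`. -/
noncomputable def SCommAlg.evalOne (A : SCommAlg.{u, a} k) : A.poly.Hom A where
  toAlgHom :=
    { Polynomial.eval₂RingHom' (RingHom.id A) 1 (fun _ => Commute.one_right _) with
      commutes' := fun c => by
        change Polynomial.eval₂ (RingHom.id A) 1 (algebraMap k (Polynomial A) c) = _
        rw [Polynomial.algebraMap_apply, Polynomial.eval₂_C]
        rfl }
  map_gr i f hf := by
    suffices h : Polynomial.eval₂ (RingHom.id A) 1 f ∈ A.gr i from h
    rw [Polynomial.eval₂_eq_sum, Polynomial.sum]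
    refine Submodule.sum_mem _ fun n _ => ?_
    rw [one_pow, mul_one]
    exact hf n

/-- The inclusion of `A[t]` in `A⟦t⟧`. -/
noncomputable def SCommAlg.polySeries (A : SCommAlg.{u, a} k) : A.poly.Hom A.series where
  toAlgHom :=
    { toFun := fun f => (PowerSeries.mk f.coeff : PowerSeries A)
      map_one' := by
        refine PowerSeries.ext fun n => ?_
        rw [PowerSeries.coeff_mk]
        erw [PowerSeries.coeff_one]
        exact Polynomial.coeff_one
      map_zero' := by
        refine PowerSeries.ext fun n => ?_
        rw [PowerSeries.coeff_mk]
        exact Polynomial.coeff_zero n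
      map_mul' := fun f g => by
        refine PowerSeries.ext fun n => ?_
        rw [PowerSeries.coeff_mk]
        erw [PowerSeries.coeff_mul]
        simp only [PowerSeries.coeff_mk]
        exact Polynomial.coeff_mul f g n
      map_add' := fun f g => by
        refine PowerSeries.ext fun n => ?_
        erw [map_add]
      commutes' := fun c => by
        refine PowerSeries.ext fun n => ?_
        rw [PowerSeries.coeff_mk]
        have h : PowerSeries.coeff n (algebraMap k (PowerSeries A) c) =
            c • PowerSeries.coeff n (1 : PowerSeries A) := by
          rw [Algebra.algebraMap_eq_smul_one]; rfl
        refine Eq.trans ?_ h.symm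
        rw [Algebra.algebraMap_eq_smul_one, Polynomial.coeff_smul, PowerSeries.coeff_one,
          Polynomial.coeff_one] }
  map_gr i f hf n := by
    change PowerSeries.coeff n (PowerSeries.mk f.coeff) ∈ _
    rw [PowerSeries.coeff_mk]; exact hf n

theorem SCommAlg.polySeries_injective (A : SCommAlg.{u, a} k) :
    Function.Injective A.polySeries.toAlgHom := by
  intro f g h
  refine Polynomial.ext fun n => ?_
  have h1 : PowerSeries.coeff n (PowerSeries.mk (Polynomial.coeff f)) =
    PowerSeries.coeff n (PowerSeries.mk (Polynomial.coeff g)) := congrArg (PowerSeries.coeff n) h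
  rwa [PowerSeries.coeff_mk, PowerSeries.coeff_mk] at h1

/-- The homomorphism acting in degree `i` by `(-1) ^ (q * i)`. -/
noncomputable def SCommAlg.twist (A : SCommAlg.{u, a} k) (q : ZMod 2) : A.Hom A :=
  if q = 0 then SCommAlg.Hom.id A else A.parityHom

theorem SCommAlg.twist_of_mem (A : SCommAlg.{u, a} k) (q : ZMod 2) {i : ZMod 2} {x : A}
    (hx : x ∈ A.gr i) : (A.twist q).toAlgHom x = sgn k (q * i) • x := by
  rcases zmod2_cases q with rfl | rfl
  · rw [zero_mul, sgn_zero, one_smul]; rfl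
  · rw [one_mul, ← A.parityHom_of_mem hx]; rfl

theorem SCommAlg.twist_twist (A : SCommAlg.{u, a} k) (q : ZMod 2) (x : A) :
    (A.twist q).toAlgHom ((A.twist q).toAlgHom x) = x := by
  rcases zmod2_cases q with rfl | rfl
  · rfl
  · exact A.parity_parity x

theorem SCommAlg.Hom.map_twist {A B : SCommAlg.{u, a} k} (f : A.Hom B) (q : ZMod 2) (x : A) :
    f.toAlgHom ((A.twist q).toAlgHom x) = (B.twist q).toAlgHom (f.toAlgHom x) := by
  rcases zmod2_cases q with rfl | rfl
  · rfl
  · exact f.map_parity x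

/-- The algebra `A⟨y⟩` obtained from `A` by adjoining a variable `y` of degree `q`, with `y ^ 2 = 0`.
The element `x + z * y` is encoded as the matrix with rows `(x, z)` and `(0, x')`, where `x'` is
such that `y * x = x' * y`. -/
def SCommAlg.adjSub (A : SCommAlg.{u, a} k) (q : ZMod 2) :
    Subalgebra k (Matrix (Fin 2) (Fin 2) A) where
  carrier := {X | X 1 0 = 0 ∧ X 1 1 = (A.twist q).toAlgHom (X 0 0)}
  mul_mem' {X Y} hX hY := by
    simp only [Set.mem_ofPred_eq, Matrix.mul_apply, Fin.sum_univ_two, hX.1, hY.1, hX.2, hY.2,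
      zero_mul, mul_zero, add_zero, zero_add, map_mul, and_self]
  add_mem' {X Y} hX hY := by
    simp only [Set.mem_ofPred_eq, Matrix.add_apply, hX.1, hY.1, hX.2, hY.2, add_zero, map_add,
      and_self]
  algebraMap_mem' c := by
    simp [Matrix.algebraMap_matrix_apply]

theorem SCommAlg.adjSub_ext {A : SCommAlg.{u, a} k} {q : ZMod 2} {X Y : A.adjSub q}
    (h0 : X.1 0 0 = Y.1 0 0) (h1 : X.1 0 1 = Y.1 0 1) : X = Y := by
  refine Subtype.ext (Matrix.ext fun i j => ?_)
  fin_cases i <;> fin_cases j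
  · exact h0
  · exact h1
  · exact X.2.1.trans Y.2.1.symm
  · exact X.2.2.trans ((congrArg _ h0).trans Y.2.2.symm)

/-- The element `x + z * y` of `A⟨y⟩`. -/
noncomputable def SCommAlg.adjMk (A : SCommAlg.{u, a} k) (q : ZMod 2) (x z : A) : A.adjSub q :=
  ⟨!![x, z; 0, (A.twist q).toAlgHom x], rfl, rfl⟩

theorem SCommAlg.adjSub_mul_zero {A : SCommAlg.{u, a} k} {q : ZMod 2} (X Y : A.adjSub q) :
    (X * Y).1 0 0 = X.1 0 0 * Y.1 0 0 := by
  refine (Matrix.mul_apply ..).trans ?_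
  rw [Fin.sum_univ_two, Y.2.1, mul_zero, add_zero]

theorem SCommAlg.adjSub_mul_one {A : SCommAlg.{u, a} k} {q : ZMod 2} (X Y : A.adjSub q) :
    (X * Y).1 0 1 = X.1 0 0 * Y.1 0 1 + X.1 0 1 * (A.twist q).toAlgHom (Y.1 0 0) := by
  refine (Matrix.mul_apply ..).trans ?_
  rw [Fin.sum_univ_two, Y.2.2]

/-- The commutative super algebra `A⟨y⟩`, with `y` of degree `q` and `y ^ 2 = 0`. -/
noncomputable abbrev SCommAlg.adj (A : SCommAlg.{u, a} k) (q : ZMod 2) : SCommAlg.{u, a} k where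
  carrier := A.adjSub q
  gr i :=
    { carrier := {X | X.1 0 0 ∈ A.gr i ∧ X.1 0 1 ∈ A.gr (i + q)}
      add_mem' := fun hX hY => ⟨Submodule.add_mem _ hX.1 hY.1, Submodule.add_mem _ hX.2 hY.2⟩
      zero_mem' := ⟨Submodule.zero_mem _, Submodule.zero_mem _⟩
      smul_mem' := fun c _ hX => ⟨Submodule.smul_mem _ c hX.1, Submodule.smul_mem _ c hX.2⟩ }
  isCompl := by
    refine ⟨?_, codisjoint_iff_le_sup.2 fun X _ => ?_⟩
    · rw [Submodule.disjoint_def]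
      intro X h0 h1
      exact SCommAlg.adjSub_ext (A.eq_zero_of_mem h0.1 h1.1)
        ((Submodule.disjoint_def.1 (A.toSuperSpace.isCompl' (0 + q)).disjoint) _ h0.2
          (by have := h1.2; rwa [zero_add, add_comm]))
    · refine Submodule.mem_sup.2
        ⟨A.adjMk q (A.toSuperSpace.pr 0 (X.1 0 0)) (A.toSuperSpace.pr (0 + q) (X.1 0 1)),
          ⟨A.toSuperSpace.pr_mem 0 _, A.toSuperSpace.pr_mem _ _⟩,
          A.adjMk q (A.toSuperSpace.pr 1 (X.1 0 0)) (A.toSuperSpace.pr (1 + q) (X.1 0 1)),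
          ⟨A.toSuperSpace.pr_mem 1 _, A.toSuperSpace.pr_mem _ _⟩, ?_⟩
      refine SCommAlg.adjSub_ext (A.toSuperSpace.pr_add_pr _) ?_
      rcases zmod2_cases q with rfl | rfl
      · exact A.toSuperSpace.pr_add_pr _
      · exact (add_comm _ _).trans (A.toSuperSpace.pr_add_pr _)
  one_mem := ⟨A.one_mem, Submodule.zero_mem _⟩
  mul_mem {i j X Y} hX hY := by
    constructor
    · rw [SCommAlg.adjSub_mul_zero]
      exact A.mul_mem hX.1 hY.1
    · rw [SCommAlg.adjSub_mul_one]
      refine Submodule.add_mem _ ?_ ?_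
      · rw [add_assoc]; exact A.mul_mem hX.1 hY.2
      · rw [add_right_comm]; exact A.mul_mem hX.2 ((A.twist q).map_gr _ _ hY.1)
  super_comm {i j X Y} hX hY := by
    refine SCommAlg.adjSub_ext ?_ ?_
    · change (X * Y).1 0 0 = sgn k (i * j) • (Y * X).1 0 0
      rw [SCommAlg.adjSub_mul_zero, SCommAlg.adjSub_mul_zero, A.super_comm hX.1 hY.1]
    · change (X * Y).1 0 1 = sgn k (i * j) • (Y * X).1 0 1
      rw [SCommAlg.adjSub_mul_one, SCommAlg.adjSub_mul_one, A.twist_of_mem q hX.1,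
        A.twist_of_mem q hY.1, A.super_comm hX.1 hY.2, mul_smul_comm, A.super_comm hX.2 hY.1,
        smul_smul, mul_smul_comm, smul_add, smul_smul, ← sgn_add, ← sgn_add, add_comm]
      have h2 : ∀ l : ZMod 2, l + l = 0 := by decide
      congr 3
      · rw [add_mul, add_left_comm, h2, add_zero]
      · rw [mul_add, mul_comm i q]

/-- The inclusion of `A` in `A⟨y⟩`. -/
noncomputable def SCommAlg.toAdj (A : SCommAlg.{u, a} k) (q : ZMod 2) : A.Hom (A.adj q) where
  toAlgHom :=
    { toFun := fun x => A.adjMk q x 0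
      map_one' := SCommAlg.adjSub_ext rfl rfl
      map_zero' := SCommAlg.adjSub_ext rfl rfl
      map_mul' := fun x y => by
        refine SCommAlg.adjSub_ext ?_ ?_
        · rw [SCommAlg.adjSub_mul_zero]; rfl
        · rw [SCommAlg.adjSub_mul_one]; simp [SCommAlg.adjMk]
      map_add' := fun x y => SCommAlg.adjSub_ext rfl (add_zero (0 : A)).symm
      commutes' := fun c => by
        refine SCommAlg.adjSub_ext ?_ ?_
        · change _ = (algebraMap k (Matrix (Fin 2) (Fin 2) A) c) 0 0
          simp [SCommAlg.adjMk, Matrix.algebraMap_matrix_apply]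
        · change _ = (algebraMap k (Matrix (Fin 2) (Fin 2) A) c) 0 1
          simp [SCommAlg.adjMk, Matrix.algebraMap_matrix_apply] }
  map_gr _ _ hx := ⟨hx, Submodule.zero_mem _⟩

/-- The homomorphism `A⟨y⟩ → A` sending `y` to `0`. -/
noncomputable def SCommAlg.ofAdj (A : SCommAlg.{u, a} k) (q : ZMod 2) : (A.adj q).Hom A where
  toAlgHom :=
    { toFun := fun X : A.adjSub q => X.1 0 0
      map_one' := rfl
      map_zero' := rfl
      map_mul' := SCommAlg.adjSub_mul_zero
      map_add' := fun _ _ => rfl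
      commutes' := fun c => by
        change (algebraMap k (Matrix (Fin 2) (Fin 2) A) c) 0 0 = _
        simp [Matrix.algebraMap_matrix_apply] }
  map_gr _ _ hx := hx.1

/-- The homomorphism `A⟨y⟩ → B⟨y⟩` extending a homomorphism `A → B`. -/
noncomputable def SCommAlg.Hom.adj {A B : SCommAlg.{u, a} k} (f : A.Hom B) (q : ZMod 2) :
    (A.adj q).Hom (B.adj q) where
  toAlgHom :=
    { toFun := fun X : A.adjSub q =>
        B.adjMk q (f.toAlgHom (X.1 0 0)) (f.toAlgHom (X.1 0 1))
      map_one' := SCommAlg.adjSub_ext (map_one f.toAlgHom) (map_zero f.toAlgHom)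
      map_zero' := SCommAlg.adjSub_ext (map_zero f.toAlgHom) (map_zero f.toAlgHom)
      map_mul' := fun X Y => by
        refine SCommAlg.adjSub_ext ?_ ?_
        · refine Eq.trans ?_ (SCommAlg.adjSub_mul_zero _ _).symm
          exact (congrArg f.toAlgHom (SCommAlg.adjSub_mul_zero X Y)).trans (map_mul _ _ _)
        · refine Eq.trans ?_ (SCommAlg.adjSub_mul_one _ _).symm
          refine (congrArg f.toAlgHom (SCommAlg.adjSub_mul_one X Y)).trans ?_
          rw [map_add, map_mul, map_mul, f.map_twist]
          rfl
      map_add' := fun X Y => SCommAlg.adjSub_ext (map_add f.toAlgHom _ _) (map_add f.toAlgHom _ _)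
      commutes' := fun c => by
        refine SCommAlg.adjSub_ext ?_ ?_
        · change f.toAlgHom ((algebraMap k (Matrix (Fin 2) (Fin 2) A) c) 0 0) =
            (algebraMap k (Matrix (Fin 2) (Fin 2) B) c) 0 0
          simp [Matrix.algebraMap_matrix_apply]
        · change f.toAlgHom ((algebraMap k (Matrix (Fin 2) (Fin 2) A) c) 0 1) =
            (algebraMap k (Matrix (Fin 2) (Fin 2) B) c) 0 1
          simp [Matrix.algebraMap_matrix_apply] }
  map_gr _ _ hx := ⟨f.map_gr _ _ hx.1, f.map_gr _ _ hx.2⟩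

/-- Finitely many variables `y j` of prescribed degrees and of square zero can be adjoined to `A`.
The map `φ` takes the coefficient of the product of all `y j`; it kills everything that does not
involve one of them, which is expressed by the substitutions `κ` of `0` for `y j`. -/
theorem SCommAlg.exists_adjoin (A : SCommAlg.{u, a} k) (d : ℕ) (q : Fin d → ZMod 2) :
    ∃ (B : SCommAlg.{u, a} k) (i : A.Hom B) (y : Fin d → B) (φ : B →ₗ[k] A),
      (∀ j, y j ∈ B.gr (q j)) ∧ (∀ x, φ ((List.ofFn y).prod * i.toAlgHom x) = x) ∧
      (∀ j, y j * y j = 0) ∧ ∀ j, ∃ κ : B.Hom B, κ.toAlgHom (y j) = 0 ∧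
        (∀ l, l ≠ j → κ.toAlgHom (y l) = y l) ∧
        (∀ x, κ.toAlgHom (i.toAlgHom x) = i.toAlgHom x) ∧ ∀ z, φ (κ.toAlgHom z) = 0 := by
  induction d with
  | zero =>
    exact ⟨A, SCommAlg.Hom.id A, Fin.elim0, LinearMap.id, fun j => j.elim0, fun x => by
      simp [SCommAlg.Hom.id], fun j => j.elim0, fun j => j.elim0⟩
  | succ d ih =>
    obtain ⟨B, i, y, φ, hy, hφ, hy2, hκ⟩ := ih (fun j => q j.succ)
    refine ⟨B.adj (q 0), (B.toAdj (q 0)).comp i,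
      Fin.cons (B.adjMk (q 0) 0 1) (fun j => (B.toAdj (q 0)).toAlgHom (y j)),
      φ ∘ₗ (B.twist (q 0)).toAlgHom.toLinearMap ∘ₗ
        { toFun := fun X : B.adjSub (q 0) => X.1 0 1
          map_add' := fun _ _ => rfl
          map_smul' := fun _ _ => rfl }, fun j => ?_, fun x => ?_, fun j => ?_, fun j => ?_⟩
    · refine Fin.cases ?_ (fun j => ?_) j
      · refine ⟨Submodule.zero_mem _, ?_⟩
        have h2 : ∀ l : ZMod 2, l + l = 0 := by decide
        rw [h2]; exact B.one_mem
      · exact (B.toAdj (q 0)).map_gr _ _ (hy j)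
    · rw [List.ofFn_succ, List.prod_cons, Fin.cons_zero]
      simp only [Fin.cons_succ]
      have h1 : (List.ofFn fun j => (B.toAdj (q 0)).toAlgHom (y j)).prod =
          (B.toAdj (q 0)).toAlgHom (List.ofFn y).prod := by
        rw [map_list_prod, List.map_ofFn]; rfl
      have h2 : ∀ z : B, B.adjMk (q 0) 0 1 * (B.toAdj (q 0)).toAlgHom z =
          B.adjMk (q 0) 0 ((B.twist (q 0)).toAlgHom z) := by
        intro z
        refine SCommAlg.adjSub_ext ?_ ?_
        · rw [SCommAlg.adjSub_mul_zero]; simp [SCommAlg.adjMk]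
        · rw [SCommAlg.adjSub_mul_one]
          simp [SCommAlg.adjMk, SCommAlg.toAdj]
      have h3 : ((B.toAdj (q 0)).comp i).toAlgHom x =
        (B.toAdj (q 0)).toAlgHom (i.toAlgHom x) := rfl
      rw [h1, h3, mul_assoc, ← map_mul]
      refine Eq.trans (congrArg _ (h2 _)) ?_
      change φ ((B.twist (q 0)).toAlgHom ((B.twist (q 0)).toAlgHom _)) = x
      rw [B.twist_twist]
      exact hφ x
    · refine Fin.cases ?_ (fun j => ?_) j
      · refine SCommAlg.adjSub_ext ?_ ?_
        · rw [SCommAlg.adjSub_mul_zero]; exact mul_zero _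
        · rw [SCommAlg.adjSub_mul_one]
          simp [SCommAlg.adjMk]
      · rw [Fin.cons_succ, ← map_mul, hy2, map_zero]
    · refine Fin.cases ?_ (fun j => ?_) j
      · refine ⟨(B.toAdj (q 0)).comp (B.ofAdj (q 0)), ?_, fun l hl => ?_, fun x => rfl, fun z => ?_⟩
        · exact map_zero (B.toAdj (q 0)).toAlgHom
        · obtain ⟨l, rfl⟩ := Fin.exists_succ_eq.2 hl
          rfl
        · change φ ((B.twist (q 0)).toAlgHom 0) = 0
          rw [map_zero, map_zero]
      · obtain ⟨κ, h1, h2, h3, h4⟩ := hκ j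
        have h5 : ∀ x, (κ.adj (q 0)).toAlgHom ((B.toAdj (q 0)).toAlgHom x) =
            (B.toAdj (q 0)).toAlgHom (κ.toAlgHom x) := fun x =>
          SCommAlg.adjSub_ext rfl (map_zero κ.toAlgHom)
        refine ⟨κ.adj (q 0), ?_, fun l hl => ?_, fun x => ?_, fun z => ?_⟩
        · rw [Fin.cons_succ, h5, h1, map_zero]
        · revert hl
          refine Fin.cases (fun _ => ?_) (fun l hl => ?_) l
          · exact SCommAlg.adjSub_ext (map_zero κ.toAlgHom) (map_one κ.toAlgHom)
          · rw [Fin.cons_succ, h5, h2 l fun h => hl (congrArg _ h)]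
        · exact (h5 _).trans (congrArg _ (h3 x))
        · change φ ((B.twist (q 0)).toAlgHom (κ.toAlgHom _)) = 0
          rw [← κ.map_twist, h4]

end algebras

/-! ### Natural functions on a super monoid and its generic point -/

section functions

variable {k : Type u} [Field k]

/-- The algebra of all families of functions `G(A) → A`. -/
abbrev SuperMonoid.Fn (G : SuperMonoid.{u, a, b} k) := ∀ A : SCommAlg.{u, a} k, G.pts A → A

/-- The functions on `G`: the families of functions `G(A) → A` that are natural in `A`. -/
def SuperMonoid.natFn (G : SuperMonoid.{u, a, b} k) : Subalgebra k G.Fn where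
  carrier := {f | ∀ {A B : SCommAlg.{u, a} k} (φ : A.Hom B) (g : G.pts A),
    φ.toAlgHom (f A g) = f B (G.map φ g)}
  mul_mem' hf hg A B φ g := by
    simp only [Pi.mul_apply, map_mul, hf φ g, hg φ g]
  add_mem' hf hg A B φ g := by
    simp only [Pi.add_apply, map_add, hf φ g, hg φ g]
  algebraMap_mem' c A B φ g := by
    simp only [Pi.algebraMap_apply, AlgHom.commutes]

/-- The parity involution on families of functions. -/
noncomputable def SuperMonoid.fnParity (G : SuperMonoid.{u, a, b} k) : G.Fn →ₐ[k] G.Fn where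
  toFun f A g := A.parityHom.toAlgHom (f A g)
  map_one' := by ext; simp
  map_mul' _ _ := by ext; simp
  map_zero' := by ext; simp
  map_add' _ _ := by ext; simp
  commutes' c := by ext A g; simp [Pi.algebraMap_apply]

theorem SuperMonoid.fnParity_mem {G : SuperMonoid.{u, a, b} k} {f : G.Fn} (hf : f ∈ G.natFn) :
    G.fnParity f ∈ G.natFn := fun φ g =>
  (φ.map_parity _).trans (congrArg _ (hf φ g))

variable {G : SuperMonoid.{u, max u v, b} k} {J : Type v} (x : J → G.Fn) (q : J → ZMod 2)

/-- The homomorphism from the free algebra sending the generator `j` to `x j`. -/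
noncomputable abbrev genLift : FreeAlgebra k J →ₐ[k] G.Fn := FreeAlgebra.lift k x

/-- A polynomial in the homogeneous functions `x j` is the sum of one with even values and one with
odd values. -/
theorem genLift_sup (hx : ∀ j A g, x j A g ∈ A.gr (q j)) (r : FreeAlgebra k J) :
    ∃ s t, s + t = r ∧ (∀ A g, genLift x s A g ∈ A.gr 0) ∧ ∀ A g, genLift x t A g ∈ A.gr 1 := by
  induction r using FreeAlgebra.induction with
  | grade0 c =>
    refine ⟨algebraMap k _ c, 0, add_zero _, fun A g => ?_, fun A g => ?_⟩
    · rw [AlgHom.commutes, Pi.algebraMap_apply, Pi.algebraMap_apply, Algebra.algebraMap_eq_smul_one]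
      exact Submodule.smul_mem _ _ A.one_mem
    · rw [map_zero]; exact Submodule.zero_mem _
  | grade1 j =>
    have h : ∀ A g, genLift x (FreeAlgebra.ι k j) A g ∈ A.gr (q j) := fun A g => by
      rw [genLift, FreeAlgebra.lift_ι_apply]; exact hx j A g
    rcases zmod2_cases (q j) with h0 | h0 <;> rw [h0] at h
    · exact ⟨_, 0, add_zero _, h, fun A g => by rw [map_zero]; exact Submodule.zero_mem _⟩
    · exact ⟨0, _, zero_add _, fun A g => by rw [map_zero]; exact Submodule.zero_mem _, h⟩
  | mul r r' h h' =>
    obtain ⟨s, t, rfl, hs, ht⟩ := h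
    obtain ⟨s', t', rfl, hs', ht'⟩ := h'
    refine ⟨s * s' + t * t', s * t' + t * s', by noncomm_ring, fun A g => ?_, fun A g => ?_⟩
    · rw [map_add, map_mul, map_mul]
      refine Submodule.add_mem _ ?_ ?_
      · have := A.mul_mem (hs A g) (hs' A g); rwa [add_zero] at this
      · have := A.mul_mem (ht A g) (ht' A g); rwa [two_eq_zero_zmod2] at this
    · rw [map_add, map_mul, map_mul]
      refine Submodule.add_mem _ ?_ ?_
      · have := A.mul_mem (hs A g) (ht' A g); rwa [zero_add] at this
      · have := A.mul_mem (ht A g) (hs' A g); rwa [add_zero] at this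
  | add r r' h h' =>
    obtain ⟨s, t, rfl, hs, ht⟩ := h
    obtain ⟨s', t', rfl, hs', ht'⟩ := h'
    refine ⟨s + s', t + t', add_add_add_comm _ _ _ _, fun A g => ?_, fun A g => ?_⟩
    · rw [map_add]; exact Submodule.add_mem _ (hs A g) (hs' A g)
    · rw [map_add]; exact Submodule.add_mem _ (ht A g) (ht' A g)

/-- The quotient of the free algebra on `J` by the polynomials in the homogeneous natural functions
`x j` that vanish at all points of `G`. An element is homogeneous when all its values are. -/
noncomputable abbrev genAlg (hx : ∀ j A g, x j A g ∈ A.gr (q j)) : SCommAlg.{u, max u v} k where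
  carrier := FreeAlgebra k J ⧸ RingHom.ker (genLift x)
  gr i := Submodule.map (Ideal.Quotient.mkₐ k (RingHom.ker (genLift x))).toLinearMap
    { carrier := {r | ∀ A g, genLift x r A g ∈ A.gr i}
      add_mem' := fun hr hs A g => by rw [map_add]; exact Submodule.add_mem _ (hr A g) (hs A g)
      zero_mem' := fun A g => by rw [map_zero]; exact Submodule.zero_mem _
      smul_mem' := fun c r hr A g => by
        rw [map_smul]; exact Submodule.smul_mem _ _ (hr A g) }
  isCompl := by
    refine ⟨?_, codisjoint_iff_le_sup.2 fun r _ => ?_⟩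
    · rw [Submodule.disjoint_def]
      rintro _ ⟨r, hr, rfl⟩ ⟨s, hs, hrs⟩
      refine Ideal.Quotient.eq_zero_iff_mem.2 ?_
      rw [RingHom.mem_ker]
      ext A g
      have h1 : genLift x s = genLift x r := by
        have := Ideal.Quotient.eq.1 hrs
        rw [RingHom.mem_ker, map_sub, sub_eq_zero] at this
        exact this
      exact A.eq_zero_of_mem (hr A g) (by have := hs A g; rwa [h1] at this)
    · obtain ⟨r, rfl⟩ := Ideal.Quotient.mk_surjective r
      obtain ⟨s, t, rfl, hs, ht⟩ := genLift_sup x q hx r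
      exact Submodule.mem_sup.2 ⟨_, ⟨s, hs, rfl⟩, _, ⟨t, ht, rfl⟩, (map_add _ _ _).symm⟩
  one_mem := ⟨1, fun A g => by rw [map_one]; exact A.one_mem,
    map_one (Ideal.Quotient.mkₐ k (RingHom.ker (genLift x)))⟩
  mul_mem := by
    rintro i j _ _ ⟨r, hr, rfl⟩ ⟨s, hs, rfl⟩
    exact ⟨r * s, fun A g => by rw [map_mul]; exact A.mul_mem (hr A g) (hs A g),
      map_mul (Ideal.Quotient.mkₐ k (RingHom.ker (genLift x))) _ _⟩
  super_comm := by
    rintro i j _ _ ⟨r, hr, rfl⟩ ⟨s, hs, rfl⟩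
    have h : (Ideal.Quotient.mkₐ k (RingHom.ker (genLift x))) (r * s) =
        (Ideal.Quotient.mkₐ k (RingHom.ker (genLift x))) (sgn k (i * j) • (s * r)) := by
      refine Ideal.Quotient.eq.2 ?_
      rw [RingHom.mem_ker, map_sub, sub_eq_zero, map_smul, map_mul, map_mul]
      ext A g
      exact A.super_comm (hr A g) (hs A g)
    rw [map_mul, map_smul, map_mul] at h
    exact h

variable {x q} (hx : ∀ j A g, x j A g ∈ A.gr (q j))

/-- The evaluation of the generic algebra at a point of `G`. -/
noncomputable def genEval (A : SCommAlg.{u, max u v} k) (g : G.pts A) : (genAlg x q hx).Hom A where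
  toAlgHom := Ideal.Quotient.liftₐ (RingHom.ker (genLift x))
    ((Pi.evalAlgHom k _ g).comp ((Pi.evalAlgHom k _ A).comp (genLift x))) fun r hr => by
      rw [RingHom.mem_ker] at hr
      simp only [AlgHom.comp_apply]
      erw [hr]
      simp
  map_gr := by
    rintro i _ ⟨r, hr, rfl⟩
    exact hr A g

theorem genEval_mk (A : SCommAlg.{u, max u v} k) (g : G.pts A) (r : FreeAlgebra k J) :
    (genEval hx A g).toAlgHom (Ideal.Quotient.mk (RingHom.ker (genLift x)) r) = genLift x r A g :=
  rfl

/-- The generator `j` of the generic algebra. -/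
noncomputable def genVar (j : J) : genAlg x q hx :=
  Ideal.Quotient.mk (RingHom.ker (genLift x)) (FreeAlgebra.ι k j)

theorem genEval_var (A : SCommAlg.{u, max u v} k) (g : G.pts A) (j : J) :
    (genEval hx A g).toAlgHom (genVar hx j) = x j A g := by
  rw [genVar, genEval_mk, genLift, FreeAlgebra.lift_ι_apply]

theorem genVar_mem (j : J) : genVar hx j ∈ (genAlg x q hx).gr (q j) :=
  ⟨FreeAlgebra.ι k j, fun A g => by
    rw [genLift, FreeAlgebra.lift_ι_apply]; exact hx j A g, rfl⟩

theorem genAlg_ext {r s : genAlg x q hx}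
    (h : ∀ A g, (genEval hx A g).toAlgHom r = (genEval hx A g).toAlgHom s) : r = s := by
  obtain ⟨r, rfl⟩ := Ideal.Quotient.mk_surjective r
  obtain ⟨s, rfl⟩ := Ideal.Quotient.mk_surjective s
  refine Ideal.Quotient.eq.2 ?_
  rw [RingHom.mem_ker, map_sub, sub_eq_zero]
  ext A g
  exact h A g

/-- If `G` has a generic point with values in the generic algebra of the functions `x j`, then all
functions on `G` are polynomials in the `x j`: this is the Yoneda lemma. -/
theorem natFn_le_adjoin (g₀ : G.pts (genAlg x q hx))
    (hg₀ : ∀ A g, G.map (genEval hx A g) g₀ = g) : G.natFn ≤ Algebra.adjoin k (Set.range x) := by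
  intro f hf
  rw [Algebra.adjoin_range_eq_range_freeAlgebra_lift]
  obtain ⟨r, hr⟩ := Ideal.Quotient.mk_surjective (f _ g₀)
  refine ⟨r, ?_⟩
  ext A g
  have h := hf (genEval hx A g) g₀
  rw [hg₀ A g, ← hr, genEval_mk] at h
  exact h

end functions

/-! ### Words and the Koszul sign of a permutation -/

section koszul

theorem perm_inv_apply {α : Type*} (σ : Equiv.Perm α) (x : α) : σ⁻¹ (σ x) = x :=
  σ.symm_apply_apply x

theorem perm_apply_inv {α : Type*} (σ : Equiv.Perm α) (x : α) : σ (σ⁻¹ x) = x :=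
  σ.apply_symm_apply x

variable (k : Type u) [Field k]

/-- The sign of the reordering of homogeneous elements of degrees `q i` by `σ`: each inversion of two
odd elements contributes a factor `-1`. -/
def koszul {n : ℕ} (σ : Equiv.Perm (Fin n)) (q : Fin n → ZMod 2) : k :=
  ∏ j, ∏ i ∈ Finset.Iio j, if σ i < σ j then 1 else sgn k (q i * q j)

variable {k}

/-- A product of a symmetric function over all pairs of indices does not depend on their order. It
is deduced from the corresponding formula for antisymmetric functions by comparison with the sign.
-/
theorem prod_pairs_comp [CharZero k] {n : ℕ} (σ : Equiv.Perm (Fin n)) {F : Fin n → Fin n → k}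
    (hF : ∀ i j, F i j = F j i) :
    ∏ j, ∏ i ∈ Finset.Iio j, F (σ i) (σ j) = ∏ j, ∏ i ∈ Finset.Iio j, F i j := by
  let v : Fin n → Fin n → k := fun i j => if i < j then 1 else if j < i then -1 else 0
  have hv : ∀ i j, v i j = -v j i := by
    intro i j
    simp only [v]
    rcases lt_trichotomy i j with h | h | h
    · simp [h, h.not_gt]
    · simp [h]
    · simp [h, h.not_gt]
  have h1 := σ.prod_Iio_comp_eq_sign_mul_prod hv
  have h2 := σ.prod_Iio_comp_eq_sign_mul_prod (f := fun i j => F i j * v i j)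
    (fun i j => by rw [hF i j, hv i j, mul_neg])
  have h3 : ∏ j, ∏ i ∈ Finset.Iio j, v i j = 1 :=
    Finset.prod_eq_one fun j _ => Finset.prod_eq_one fun i hi => by
      simp [v, Finset.mem_Iio.1 hi]
  simp only [Finset.prod_mul_distrib] at h2
  rw [h1, h3, mul_one, mul_one, mul_comm] at h2
  refine mul_left_cancel₀ ?_ h2
  rcases Int.units_eq_one_or (Equiv.Perm.sign σ) with h | h <;> simp [h]

theorem koszul_mul [CharZero k] {n : ℕ} (σ τ : Equiv.Perm (Fin n)) (q : Fin n → ZMod 2) :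
    koszul k (σ * τ) q = koszul k σ (fun i => q (τ⁻¹ i)) * koszul k τ q := by
  have h1 : koszul k σ (fun i => q (τ⁻¹ i)) = ∏ j, ∏ i ∈ Finset.Iio j,
      if (i < j ↔ σ i < σ j) then 1 else sgn k (q (τ⁻¹ i) * q (τ⁻¹ j)) := by
    refine Finset.prod_congr rfl fun j _ => Finset.prod_congr rfl fun i hi => ?_
    simp [Finset.mem_Iio.1 hi]
  rw [h1, ← prod_pairs_comp τ, koszul, koszul, ← Finset.prod_mul_distrib]
  · refine Finset.prod_congr rfl fun j _ => ?_
    rw [← Finset.prod_mul_distrib]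
    refine Finset.prod_congr rfl fun i hi => ?_
    simp only [Equiv.Perm.mul_apply, perm_inv_apply]
    by_cases h2 : τ i < τ j <;> by_cases h3 : σ (τ i) < σ (τ j) <;> simp [h2, h3, sgn_mul_self]
  · intro i j
    by_cases hij : i = j
    · rw [hij]
    · have h2 : (i < j ↔ σ i < σ j) ↔ (j < i ↔ σ j < σ i) := by
        have h3 : σ i ≠ σ j := fun h => hij (σ.injective h)
        rcases lt_or_gt_of_ne hij with h4 | h4 <;> rcases lt_or_gt_of_ne h3 with h5 | h5 <;>
          simp [h4, h5, h4.not_gt, h5.not_gt]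
      simp only [h2, mul_comm]

theorem koszul_one {n : ℕ} (q : Fin n → ZMod 2) : koszul k 1 q = 1 :=
  Finset.prod_eq_one fun j _ => Finset.prod_eq_one fun i hi => by
    simp [Finset.mem_Iio.1 hi]

theorem koszul_mul_self {n : ℕ} (σ : Equiv.Perm (Fin n)) (q : Fin n → ZMod 2) :
    koszul k σ q * koszul k σ q = 1 := by
  rw [koszul, ← Finset.prod_mul_distrib]
  refine Finset.prod_eq_one fun j _ => ?_
  rw [← Finset.prod_mul_distrib]
  refine Finset.prod_eq_one fun i _ => ?_
  split_ifs
  · rw [mul_one]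
  · exact sgn_mul_self _

theorem koszul_decomposeFin {n : ℕ} (e : Equiv.Perm (Fin n)) (q : Fin (n + 1) → ZMod 2) :
    koszul k (Equiv.Perm.decomposeFin.symm (0, e)) q = koszul k e (fun i => q i.succ) := by
  have key : ∀ {m : ℕ} (σ : Equiv.Perm (Fin m)) (q : Fin m → ZMod 2), koszul k σ q =
      ∏ j, ∏ i, if i < j then (if σ i < σ j then 1 else sgn k (q i * q j)) else 1 := by
    intro m σ q
    refine Finset.prod_congr rfl fun j _ => ?_
    rw [← Finset.prod_filter]
    refine Finset.prod_congr ?_ fun _ _ => rfl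
    ext i; simp
  rw [key, key, Fin.prod_univ_succ]
  have h0 : ∏ i : Fin (n + 1), (if i < 0 then (if Equiv.Perm.decomposeFin.symm (0, e) i <
      Equiv.Perm.decomposeFin.symm (0, e) 0 then 1 else sgn k (q i * q 0)) else 1) = 1 :=
    Finset.prod_eq_one fun i _ => by simp
  rw [h0, one_mul]
  refine Finset.prod_congr rfl fun j _ => ?_
  rw [Fin.prod_univ_succ]
  simp

theorem koszul_swap {n : ℕ} (l : Fin n) (q : Fin (n + 1) → ZMod 2) :
    koszul k (Equiv.swap l.castSucc l.succ) q = sgn k (q l.castSucc * q l.succ) := by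
  have hs : ∀ i j : Fin (n + 1), i < j → ¬(i = l.castSucc ∧ j = l.succ) →
      Equiv.swap l.castSucc l.succ i < Equiv.swap l.castSucc l.succ j := by
    intro i j hij hne
    rw [Equiv.swap_apply_def, Equiv.swap_apply_def]
    simp only [Fin.ext_iff, Fin.lt_def, Fin.val_castSucc, Fin.val_succ] at hij hne ⊢
    split_ifs <;> (try simp only [Fin.val_castSucc, Fin.val_succ]) <;> omega
  rw [koszul, Finset.prod_eq_single l.succ, Finset.prod_eq_single l.castSucc]
  · simp [Fin.castSucc_lt_succ.not_gt]
  · intro i hi hne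
    rw [if_pos (hs i _ (Finset.mem_Iio.1 hi) fun h => hne h.1)]
  · intro h
    exact absurd (Finset.mem_Iio.2 Fin.castSucc_lt_succ) h
  · intro j _ hj
    exact Finset.prod_eq_one fun i hi => by
      rw [if_pos (hs i _ (Finset.mem_Iio.1 hi) fun h => hj h.2)]
  · intro h
    exact absurd (Finset.mem_univ _) h

end koszul

section words

variable {k : Type u} [Field k] {ι : Type} (p : ι → ZMod 2)

/-- The degree of a word in homogeneous letters. -/
def wpar {n : ℕ} (s : Fin n → ι) : ZMod 2 := ∑ i, p (s i)

theorem wpar_succ {n : ℕ} (s : Fin (n + 1) → ι) :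
    wpar p s = p (s 0) + wpar p (fun i => s i.succ) := Fin.sum_univ_succ _

theorem wpar_perm {n : ℕ} (σ : Equiv.Perm (Fin n)) (s : Fin n → ι) :
    wpar p (fun i => s (σ i)) = wpar p s := Equiv.sum_comp σ fun i => p (s i)

/-- The matrix of the tensor product of the even matrices `X 0, …, X (n - 1)` over `A`, in the basis
of words. The signs come from moving the entries of a matrix past the letters to its right. -/
def wordMat {A : SCommAlg.{u, a} k} :
    ∀ {n : ℕ}, (Fin n → Matrix ι ι A) → Matrix (Fin n → ι) (Fin n → ι) A
  | 0, _ => fun _ _ => 1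
  | _ + 1, X => fun s t =>
      sgn k ((p (s 0) + p (t 0)) * wpar p (fun i => s i.succ)) •
        (X 0 (s 0) (t 0) * wordMat (fun i => X i.succ) (fun i => s i.succ) (fun i => t i.succ))

variable {p} {A : SCommAlg.{u, a} k}

theorem wordMat_succ {n : ℕ} (X : Fin (n + 1) → Matrix ι ι A) (s t : Fin (n + 1) → ι) :
    wordMat p X s t = sgn k ((p (s 0) + p (t 0)) * wpar p (fun i => s i.succ)) •
      (X 0 (s 0) (t 0) *
        wordMat p (fun i => X i.succ) (fun i => s i.succ) (fun i => t i.succ)) := rfl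

theorem wordMat_mem' {n : ℕ} {X : Fin n → Matrix ι ι A}
    (hX : ∀ i s t, X i s t ∈ A.gr (p s + p t)) (s t : Fin n → ι) :
    wordMat p X s t ∈ A.gr (wpar p s + wpar p t) := by
  induction n with
  | zero =>
    have h : wpar p s + wpar p t = 0 := by simp [wpar]
    rw [h]; exact A.one_mem
  | succ n ih =>
    rw [wordMat_succ, wpar_succ, wpar_succ, add_add_add_comm]
    exact Submodule.smul_mem _ _ (A.mul_mem (hX _ _ _) (ih (fun i => hX i.succ) _ _))

theorem sum_words [Fintype ι] {n : ℕ} {M : Type*} [AddCommMonoid M]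
    (f : (Fin (n + 1) → ι) → M) :
    ∑ s, f s = ∑ x, ∑ s : Fin n → ι, f (Fin.cons x s) := by
  rw [← (Fin.consEquiv fun _ => ι).sum_comp, Fintype.sum_prod_type]
  rfl

theorem wordMat_mul [Fintype ι] {n : ℕ} {X Y : Fin n → Matrix ι ι A}
    (hX : ∀ i s t, X i s t ∈ A.gr (p s + p t)) (hY : ∀ i s t, Y i s t ∈ A.gr (p s + p t)) :
    wordMat p (fun i => X i * Y i) = wordMat p X * wordMat p Y := by
  induction n with
  | zero =>
    ext s t
    rw [Matrix.mul_apply, Fintype.sum_unique]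
    simp [wordMat]
  | succ n ih =>
    ext s t
    rw [wordMat_succ, ih (fun i => hX i.succ) (fun i => hY i.succ), Matrix.mul_apply,
      Matrix.mul_apply, Matrix.mul_apply, sum_words, Finset.sum_mul, Finset.smul_sum]
    refine Finset.sum_congr rfl fun x _ => ?_
    rw [Finset.mul_sum, Finset.smul_sum]
    refine Finset.sum_congr rfl fun r _ => ?_
    have h1 := wordMat_mem' (fun i => hX i.succ) (fun i => s i.succ) r
    rw [wordMat_succ, wordMat_succ]
    simp only [Fin.cons_zero, Fin.cons_succ]
    rw [smul_mul_smul_comm, ← sgn_add, mul_assoc, ← mul_assoc (Y 0 x (t 0)),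
      A.super_comm (hY 0 x (t 0)) h1, smul_mul_assoc, mul_smul_comm, smul_smul, ← sgn_add,
      ← mul_assoc, ← mul_assoc, ← mul_assoc]
    congr 2
    generalize p (s 0) = i1
    generalize p x = i2
    generalize p (t 0) = i3
    generalize wpar p (fun i => s i.succ) = i4
    generalize wpar p r = i5
    clear! s t
    revert i1 i2 i3 i4 i5
    decide

/-- The case of the exchange of two adjacent factors, where the Koszul signs are explicit. -/
theorem wordMat_swap {n : ℕ} (l : Fin n) {X : Fin (n + 1) → Matrix ι ι A}
    (hX : ∀ i s t, X i s t ∈ A.gr (p s + p t)) (s t : Fin (n + 1) → ι) :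
    wordMat p (fun i => X (Equiv.swap l.castSucc l.succ i))
      (fun i => s (Equiv.swap l.castSucc l.succ i)) (fun i => t (Equiv.swap l.castSucc l.succ i)) =
    (sgn k (p (s l.castSucc) * p (s l.succ)) * sgn k (p (t l.castSucc) * p (t l.succ))) •
      wordMat p X s t := by
  induction n with
  | zero => exact l.elim0
  | succ n ih =>
    refine Fin.cases ?_ (fun l => ?_) l
    · have h1 : ∀ i : Fin n, Equiv.swap (0 : Fin (n + 2)) 1 i.succ.succ = i.succ.succ := fun i =>
        Equiv.swap_apply_of_ne_of_ne (by simp [Fin.ext_iff]) (by simp [Fin.ext_iff])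
      have h2 : ((0 : Fin (n + 1)).castSucc : Fin (n + 2)) = 0 := rfl
      have h3 : ((0 : Fin (n + 1)).succ : Fin (n + 2)) = 1 := rfl
      simp only [h2, wordMat_succ, wpar_succ, h3, Equiv.swap_apply_left, Equiv.swap_apply_right, h1]
      have h4 := A.super_comm (hX 1 (s 1) (t 1)) (hX 0 (s 0) (t 0))
      simp only [mul_smul_comm, smul_smul, ← sgn_add, ← mul_assoc]
      rw [h4, smul_mul_assoc, smul_smul, ← sgn_add]
      congr 2
      generalize p (s 0) = i1
      generalize p (s 1) = i2
      generalize p (t 0) = i3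
      generalize p (t 1) = i5
      generalize wpar p (fun i => s i.succ.succ) = i4
      clear! s t
      revert i1 i2 i3 i4 i5
      decide
    · have h1 : ∀ i : Fin (n + 1), Equiv.swap l.succ.castSucc l.succ.succ i.succ =
          (Equiv.swap l.castSucc l.succ i).succ := by
        intro i
        rw [Fin.castSucc_succ, Equiv.swap_apply_def, Equiv.swap_apply_def]
        simp only [Fin.succ_inj]
        split_ifs <;> rfl
      have h0 : Equiv.swap l.succ.castSucc l.succ.succ 0 = (0 : Fin (n + 2)) :=
        Equiv.swap_apply_of_ne_of_ne (by simp [Fin.ext_iff]) (by simp [Fin.ext_iff])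
      rw [wordMat_succ, wordMat_succ (X := X)]
      simp only [h1, h0]
      rw [ih l (X := fun i => X i.succ) (fun i => hX i.succ) (fun i => s i.succ)
        (fun i => t i.succ), wpar_perm p (Equiv.swap l.castSucc l.succ) (fun i => s i.succ),
        mul_smul_comm, smul_comm]
      rfl

/-- Permuting the factors permutes the words up to Koszul signs. -/
theorem wordMat_perm [CharZero k] {n : ℕ} (σ : Equiv.Perm (Fin n)) {X : Fin n → Matrix ι ι A}
    (hX : ∀ i s t, X i s t ∈ A.gr (p s + p t)) (s t : Fin n → ι) :
    wordMat p (fun i => X (σ⁻¹ i)) (fun i => s (σ⁻¹ i)) (fun i => t (σ⁻¹ i)) =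
      (koszul k σ (fun i => p (s i)) * koszul k σ (fun i => p (t i))) • wordMat p X s t := by
  rcases n with _ | n
  · simp [wordMat, koszul]
  have hσ : σ ∈ Submonoid.closure
      (Set.range fun i : Fin n => Equiv.swap i.castSucc i.succ) := by
    rw [Equiv.Perm.mclosure_swap_castSucc_succ]; trivial
  induction hσ using Submonoid.closure_induction generalizing X s t with
  | mem σ h =>
    obtain ⟨l, rfl⟩ := h
    rw [koszul_swap, koszul_swap, Equiv.swap_inv]
    exact wordMat_swap l hX s t
  | one => simp [koszul_one]
  | mul σ τ _ _ h1 h2 =>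
    rw [koszul_mul, koszul_mul]
    simp only [mul_inv_rev, Equiv.Perm.mul_apply]
    rw [h1 (X := fun i => X (τ⁻¹ i)) (fun i => hX _) (fun i => s (τ⁻¹ i)) (fun i => t (τ⁻¹ i)),
      h2 hX, smul_smul]
    congr 1
    ring

variable (k p) [DecidableEq ι]

/-- The action of the permutation `σ` on the span of words, with its Koszul signs. -/
def permMat {n : ℕ} (σ : Equiv.Perm (Fin n)) : Matrix (Fin n → ι) (Fin n → ι) k :=
  fun s t => if (fun i => s (σ i)) = t then koszul k σ (fun i => p (t i)) else 0

variable {k p}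

theorem permMat_perm {n : ℕ} (σ : Equiv.Perm (Fin n)) (s t : Fin n → ι) :
    permMat k p σ (fun i => s (σ⁻¹ i)) t = if s = t then koszul k σ (fun i => p (t i)) else 0 := by
  simp only [permMat, perm_inv_apply]

theorem permMat_mul_apply [Fintype ι] {n : ℕ} {κ : Type*} {A : Type*} [Ring A] [Algebra k A]
    (σ : Equiv.Perm (Fin n)) (F : Matrix (Fin n → ι) κ A) (s : Fin n → ι) (t : κ) :
    ((permMat k p σ).map (algebraMap k A) * F) s t =
      koszul k σ (fun i => p (s (σ i))) • F (fun i => s (σ i)) t := by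
  rw [Matrix.mul_apply, Finset.sum_eq_single fun i => s (σ i)]
  · rw [Matrix.map_apply, permMat, if_pos rfl, Algebra.smul_def]
  · intro r _ hr
    rw [Matrix.map_apply, permMat, if_neg (Ne.symm hr), map_zero, zero_mul]
  · intro h
    exact absurd (Finset.mem_univ _) h

theorem mul_permMat_apply [Fintype ι] {n : ℕ} {κ : Type*} {A : Type*} [Ring A] [Algebra k A]
    (σ : Equiv.Perm (Fin n)) (F : Matrix κ (Fin n → ι) A) (s : κ) (t : Fin n → ι) :
    (F * (permMat k p σ).map (algebraMap k A)) s t =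
      koszul k σ (fun i => p (t i)) • F s (fun i => t (σ⁻¹ i)) := by
  rw [Matrix.mul_apply, Finset.sum_eq_single fun i => t (σ⁻¹ i)]
  · rw [Matrix.map_apply, permMat_perm, if_pos rfl, Algebra.smul_def, Algebra.commutes]
  · intro r _ hr
    rw [Matrix.map_apply, permMat, if_neg, map_zero, mul_zero]
    rintro rfl
    exact hr (funext fun i => by simp only [perm_apply_inv])
  · intro h
    exact absurd (Finset.mem_univ _) h

theorem permMat_mul [Fintype ι] [CharZero k] {n : ℕ} (σ τ : Equiv.Perm (Fin n)) :
    permMat k p (σ * τ) = permMat k p σ * permMat k p τ := by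
  ext s t
  have h := permMat_mul_apply (k := k) (A := k) (p := p) σ (permMat k p τ) s t
  rw [Algebra.algebraMap_self, RingHom.coe_id, Matrix.map_id] at h
  rw [h, permMat, permMat]
  by_cases hs : (fun i => s (σ (τ i))) = t
  · rw [if_pos (show (fun i => s ((σ * τ) i)) = t from hs), if_pos hs, koszul_mul, smul_eq_mul]
    congr 2
    subst hs
    funext i
    simp only [perm_apply_inv]
  · rw [if_neg (show ¬(fun i => s ((σ * τ) i)) = t from hs), if_neg hs, smul_zero]

theorem permMat_one [Fintype ι] {n : ℕ} : permMat k p (1 : Equiv.Perm (Fin n)) = 1 := by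
  ext s t
  rw [permMat, koszul_one, Matrix.one_apply]
  rfl

theorem permMat_mul_wordMat [Fintype ι] [CharZero k] {n : ℕ} (σ : Equiv.Perm (Fin n))
    {X : Fin n → Matrix ι ι A} (hX : ∀ i s t, X i s t ∈ A.gr (p s + p t)) :
    (permMat k p σ).map (algebraMap k A) * wordMat p X =
      wordMat p (fun i => X (σ⁻¹ i)) * (permMat k p σ).map (algebraMap k A) := by
  ext s t
  rw [permMat_mul_apply, mul_permMat_apply]
  have h := wordMat_perm σ hX (fun i => s (σ i)) t
  simp only [perm_apply_inv] at h
  rw [h, smul_smul, mul_left_comm, koszul_mul_self, mul_one]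

end words

/-! ### Linear relations between signed permutations, and clearing of denominators -/

section relations

variable {k : Type u} [Field k] {ι : Type} (p : ι → ZMod 2) [Fintype ι] [DecidableEq ι]

/-- There are too many permutations of `n` letters, for large `n`, to act by linearly independent
matrices on words; the minimal such `n` gives a relation that does not come from a relation between
permutations of fewer letters. -/
theorem exists_relation [CharZero k] : ∃ (d : ℕ) (c : Equiv.Perm (Fin (d + 1)) → k),
    ∑ σ, c σ • permMat k p σ = 0 ∧
      ∑ e, c (Equiv.Perm.decomposeFin.symm (0, e)) • permMat k p e ≠ 0 := by
  classical
  have hex : ∃ n, ¬ LinearIndependent k (fun σ : Equiv.Perm (Fin n) => permMat k p σ) := by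
    by_contra! hall
    -- There are `n!` permutations, in a space of matrices of dimension `(card ι) ^ (2 * n)`.
    let c : ℝ := (Fintype.card ι : ℝ) ^ 2
    have hle : ∀ n : ℕ, (1 : ℝ) ≤ c ^ n / n.factorial := by
      intro n
      have h1 := (hall n).fintype_card_le_finrank
      rw [Fintype.card_perm, Fintype.card_fin, Module.finrank_matrix, Module.finrank_self, mul_one,
        Fintype.card_fun, Fintype.card_fin, ← pow_add] at h1
      rw [le_div_iff₀ (by positivity), one_mul, ← pow_mul, two_mul]
      rw [← two_mul] at h1
      rw [← two_mul]
      exact_mod_cast h1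
    have h2 := FloorSemiring.tendsto_pow_div_factorial_atTop c
    have h3 := ge_of_tendsto' h2 hle
    norm_num at h3
  -- The minimal `n` is positive, since the empty permutation acts by the identity.
  obtain ⟨d, hd⟩ : ∃ d, Nat.find hex = d + 1 := by
    refine Nat.exists_eq_succ_of_ne_zero fun h => ?_
    have h1 := Nat.find_spec hex
    rw [h] at h1
    refine h1 (linearIndependent_unique_iff.2 ?_)
    intro h2
    have h3 := congrFun (congrFun h2 default) default
    rw [Subsingleton.elim (default : Equiv.Perm (Fin 0)) 1, permMat_one] at h3
    simp at h3
  have hdep := Nat.find_spec hex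
  rw [hd] at hdep
  have hind := not_not.1 (Nat.find_min hex (m := d) (by omega))
  obtain ⟨g, hg, τ, hτ⟩ := Fintype.not_linearIndependent_iff.1 hdep
  -- Translating the relation by `τ`, the identity gets a nonzero coefficient.
  refine ⟨d, fun σ => g (τ * σ), ?_, fun h => ?_⟩
  · have h1 : permMat k p τ * ∑ σ, g (τ * σ) • permMat k p σ = 0 := by
      rw [Finset.mul_sum, ← hg, ← Equiv.sum_comp (Equiv.mulLeft τ) (fun σ => g σ • permMat k p σ)]
      exact Finset.sum_congr rfl fun σ _ => by
        rw [mul_smul_comm, Equiv.coe_mulLeft, permMat_mul]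
    have h2 := congrArg (permMat k p τ⁻¹ * ·) h1
    simpa only [← mul_assoc, ← permMat_mul, inv_mul_cancel, permMat_one, one_mul, mul_zero]
      using h2
  · have h1 := Fintype.linearIndependent_iff.1 hind _ h 1
    rw [Equiv.Perm.decomposeFin_symm_of_one, Equiv.swap_self] at h1
    refine hτ ?_
    rw [← mul_one τ]
    exact h1

end relations

section partial_trace

variable {k : Type u} [Field k] {ι : Type} {p : ι → ZMod 2}
  {A : SCommAlg.{u, a} k}

/-- The extension of a permutation of `n` letters by a new first letter, which is fixed. -/
abbrev liftPerm {n : ℕ} (e : Equiv.Perm (Fin n)) : Equiv.Perm (Fin (n + 1)) :=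
  Equiv.Perm.decomposeFin.symm (0, e)

theorem liftPerm_zero {n : ℕ} (e : Equiv.Perm (Fin n)) : liftPerm e 0 = 0 :=
  Equiv.Perm.decomposeFin_symm_apply_zero 0 e

theorem liftPerm_succ {n : ℕ} (e : Equiv.Perm (Fin n)) (x : Fin n) :
    liftPerm e x.succ = (e x).succ := by
  rw [liftPerm, Equiv.Perm.decomposeFin_symm_apply_succ, Equiv.swap_self]
  rfl

theorem liftPerm_inv {n : ℕ} (e : Equiv.Perm (Fin n)) : (liftPerm e)⁻¹ = liftPerm e⁻¹ := by
  rw [inv_eq_iff_mul_eq_one]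
  ext x : 1
  refine Fin.cases ?_ (fun x => ?_) x
  · rw [Equiv.Perm.mul_apply, liftPerm_zero, liftPerm_zero]; rfl
  · rw [Equiv.Perm.mul_apply, liftPerm_succ, liftPerm_succ, perm_apply_inv]; rfl

theorem liftPerm_mul {n : ℕ} (e f : Equiv.Perm (Fin n)) :
    liftPerm (e * f) = liftPerm e * liftPerm f := by
  ext x : 1
  refine Fin.cases ?_ (fun x => ?_) x
  · rw [Equiv.Perm.mul_apply, liftPerm_zero, liftPerm_zero, liftPerm_zero]
  · rw [Equiv.Perm.mul_apply, liftPerm_succ, liftPerm_succ, liftPerm_succ, Equiv.Perm.mul_apply]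

theorem decomposeFin_symm_eq {n : ℕ} (j : Fin (n + 1)) (e : Equiv.Perm (Fin n)) :
    Equiv.Perm.decomposeFin.symm (j, e) = Equiv.swap 0 j * liftPerm e := by
  ext x : 1
  refine Fin.cases ?_ (fun x => ?_) x
  · rw [Equiv.Perm.mul_apply, liftPerm_zero, Equiv.Perm.decomposeFin_symm_apply_zero,
      Equiv.swap_apply_left]
  · rw [Equiv.Perm.mul_apply, liftPerm_succ, Equiv.Perm.decomposeFin_symm_apply_succ]

/-- A permutation moving the first letter to `j + 1` is a product of one flip of the first two
letters and of permutations fixing the first letter. -/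
theorem decomposeFin_symm_succ {n : ℕ} (j : Fin (n + 1)) (e : Equiv.Perm (Fin (n + 1))) :
    Equiv.Perm.decomposeFin.symm (j.succ, e) =
      liftPerm (Equiv.swap 0 j) * (Equiv.swap 0 1 * liftPerm ((Equiv.swap 0 j)⁻¹ * e)) := by
  have h := Equiv.swap_apply_apply (liftPerm (Equiv.swap 0 j)) 0 1
  have h1 : liftPerm (Equiv.swap 0 j) 1 = j.succ := by
    rw [← Fin.succ_zero_eq_one, liftPerm_succ, Equiv.swap_apply_left]
  rw [liftPerm_zero, h1] at h
  rw [decomposeFin_symm_eq, h, liftPerm_mul, ← liftPerm_inv]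
  simp only [mul_assoc]

theorem cons_comp_liftPerm {α : Type*} {n : ℕ} (e : Equiv.Perm (Fin n)) (x : α) (s : Fin n → α) :
    (fun i => (Fin.cons x s : Fin (n + 1) → α) (liftPerm e i)) =
      Fin.cons x (fun i => s (e i)) := by
  funext i
  refine Fin.cases ?_ (fun i => ?_) i
  · rw [liftPerm_zero]; rfl
  · rw [liftPerm_succ]; rfl

theorem map_wordMat {B : SCommAlg.{u, a} k} (f : A.Hom B) {n : ℕ} (X : Fin n → Matrix ι ι A)
    (s t : Fin n → ι) :
    f.toAlgHom (wordMat p X s t) = wordMat p (fun i => (X i).map f.toAlgHom) s t := by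
  induction n with
  | zero => exact map_one _
  | succ n ih => rw [wordMat_succ, wordMat_succ, map_smul, map_mul, ih]; rfl

variable [Fintype ι]

variable (p) in
/-- The partial supertrace over the first letter. -/
def ptr {n : ℕ} (F : Matrix (Fin (n + 1) → ι) (Fin (n + 1) → ι) A) :
    Matrix (Fin n → ι) (Fin n → ι) A :=
  fun s t => ∑ x, sgn k (p x) • F (Fin.cons x s) (Fin.cons x t)

theorem ptr_sum {n : ℕ} {κ : Type*} (S : Finset κ)
    (F : κ → Matrix (Fin (n + 1) → ι) (Fin (n + 1) → ι) A) :
    ptr p (∑ j ∈ S, F j) = ∑ j ∈ S, ptr p (F j) := by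
  ext s t
  simp only [ptr, Matrix.sum_apply, Finset.smul_sum]
  rw [Finset.sum_comm]

theorem ptr_smul {n : ℕ} (c : k) (F : Matrix (Fin (n + 1) → ι) (Fin (n + 1) → ι) A) :
    ptr p (c • F) = c • ptr p F := by
  ext s t
  simp only [ptr, Matrix.smul_apply, Finset.smul_sum, smul_comm c]

theorem ptr_wordMat {n : ℕ} (X : Fin (n + 1) → Matrix ι ι A) :
    ptr p (wordMat p X) =
      (∑ x, sgn k (p x) • X 0 x x) • wordMat p (fun i => X i.succ) := by
  have h2 : ∀ q : ZMod 2, q + q = 0 := by decide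
  ext s t
  rw [ptr, Matrix.smul_apply, smul_eq_mul, Finset.sum_mul]
  refine Finset.sum_congr rfl fun x _ => ?_
  rw [wordMat_succ]
  simp only [Fin.cons_zero, Fin.cons_succ, h2, zero_mul, sgn_zero, one_smul, smul_mul_assoc]

variable [DecidableEq ι]

theorem ptr_permMat_mul {n : ℕ} (e : Equiv.Perm (Fin n))
    (F : Matrix (Fin (n + 1) → ι) (Fin (n + 1) → ι) A) :
    ptr p ((permMat k p (liftPerm e)).map (algebraMap k A) * F) =
      (permMat k p e).map (algebraMap k A) * ptr p F := by
  ext s t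
  rw [permMat_mul_apply, ptr, ptr, Finset.smul_sum]
  refine Finset.sum_congr rfl fun x _ => ?_
  rw [permMat_mul_apply, cons_comp_liftPerm, koszul_decomposeFin, smul_comm]
  congr 2

theorem ptr_mul_permMat {n : ℕ} (e : Equiv.Perm (Fin n))
    (F : Matrix (Fin (n + 1) → ι) (Fin (n + 1) → ι) A) :
    ptr p (F * (permMat k p (liftPerm e)).map (algebraMap k A)) =
      ptr p F * (permMat k p e).map (algebraMap k A) := by
  ext s t
  rw [mul_permMat_apply, ptr, ptr, Finset.smul_sum]
  refine Finset.sum_congr rfl fun x _ => ?_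
  rw [mul_permMat_apply, liftPerm_inv, cons_comp_liftPerm, koszul_decomposeFin, smul_comm]
  rfl

/-- The partial supertrace of the composite with the flip of the first two letters is a product. -/
theorem ptr_wordMat_swap {n : ℕ} {X : Fin (n + 2) → Matrix ι ι A}
    (hX : ∀ i s t, X i s t ∈ A.gr (p s + p t)) :
    ptr p (wordMat p X * (permMat k p (Equiv.swap 0 1)).map (algebraMap k A)) =
      wordMat p (Fin.cons (X 1 * X 0) fun i => X i.succ.succ) := by
  ext s t
  have h1 : ∀ i : Fin n, Equiv.swap (0 : Fin (n + 2)) 1 i.succ.succ = i.succ.succ := fun i =>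
    Equiv.swap_apply_of_ne_of_ne (by simp [Fin.ext_iff]) (by simp [Fin.ext_iff])
  rw [wordMat_succ, ptr, Fin.cons_zero, Matrix.mul_apply, Finset.sum_mul, Finset.smul_sum]
  refine Finset.sum_congr rfl fun x _ => ?_
  have h4 := koszul_swap (k := k) (0 : Fin (n + 1))
    (fun i => p ((Fin.cons x t : Fin (n + 2) → ι) i))
  have h3 : ((0 : Fin (n + 1)).castSucc : Fin (n + 2)) = 0 := rfl
  rw [h3, Fin.succ_zero_eq_one] at h4
  have h6 : ∀ {α : Type} (x : α) (t : Fin (n + 1) → α), (Fin.cons x t : Fin (n + 2) → α) 1 = t 0 :=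
    fun _ _ => rfl
  rw [mul_permMat_apply, h4, Equiv.swap_inv, wordMat_succ, wordMat_succ (X := fun i => X i.succ),
    wpar_succ p (fun i => (Fin.cons x s : Fin (n + 2) → ι) i.succ)]
  simp only [Fin.cons_zero, Fin.cons_succ, Equiv.swap_apply_left, h1, h6, Fin.succ_zero_eq_one,
    Equiv.swap_apply_right]
  have h5 := A.super_comm (hX 0 x (t 0)) (hX 1 (s 0) x)
  simp only [mul_smul_comm, smul_smul, ← sgn_add, ← mul_assoc]
  rw [h5, smul_mul_assoc, smul_smul, ← sgn_add]
  congr 2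
  generalize p (s 0) = i1
  generalize p x = i2
  generalize p (t 0) = i3
  generalize wpar p (fun i => s i.succ) = i4
  clear! s t
  revert i1 i2 i3 i4
  decide

end partial_trace

section clearing

variable {k : Type u} [Field k] {ι : Type} {p : ι → ZMod 2}

theorem map_sum_smul {n : ℕ} {A : SCommAlg.{u, a} k} {κ : Type*} (S : Finset κ) (c : κ → k)
    (F : κ → Matrix (Fin n → ι) (Fin n → ι) k) :
    (∑ j ∈ S, c j • F j).map (algebraMap k A) = ∑ j ∈ S, c j • (F j).map (algebraMap k A) := by
  ext s t
  rw [Matrix.map_apply, Matrix.sum_apply, Matrix.sum_apply, map_sum]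
  refine Finset.sum_congr rfl fun j _ => ?_
  rw [Matrix.smul_apply, Matrix.smul_apply, smul_eq_mul, map_mul, Algebra.smul_def]
  rfl

variable [DecidableEq ι]

/-- The entries of a tensor product of matrices depend linearly on an entry of the first factor. -/
theorem wordMat_single {n : ℕ} {A B : SCommAlg.{u, a} k} (f : A.Hom B) (z : B) (s₀ t₀ : ι)
    (X : Matrix ι ι A) (s t : Fin (n + 1) → ι) :
    wordMat p (Fin.cons (Matrix.single s₀ t₀ z) fun _ => X.map f.toAlgHom :
        Fin (n + 1) → Matrix ι ι B) s t =
      z * f.toAlgHom (wordMat p (Fin.cons (Matrix.single s₀ t₀ 1) fun _ => X :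
        Fin (n + 1) → Matrix ι ι A) s t) := by
  rw [wordMat_succ, wordMat_succ, map_smul, map_mul, mul_smul_comm, map_wordMat]
  simp only [Fin.cons_zero, Fin.cons_succ, Matrix.single_apply]
  split_ifs
  · rw [map_one, one_mul]
  · rw [zero_mul, map_zero, zero_mul, mul_zero]

variable [Fintype ι]

/-- The partial supertrace of `Q ⊗ h ⊗ ⋯ ⊗ h` composed with a permutation moving the first letter:
the matrix `Q` reappears as the product `h * Q`, between permutations of the remaining letters. -/
theorem ptr_wordMat_permMat [CharZero k] {n : ℕ} (j : Fin (n + 1)) (e : Equiv.Perm (Fin (n + 1)))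
    {A : SCommAlg.{u, a} k} {Q h : Matrix ι ι A} (hQ : Q ∈ superMat p A) (hh : h ∈ superMat p A) :
    ptr p (wordMat p (Fin.cons Q fun _ => h : Fin (n + 2) → Matrix ι ι A) *
        (permMat k p (Equiv.Perm.decomposeFin.symm (j.succ, e))).map (algebraMap k A)) =
      (permMat k p (Equiv.swap 0 j)).map (algebraMap k A) *
        wordMat p (Fin.cons (h * Q) fun _ => h : Fin (n + 1) → Matrix ι ι A) *
          (permMat k p ((Equiv.swap 0 j)⁻¹ * e)).map (algebraMap k A) := by
  have hZ : ∀ i s t, (Fin.cons Q fun _ => h : Fin (n + 2) → Matrix ι ι A) i s t ∈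
      A.gr (p s + p t) := by
    intro i s t
    refine Fin.cases ?_ (fun i => ?_) i
    · exact hQ s t
    · exact hh s t
  have hZ1 : (fun i => (Fin.cons Q fun _ => h : Fin (n + 2) → Matrix ι ι A)
      ((liftPerm (Equiv.swap 0 j))⁻¹ i)) = Fin.cons Q fun _ => h := by
    rw [liftPerm_inv]
    exact cons_comp_liftPerm _ Q fun _ => h
  have h1 := permMat_mul_wordMat (k := k) (liftPerm (Equiv.swap 0 j)) hZ
  rw [hZ1] at h1
  rw [decomposeFin_symm_succ, permMat_mul, permMat_mul, Matrix.map_mul, Matrix.map_mul,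
    ← Matrix.mul_assoc, ← Matrix.mul_assoc, ← h1, ptr_mul_permMat, Matrix.mul_assoc,
    ptr_permMat_mul, ptr_wordMat_swap hZ]
  rfl

theorem permMat_mul_mul_apply {n : ℕ} {A B : SCommAlg.{u, a} k} (f : A.Hom B) (z : B)
    (α β : Equiv.Perm (Fin n)) {F : Matrix (Fin n → ι) (Fin n → ι) B}
    {G : Matrix (Fin n → ι) (Fin n → ι) A} (h : ∀ s t, F s t = z * f.toAlgHom (G s t))
    (s t : Fin n → ι) :
    ((permMat k p α).map (algebraMap k B) * F * (permMat k p β).map (algebraMap k B)) s t =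
      z * f.toAlgHom (((permMat k p α).map (algebraMap k A) * G *
        (permMat k p β).map (algebraMap k A)) s t) := by
  rw [mul_permMat_apply, permMat_mul_apply, mul_permMat_apply, permMat_mul_apply, h,
    map_smul, map_smul, mul_smul_comm, mul_smul_comm]

/-- If the permutations of `d + 1` letters are linearly dependent on words, then the partial
supertrace of a relation multiplies the entries of the inverse of `X` into polynomials in `X`. -/
theorem exists_clearing [CharZero k] (p : ι → ZMod 2) :
    ∃ (d : ℕ) (c : Matrix (Fin d → ι) (Fin d → ι) k), c ≠ 0 ∧
      (∀ (A : SCommAlg.{u, a} k) (X : superMat p A),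
        c.map (algebraMap k A) * wordMat p (fun _ => X.1) =
          wordMat p (fun _ => X.1) * c.map (algebraMap k A)) ∧
      ∀ (i j : ι) (s t : Fin d → ι), ∃ G : ∀ A : SCommAlg.{u, a} k, superMat p A → A,
        (∀ {A B : SCommAlg.{u, a} k} (f : A.Hom B) X,
          f.toAlgHom (G A X) = G B (superMat.map p f X)) ∧
        ∀ (A : SCommAlg.{u, a} k) (X : (superMat p A)ˣ),
          (X⁻¹).1.1 i j * (wordMat p (fun _ => X.1.1) * c.map (algebraMap k A) :
            Matrix (Fin d → ι) (Fin d → ι) A) s t = G A X.1 := by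
  obtain ⟨d, c, hc, hc0⟩ := exists_relation (k := k) p
  refine ⟨d, ∑ e, c (Equiv.Perm.decomposeFin.symm (0, e)) • permMat k p e, hc0,
    fun A X => ?_, fun v u s t => ?_⟩
  · have h1 : ∀ e : Equiv.Perm (Fin d), (permMat k p e).map (algebraMap k A) *
        wordMat p (fun _ => X.1) = wordMat p (fun _ => X.1) * (permMat k p e).map (algebraMap k A) :=
      fun e => permMat_mul_wordMat e fun _ => X.2
    rw [map_sum_smul, Finset.sum_mul, Finset.mul_sum]
    exact Finset.sum_congr rfl fun e _ => by rw [smul_mul_assoc, mul_smul_comm, h1]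
  · have hp : ∀ q : ZMod 2, q + q = 0 := by decide
    -- With `Q` the product of the inverse of `X` and of an elementary matrix `z`, the products `X *
    -- Q` in the terms moving the first letter do not involve the inverse any more.
    have key : ∃ G : ∀ A : SCommAlg.{u, a} k, superMat p A → A,
        (∀ {A B : SCommAlg.{u, a} k} (f : A.Hom B) X,
          f.toAlgHom (G A X) = G B (superMat.map p f X)) ∧
        ∀ {A B : SCommAlg.{u, a} k} (f : A.Hom B) (z : B) (hz : z ∈ B.gr (p u + p v))
          (X : (superMat p A)ˣ),
          ptr p (wordMat p (Fin.cons ((X⁻¹).1.1.map f.toAlgHom * Matrix.single u v z)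
            fun _ => X.1.1.map f.toAlgHom : Fin (d + 1) → Matrix ι ι B) *
            (∑ j : Fin d, ∑ e, c (Equiv.Perm.decomposeFin.symm (j.succ, e)) •
              (permMat k p (Equiv.Perm.decomposeFin.symm (j.succ, e))).map (algebraMap k B))) s t =
            z * f.toAlgHom (G A X.1) := by
      rcases d with _ | d
      · refine ⟨fun A X => 0, fun f X => map_zero _, fun f z hz X => ?_⟩
        rw [Fin.sum_univ_zero, mul_zero, map_zero, mul_zero]
        simp [ptr]
      · refine ⟨fun A X => ∑ j, ∑ e, c (Equiv.Perm.decomposeFin.symm (j.succ, e)) •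
          ((permMat k p (Equiv.swap 0 j)).map (algebraMap k A) *
            wordMat p (Fin.cons (Matrix.single u v 1) fun _ => X.1 : Fin (d + 1) → Matrix ι ι A) *
            (permMat k p ((Equiv.swap 0 j)⁻¹ * e)).map (algebraMap k A) :
              Matrix (Fin (d + 1) → ι) (Fin (d + 1) → ι) A) s t, fun {A B} f X => ?_,
          fun {A B} f z hz X => ?_⟩
        · simp only [map_sum, map_smul]
          refine Finset.sum_congr rfl fun j _ => Finset.sum_congr rfl fun e _ => ?_
          refine congrArg _ (Eq.symm ?_)
          exact (permMat_mul_mul_apply f 1 _ _ (F := wordMat p (Fin.cons (Matrix.single u v 1)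
            fun _ => X.1.map f.toAlgHom : Fin (d + 1) → Matrix ι ι B))
            (wordMat_single f 1 u v X.1) s t).trans (one_mul _)
        · have hX : X.1.1.map f.toAlgHom ∈ superMat p B := (superMat.map p f X.1).2
          have hQ : (X⁻¹).1.1.map f.toAlgHom * Matrix.single u v z ∈ superMat p B := by
            refine Submonoid.mul_mem _ (superMat.map p f (X⁻¹).1).2 fun i j => ?_
            rw [Matrix.single_apply]
            split_ifs with h
            · rw [← h.1, ← h.2]; exact hz
            · exact Submodule.zero_mem _
          have hXQ : X.1.1.map f.toAlgHom * ((X⁻¹).1.1.map f.toAlgHom * Matrix.single u v z) =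
              Matrix.single u v z := by
            rw [← Matrix.mul_assoc, ← Matrix.map_mul]
            have h1 : X.1.1 * (X⁻¹).1.1 = 1 := congrArg Subtype.val X.mul_inv
            rw [h1, Matrix.map_one _ (map_zero _) (map_one _), Matrix.one_mul]
          simp only [Finset.mul_sum, ptr_sum, mul_smul_comm, ptr_smul, Matrix.sum_apply,
            Matrix.smul_apply, map_sum, map_smul]
          refine Finset.sum_congr rfl fun j _ => Finset.sum_congr rfl fun e _ => ?_
          rw [ptr_wordMat_permMat j e hQ hX, hXQ,
            permMat_mul_mul_apply f z _ _ (fun s t => wordMat_single f z u v X.1.1 s t)]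
    obtain ⟨G, hG, hGX⟩ := key
    refine ⟨fun A X => -(sgn k (p u) • G A X), fun f X => by rw [map_neg, map_smul, hG], fun A X => ?_⟩
    -- The elementary matrix has to be even, so its entry `z` is a new variable of the right degree,
    -- whose coefficient is extracted by `φ`.
    obtain ⟨B, f, y, φ, hy, hφ, -⟩ := A.exists_adjoin 1 fun _ => p u + p v
    have hφ1 : ∀ x, φ (y 0 * f.toAlgHom x) = x := fun x => by
      have := hφ x
      rwa [List.ofFn_succ, List.ofFn_zero, List.prod_cons, List.prod_nil, mul_one] at this
    set Z : Fin (d + 1) → Matrix ι ι B := Fin.cons ((X⁻¹).1.1.map f.toAlgHom * Matrix.single u v (y 0))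
      fun _ => X.1.1.map f.toAlgHom with hZ
    have h0 : ∑ σ, c σ • (permMat k p σ).map (algebraMap k B) = 0 := by
      rw [← map_sum_smul, hc]
      exact Matrix.map_zero _ (map_zero _)
    rw [← Equiv.Perm.decomposeFin.symm.sum_comp, Fintype.sum_prod_type, Fin.sum_univ_succ] at h0
    have h1 := hGX f (y 0) (hy 0) X
    rw [← hZ, ← neg_eq_of_add_eq_zero_right h0, mul_neg] at h1
    have h2 : ∀ F : Matrix (Fin (d + 1) → ι) (Fin (d + 1) → ι) B, ptr p (-F) s t = -ptr p F s t := by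
      intro F
      simp [ptr]
    -- In the terms that fix the first letter, the supertrace of `Q` is an entry of the inverse.
    have h3 : ∀ e : Equiv.Perm (Fin d), ptr p (wordMat p Z *
        (permMat k p (Equiv.Perm.decomposeFin.symm (0, e))).map (algebraMap k B)) =
        (sgn k (p v) • (f.toAlgHom ((X⁻¹).1.1 v u) * y 0)) •
          (wordMat p (fun _ => X.1.1.map f.toAlgHom) *
            (permMat k p e).map (algebraMap k B)) := by
      intro e
      refine (ptr_mul_permMat e _).trans ?_
      rw [ptr_wordMat, smul_mul_assoc]
      congr 1
      rw [Finset.sum_eq_single v]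
      · rw [hZ, Fin.cons_zero, Matrix.mul_single_apply_same, Matrix.map_apply]
      · intro x _ hx
        rw [hZ, Fin.cons_zero, Matrix.mul_single_apply_of_ne _ _ _ _ _ hx, smul_zero]
      · intro h
        exact absurd (Finset.mem_univ v) h
    have h4 : ptr p (wordMat p Z * ∑ e, c (Equiv.Perm.decomposeFin.symm (0, e)) •
        (permMat k p (Equiv.Perm.decomposeFin.symm (0, e))).map (algebraMap k B)) =
        (sgn k (p v) • (f.toAlgHom ((X⁻¹).1.1 v u) * y 0)) •
          (wordMat p (fun _ => X.1.1) * (∑ e, c (Equiv.Perm.decomposeFin.symm (0, e)) •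
            permMat k p e).map (algebraMap k A)).map f.toAlgHom := by
      have h5 : (wordMat p (fun _ => X.1.1)).map f.toAlgHom =
          wordMat p (fun _ : Fin d => X.1.1.map f.toAlgHom) :=
        Matrix.ext fun s t => map_wordMat f _ s t
      have h6 : ∀ F : Matrix (Fin d → ι) (Fin d → ι) k,
          (F.map (algebraMap k A)).map f.toAlgHom = F.map (algebraMap k B) := fun F =>
        Matrix.ext fun s t => AlgHom.commutes _ _
      rw [Matrix.map_mul, h5, h6, map_sum_smul, Finset.mul_sum, ptr_sum, Finset.mul_sum,
        Finset.smul_sum]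
      refine Finset.sum_congr rfl fun e _ => ?_
      rw [mul_smul_comm, ptr_smul, h3, mul_smul_comm, smul_comm]
    have h5 := B.super_comm (f.map_gr _ _ ((X⁻¹).1.2 v u)) (hy 0)
    have h6 : sgn k (p v) * sgn k ((p v + p u) * (p u + p v)) = sgn k (p u) := by
      rw [← sgn_add]
      congr 1
      generalize p u = i1
      generalize p v = i2
      revert i1 i2
      decide
    rw [h2, h4, Matrix.smul_apply, Matrix.map_apply, h5, smul_smul, h6, smul_eq_mul,
      smul_mul_assoc, mul_assoc, ← map_mul] at h1
    have h7 := congrArg (fun z => φ (-(sgn k (p u) • z))) h1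
    simp only [smul_neg, neg_neg, smul_smul, sgn_mul_self, one_smul] at h7
    rw [hφ1, map_neg, map_smul, hφ1] at h7
    exact h7

end clearing

/-! ### Matrix coefficients, and representations in terms of matrices -/

section coefficients

variable {k : Type u} [Field k]

/-- The evaluation `V ⊗ A → A` of a linear form. -/
noncomputable def contr (A : SCommAlg.{u, a} k) {V : SuperSpace.{u, w} k} (ξ : Module.Dual k V) :
    V ⊗[k] A →ₗ[k] A :=
  (TensorProduct.lid k A).toLinearMap ∘ₗ LinearMap.rTensor A ξ

variable {A : SCommAlg.{u, a} k} {V : SuperSpace.{u, w} k} {W : SuperSpace.{u, w'} k}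

theorem contr_tmul (ξ : Module.Dual k V) (v : V) (x : A) :
    contr A ξ (v ⊗ₜ[k] x) = ξ v • x := by
  simp [contr]

theorem contr_rmul (ξ : Module.Dual k V) (z : V ⊗[k] A) (x : A) :
    contr A ξ (rmul V A x z) = contr A ξ z * x := by
  induction z using TensorProduct.induction_on with
  | zero => simp
  | add z t hz ht => simp only [map_add, hz, ht, add_mul]
  | tmul v y => rw [rmul_tmul, contr_tmul, contr_tmul, smul_mul_assoc]

theorem contr_baseMap {B : SCommAlg.{u, a} k} (f : A.Hom B) (ξ : Module.Dual k V) (z : V ⊗[k] A) :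
    contr B ξ (baseMap V f z) = f.toAlgHom (contr A ξ z) := by
  induction z using TensorProduct.induction_on with
  | zero => simp
  | add z t hz ht => simp only [map_add, hz, ht]
  | tmul v y => rw [baseMap_tmul, contr_tmul, contr_tmul, map_smul]

theorem contr_rTensor (F : V →ₗ[k] W) (ξ : Module.Dual k W) (z : V ⊗[k] A) :
    contr A ξ (LinearMap.rTensor A F z) = contr A (ξ ∘ₗ F) z := by
  induction z using TensorProduct.induction_on with
  | zero => simp
  | add z t hz ht => simp only [map_add, hz, ht]
  | tmul v y => rw [LinearMap.rTensor_tmul, contr_tmul, contr_tmul, LinearMap.comp_apply]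

theorem contr_add (ξ η : Module.Dual k V) (z : V ⊗[k] A) :
    contr A (ξ + η) z = contr A ξ z + contr A η z := by
  simp [contr, LinearMap.rTensor_add]

theorem contr_smul (c : k) (ξ : Module.Dual k V) (z : V ⊗[k] A) :
    contr A (c • ξ) z = c • contr A ξ z := by
  simp [contr, LinearMap.rTensor_smul]

theorem eq_sum_contr {ι : Type*} [Fintype ι] (b : Module.Basis ι k V) (z : V ⊗[k] A) :
    z = ∑ s, b s ⊗ₜ[k] contr A (b.coord s) z := by
  induction z using TensorProduct.induction_on with
  | zero => simp
  | add z t hz ht =>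
    simp only [map_add, TensorProduct.tmul_add, Finset.sum_add_distrib]
    rw [← hz, ← ht]
  | tmul v y =>
    conv_lhs => rw [← b.sum_repr v, TensorProduct.sum_tmul]
    refine Finset.sum_congr rfl fun s _ => ?_
    rw [contr_tmul, TensorProduct.smul_tmul, Module.Basis.coord_apply]

theorem contr_ext [Module.Finite k V] {z t : V ⊗[k] A} (h : ∀ ξ, contr A ξ z = contr A ξ t) :
    z = t := by
  rw [eq_sum_contr (Module.finBasis k V) z, eq_sum_contr (Module.finBasis k V) t]
  exact Finset.sum_congr rfl fun s _ => by rw [h]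

theorem tmul_eq_rmul (v : V) (x : A) : v ⊗ₜ[k] x = rmul V A x (v ⊗ₜ[k] 1) := by
  rw [rmul_tmul, one_mul]

theorem contr_mem {ξ : Module.Dual k V} {i j : ZMod 2} (hξ : ξ ∈ V.dual.gr i) {z : V ⊗[k] A}
    (hz : z ∈ tensorGr V A.toSuperSpace j) : contr A ξ z ∈ A.gr (i + j) := by
  induction hz using Submodule.span_induction with
  | zero => simp
  | add p q _ _ hp hq => rw [map_add]; exact Submodule.add_mem _ hp hq
  | smul c p _ hp => rw [map_smul]; exact Submodule.smul_mem _ _ hp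
  | mem z hz =>
    obtain ⟨i1, i2, rfl, v, hv, x, hx, rfl⟩ := hz
    rw [contr_tmul]
    by_cases h : i1 = i
    · subst h
      have h2 : ∀ q r : ZMod 2, q + (q + r) = r := by decide
      rw [h2]
      exact Submodule.smul_mem _ _ hx
    · have h3 : i + 1 = i1 := zmod2_succ fun h' => h h'.symm
      rw [(Submodule.mem_dualAnnihilator ξ).1 hξ v (by rwa [h3]), zero_smul]
      exact Submodule.zero_mem _

theorem exists_homogeneous_basis (V : SuperSpace.{u, w} k) [Module.Finite k V] :
    ∃ (n : ℕ) (p : Fin n → ZMod 2) (b : Module.Basis (Fin n) k V), ∀ s, b s ∈ V.gr (p s) := by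
  let b := (((Module.finBasis k (V.gr 0)).prod (Module.finBasis k (V.gr 1))).map
    (Submodule.prodEquivOfIsCompl _ _ V.isCompl)).reindex finSumFinEquiv
  refine ⟨_, fun s => Sum.elim (fun _ => 0) (fun _ => 1) (finSumFinEquiv.symm s), b, fun s => ?_⟩
  obtain ⟨s, rfl⟩ := finSumFinEquiv.surjective s
  rw [Module.Basis.reindex_apply, Equiv.symm_apply_apply, Module.Basis.map_apply]
  rcases s with s | s
  · rw [Module.Basis.prod_apply]
    simp
  · rw [Module.Basis.prod_apply]
    simp

theorem coord_mem_dual {ι : Type*} {p : ι → ZMod 2} {b : Module.Basis ι k V}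
    (hb : ∀ s, b s ∈ V.gr (p s)) (s : ι) : b.coord s ∈ V.dual.gr (p s) := by
  rw [Submodule.mem_dualAnnihilator]
  intro x hx
  have h : b.coord s ∘ₗ V.pr (p s + 1) = 0 := by
    refine b.ext fun t => ?_
    rw [LinearMap.comp_apply, V.pr_of_mem _ (hb t)]
    split_ifs with h
    · have hst : t ≠ s := by
        rintro rfl
        revert h
        generalize p t = q
        revert q
        decide
      rw [Module.Basis.coord_apply, Module.Basis.repr_self, Finsupp.single_eq_of_ne hst.symm]
      rfl
    · exact map_zero _
  have h1 := LinearMap.congr_fun h x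
  rwa [LinearMap.comp_apply, V.pr_of_mem _ hx, if_pos rfl] at h1

variable {G : SuperMonoid.{u, a, b} k}

theorem Rep.act_tmul (ρ : Rep G V) (g : G.pts A) (v : V) (x : A) :
    (ρ.act A g).1 (v ⊗ₜ[k] x) = rmul V A x ((ρ.act A g).1 (v ⊗ₜ[k] 1)) := by
  rw [tmul_eq_rmul, (ρ.act A g).2.1]

/-- A representation is determined by the action on the vectors of `V`. -/
theorem Rep.ext {ρ σ : Rep G V}
    (h : ∀ A g v, (ρ.act A g).1 (v ⊗ₜ[k] 1) = (σ.act A g).1 (v ⊗ₜ[k] 1)) : ρ = σ := by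
  have h1 : ρ.act = σ.act := by
    funext A
    refine MonoidHom.ext fun g => Subtype.ext (TensorProduct.ext' fun v x => ?_)
    rw [ρ.act_tmul, σ.act_tmul, h]
  cases ρ
  cases σ
  cases h1
  rfl

/-- The matrix coefficients `g ↦ ξ (g v)` of a representation. -/
noncomputable def Rep.coef (ρ : Rep G V) : Module.Dual k V →ₗ[k] V →ₗ[k] G.Fn :=
  LinearMap.mk₂ k (fun ξ v A g => contr A ξ ((ρ.act A g).1 (v ⊗ₜ[k] 1)))
    (fun ξ η v => by ext A g; exact contr_add _ _ _)
    (fun c ξ v => by ext A g; exact contr_smul _ _ _)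
    (fun ξ v v' => by ext A g; simp [TensorProduct.add_tmul])
    (fun c ξ v => by ext A g; simp [← TensorProduct.smul_tmul'])

theorem Rep.coef_apply (ρ : Rep G V) (ξ : Module.Dual k V) (v : V) (g : G.pts A) :
    ρ.coef ξ v A g = contr A ξ ((ρ.act A g).1 (v ⊗ₜ[k] 1)) := rfl

theorem Rep.coef_mem (ρ : Rep G V) (ξ : Module.Dual k V) (v : V) : ρ.coef ξ v ∈ G.natFn := by
  intro A B f g
  rw [ρ.coef_apply, ρ.coef_apply, ← contr_baseMap, ρ.act_map, baseMap_tmul, map_one]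

theorem Rep.coef_mem_gr (ρ : Rep G V) {i j : ZMod 2} {ξ : Module.Dual k V} (hξ : ξ ∈ V.dual.gr i)
    {v : V} (hv : v ∈ V.gr j) (g : G.pts A) : ρ.coef ξ v A g ∈ A.gr (i + j) :=
  contr_mem hξ ((ρ.act A g).2.2 _ _ (tmul_mem_zero hv A.one_mem))

theorem Rep.coef_one (ρ : Rep G V) (ξ : Module.Dual k V) (v : V) :
    ρ.coef ξ v A 1 = ξ v • (1 : A) := by
  rw [ρ.coef_apply, map_one]
  exact contr_tmul _ _ _

theorem Rep.coef_mul (ρ : Rep G V) {ι : Type*} [Fintype ι] (b : Module.Basis ι k V)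
    (ξ : Module.Dual k V) (v : V) (g h : G.pts A) :
    ρ.coef ξ v A (g * h) = ∑ s, ρ.coef ξ (b s) A g * ρ.coef (b.coord s) v A h := by
  rw [ρ.coef_apply, map_mul]
  change contr A ξ ((ρ.act A g).1 ((ρ.act A h).1 _)) = _
  rw [eq_sum_contr b ((ρ.act A h).1 _), map_sum, map_sum]
  refine Finset.sum_congr rfl fun s _ => ?_
  rw [ρ.act_tmul, contr_rmul]
  rfl

theorem Rep.act_eq_sum (ρ : Rep G V) {ι : Type*} [Fintype ι] (b : Module.Basis ι k V)
    (v : V) (g : G.pts A) :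
    (ρ.act A g).1 (v ⊗ₜ[k] 1) = ∑ s, b s ⊗ₜ[k] ρ.coef (b.coord s) v A g :=
  eq_sum_contr b _

end coefficients

section matrix_rep

variable {k : Type u} [Field k] {ι : Type} {p : ι → ZMod 2} {V : SuperSpace.{u, w} k}
  {A : SCommAlg.{u, a} k}

theorem basis_tensor_ext (b : Module.Basis ι k V) {Y : Type b'} [AddCommGroup Y]
    [Module k Y] {f g : V ⊗[k] A →ₗ[k] Y} (h : ∀ (t : ι) (x : A), f (b t ⊗ₜ[k] x) =
      g (b t ⊗ₜ[k] x)) : f = g :=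
  TensorProduct.ext (b.ext fun t => LinearMap.ext fun x => h t x)

variable [Fintype ι]

/-- The endomorphism of `V ⊗ A` with matrix `X` in the basis `b` of `V`. -/
noncomputable def basisEnd (b : Module.Basis ι k V) (X : Matrix ι ι A) :
    Module.End k (V ⊗[k] A) :=
  ∑ s, ∑ t, TensorProduct.map ((b.coord t).smulRight (b s)) (LinearMap.mulLeft k (X s t))

theorem basisEnd_basis (b : Module.Basis ι k V) (X : Matrix ι ι A) (t : ι) (x : A) :
    basisEnd b X (b t ⊗ₜ[k] x) = ∑ s, b s ⊗ₜ[k] (X s t * x) := by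
  rw [basisEnd, LinearMap.sum_apply]
  refine Finset.sum_congr rfl fun s _ => ?_
  rw [LinearMap.sum_apply, Finset.sum_eq_single t]
  · simp
  · intro r _ hr
    simp [Finsupp.single_eq_of_ne hr]
  · intro h
    exact absurd (Finset.mem_univ t) h

variable [DecidableEq ι]

theorem basisEnd_mem {b : Module.Basis ι k V} (hb : ∀ s, b s ∈ V.gr (p s)) (X : superMat p A) :
    basisEnd b X.1 ∈ AEnd V A := by
  refine ⟨fun x z => ?_, fun d z hz => ?_⟩
  · have h : basisEnd b X.1 ∘ₗ rmul V A x = rmul V A x ∘ₗ basisEnd b X.1 := by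
      refine basis_tensor_ext b fun t y => ?_
      simp only [LinearMap.comp_apply]
      rw [rmul_tmul, basisEnd_basis, basisEnd_basis, map_sum]
      exact Finset.sum_congr rfl fun s _ => by rw [rmul_tmul, mul_assoc]
    exact LinearMap.congr_fun h z
  · induction hz using Submodule.span_induction with
    | zero => simp
    | add p q _ _ hp hq => rw [map_add]; exact Submodule.add_mem _ hp hq
    | smul c p _ hp => rw [map_smul]; exact Submodule.smul_mem _ _ hp
    | mem z hz =>
      obtain ⟨i, j, rfl, v, hv, x, hx, rfl⟩ := hz
      rw [← b.sum_repr v, TensorProduct.sum_tmul, map_sum]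
      refine Submodule.sum_mem _ fun t _ => ?_
      rw [← TensorProduct.smul_tmul', map_smul]
      by_cases h : p t = i
      · subst h
        refine Submodule.smul_mem _ _ ?_
        rw [basisEnd_basis]
        refine Submodule.sum_mem _ fun s _ => ?_
        have h3 := tmul_mem (W := A.toSuperSpace) (hb s) (A.mul_mem (X.2 s t) hx)
        have h2 : ∀ q r l : ZMod 2, q + (q + r + l) = r + l := by decide
        rwa [h2] at h3
      · have h0 : b.repr v t = 0 := (Submodule.mem_dualAnnihilator _).1 (coord_mem_dual hb t) v
          (by rwa [zmod2_succ fun h' => h h'])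
        rw [h0, zero_smul]
        exact Submodule.zero_mem _

variable {G : SuperMonoid.{u, a, b} k}

/-- The representation with given matrices in a homogeneous basis. -/
noncomputable def matRep (b : Module.Basis ι k V) (hb : ∀ s, b s ∈ V.gr (p s))
    (χ : ∀ A : SCommAlg.{u, a} k, G.pts A →* superMat p A)
    (hχ : ∀ {A B : SCommAlg.{u, a} k} (f : A.Hom B) (g : G.pts A),
      χ B (G.map f g) = superMat.map p f (χ A g))
    (hε : ∀ A, χ A (G.eps A) = superMat.eps p A) : Rep G V where
  finite := Module.Finite.of_basis b
  act A :=
    { toFun := fun g => ⟨basisEnd b (χ A g).1, basisEnd_mem hb _⟩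
      map_one' := by
        refine Subtype.ext (basis_tensor_ext b fun t x => ?_)
        rw [map_one, basisEnd_basis, Finset.sum_eq_single t]
        · simp
        · intro s _ hs
          simp [Matrix.one_apply_ne hs]
        · intro h
          exact absurd (Finset.mem_univ t) h
      map_mul' := fun g h => by
        refine Subtype.ext (basis_tensor_ext b fun t x => ?_)
        rw [map_mul]
        change basisEnd b ((χ A g).1 * (χ A h).1) _ =
          basisEnd b (χ A g).1 (basisEnd b (χ A h).1 _)
        rw [basisEnd_basis, basisEnd_basis, map_sum]
        simp only [Matrix.mul_apply, Finset.sum_mul, TensorProduct.tmul_sum, mul_assoc]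
        rw [Finset.sum_comm]
        exact Finset.sum_congr rfl fun r _ => (basisEnd_basis b _ r _).symm }
  act_map {A B} f g z := by
    have h : baseMap V f ∘ₗ basisEnd b (χ A g).1 =
        basisEnd b (χ B (G.map f g)).1 ∘ₗ baseMap V f := by
      refine basis_tensor_ext b fun t x => ?_
      rw [LinearMap.comp_apply, LinearMap.comp_apply, baseMap_tmul, basisEnd_basis, basisEnd_basis,
        map_sum]
      refine Finset.sum_congr rfl fun s _ => ?_
      rw [baseMap_tmul, map_mul, hχ]
      rfl
    exact LinearMap.congr_fun h z
  act_eps A d v hv x := by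
    change basisEnd b (χ A (G.eps A)).1 _ = _
    rw [hε, ← b.sum_repr v, TensorProduct.sum_tmul, map_sum, Finset.smul_sum]
    refine Finset.sum_congr rfl fun t _ => ?_
    rw [← TensorProduct.smul_tmul', map_smul, smul_comm]
    by_cases h : p t = d
    · rw [basisEnd_basis, Finset.sum_eq_single t]
      · simp only [superMat.eps, Matrix.diagonal_apply_eq, smul_mul_assoc, one_mul,
          TensorProduct.tmul_smul, h]
      · intro s _ hs
        simp [superMat.eps, Matrix.diagonal_apply_ne _ hs]
      · intro h
        exact absurd (Finset.mem_univ t) h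
    · have h0 : b.repr v t = 0 := (Submodule.mem_dualAnnihilator _).1 (coord_mem_dual hb t) v
        (by rwa [zmod2_succ fun h' => h h'])
      rw [h0, zero_smul, zero_smul]

theorem matRep_act (b : Module.Basis ι k V) (hb : ∀ s, b s ∈ V.gr (p s))
    (χ : ∀ A : SCommAlg.{u, a} k, G.pts A →* superMat p A)
    (hχ : ∀ {A B : SCommAlg.{u, a} k} (f : A.Hom B) (g : G.pts A),
      χ B (G.map f g) = superMat.map p f (χ A g))
    (hε : ∀ A, χ A (G.eps A) = superMat.eps p A) (A : SCommAlg.{u, a} k) (g : G.pts A) (t : ι) :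
    ((matRep b hb χ hχ hε).act A g).1 (b t ⊗ₜ[k] 1) = ∑ s, b s ⊗ₜ[k] (χ A g).1 s t := by
  refine (basisEnd_basis b _ t 1).trans ?_
  simp only [mul_one]

end matrix_rep

section homs

variable {k : Type u} [Field k] {G : SuperMonoid.{u, a, b} k} {V : SuperSpace.{u, w} k}
  {W : SuperSpace.{u, w'} k} {U : SuperSpace.{u, b'} k}

/-- The composite of homomorphisms of representations. -/
def Rep.Hom.comp {ρ : Rep G V} {σ : Rep G W} {τ : Rep G U} (f : σ.Hom τ) (g : ρ.Hom σ) :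
    ρ.Hom τ where
  toLinearMap := f.toLinearMap ∘ₗ g.toLinearMap
  map_gr i v hv := f.map_gr _ _ (g.map_gr _ _ hv)
  map_act A h z := by
    rw [LinearMap.rTensor_comp_apply, LinearMap.rTensor_comp_apply, g.map_act, f.map_act]

/-- The identity homomorphism. -/
def Rep.Hom.id (ρ : Rep G V) : ρ.Hom ρ where
  toLinearMap := LinearMap.id
  map_gr _ _ hv := hv
  map_act A h z := by
    rw [LinearMap.rTensor_id_apply, LinearMap.rTensor_id_apply]

/-- A homomorphism of representations, restricted along a homomorphism of super monoids. -/
def Rep.Hom.res {G' : SuperMonoid.{u, a, b'} k} {ρ : Rep G V} {σ : Rep G W} (f : ρ.Hom σ)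
    (h : G'.Hom G) : (ρ.res h).Hom (σ.res h) where
  toLinearMap := f.toLinearMap
  map_gr := f.map_gr
  map_act A g z := f.map_act A (h.app A g) z

/-- The inverse of a bijective homomorphism of representations. -/
noncomputable def Rep.Hom.inv {ρ : Rep G V} {σ : Rep G W} (f : ρ.Hom σ)
    (hf : Function.Bijective f.toLinearMap) : σ.Hom ρ where
  toLinearMap := (LinearEquiv.ofBijective f.toLinearMap hf).symm.toLinearMap
  map_gr i v hv := by
    obtain ⟨v, rfl⟩ := hf.2 v
    have h1 : (LinearEquiv.ofBijective f.toLinearMap hf).symm (f.toLinearMap v) = v :=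
      (LinearEquiv.ofBijective f.toLinearMap hf).symm_apply_apply v
    rw [LinearEquiv.coe_coe, h1]
    refine V.mem_of_pr _ _ (hf.1 ?_)
    rw [map_zero]
    have h2 : f.toLinearMap ∘ₗ V.pr (i + 1) = W.pr (i + 1) ∘ₗ f.toLinearMap := by
      refine V.hom_ext fun j x hx => ?_
      rw [LinearMap.comp_apply, LinearMap.comp_apply, V.pr_of_mem _ hx,
        W.pr_of_mem _ (f.map_gr _ _ hx)]
      split_ifs
      · rfl
      · exact map_zero _
    have h3 := LinearMap.congr_fun h2 v
    rw [LinearMap.comp_apply, LinearMap.comp_apply, W.pr_of_mem _ hv, if_neg] at h3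
    · exact h3
    · simp
  map_act A g z := by
    have h1 : Function.Injective (LinearMap.rTensor A f.toLinearMap) := by
      have h2 : (LinearMap.rTensor A (LinearEquiv.ofBijective f.toLinearMap hf).symm.toLinearMap) ∘ₗ
          LinearMap.rTensor A f.toLinearMap = LinearMap.id := by
        rw [← LinearMap.rTensor_comp, ← LinearMap.rTensor_id]
        congr 1
        ext v
        exact (LinearEquiv.ofBijective f.toLinearMap hf).symm_apply_apply v
      exact Function.LeftInverse.injective (LinearMap.congr_fun h2)
    have h2 : f.toLinearMap ∘ₗ (LinearEquiv.ofBijective f.toLinearMap hf).symm.toLinearMap =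
        LinearMap.id := by
      ext v
      exact (LinearEquiv.ofBijective f.toLinearMap hf).apply_symm_apply v
    apply h1
    rw [← LinearMap.rTensor_comp_apply, h2, LinearMap.rTensor_id_apply, f.map_act,
      ← LinearMap.rTensor_comp_apply, h2, LinearMap.rTensor_id_apply]

end homs

section automatic

variable {k : Type u} [Field k] {G : SuperMonoid.{u, max u v, b} k} {V : SuperSpace.{u, w} k}
  {W : SuperSpace.{u, w'} k}

/-- The field `k` as a commutative super algebra in a larger universe. -/
abbrev SCommAlg.base (k : Type u) [Field k] : SCommAlg.{u, max u v} k where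
  carrier := ULift.{v} k
  gr i := if i = 0 then ⊤ else ⊥
  isCompl := by simpa using isCompl_top_bot
  one_mem := by simp
  mul_mem {i j x y} hx hy := by
    rcases zmod2_cases i with rfl | rfl <;> rcases zmod2_cases j with rfl | rfl <;> simp_all
  super_comm {i j x y} hx hy := by
    rcases zmod2_cases i with rfl | rfl <;> rcases zmod2_cases j with rfl | rfl <;>
      simp_all [sgn, mul_comm]

/-- A linear map compatible with the actions has degree `0`, since it is compatible with the
actions of `ε`. -/
noncomputable def Rep.Hom.mk' [CharZero k] {ρ : Rep G V} {σ : Rep G W} (F : V →ₗ[k] W)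
    (h : ∀ (A : SCommAlg.{u, max u v} k) (g : G.pts A) (v : V),
      LinearMap.rTensor A F ((ρ.act A g).1 (v ⊗ₜ[k] 1)) = (σ.act A g).1 (F v ⊗ₜ[k] 1)) :
    ρ.Hom σ where
  toLinearMap := F
  map_gr i v hv := by
    refine W.mem_of_pr _ _ ?_
    have h1 := h (SCommAlg.base k) (G.eps _) v
    rw [ρ.act_eps _ i v hv, map_smul, LinearMap.rTensor_tmul] at h1
    nth_rewrite 2 [← W.pr_add_pr (F v)] at h1
    rw [TensorProduct.add_tmul, map_add, σ.act_eps _ 0 _ (W.pr_mem 0 _),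
      σ.act_eps _ 1 _ (W.pr_mem 1 _)] at h1
    have h2 := congrArg (fun z => (TensorProduct.rid k W)
      (LinearMap.lTensor W (ULift.moduleEquiv.{u, u, v} (R := k) (M := k)).toLinearMap z)) h1
    simp only [map_add, map_smul, LinearMap.lTensor_tmul, LinearEquiv.coe_coe,
      ULift.moduleEquiv_apply, ULift.one_down, TensorProduct.rid_tmul, one_smul] at h2
    rw [sgn_zero, sgn_one] at h2
    have h3 := W.pr_add_pr (F v)
    rcases zmod2_cases i with rfl | rfl
    · rw [sgn_zero, one_smul, one_smul, ← sub_eq_zero] at h2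
      nth_rewrite 1 [← h3] at h2
      rw [zero_add]
      have h4 : (2 : k) • W.pr 1 (F v) = 0 := by
        rw [← h2, two_smul, neg_smul, one_smul]; abel
      exact (smul_eq_zero.1 h4).resolve_left two_ne_zero
    · rw [sgn_one, one_smul, ← sub_eq_zero] at h2
      nth_rewrite 1 [← h3] at h2
      rw [two_eq_zero_zmod2]
      have h4 : (2 : k) • W.pr 0 (F v) = 0 := by
        rw [← neg_eq_zero, ← h2, two_smul, neg_smul, one_smul, neg_smul, one_smul]; abel
      exact (smul_eq_zero.1 h4).resolve_left two_ne_zero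
  map_act A g z := by
    induction z using TensorProduct.induction_on with
    | zero => simp
    | add z t hz ht => simp only [map_add, hz, ht]
    | tmul v x =>
      rw [ρ.act_tmul, rTensor_rmul, h, LinearMap.rTensor_tmul, σ.act_tmul g (F v) x]

/-- Compatibility with the actions can be checked on a basis. -/
noncomputable def Rep.Hom.ofBasis [CharZero k] {ρ : Rep G V} {σ : Rep G W} {ι : Type*}
    (b : Module.Basis ι k V) (F : V →ₗ[k] W)
    (h : ∀ (A : SCommAlg.{u, max u v} k) (g : G.pts A) (t : ι),
      LinearMap.rTensor A F ((ρ.act A g).1 (b t ⊗ₜ[k] 1)) = (σ.act A g).1 (F (b t) ⊗ₜ[k] 1)) :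
    ρ.Hom σ :=
  Rep.Hom.mk' F fun A g v => by
    have h1 : LinearMap.rTensor A F ∘ₗ (ρ.act A g).1 ∘ₗ (TensorProduct.mk k V A).flip 1 =
        (σ.act A g).1 ∘ₗ (TensorProduct.mk k W A).flip 1 ∘ₗ F := b.ext fun t => h A g t
    exact LinearMap.congr_fun h1 v

end automatic

/-! ### Word representations and images of homomorphisms -/

section word_rep

variable {k : Type u} [Field k] {ι : Type} [DecidableEq ι] {p : ι → ZMod 2}

theorem wordMat_diagonal (A : SCommAlg.{u, a} k) (c : ι → k) (n : ℕ) :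
    wordMat p (fun _ : Fin n => Matrix.diagonal fun s => c s • (1 : A)) =
      Matrix.diagonal fun s => (∏ i, c (s i)) • (1 : A) := by
  have hp : ∀ q : ZMod 2, q + q = 0 := by decide
  induction n with
  | zero =>
    ext s t
    rw [Subsingleton.elim s t, Matrix.diagonal_apply_eq]
    simp [wordMat]
  | succ n ih =>
    ext s t
    rw [wordMat_succ, ih]
    by_cases h : s = t
    · subst h
      rw [Matrix.diagonal_apply_eq, Matrix.diagonal_apply_eq, Matrix.diagonal_apply_eq, hp,
        zero_mul, sgn_zero, one_smul, smul_mul_smul_comm, one_mul, Fin.prod_univ_succ]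
    · rw [Matrix.diagonal_apply_ne _ h]
      by_cases h0 : s 0 = t 0
      · rw [Matrix.diagonal_apply_ne (i := fun i : Fin n => s i.succ), mul_zero, smul_zero]
        intro h1
        refine h (funext fun i => ?_)
        refine Fin.cases h0 (fun i => ?_) i
        exact congrFun h1 i
      · rw [Matrix.diagonal_apply_ne _ h0, zero_mul, smul_zero]

variable [Fintype ι]

variable (p) in
/-- The matrix of the `d`-th tensor power of an endomorphism, in the basis of words. -/
def wordHom (d : ℕ) (A : SCommAlg.{u, a} k) :
    superMat p A →* superMat (fun s : Fin d → ι => wpar p s) A where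
  toFun X := ⟨wordMat p fun _ => X.1, wordMat_mem' fun _ => X.2⟩
  map_one' := by
    refine Subtype.ext ?_
    have h := wordMat_diagonal (p := p) A 1 d
    simp only [Pi.one_apply, one_smul, Finset.prod_const_one, Matrix.diagonal_one] at h
    exact h
  map_mul' X Y := Subtype.ext (wordMat_mul (fun _ => X.2) fun _ => Y.2)

theorem wordHom_map (d : ℕ) {A B : SCommAlg.{u, a} k} (f : A.Hom B) (X : superMat p A) :
    wordHom p d B (superMat.map p f X) = superMat.map _ f (wordHom p d A X) :=
  Subtype.ext (Matrix.ext fun s t => (map_wordMat f _ s t).symm)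

theorem wordHom_eps (d : ℕ) (A : SCommAlg.{u, a} k) :
    wordHom p d A (superMat.eps p A) = superMat.eps _ A := by
  refine Subtype.ext ((wordMat_diagonal A _ d).trans ?_)
  refine congrArg Matrix.diagonal (funext fun s => congrArg (· • (1 : A)) ?_)
  change ∏ i, sgn k (p (s i)) = sgn k (wpar p s)
  induction d with
  | zero => exact sgn_zero.symm
  | succ d ih => rw [Fin.prod_univ_succ, wpar_succ, sgn_add, ih fun i => s i.succ]

variable {G : SuperMonoid.{u, a, b} k}

/-- The representation on the span of the words of length `d` associated with a representation by
matrices: the `d`-th tensor power of the latter. -/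
noncomputable def wordRep (d : ℕ) (χ : ∀ A : SCommAlg.{u, a} k, G.pts A →* superMat p A)
    (hχ : ∀ {A B : SCommAlg.{u, a} k} (f : A.Hom B) (g : G.pts A),
      χ B (G.map f g) = superMat.map p f (χ A g))
    (hε : ∀ A, χ A (G.eps A) = superMat.eps p A) :
    Rep G (SuperSpace.free k fun s : Fin d → ι => wpar p s) :=
  matRep (V := SuperSpace.free k fun s : Fin d → ι => wpar p s) (p := fun s => wpar p s)
    (Pi.basisFun k (Fin d → ι)) (fun s => by
      rw [Pi.basisFun_apply]; exact single_mem_free (fun s : Fin d → ι => wpar p s) s)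
    (fun A => (wordHom p d A).comp (χ A))
    (fun f g => by rw [MonoidHom.comp_apply, hχ, wordHom_map]; rfl)
    (fun A => by rw [MonoidHom.comp_apply, hε, wordHom_eps])

theorem wordRep_act (d : ℕ) (χ : ∀ A : SCommAlg.{u, a} k, G.pts A →* superMat p A)
    (hχ : ∀ {A B : SCommAlg.{u, a} k} (f : A.Hom B) (g : G.pts A),
      χ B (G.map f g) = superMat.map p f (χ A g))
    (hε : ∀ A, χ A (G.eps A) = superMat.eps p A) (A : SCommAlg.{u, a} k) (g : G.pts A)
    (t : Fin d → ι) :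
    ((wordRep d χ hχ hε).act A g).1 ((Pi.single t 1 : (Fin d → ι) → k) ⊗ₜ[k] 1) =
      ∑ s, (Pi.single s 1 : (Fin d → ι) → k) ⊗ₜ[k] wordMat p (fun _ => (χ A g).1) s t := by
  have h := matRep_act (V := SuperSpace.free k fun s : Fin d → ι => wpar p s)
    (p := fun s => wpar p s) (Pi.basisFun k (Fin d → ι)) (fun s => by
      rw [Pi.basisFun_apply]; exact single_mem_free (fun s : Fin d → ι => wpar p s) s)
    (fun A => (wordHom p d A).comp (χ A))
    (fun f g => by rw [MonoidHom.comp_apply, hχ, wordHom_map]; rfl)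
    (fun A => by rw [MonoidHom.comp_apply, hε, wordHom_eps]) A g t
  simp only [Pi.basisFun_apply] at h
  exact h

end word_rep

section range

variable {k : Type u} [Field k] {G : SuperMonoid.{u, a, b} k} {V : SuperSpace.{u, w} k}
  {W : SuperSpace.{u, w'} k} {ρ : Rep G V} {σ : Rep G W}

/-- The image of a homomorphism of representations, as a super vector space. -/
noncomputable abbrev Rep.Hom.rangeSpace (L : ρ.Hom σ) : SuperSpace.{u, w'} k where
  carrier := LinearMap.range L.toLinearMap
  gr i := (W.gr i).comap (LinearMap.range L.toLinearMap).subtype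
  isCompl := by
    refine ⟨?_, codisjoint_iff_le_sup.2 ?_⟩
    · rw [Submodule.disjoint_def]
      intro x h0 h1
      exact Subtype.ext (Submodule.disjoint_def.1 W.isCompl.disjoint _ h0 h1)
    · rintro ⟨_, v, rfl⟩ _
      refine Submodule.mem_sup.2 ⟨⟨_, V.pr 0 v, rfl⟩, L.map_gr _ _ (V.pr_mem 0 v),
        ⟨_, V.pr 1 v, rfl⟩, L.map_gr _ _ (V.pr_mem 1 v), Subtype.ext ?_⟩
      exact (map_add _ _ _).symm.trans (congrArg _ (V.pr_add_pr v))

/-- The projections make a retraction onto the image homogeneous. -/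
theorem Rep.Hom.exists_retraction (L : ρ.Hom σ) :
    ∃ q : W →ₗ[k] L.rangeSpace, (∀ i, ∀ w ∈ W.gr i, q w ∈ L.rangeSpace.gr i) ∧
      q ∘ₗ (LinearMap.range L.toLinearMap).subtype = LinearMap.id := by
  obtain ⟨q, hq⟩ := (LinearMap.range L.toLinearMap).subtype.exists_leftInverse_of_injective
    (LinearMap.ker_eq_bot.2 Subtype.val_injective)
  refine ⟨(L.rangeSpace.pr 0 ∘ₗ q ∘ₗ W.pr 0) + (L.rangeSpace.pr 1 ∘ₗ q ∘ₗ W.pr 1),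
    fun i x hx => ?_, ?_⟩
  · simp only [LinearMap.add_apply, LinearMap.comp_apply]
    rw [W.pr_of_mem 0 hx, W.pr_of_mem 1 hx]
    rcases zmod2_cases i with rfl | rfl
    · rw [if_pos rfl, if_neg (by decide), map_zero, map_zero, add_zero]
      exact L.rangeSpace.pr_mem 0 _
    · rw [if_pos rfl, if_neg (by decide), map_zero, map_zero, zero_add]
      exact L.rangeSpace.pr_mem 1 _
  · refine L.rangeSpace.hom_ext fun i x hx => ?_
    have h1 : q x.1 = x := LinearMap.congr_fun hq x
    simp only [LinearMap.add_apply, LinearMap.comp_apply, Submodule.subtype_apply,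
      LinearMap.id_apply]
    have hx' : x.1 ∈ W.gr i := hx
    rw [W.pr_of_mem 0 hx', W.pr_of_mem 1 hx']
    rcases zmod2_cases i with rfl | rfl
    · rw [if_pos rfl, if_neg (by decide), map_zero, map_zero, add_zero, h1,
        L.rangeSpace.pr_of_mem 0 hx, if_pos rfl]
    · rw [if_pos rfl, if_neg (by decide), map_zero, map_zero, zero_add, h1,
        L.rangeSpace.pr_of_mem 1 hx, if_pos rfl]

theorem Rep.Hom.range_stable (L : ρ.Hom σ) {q : W →ₗ[k] L.rangeSpace}
    (hq : q ∘ₗ (LinearMap.range L.toLinearMap).subtype = LinearMap.id) (A : SCommAlg.{u, a} k)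
    (g : G.pts A) (z : L.rangeSpace ⊗[k] A) :
    LinearMap.rTensor A (LinearMap.range L.toLinearMap).subtype (LinearMap.rTensor A q
      ((σ.act A g).1 (LinearMap.rTensor A (LinearMap.range L.toLinearMap).subtype z))) =
      (σ.act A g).1 (LinearMap.rTensor A (LinearMap.range L.toLinearMap).subtype z) := by
  obtain ⟨z, rfl⟩ := LinearMap.rTensor_surjective A
    (LinearMap.surjective_rangeRestrict L.toLinearMap) z
  have h1 : (LinearMap.range L.toLinearMap).subtype ∘ₗ L.toLinearMap.rangeRestrict =
    L.toLinearMap := rfl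
  have h2 : (LinearMap.range L.toLinearMap).subtype ∘ₗ q ∘ₗ L.toLinearMap = L.toLinearMap := by
    ext v
    exact congrArg Subtype.val (LinearMap.congr_fun hq (L.toLinearMap.rangeRestrict v))
  rw [← LinearMap.rTensor_comp_apply _ _ L.toLinearMap.rangeRestrict, h1, ← L.map_act,
    ← LinearMap.rTensor_comp_apply, ← LinearMap.rTensor_comp_apply, LinearMap.comp_assoc, h2]

/-- The image of a homomorphism of representations is stable; the action is expressed through a
retraction `q` onto the image. -/
noncomputable def Rep.Hom.rangeRep (L : ρ.Hom σ) {q : W →ₗ[k] L.rangeSpace}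
    (hgr : ∀ i, ∀ w ∈ W.gr i, q w ∈ L.rangeSpace.gr i)
    (hq : q ∘ₗ (LinearMap.range L.toLinearMap).subtype = LinearMap.id) : Rep G L.rangeSpace where
  finite := by
    have := σ.finite
    exact inferInstanceAs (Module.Finite k (LinearMap.range L.toLinearMap))
  act A :=
    { toFun := fun g => ⟨LinearMap.rTensor A q ∘ₗ (σ.act A g).1 ∘ₗ
          LinearMap.rTensor A (LinearMap.range L.toLinearMap).subtype, fun x z => by
            have h := rTensor_rmul (V := L.rangeSpace) (W := W)
              (LinearMap.range L.toLinearMap).subtype A x z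
            simp only [LinearMap.comp_apply]
            rw [h, (σ.act A g).2.1, rTensor_rmul], fun i z hz =>
          rTensor_mem q hgr _ ((σ.act A g).2.2 _ _ (rTensor_mem (V := L.rangeSpace) (W := W)
            (LinearMap.range L.toLinearMap).subtype (fun _ _ h => h) _ hz))⟩
      map_one' := Subtype.ext <| LinearMap.ext fun z => by
        rw [map_one]
        change LinearMap.rTensor A q (LinearMap.rTensor A _ z) = z
        rw [← LinearMap.rTensor_comp_apply, hq, LinearMap.rTensor_id_apply]
      map_mul' := fun g h => Subtype.ext <| LinearMap.ext fun z => by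
        rw [map_mul]
        exact congrArg (fun t => LinearMap.rTensor A q ((σ.act A g).1 t))
          (L.range_stable hq A h z).symm }
  act_map {A B} f g z := by
    change baseMap L.rangeSpace f (LinearMap.rTensor A q _) = LinearMap.rTensor B q _
    rw [← rTensor_baseMap]
    have h := rTensor_baseMap (V := L.rangeSpace) (W := W)
      (LinearMap.range L.toLinearMap).subtype f z
    refine congrArg _ ((σ.act_map f g _).trans ?_)
    rw [← h]
    rfl
  act_eps A i v hv x := by
    have h := σ.act_eps A i v.1 hv x
    change LinearMap.rTensor A q ((σ.act A (G.eps A)).1 (v.1 ⊗ₜ[k] x)) = _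
    rw [h, map_smul, LinearMap.rTensor_tmul]
    congr 2
    exact LinearMap.congr_fun hq v

theorem Rep.Hom.rangeRep_coef (L : ρ.Hom σ) {q : W →ₗ[k] L.rangeSpace}
    (hgr : ∀ i, ∀ w ∈ W.gr i, q w ∈ L.rangeSpace.gr i)
    (hq : q ∘ₗ (LinearMap.range L.toLinearMap).subtype = LinearMap.id)
    (ξ : Module.Dual k L.rangeSpace) (v : V) :
    (L.rangeRep hgr hq).coef ξ (L.toLinearMap.rangeRestrict v) =
      σ.coef (ξ ∘ₗ q) (L.toLinearMap v) := by
  ext A g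
  rw [Rep.coef_apply, Rep.coef_apply, ← contr_rTensor]
  rfl

end range

/-! ### Density of `GL` in `M` -/

section path

variable {k : Type u} [Field k] {ι : Type} [Fintype ι] [DecidableEq ι] {p : ι → ZMod 2}
  {A : SCommAlg.{u, a} k}

/-- The matrix of power series whose coefficients are given by a power series with matrix
coefficients. -/
noncomputable def seriesMat (A : SCommAlg.{u, a} k) :
    PowerSeries (Matrix ι ι A) →* Matrix ι ι (PowerSeries A) where
  toFun F := Matrix.of fun s t => PowerSeries.mk fun n => PowerSeries.coeff n F s t
  map_one' := by
    ext s t n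
    rw [Matrix.of_apply, PowerSeries.coeff_mk, PowerSeries.coeff_one, Matrix.one_apply]
    by_cases hn : n = 0 <;> by_cases hst : s = t <;>
      simp [hn, hst, PowerSeries.coeff_one, Matrix.one_apply]
  map_mul' F F' := by
    ext s t n
    rw [Matrix.of_apply, PowerSeries.coeff_mk, PowerSeries.coeff_mul, Matrix.sum_apply,
      Matrix.mul_apply, map_sum]
    simp only [PowerSeries.coeff_mul, PowerSeries.coeff_mk, Matrix.mul_apply, Matrix.of_apply]
    exact Finset.sum_comm

theorem coeff_seriesMat (F : PowerSeries (Matrix ι ι A)) (s t : ι) (n : ℕ) :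
    PowerSeries.coeff n (seriesMat A F s t) = PowerSeries.coeff n F s t := by
  change PowerSeries.coeff n (Matrix.of (fun s t => PowerSeries.mk fun n =>
    PowerSeries.coeff n F s t) s t) = _
  rw [Matrix.of_apply, PowerSeries.coeff_mk]

/-- Any point `X` of `M` is the value at `t = 1` of `1 + t (X - 1)`, which becomes invertible over
the power series in `t`. -/
theorem exists_path (X : superMat p A) : ∃ (Y : superMat p A.poly) (Z : (superMat p A.series)ˣ),
    superMat.map p A.evalOne Y = X ∧ superMat.map p A.polySeries Y = Z.1 := by
  have hN : ∀ n s t, ((1 - X.1) ^ n : Matrix ι ι A) s t ∈ A.gr (p s + p t) := by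
    intro n
    induction n with
    | zero => rw [pow_zero]; exact (1 : superMat p A).2
    | succ n ih =>
      rw [pow_succ]
      exact (superMat p A).mul_mem (show (1 - X.1) ^ n ∈ superMat p A from ih)
        (show 1 - X.1 ∈ superMat p A from fun s t =>
          Submodule.sub_mem _ ((1 : superMat p A).2 s t) (X.2 s t))
  -- The inverse of `1 - (1 - X) t` is the geometric series.
  let F : PowerSeries (Matrix ι ι A) := 1 - PowerSeries.C (1 - X.1) * PowerSeries.X
  let F' : PowerSeries (Matrix ι ι A) := PowerSeries.mk fun n => (1 - X.1) ^ n
  have hF1 : F * F' = 1 := by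
    refine PowerSeries.ext fun n => ?_
    rw [sub_mul, one_mul, mul_assoc, map_sub, PowerSeries.coeff_C_mul, PowerSeries.coeff_one]
    rcases n with _ | n
    · simp [F']
    · rw [PowerSeries.coeff_succ_X_mul, PowerSeries.coeff_mk, PowerSeries.coeff_mk, ← pow_succ',
        sub_self, if_neg n.succ_ne_zero]
  have hF2 : F' * F = 1 := by
    refine PowerSeries.ext fun n => ?_
    rw [mul_sub, mul_one, ← mul_assoc, map_sub, PowerSeries.coeff_one]
    rcases n with _ | n
    · simp [F']
    · rw [PowerSeries.coeff_succ_mul_X, PowerSeries.coeff_mul_C, PowerSeries.coeff_mk,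
        PowerSeries.coeff_mk, ← pow_succ, sub_self, if_neg n.succ_ne_zero]
  have hFc : ∀ n s t, PowerSeries.coeff n F s t =
      (Polynomial.C ((1 : Matrix ι ι A) s t) -
        Polynomial.C ((1 - X.1) s t) * Polynomial.X).coeff n := by
    intro n s t
    rw [map_sub, PowerSeries.coeff_C_mul, PowerSeries.coeff_one, PowerSeries.coeff_X,
      Polynomial.coeff_sub, Polynomial.coeff_C_mul, Polynomial.coeff_C, Polynomial.coeff_X]
    rcases n with _ | _ | n <;> simp
  have hFgr : ∀ n s t, PowerSeries.coeff n F s t ∈ A.gr (p s + p t) := by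
    intro n s t
    rw [map_sub, PowerSeries.coeff_C_mul, PowerSeries.coeff_one, PowerSeries.coeff_X]
    have h1 := (1 : superMat p A).2 s t
    have h2 := hN 1 s t
    rw [pow_one] at h2
    split_ifs
    · simpa using Submodule.sub_mem _ h1 h2
    · simpa using h1
    · simpa using Submodule.neg_mem _ h2
    · simp
  refine ⟨⟨fun s t => Polynomial.C ((1 : Matrix ι ι A) s t) -
      Polynomial.C ((1 - X.1) s t) * Polynomial.X, fun s t n => ?_⟩,
    ⟨⟨seriesMat A F, fun s t n => ?_⟩, ⟨seriesMat A F', fun s t n => ?_⟩, ?_, ?_⟩, ?_, ?_⟩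
  · rw [← hFc]; exact hFgr n s t
  · rw [coeff_seriesMat]; exact hFgr n s t
  · rw [coeff_seriesMat, PowerSeries.coeff_mk]; exact hN n s t
  · refine Subtype.ext ?_
    change seriesMat A F * seriesMat A F' = 1
    rw [← map_mul, hF1, map_one]
  · refine Subtype.ext ?_
    change seriesMat A F' * seriesMat A F = 1
    rw [← map_mul, hF2, map_one]
  · refine Subtype.ext (Matrix.ext fun s t => ?_)
    change Polynomial.eval₂ (RingHom.id A) 1 _ = _
    rw [Polynomial.eval₂_sub, Polynomial.eval₂_C, Polynomial.eval₂_mul_X, Polynomial.eval₂_C]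
    simp
  · refine Subtype.ext (Matrix.ext fun s t => ?_)
    refine PowerSeries.ext fun n => ?_
    exact (PowerSeries.coeff_mk _ _).trans ((coeff_seriesMat F s t n).trans (hFc n s t)).symm

end path

section extension

variable {k : Type u} [Field k] {Γ : Type v} {m n : Γ → ℕ}

theorem superM_exists_path {A : SCommAlg.{u, a} k} (h : (superM.{u, v, a} k m n).pts A) :
    ∃ (Y : (superM.{u, v, a} k m n).pts A.poly) (Z : (superGL.{u, v, a} k m n).pts A.series),
      (superM k m n).map A.evalOne Y = h ∧
        (superM k m n).map A.polySeries Y = (superGL.toM k m n).app _ Z := by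
  choose Y Z hY hZ using fun γ => exists_path (h γ)
  exact ⟨Y, Z, funext hY, funext hZ⟩

/-- The pullback of functions along a homomorphism of super monoids. -/
def SuperMonoid.Hom.pullback {G : SuperMonoid.{u, a, b} k} {M : SuperMonoid.{u, a, b'} k}
    (h : G.Hom M) : M.Fn →ₐ[k] G.Fn where
  toFun F A g := F A (h.app A g)
  map_one' := rfl
  map_mul' _ _ := rfl
  map_zero' := rfl
  map_add' _ _ := rfl
  commutes' _ := rfl

variable (k m n) in
/-- The functions on `GL_{m|n}` that are restrictions of functions on `M_{m|n}`. -/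
noncomputable def polyFn : Subalgebra k (superGL.{u, v, a} k m n).Fn :=
  (superM.{u, v, a} k m n).natFn.map (superGL.toM k m n).pullback

/-- A representation of `GL` whose matrix coefficients extend to `M` is the restriction of a
representation of `M`: the laws hold on `M` by density. -/
theorem exists_extension {U : SuperSpace.{u, w} k} (ρ : Rep (superGL.{u, v, a} k m n) U)
    (h : ∀ ξ x, ρ.coef ξ x ∈ polyFn k m n) :
    ∃ τ : Rep (superM.{u, v, a} k m n) U, τ.res (superGL.toM k m n) = ρ := by
  have := ρ.finite
  obtain ⟨N, p, b, hb⟩ := exists_homogeneous_basis U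
  choose F hF hFρ using fun s t => h (b.coord s) (b t)
  have hFρ' : ∀ s t A (g : (superGL.{u, v, a} k m n).pts A),
      F s t A ((superGL.toM k m n).app A g) = ρ.coef (b.coord s) (b t) A g :=
    fun s t A g => congrFun (congrFun (hFρ s t) A) g
  have hFnat : ∀ s t {A B : SCommAlg.{u, a} k} (φ : A.Hom B) g,
      φ.toAlgHom (F s t A g) = F s t B ((superM k m n).map φ g) := fun s t A B φ g => hF s t φ g
  let χ : ∀ A : SCommAlg.{u, a} k, (superM.{u, v, a} k m n).pts A →* superMat p A := fun A =>
    { toFun := fun g => ⟨fun s t => F s t A g, fun s t => by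
        obtain ⟨Y, Z, hY, hZ⟩ := superM_exists_path g
        -- The laws of a representation hold on the point `Z` of `GL`, with values in power series.
        -- They hold for `Y`, since polynomials inject in power series, and hence for `g`.
        change F s t A g ∈ _
        rw [← hY, ← hFnat]
        refine A.evalOne.map_gr _ _ fun l => ?_
        have h1 := hFnat s t A.polySeries Y
        rw [hZ, hFρ'] at h1
        have h2 := ρ.coef_mem_gr (coord_mem_dual hb s) (hb t) Z
        rw [← h1] at h2
        have h3 := h2 l
        change PowerSeries.coeff l (PowerSeries.mk _) ∈ _ at h3
        rwa [PowerSeries.coeff_mk] at h3⟩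
      map_one' := Subtype.ext <| Matrix.ext fun s t => by
        change F s t A 1 = (1 : Matrix _ _ A) s t
        rw [← map_one ((superGL.toM k m n).app A), hFρ', ρ.coef_one, b.coord_apply,
          b.repr_self, Finsupp.single_apply, Matrix.one_apply]
        by_cases hst : t = s
        · rw [if_pos hst, if_pos hst.symm, one_smul]
        · rw [if_neg hst, if_neg (Ne.symm hst), zero_smul]
      map_mul' := fun g g' => Subtype.ext <| Matrix.ext fun s t => by
        change F s t A (g * g') = ∑ r, F s r A g * F r t A g'
        obtain ⟨Y, Z, hY, hZ⟩ := superM_exists_path g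
        obtain ⟨Y', Z', hY', hZ'⟩ := superM_exists_path g'
        have h1 : F s t A.poly (Y * Y') = ∑ r, F s r A.poly Y * F r t A.poly Y' := by
          apply A.polySeries_injective
          simp only [map_sum, map_mul, hFnat, hZ, hZ']
          rw [← map_mul, hFρ', ρ.coef_mul b]
          simp only [hFρ']
        have h2 := congrArg A.evalOne.toAlgHom h1
        simp only [map_sum, map_mul, hFnat, hY, hY'] at h2
        exact h2 }
  have hχ : ∀ {A B : SCommAlg.{u, a} k} (f : A.Hom B) (g : (superM.{u, v, a} k m n).pts A),
      χ B ((superM k m n).map f g) = superMat.map p f (χ A g) := fun f g =>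
    Subtype.ext <| Matrix.ext fun s t => (hFnat s t f g).symm
  have hε : ∀ A, χ A ((superM k m n).eps A) = superMat.eps p A := fun A =>
    Subtype.ext <| Matrix.ext fun s t => by
      change F s t A ((superM k m n).eps A) = _
      rw [← (superGL.toM k m n).app_eps, hFρ', ρ.coef_apply, ρ.act_eps A _ _ (hb t), map_smul,
        contr_tmul, b.coord_apply, b.repr_self, Finsupp.single_apply]
      change _ = Matrix.diagonal _ s t
      rw [Matrix.diagonal_apply]
      by_cases hst : t = s
      · rw [if_pos hst, if_pos hst.symm, one_smul, hst]
      · rw [if_neg hst, if_neg (Ne.symm hst), zero_smul, smul_zero]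
  refine ⟨matRep b hb χ hχ hε, Rep.ext fun A g x => ?_⟩
  have h1 : (((matRep b hb χ hχ hε).res (superGL.toM k m n)).act A g).1 = (ρ.act A g).1 := by
    refine basis_tensor_ext b fun t x => ?_
    rw [Rep.act_tmul, ρ.act_tmul]
    congr 1
    refine (matRep_act b hb χ hχ hε A _ t).trans ?_
    rw [ρ.act_eq_sum b]
    exact Finset.sum_congr rfl fun s _ => congrArg _ (hFρ' s t A g)
  rw [h1]

end extension

section generic

variable (k : Type u) [Field k] {Γ : Type v} (m n : Γ → ℕ)

/-- The indices of the entries of the matrices in `M_{m|n}`. -/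
abbrev Entry : Type v := Σ γ : Γ, (Fin (m γ) ⊕ Fin (n γ)) × (Fin (m γ) ⊕ Fin (n γ))

/-- The degree of an entry. -/
abbrev entryPar (e : Entry m n) : ZMod 2 :=
  par (m e.1) (n e.1) e.2.1 + par (m e.1) (n e.1) e.2.2

/-- The entries of the matrices in `M_{m|n}`, as functions. -/
def entryFn (e : Entry m n) : (superM.{u, v, a} k m n).Fn := fun _ h => (h e.1).1 e.2.1 e.2.2

/-- The entries of the matrices in `GL_{m|n}` and of their inverses, as functions. -/
def entryInvFn : Entry m n ⊕ Entry m n → (superGL.{u, v, a} k m n).Fn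
  | .inl e => fun _ g => (g e.1).1.1 e.2.1 e.2.2
  | .inr e => fun _ g => ((g e.1)⁻¹).1.1 e.2.1 e.2.2

theorem entryFn_mem_gr (e : Entry m n) (A : SCommAlg.{u, a} k)
    (h : (superM.{u, v, a} k m n).pts A) : entryFn k m n e A h ∈ A.gr (entryPar m n e) :=
  (h e.1).2 _ _

theorem entryInvFn_mem_gr (e : Entry m n ⊕ Entry m n) (A : SCommAlg.{u, a} k)
    (g : (superGL.{u, v, a} k m n).pts A) :
    entryInvFn k m n e A g ∈ A.gr (Sum.elim (entryPar m n) (entryPar m n) e) := by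
  rcases e with e | e
  · exact (g e.1).1.2 _ _
  · exact ((g e.1)⁻¹).1.2 _ _

/-- The functions on `M_{m|n}` are polynomials in the entries of the matrices. -/
theorem superM_natFn_le : (superM.{u, v, max u v} k m n).natFn ≤
    Algebra.adjoin k (Set.range (entryFn k m n)) := by
  refine natFn_le_adjoin (entryFn_mem_gr k m n)
    (fun γ => ⟨fun s t => genVar (entryFn_mem_gr k m n) ⟨γ, s, t⟩, fun s t =>
      genVar_mem (entryFn_mem_gr k m n) ⟨γ, s, t⟩⟩) fun A h => funext fun γ => ?_
  refine Subtype.ext (Matrix.ext fun s t => ?_)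
  exact genEval_var (entryFn_mem_gr k m n) A h ⟨γ, s, t⟩

/-- The functions on `GL_{m|n}` are polynomials in the entries of the matrices and of their
inverses. -/
theorem superGL_natFn_le : (superGL.{u, v, max u v} k m n).natFn ≤
    Algebra.adjoin k (Set.range (entryInvFn k m n)) := by
  have hx := entryInvFn_mem_gr.{u, v, max u v} k m n
  let X : ∀ γ, superMat (par (m γ) (n γ)) (genAlg _ _ hx) := fun γ =>
    ⟨fun s t => genVar hx (.inl ⟨γ, s, t⟩), fun s t => genVar_mem hx (.inl ⟨γ, s, t⟩)⟩
  let Y : ∀ γ, superMat (par (m γ) (n γ)) (genAlg _ _ hx) := fun γ =>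
    ⟨fun s t => genVar hx (.inr ⟨γ, s, t⟩), fun s t => genVar_mem hx (.inr ⟨γ, s, t⟩)⟩
  have hX : ∀ γ A g, superMat.map (par (m γ) (n γ)) (genEval hx A g) (X γ) = (g γ).1 :=
    fun γ A g => Subtype.ext (Matrix.ext fun s t => genEval_var hx A g (.inl ⟨γ, s, t⟩))
  have hY : ∀ γ A g, superMat.map (par (m γ) (n γ)) (genEval hx A g) (Y γ) = ((g γ)⁻¹).1 :=
    fun γ A g => Subtype.ext (Matrix.ext fun s t => genEval_var hx A g (.inr ⟨γ, s, t⟩))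
  have hext : ∀ γ (Z Z' : superMat (par (m γ) (n γ)) (genAlg _ _ hx)),
      (∀ A g, superMat.map _ (genEval hx A g) Z = superMat.map _ (genEval hx A g) Z') → Z = Z' :=
    fun γ Z Z' h => Subtype.ext <| Matrix.ext fun s t => genAlg_ext hx fun A g =>
      congrFun (congrFun (congrArg Subtype.val (h A g)) s) t
  refine natFn_le_adjoin hx (fun γ => ⟨X γ, Y γ, ?_, ?_⟩) fun A g => funext fun γ => ?_
  · refine hext γ _ _ fun A g => ?_
    rw [map_mul, hX, hY, Units.mul_inv, map_one]
  · refine hext γ _ _ fun A g => ?_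
    rw [map_mul, hX, hY, Units.inv_mul, map_one]
  · exact Units.ext (hX γ A g)

end generic

/-! ### Clearing the denominators of a representation -/

section tensor_coef

variable {k : Type u} [Field k] {G : SuperMonoid.{u, a, b} k} {V : SuperSpace.{u, w} k}
  {W : SuperSpace.{u, w'} k} {A : SCommAlg.{u, a} k}

/-- The pairing of `ξ ⊗ η` with a product in `(V ⊗ W) ⊗ A` exchanges the coefficient of the first
factor with the vector of the second one, whence the two parts of `η`. -/
theorem contr_superMul (ξ : Module.Dual k V) (η : Module.Dual k W) (z : V ⊗[k] A) (t : W ⊗[k] A) :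
    contr A (V := V.tensor W) (TensorProduct.dualDistrib k V W (ξ ⊗ₜ[k] η))
      (superMul V W A (z ⊗ₜ[k] t)) = contr A ξ z * contr A (η ∘ₗ W.pr 0) t +
        A.parityHom.toAlgHom (contr A ξ z) * contr A (η ∘ₗ W.pr 1) t := by
  have h : contr A (V := V.tensor W) (TensorProduct.dualDistrib k V W (ξ ⊗ₜ[k] η)) ∘ₗ
      superMul V W A = LinearMap.mul' k A ∘ₗ
        (TensorProduct.map (contr A ξ) (contr A (η ∘ₗ W.pr 0)) +
        TensorProduct.map (A.parityHom.toAlgHom.toLinearMap ∘ₗ contr A ξ)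
          (contr A (η ∘ₗ W.pr 1))) := by
    refine TensorProduct.ext (superMul_gr_ext V A fun i j v hv x hx =>
      superMul_gr_ext W A fun l q t ht y hy => ?_)
    simp only [LinearMap.compr₂ₛₗ_apply, TensorProduct.mk_apply, LinearMap.comp_apply,
      LinearMap.add_apply, TensorProduct.map_tmul, contr_tmul, map_add, LinearMap.mul'_apply,
      AlgHom.toLinearMap_apply, map_smul]
    rw [superMul_tmul V W A v hx ht, map_smul]
    erw [contr_tmul]
    rw [W.pr_of_mem 0 ht, W.pr_of_mem 1 ht, A.parityHom_of_mem hx,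
      TensorProduct.dualDistrib_apply]
    rcases zmod2_cases l with rfl | rfl
    · simp [sgn_zero, smul_smul, mul_comm]
    · simp [smul_smul, mul_comm, mul_assoc]
  exact LinearMap.congr_fun h (z ⊗ₜ[k] t)

theorem Rep.tensor_act (ρ : Rep G V) (σ : Rep G W) (g : G.pts A) (z : V ⊗[k] A) (t : W ⊗[k] A) :
    ((ρ.tensor σ).act A g).1 (superMul V W A (z ⊗ₜ[k] t)) =
      superMul V W A ((ρ.act A g).1 z ⊗ₜ[k] (σ.act A g).1 t) :=
  tensorEnd_superMul _ _ _ _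

theorem Rep.coef_tensor (ρ : Rep G V) (σ : Rep G W) (ξ : Module.Dual k V) (η : Module.Dual k W)
    (v : V) (t : W) :
    (ρ.tensor σ).coef (TensorProduct.dualDistrib k V W (ξ ⊗ₜ[k] η)) (v ⊗ₜ[k] t) =
      ρ.coef ξ v * σ.coef (η ∘ₗ W.pr 0) t + G.fnParity (ρ.coef ξ v) * σ.coef (η ∘ₗ W.pr 1) t := by
  ext A g
  rw [Rep.coef_apply, ← superMul_one, Rep.tensor_act, contr_superMul]
  rfl

/-- A submodule of functions contains the matrix coefficients of a tensor product as soon as it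
contains the products of the matrix coefficients of the factors, up to parity. -/
theorem Rep.coef_tensor_mem (ρ : Rep G V) (σ : Rep G W) (S : Submodule k G.Fn)
    (h : ∀ ξ v η t, ρ.coef ξ v * σ.coef η t ∈ S ∧ G.fnParity (ρ.coef ξ v) * σ.coef η t ∈ S)
    (ζ : Module.Dual k (V.tensor W)) (z : V.tensor W) : (ρ.tensor σ).coef ζ z ∈ S := by
  have := ρ.finite
  have := σ.finite
  obtain ⟨ζ, rfl⟩ := (TensorProduct.dualDistribEquiv k V W).surjective ζ
  induction ζ using TensorProduct.induction_on with
  | zero => rw [map_zero, map_zero]; exact Submodule.zero_mem _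
  | add ζ ζ' h1 h2 =>
    rw [map_add, map_add, LinearMap.add_apply]
    exact Submodule.add_mem _ h1 h2
  | tmul ξ η =>
    induction z using TensorProduct.induction_on with
    | zero => rw [map_zero]; exact Submodule.zero_mem _
    | add z z' h1 h2 => rw [map_add]; exact Submodule.add_mem _ h1 h2
    | tmul v t =>
      have h1 := ρ.coef_tensor σ ξ η v t
      refine (congrArg (· ∈ S) h1).mpr (Submodule.add_mem _ (h _ _ _ _).1 (h _ _ _ _).2)

end tensor_coef

section word_hom

variable {k : Type u} [Field k] {ι : Type} [Fintype ι] [DecidableEq ι] {p : ι → ZMod 2}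
  {d : ℕ}

theorem toLin'_single (c : Matrix ι ι k) (t : ι) :
    Matrix.toLin' c (Pi.single t 1) = ∑ r, c r t • (Pi.single r 1 : ι → k) := by
  ext r
  simp [Matrix.toLin'_apply, Finset.sum_apply, Pi.single_apply]

section act

variable {G : SuperMonoid.{u, a, b} k} {χ : ∀ A : SCommAlg.{u, a} k, G.pts A →* superMat p A}
  {hχ : ∀ {A B : SCommAlg.{u, a} k} (f : A.Hom B) (g : G.pts A),
    χ B (G.map f g) = superMat.map p f (χ A g)}
  {hε : ∀ A, χ A (G.eps A) = superMat.eps p A}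

theorem wordRep_act_toLin' (A : SCommAlg.{u, a} k) (g : G.pts A)
    (c : Matrix (Fin d → ι) (Fin d → ι) k) (t : Fin d → ι) :
    ((wordRep d χ hχ hε).act A g).1 (Matrix.toLin' c (Pi.single t 1) ⊗ₜ[k] 1) =
      ∑ s, (Pi.single s 1 : (Fin d → ι) → k) ⊗ₜ[k]
        (wordMat p (fun _ => (χ A g).1) * c.map (algebraMap k A) :
          Matrix (Fin d → ι) (Fin d → ι) A) s t := by
  rw [toLin'_single, TensorProduct.sum_tmul, map_sum]
  simp only [Matrix.mul_apply, TensorProduct.tmul_sum]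
  rw [Finset.sum_comm]
  refine Finset.sum_congr rfl fun r _ => ?_
  rw [← TensorProduct.smul_tmul', map_smul]
  refine (congrArg (c r t • ·) (wordRep_act d χ hχ hε A g r)).trans ?_
  rw [Finset.smul_sum]
  refine Finset.sum_congr rfl fun s _ => ?_
  rw [Matrix.map_apply, ← Algebra.commutes, ← Algebra.smul_def, TensorProduct.tmul_smul]

theorem wordRep_coef_toLin' (A : SCommAlg.{u, a} k) (g : G.pts A)
    (c : Matrix (Fin d → ι) (Fin d → ι) k) (t : Fin d → ι)
    (η : Module.Dual k ((Fin d → ι) → k)) :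
    (wordRep d χ hχ hε).coef η (Matrix.toLin' c (Pi.single t 1)) A g =
      ∑ s, η (Pi.single s 1) • (wordMat p (fun _ => (χ A g).1) * c.map (algebraMap k A) :
          Matrix (Fin d → ι) (Fin d → ι) A) s t := by
  rw [Rep.coef_apply, wordRep_act_toLin', map_sum]
  exact Finset.sum_congr rfl fun s _ => contr_tmul ..

end act

variable {G : SuperMonoid.{u, max u v, b} k}
  {χ : ∀ A : SCommAlg.{u, max u v} k, G.pts A →* superMat p A}
  {hχ : ∀ {A B : SCommAlg.{u, max u v} k} (f : A.Hom B) (g : G.pts A),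
    χ B (G.map f g) = superMat.map p f (χ A g)}
  {hε : ∀ A, χ A (G.eps A) = superMat.eps p A}

/-- A scalar matrix commuting with the action on words is an endomorphism of the representation. -/
theorem wordRep_exists_hom [CharZero k] (c : Matrix (Fin d → ι) (Fin d → ι) k)
    (hc : ∀ (A : SCommAlg.{u, max u v} k) (X : superMat p A),
      c.map (algebraMap k A) * wordMat p (fun _ => X.1) =
        wordMat p (fun _ => X.1) * c.map (algebraMap k A)) :
    ∃ L : (wordRep d χ hχ hε).Hom (wordRep d χ hχ hε), L.toLinearMap = Matrix.toLin' c := by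
  refine ⟨Rep.Hom.ofBasis (Pi.basisFun k _) (Matrix.toLin' c) fun A g t => ?_, rfl⟩
  rw [Pi.basisFun_apply, wordRep_act_toLin', wordRep_act, map_sum, ← hc A (χ A g)]
  simp only [LinearMap.rTensor_tmul, toLin'_single, TensorProduct.sum_tmul, Matrix.mul_apply,
    TensorProduct.tmul_sum]
  rw [Finset.sum_comm]
  refine Finset.sum_congr rfl fun s _ => Finset.sum_congr rfl fun r _ => ?_
  rw [Matrix.map_apply, ← Algebra.smul_def, TensorProduct.tmul_smul, TensorProduct.smul_tmul']

end word_hom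

section clears

variable {k : Type u} [Field k] {Γ : Type v} {m n : Γ → ℕ}

theorem fnParity_fnParity {G : SuperMonoid.{u, a, b} k} (f : G.Fn) :
    G.fnParity (G.fnParity f) = f := by
  ext A g
  exact A.parity_parity _

/-- Commutation of two elements which need not be homogeneous, in terms of the even and odd parts
`(y ± ι(y)) / 2` of `y`, for the parity involution `ι`. -/
theorem mul_eq_parity {A : SCommAlg.{u, a} k} (x y : A) :
    (2 : k) • (x * y) = (y + A.parityHom.toAlgHom y) * x +
      (y - A.parityHom.toAlgHom y) * A.parityHom.toAlgHom x := by
  have h0 : ∀ z ∈ A.gr 0, x * z = z * x := by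
    intro z hz
    have h : LinearMap.mulRight k z = LinearMap.mulLeft k z := by
      refine A.toSuperSpace.hom_ext fun i x hx => ?_
      rw [LinearMap.mulRight_apply, LinearMap.mulLeft_apply]
      exact (A.super_comm hx hz).trans (by rw [mul_zero, sgn_zero, one_smul])
    exact LinearMap.congr_fun h x
  have h1 : ∀ z ∈ A.gr 1, x * z = z * A.parityHom.toAlgHom x := by
    intro z hz
    have h : LinearMap.mulRight k z =
        LinearMap.mulLeft k z ∘ₗ A.parityHom.toAlgHom.toLinearMap := by
      refine A.toSuperSpace.hom_ext fun i x hx => ?_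
      rw [LinearMap.mulRight_apply, LinearMap.comp_apply, LinearMap.mulLeft_apply,
        AlgHom.toLinearMap_apply, A.parityHom_of_mem hx, mul_smul_comm]
      exact (A.super_comm hx hz).trans (by rw [mul_one])
    exact LinearMap.congr_fun h x
  obtain ⟨y₀, hy₀, y₁, hy₁, rfl⟩ := Submodule.mem_sup.1 (A.mem_sup y)
  rw [map_add, A.parityHom_of_mem hy₀, A.parityHom_of_mem hy₁, sgn_zero, sgn_one, one_smul,
    neg_smul, one_smul, mul_add, h0 _ hy₀, h1 _ hy₁, two_smul]
  noncomm_ring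

theorem fnParity_mem_polyFn {f : (superGL.{u, v, a} k m n).Fn} (hf : f ∈ polyFn k m n) :
    SuperMonoid.fnParity _ f ∈ polyFn k m n := by
  obtain ⟨F, hF, rfl⟩ := hf
  exact ⟨_, SuperMonoid.fnParity_mem hF, rfl⟩

theorem coef_mem_polyFn {W : SuperSpace.{u, w} k} (σ : Rep (superM.{u, v, a} k m n) W)
    (η : Module.Dual k W) (x : W) :
    (σ.res (superGL.toM k m n)).coef η x ∈ polyFn k m n :=
  ⟨_, σ.coef_mem η x, rfl⟩

/-- A representation `σ` of `M` clears the denominators of a function `f` on `GL` if the products of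
`f` and of its parity conjugate with the matrix coefficients of `σ` extend to `M`. -/
def Clears {W : SuperSpace.{u, w} k} (σ : Rep (superM.{u, v, a} k m n) W)
    (f : (superGL.{u, v, a} k m n).Fn) : Prop :=
  ∀ η x, f * (σ.res (superGL.toM k m n)).coef η x ∈ polyFn k m n ∧
    SuperMonoid.fnParity _ f * (σ.res (superGL.toM k m n)).coef η x ∈ polyFn k m n

variable {W : SuperSpace.{u, w} k} {σ : Rep (superM.{u, v, a} k m n) W}
  {f f' : (superGL.{u, v, a} k m n).Fn}

theorem clears_of_mem (σ : Rep (superM.{u, v, a} k m n) W) (hf : f ∈ polyFn k m n) :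
    Clears σ f := fun η x =>
  ⟨Subalgebra.mul_mem _ hf (coef_mem_polyFn σ η x),
    Subalgebra.mul_mem _ (fnParity_mem_polyFn hf) (coef_mem_polyFn σ η x)⟩

theorem Clears.parity (h : Clears σ f) : Clears σ (SuperMonoid.fnParity _ f) := fun η x =>
  ⟨(h η x).2, by rw [fnParity_fnParity]; exact (h η x).1⟩

theorem Clears.add (h : Clears σ f) (h' : Clears σ f') : Clears σ (f + f') := fun η x => by
  rw [map_add, add_mul, add_mul]
  exact ⟨Subalgebra.add_mem _ (h η x).1 (h' η x).1, Subalgebra.add_mem _ (h η x).2 (h' η x).2⟩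

theorem Clears.smul (c : k) (h : Clears σ f) : Clears σ (c • f) := fun η x => by
  rw [map_smul, smul_mul_assoc, smul_mul_assoc]
  exact ⟨Subalgebra.smul_mem _ (h η x).1 c, Subalgebra.smul_mem _ (h η x).2 c⟩

/-- Denominators of products are cleared by tensor products. -/
theorem Clears.mul [CharZero k] {W' : SuperSpace.{u, w'} k}
    {τ : Rep (superM.{u, v, a} k m n) W'} (h : Clears σ f) (h' : Clears τ f') :
    Clears (σ.tensor τ) (f * f') := by
  have key : ∀ {f f'}, Clears σ f → Clears τ f' → ∀ ξ v,
      f * f' * (((σ.tensor τ).res (superGL.toM k m n)).coef ξ v) ∈ polyFn k m n := by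
    intro f f' h h' ξ v
    let S : Submodule k (superGL.{u, v, a} k m n).Fn :=
      (Subalgebra.toSubmodule (polyFn k m n)).comap (LinearMap.mulLeft k (f * f'))
    have hθ : ∀ η x, f * SuperMonoid.fnParity _ ((σ.res (superGL.toM k m n)).coef η x) ∈
        polyFn k m n := by
      intro η x
      have h1 := fnParity_mem_polyFn (h η x).2
      rwa [map_mul, fnParity_fnParity] at h1
    have hc : ∀ c η x, f * c ∈ polyFn k m n → f * SuperMonoid.fnParity _ c ∈ polyFn k m n →
        f * f' * (c * (τ.res (superGL.toM k m n)).coef η x) ∈ polyFn k m n := by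
      intro c η x h1 h2
      -- The coefficients `c` of `σ` are moved past the second function, next to `f`.
      have h3 : (2 : k) • (f' * c) = (c + SuperMonoid.fnParity _ c) * f' +
          (c - SuperMonoid.fnParity _ c) * SuperMonoid.fnParity _ f' := by
        ext A g
        exact mul_eq_parity _ _
      have h4 : f * f' * (c * (τ.res (superGL.toM k m n)).coef η x) =
          (2 : k)⁻¹ • ((f * c + f * SuperMonoid.fnParity _ c) *
            (f' * (τ.res (superGL.toM k m n)).coef η x) +
            (f * c - f * SuperMonoid.fnParity _ c) *
            (SuperMonoid.fnParity _ f' * (τ.res (superGL.toM k m n)).coef η x)) := by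
        rw [eq_inv_smul_iff₀ two_ne_zero, mul_assoc f f', ← mul_assoc f' c, ← mul_smul_comm,
          ← smul_mul_assoc, h3]
        noncomm_ring
      rw [h4]
      exact Subalgebra.smul_mem _ (Subalgebra.add_mem _
        (Subalgebra.mul_mem _ (Subalgebra.add_mem _ h1 h2) (h' η x).1)
        (Subalgebra.mul_mem _ (Subalgebra.sub_mem _ h1 h2) (h' η x).2)) _
    refine Rep.coef_tensor_mem (σ.res (superGL.toM k m n)) (τ.res (superGL.toM k m n)) S
      (fun ξ v η t => ⟨hc _ η t (h ξ v).1 (hθ ξ v), hc _ η t (hθ ξ v) ?_⟩) ξ v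
    rw [fnParity_fnParity]
    exact (h ξ v).1
  intro ξ v
  refine ⟨key h h' ξ v, ?_⟩
  rw [map_mul]
  exact key h.parity h'.parity ξ v

/-- The projection of `M_{m|n}` to its factor at `γ`. -/
def superM.eval (k : Type u) [Field k] (m n : Γ → ℕ) (γ : Γ) (A : SCommAlg.{u, a} k) :
    (superM.{u, v, a} k m n).pts A →* superMat (par (m γ) (n γ)) A where
  toFun h := h γ
  map_one' := rfl
  map_mul' _ _ := rfl

theorem entryInvFn_parity (e : Entry m n) :
    SuperMonoid.fnParity _ (entryInvFn.{u, v, a} k m n (.inr e)) =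
      sgn k (entryPar m n e) • entryInvFn.{u, v, a} k m n (.inr e) := by
  ext A g
  exact A.parityHom_of_mem (entryInvFn_mem_gr k m n (.inr e) A g)

/-- The denominators of the entries of the inverse of a matrix are cleared by the image of the
endomorphism of `exists_clearing`. -/
theorem exists_clears_inv [CharZero k] (γ : Γ) (i j : Fin (m γ) ⊕ Fin (n γ)) :
    ∃ (W : SuperSpace.{u, u} k) (σ : Rep (superM.{u, v, max u v} k m n) W), Nontrivial W ∧
      Clears σ (entryInvFn k m n (.inr ⟨γ, i, j⟩)) := by
  obtain ⟨d, c, hc0, hcX, hG⟩ :=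
    exists_clearing.{u, max u v} (k := k) (par (m γ) (n γ))
  obtain ⟨L, hL⟩ := wordRep_exists_hom.{u, v} (G := superM.{u, v, max u v} k m n)
    (χ := superM.eval k m n γ) (hχ := fun _ _ => rfl) (hε := fun _ => rfl) c hcX
  generalize hρ : wordRep d (superM.eval.{u, v, max u v} k m n γ) (fun _ _ => rfl)
    (fun _ => rfl) = ρ at L
  have hρc := fun A g t => wordRep_coef_toLin' (G := superM.{u, v, max u v} k m n)
    (χ := superM.eval k m n γ) (hχ := fun _ _ => rfl) (hε := fun _ => rfl) A g c t
  rw [hρ] at hρc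
  obtain ⟨q, hgr, hq⟩ := L.exists_retraction
  refine ⟨_, L.rangeRep hgr hq, ?_, fun η x => ?_⟩
  · have h1 : ∃ s t, c s t ≠ 0 := by
      by_contra! h
      exact hc0 (Matrix.ext h)
    obtain ⟨s, t, hst⟩ := h1
    refine ⟨⟨⟨_, Pi.single t 1, rfl⟩, 0, fun h => hst ?_⟩⟩
    have h2 : Matrix.toLin' c (Pi.single t 1) = 0 := by
      rw [← hL]
      exact congrArg Subtype.val h
    rw [Matrix.toLin'_apply, Matrix.mulVec_single_one] at h2
    exact congrFun h2 s
  · choose F hF hFX using hG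
    have h1 : entryInvFn k m n (.inr ⟨γ, i, j⟩) *
        ((L.rangeRep hgr hq).res (superGL.toM k m n)).coef η x ∈ polyFn k m n := by
      obtain ⟨y, rfl⟩ := L.toLinearMap.surjective_rangeRestrict x
      have h2 : (L.rangeRep hgr hq).coef η (L.toLinearMap.rangeRestrict y) =
          ρ.coef (η ∘ₗ q) (Matrix.toLin' c y) := by
        rw [← hL]
        exact L.rangeRep_coef hgr hq η y
      have hbasis : ∀ t, entryInvFn k m n (.inr ⟨γ, i, j⟩) * (superGL.toM k m n).pullback
          (ρ.coef (η ∘ₗ q) (Matrix.toLin' c (Pi.single t 1))) ∈ polyFn k m n := by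
        intro t
        have hFγ : ∀ s, (fun A h => F i j s t A (h γ) : (superM.{u, v, max u v} k m n).Fn) ∈
            (superM.{u, v, max u v} k m n).natFn := fun s A B φ h => hF i j s t φ (h γ)
        have hsum : (∑ s, (η ∘ₗ q) (Pi.single s 1) • fun A h => F i j s t A (h γ) :
            (superM.{u, v, max u v} k m n).Fn) ∈ (superM.{u, v, max u v} k m n).natFn := by
          apply Subalgebra.sum_mem
          intro s _
          apply Subalgebra.smul_mem
          exact hFγ s
        refine ⟨_, hsum, ?_⟩
        · ext A g
          change (∑ s, _ : (superM.{u, v, max u v} k m n).Fn) A ((superGL.toM k m n).app A g) =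
            _ * ρ.coef (η ∘ₗ q) _ A ((superGL.toM k m n).app A g)
          rw [hρc, Finset.mul_sum, Finset.sum_apply, Finset.sum_apply]
          refine Finset.sum_congr rfl fun s _ => ?_
          rw [mul_smul_comm]
          exact congrArg _ (hFX i j s t A (g γ)).symm
      change _ * (superGL.toM k m n).pullback ((L.rangeRep hgr hq).coef η _) ∈ _
      rw [h2, ← (Pi.basisFun k _).sum_repr y, map_sum, map_sum, map_sum, Finset.mul_sum]
      refine Subalgebra.sum_mem _ fun t _ => ?_
      rw [Pi.basisFun_apply, map_smul, map_smul, map_smul, mul_smul_comm]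
      exact Subalgebra.smul_mem _ (hbasis t) _
    refine ⟨h1, ?_⟩
    rw [entryInvFn_parity, smul_mul_assoc]
    exact Subalgebra.smul_mem _ h1 _

/-- The denominators of any function on `GL_{m|n}` are cleared by some nonzero representation. -/
theorem exists_clears [CharZero k] {f : (superGL.{u, v, max u v} k m n).Fn}
    (hf : f ∈ (superGL.{u, v, max u v} k m n).natFn) :
    ∃ (W : SuperSpace.{u, u} k) (σ : Rep (superM.{u, v, max u v} k m n) W), Nontrivial W ∧
      Clears σ f := by
  have hmul : ∀ f f', (∃ (W : SuperSpace.{u, u} k) (σ : Rep (superM.{u, v, max u v} k m n) W),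
      Nontrivial W ∧ Clears σ f) → (∃ (W : SuperSpace.{u, u} k)
      (σ : Rep (superM.{u, v, max u v} k m n) W), Nontrivial W ∧ Clears σ f') →
      ∃ (W : SuperSpace.{u, u} k) (σ : Rep (superM.{u, v, max u v} k m n) W),
        Nontrivial W ∧ Clears σ (f * f') ∧ Clears σ f ∧ Clears σ f' := by
    rintro f f' ⟨W, σ, hW, h⟩ ⟨W', σ', hW', h'⟩
    refine ⟨_, σ.tensor σ', inferInstanceAs (Nontrivial (W ⊗[k] W')), h.mul h', ?_, ?_⟩
    · simpa using h.mul (clears_of_mem σ' (one_mem _))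
    · simpa using (clears_of_mem σ (one_mem _)).mul h'
  have hpoly : ∀ f ∈ polyFn k m n, ∃ (W : SuperSpace.{u, u} k)
      (σ : Rep (superM.{u, v, max u v} k m n) W), Nontrivial W ∧ Clears σ f := fun f hf =>
    ⟨_, Rep.unit _, inferInstanceAs (Nontrivial k), clears_of_mem _ hf⟩
  have hf' := superGL_natFn_le k m n hf
  clear hf
  induction hf' using Algebra.adjoin_induction with
  | mem f hf =>
    obtain ⟨e | ⟨γ, i, j⟩, rfl⟩ := hf
    · exact hpoly _ ⟨entryFn k m n e, fun _ _ => rfl, rfl⟩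
    · exact exists_clears_inv γ i j
  | algebraMap c => exact hpoly _ (Subalgebra.algebraMap_mem _ c)
  | add f f' _ _ h h' =>
    obtain ⟨W, σ, hW, -, h1, h2⟩ := hmul _ _ h h'
    exact ⟨W, σ, hW, h1.add h2⟩
  | mul f f' _ _ h h' =>
    obtain ⟨W, σ, hW, h1, -⟩ := hmul _ _ h h'
    exact ⟨W, σ, hW, h1⟩

/-- Finitely many functions have a common denominator. -/
theorem exists_clears_finset [CharZero k] (S : Finset (superGL.{u, v, max u v} k m n).Fn)
    (hS : ∀ f ∈ S, f ∈ (superGL.{u, v, max u v} k m n).natFn) :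
    ∃ (W : SuperSpace.{u, u} k) (σ : Rep (superM.{u, v, max u v} k m n) W), Nontrivial W ∧
      ∀ f ∈ S, Clears σ f := by
  classical
  induction S using Finset.induction_on with
  | empty => exact ⟨_, Rep.unit _, inferInstanceAs (Nontrivial k), by simp⟩
  | insert f S _ ih =>
    obtain ⟨W, σ, hW, h⟩ := ih fun f hf => hS f (Finset.mem_insert_of_mem hf)
    obtain ⟨W', σ', hW', h'⟩ := exists_clears (hS f (Finset.mem_insert_self f S))
    refine ⟨_, σ.tensor σ', inferInstanceAs (Nontrivial (W ⊗[k] W')), fun f' hf' => ?_⟩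
    rcases Finset.mem_insert.1 hf' with rfl | hf'
    · simpa using (clears_of_mem σ (one_mem _)).mul h'
    · simpa using (h f' hf').mul (clears_of_mem σ' (one_mem _))

/-- Every representation of `GL` becomes a representation of `M` after tensoring with a suitable
nonzero representation of `M`, whose matrix coefficients clear the denominators. -/
theorem exists_tensor_extension [CharZero k] {V : SuperSpace.{u, w} k}
    (ρ : Rep (superGL.{u, v, max u v} k m n) V) :
    ∃ (W : SuperSpace.{u, u} k) (σ : Rep (superM.{u, v, max u v} k m n) W), Nontrivial W ∧
      ∃ τ : Rep (superM.{u, v, max u v} k m n) (V.tensor W),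
        τ.res (superGL.toM k m n) = ρ.tensor (σ.res (superGL.toM k m n)) := by
  classical
  have := ρ.finite
  let b := Module.finBasis k V
  obtain ⟨W, σ, hW, h⟩ := exists_clears_finset (m := m) (n := n)
    (Finset.univ.image fun i : Fin _ × Fin _ => ρ.coef (b.coord i.1) (b i.2)) (by
      intro f hf
      obtain ⟨i, -, rfl⟩ := Finset.mem_image.1 hf
      exact ρ.coef_mem _ _)
  refine ⟨W, σ, hW, exists_extension _ fun ζ z => ?_⟩
  have hb : ∀ ξ v, Clears σ (ρ.coef ξ v) := by
    intro ξ v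
    rw [← b.sum_dual_apply_smul_coord ξ, ← b.sum_repr v]
    simp only [map_sum, LinearMap.sum_apply, map_smul, LinearMap.smul_apply]
    have h0 : Clears σ (0 : (superGL.{u, v, max u v} k m n).Fn) := clears_of_mem σ (zero_mem _)
    refine Finset.sum_induction _ _ (fun _ _ => Clears.add) h0 fun j _ => ?_
    refine Clears.smul _ (Finset.sum_induction _ _ (fun _ _ => Clears.add) h0 fun i _ => ?_)
    exact Clears.smul _ (h _ (Finset.mem_image.2 ⟨(i, j), Finset.mem_univ _, rfl⟩))
  exact Rep.coef_tensor_mem ρ (σ.res (superGL.toM k m n)) (Subalgebra.toSubmodule (polyFn k m n))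
    (fun ξ v η t => hb ξ v η t) ζ z

end clears

/-! ### Polarization of representations with polynomial matrix coefficients -/

section words

variable {k : Type u} [Field k] {ι : Type} {p : ι → ZMod 2} {A B : SCommAlg.{u, a} k}

theorem SCommAlg.mul_eq_mul_twist (A : SCommAlg.{u, a} k) (x : A) {q : ZMod 2} {y : A}
    (hy : y ∈ A.gr q) : x * y = y * (A.twist q).toAlgHom x := by
  have h : LinearMap.mulRight k y =
      LinearMap.mulLeft k y ∘ₗ (A.twist q).toAlgHom.toLinearMap := by
    refine A.toSuperSpace.hom_ext fun i x hx => ?_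
    rw [LinearMap.mulRight_apply, LinearMap.comp_apply, LinearMap.mulLeft_apply,
      AlgHom.toLinearMap_apply, A.twist_of_mem q hx, mul_smul_comm, mul_comm q]
    exact A.super_comm hx hy
  exact LinearMap.congr_fun h x

theorem SCommAlg.list_prod_mem (A : SCommAlg.{u, a} k) {J : Type*} {y : J → A} {q : J → ZMod 2}
    (hy : ∀ j, y j ∈ A.gr (q j)) (l : List J) : (l.map y).prod ∈ A.gr (l.map q).sum := by
  induction l with
  | nil => exact A.one_mem
  | cons j l ih =>
    rw [List.map_cons, List.map_cons, List.prod_cons, List.sum_cons]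
    exact A.mul_mem (hy j) ih

/-- A product of homogeneous elements of square zero vanishes if a factor is repeated. -/
theorem SCommAlg.list_prod_eq_zero (A : SCommAlg.{u, a} k) {J : Type*} {y : J → A}
    {q : J → ZMod 2} (hy : ∀ j, y j ∈ A.gr (q j)) (hy2 : ∀ j, y j * y j = 0) {l : List J}
    (hl : ¬ l.Nodup) : (l.map y).prod = 0 := by
  induction l with
  | nil => exact absurd List.nodup_nil hl
  | cons j l ih =>
    rw [List.map_cons, List.prod_cons]
    by_cases h : l.Nodup
    · have hj : j ∈ l := by
        by_contra hj
        exact hl (List.nodup_cons.2 ⟨hj, h⟩)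
      obtain ⟨l₁, l₂, rfl⟩ := List.append_of_mem hj
      rw [List.map_append, List.map_cons, List.prod_append, List.prod_cons, ← mul_assoc,
        ← mul_assoc, mul_assoc (y j), A.mul_eq_mul_twist _ (hy j), ← mul_assoc (y j), hy2, zero_mul,
        zero_mul]
    · rw [ih h, mul_zero]

variable (k p) in
/-- The sign in the entry at `(s, t)` of a tensor product of matrices. -/
def wordSgn : ∀ {n : ℕ}, (Fin n → ι) → (Fin n → ι) → k
  | 0, _, _ => 1
  | _ + 1, s, t => sgn k ((p (s 0) + p (t 0)) * wpar p (fun i => s i.succ)) *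
      wordSgn (fun i => s i.succ) (fun i => t i.succ)

theorem wordSgn_mul_self {n : ℕ} (s t : Fin n → ι) : wordSgn k p s t * wordSgn k p s t = 1 := by
  induction n with
  | zero => exact one_mul 1
  | succ n ih => rw [wordSgn, mul_mul_mul_comm, sgn_mul_self, ih, one_mul]

theorem wordMat_apply {n : ℕ} (X : Fin n → Matrix ι ι A) (s t : Fin n → ι) :
    wordMat p X s t = wordSgn k p s t • (List.ofFn fun i => X i (s i) (t i)).prod := by
  induction n with
  | zero => simp [wordMat, wordSgn]
  | succ n ih =>
    rw [wordMat_succ, ih, wordSgn, List.ofFn_succ, List.prod_cons, mul_smul_comm, smul_smul]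

theorem wordMat_sum {J : Type} [Fintype J] {n : ℕ} (Z : J → Matrix ι ι A) (s t : Fin n → ι) :
    wordMat p (fun _ => ∑ j, Z j) s t = ∑ f : Fin n → J, wordMat p (fun i => Z (f i)) s t := by
  induction n with
  | zero =>
    exact (Fintype.sum_unique (fun f : Fin 0 → J => wordMat p (fun i => Z (f i)) s t)).symm
  | succ n ih =>
    rw [sum_words, wordMat_succ, ih, Matrix.sum_apply, Finset.sum_mul, Finset.smul_sum]
    refine Finset.sum_congr rfl fun j _ => ?_
    rw [Finset.mul_sum, Finset.smul_sum]
    rfl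

variable (k p) in
/-- The symmetrization of a function of pairs of words. -/
def wordSym {n : ℕ} (L : (Fin n → ι) → (Fin n → ι) → k) (s t : Fin n → ι) : k :=
  ∑ σ : Equiv.Perm (Fin n), koszul k σ (fun i => p (s i)) * koszul k σ (fun i => p (t i)) *
    L (fun i => s (σ⁻¹ i)) (fun i => t (σ⁻¹ i))

theorem sum_wordSym_self [Fintype ι] {n : ℕ} (L : (Fin n → ι) → (Fin n → ι) → k) :
    ∑ s, wordSym k p L s s = (n.factorial : k) * ∑ s, L s s := by
  simp only [wordSym]
  rw [Finset.sum_comm]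
  have h : ∀ σ : Equiv.Perm (Fin n), ∑ s : Fin n → ι, koszul k σ (fun i => p (s i)) *
      koszul k σ (fun i => p (s i)) * L (fun i => s (σ⁻¹ i)) (fun i => s (σ⁻¹ i)) =
      ∑ s, L s s := by
    intro σ
    simp only [koszul_mul_self, one_mul]
    exact (Equiv.arrowCongr σ (Equiv.refl ι)).sum_comp fun s => L s s
  rw [Finset.sum_congr rfl fun σ _ => h σ, Finset.sum_const, Finset.card_univ, Fintype.card_perm,
    Fintype.card_fin, nsmul_eq_mul]

/-- Polarization: a linear form `ψ` which only sees the multilinear part of the matrix coefficients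
of `∑ j, X j` turns a combination of matrix coefficients into its symmetrization. -/
theorem polarization [CharZero k] [Fintype ι] {d : ℕ} {X : Fin d → Matrix ι ι B}
    (hX : ∀ j s t, X j s t ∈ B.gr (p s + p t)) (ψ : B →ₗ[k] A)
    (hψ : ∀ {e : ℕ} (f : Fin e → Fin d) (s t : Fin e → ι), ¬ Function.Bijective f →
      ψ (wordMat p (fun i => X (f i)) s t) = 0) (S : Finset ℕ) (hd : d ∈ S)
    (L : ∀ e : ℕ, (Fin e → ι) → (Fin e → ι) → k) :
    ψ (∑ e ∈ S, ∑ s, ∑ t, L e s t • wordMat p (fun _ : Fin e => ∑ j, X j) s t) =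
      ∑ s, ∑ t, wordSym k p (L d) s t • ψ (wordMat p X s t) := by
  rw [map_sum, Finset.sum_eq_single_of_mem d hd]
  · simp only [map_sum, map_smul, wordMat_sum, wordSym, Finset.sum_smul]
    have h1 : ∀ s t, ∑ f : Fin d → Fin d, ψ (wordMat p (fun i => X (f i)) s t) =
        ∑ σ : Equiv.Perm (Fin d), ψ (wordMat p (fun i => X (σ⁻¹ i)) s t) := by
      intro s t
      refine (Finset.sum_of_injOn (fun σ : Equiv.Perm (Fin d) => ⇑σ⁻¹) ?_ ?_ ?_ ?_).symm
      · exact fun σ _ τ _ h => inv_injective (Equiv.coe_fn_injective h)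
      · exact fun _ _ => Finset.mem_coe.2 (Finset.mem_univ _)
      · intro f _ hf
        refine hψ f s t fun hf' => hf ⟨(Equiv.ofBijective f hf')⁻¹, Finset.mem_coe.2
          (Finset.mem_univ _), ?_⟩
        simp only [inv_inv]
        rfl
      · exact fun _ _ => rfl
    simp only [h1, Finset.smul_sum]
    have h2 : ∀ σ : Equiv.Perm (Fin d),
        ∑ s, ∑ t, L d s t • ψ (wordMat p (fun i => X (σ⁻¹ i)) s t) =
        ∑ s, ∑ t, (koszul k σ (fun i => p (s i)) * koszul k σ (fun i => p (t i)) *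
          L d (fun i => s (σ⁻¹ i)) (fun i => t (σ⁻¹ i))) • ψ (wordMat p X s t) := by
      intro σ
      rw [← (Equiv.arrowCongr σ (Equiv.refl ι)).sum_comp]
      refine Finset.sum_congr rfl fun s _ => ?_
      rw [← (Equiv.arrowCongr σ (Equiv.refl ι)).sum_comp]
      refine Finset.sum_congr rfl fun t _ => ?_
      have h3 := wordMat_perm σ hX s t
      change L d (fun i => s (σ⁻¹ i)) (fun i => t (σ⁻¹ i)) •
        ψ (wordMat p (fun i => X (σ⁻¹ i)) (fun i => s (σ⁻¹ i)) (fun i => t (σ⁻¹ i))) = _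
      rw [h3, map_smul, smul_smul, mul_comm]
    have h3 : ∀ F : (Fin d → ι) → (Fin d → ι) → Equiv.Perm (Fin d) → A,
        ∑ s, ∑ t, ∑ σ, F s t σ = ∑ σ, ∑ s, ∑ t, F s t σ := by
      intro F
      exact (Finset.sum_congr rfl fun s _ => Finset.sum_comm).trans Finset.sum_comm
    rw [h3, h3]
    exact Finset.sum_congr rfl fun σ _ => h2 σ
  -- In degree `e ≠ d` no map from the factors to the matrices `X j` is bijective.
  · intro e _ hed
    simp only [map_sum, map_smul, wordMat_sum]
    refine Finset.sum_eq_zero fun s _ => Finset.sum_eq_zero fun t _ => ?_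
    rw [Finset.sum_eq_zero, smul_zero]
    intro f _
    refine hψ f s t fun hf => hed ?_
    simpa using Fintype.card_of_bijective hf

variable [DecidableEq ι]

/-- A tensor product of matrix units has, up to a scalar, the product of their coefficients as its
entries. -/
theorem wordMat_units {n e : ℕ} (s t : Fin n → ι) (y : Fin n → A) (f : Fin e → Fin n)
    (w r : Fin e → ι) :
    ∃ c : k, wordMat p (fun i => Matrix.single (s (f i)) (t (f i)) (y (f i))) w r =
      c • ((List.ofFn f).map y).prod := by
  rw [wordMat_apply]
  by_cases h : ∀ i, s (f i) = w i ∧ t (f i) = r i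
  · refine ⟨wordSgn k p w r, ?_⟩
    congr 2
    rw [List.map_ofFn]
    congr 1
    funext i
    rw [Matrix.single_apply, if_pos (h i)]
    rfl
  · push Not at h
    obtain ⟨i, hi⟩ := h
    refine ⟨0, ?_⟩
    rw [zero_smul, List.prod_eq_zero, smul_zero]
    rw [List.mem_ofFn]
    exact ⟨i, by rw [Matrix.single_apply, if_neg]; exact fun h => hi h.1 h.2⟩

theorem wordMat_units_self {n : ℕ} (s t : Fin n → ι) (y : Fin n → A) :
    wordMat p (fun i => Matrix.single (s i) (t i) (y i)) =
      Matrix.single s t (wordSgn k p s t • (List.ofFn y).prod) := by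
  ext w r
  rw [wordMat_apply, Matrix.single_apply]
  split_ifs with h
  · rw [← h.1, ← h.2]
    simp only [Matrix.single_apply_same]
  · rw [List.prod_eq_zero, smul_zero]
    rw [List.mem_ofFn]
    by_contra! h1
    refine h ⟨funext fun i => ?_, funext fun i => ?_⟩
    · by_contra h2
      exact h1 i (by rw [Matrix.single_apply, if_neg]; exact fun h => h2 h.1)
    · by_contra h2
      exact h1 i (by rw [Matrix.single_apply, if_neg]; exact fun h => h2 h.2)

end words

section polarized

variable {k : Type u} [Field k] {ι : Type} [Fintype ι] [DecidableEq ι] {p : ι → ZMod 2}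

/-- The coefficient of the product of all adjoined variables of square zero vanishes on the products
in which a variable is missing or repeated. -/
theorem adjoin_coeff_eq_zero {A B : SCommAlg.{u, a} k} {i : A.Hom B} {d : ℕ} {q : Fin d → ZMod 2}
    {y : Fin d → B} {φ : B →ₗ[k] A} (hy : ∀ j, y j ∈ B.gr (q j)) (hy2 : ∀ j, y j * y j = 0)
    (hκ : ∀ j, ∃ κ : B.Hom B, κ.toAlgHom (y j) = 0 ∧
      (∀ l, l ≠ j → κ.toAlgHom (y l) = y l) ∧
      (∀ x, κ.toAlgHom (i.toAlgHom x) = i.toAlgHom x) ∧ ∀ z, φ (κ.toAlgHom z) = 0)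
    {e : ℕ} {f : Fin e → Fin d} (hf : ¬ Function.Bijective f) (x : A) :
    φ (((List.ofFn f).map y).prod * i.toAlgHom x) = 0 := by
  by_cases hinj : Function.Injective f
  · obtain ⟨j, hj⟩ : ∃ j, ∀ l, f l ≠ j := by
      by_contra! h
      exact hf ⟨hinj, h⟩
    obtain ⟨κ, -, h1, h2, h3⟩ := hκ j
    rw [← h3 (((List.ofFn f).map y).prod * i.toAlgHom x), map_mul κ.toAlgHom, h2, map_list_prod,
      List.map_map]
    congr 3
    refine List.map_congr_left fun l hl => ?_
    obtain ⟨l, rfl⟩ := List.mem_ofFn.1 hl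
    exact (h1 _ (hj l)).symm
  · rw [B.list_prod_eq_zero hy hy2 (fun h => hinj (List.nodup_ofFn.1 h)), zero_mul, map_zero]

variable {G : SuperMonoid.{u, a, b} k} {V : SuperSpace.{u, w} k}
  {χ : ∀ A : SCommAlg.{u, a} k, G.pts A →* superMat p A} {ρ : Rep G V} {κ : Type*} [Fintype κ]
  {bV : Module.Basis κ k V} {S : Finset ℕ} {L : κ → κ → ∀ e : ℕ, (Fin e → ι) → (Fin e → ι) → k}

/-- For every algebra `A` there is a generic block of matrix units `Z`, over an algebra `B` under
`A`, and a linear form `φ` taking the coefficient of the multilinear part in the `Z j`. -/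
theorem exists_multilinear {d : ℕ} {s t : Fin d → ι}
    (hst : ∀ (B : SCommAlg.{u, a} k) (y : Fin d → B),
      (∀ j, y j ∈ B.gr (p (s j) + p (t j))) →
      ∃ g : G.pts B, (χ B g).1 = ∑ j, Matrix.single (s j) (t j) (y j)) (A : SCommAlg.{u, a} k) :
    ∃ (B : SCommAlg.{u, a} k) (i : A.Hom B) (Z : Fin d → superMat p B) (h : G.pts B)
      (φ : B →ₗ[k] A) (q : ZMod 2), (χ B h).1 = ∑ j, (Z j).1 ∧
      (∀ {e : ℕ} (f : Fin e → Fin d) (l r : Fin e → ι) (x : A), ¬ Function.Bijective f →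
        φ (wordMat p (fun j => (Z (f j)).1) l r * i.toAlgHom x) = 0 ∧
        φ (i.toAlgHom x * wordMat p (fun j => (Z (f j)).1) l r) = 0) ∧
      ∀ (l r : Fin d → ι) (x : A),
        φ (wordMat p (fun j => (Z j).1) l r * i.toAlgHom x) =
          (if s = l ∧ t = r then wordSgn k p s t • x else 0) ∧
        φ (i.toAlgHom x * wordMat p (fun j => (Z j).1) l r) =
          (if s = l ∧ t = r then wordSgn k p s t • (A.twist q).toAlgHom x else 0) := by
  obtain ⟨B, i, η, φ, hη, hφ, hη2, hκ⟩ := A.exists_adjoin d fun j => p (s j) + p (t j)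
  obtain ⟨h, hh⟩ := hst B η hη
  have hZ : ∀ j l r, Matrix.single (s j) (t j) (η j) l r ∈ B.gr (p l + p r) := by
    intro j l r
    rw [Matrix.single_apply]
    split_ifs with h
    · rw [← h.1, ← h.2]; exact hη j
    · exact zero_mem _
  refine ⟨B, i, fun j => ⟨_, hZ j⟩, h, φ, ((List.ofFn id).map fun j => p (s j) + p (t j)).sum, hh,
    fun f l r x hf => ?_, fun l r x => ?_⟩
  · obtain ⟨c, hc⟩ := wordMat_units (p := p) s t η f l r
    rw [hc, smul_mul_assoc, map_smul, adjoin_coeff_eq_zero hη hη2 hκ hf, mul_smul_comm,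
      B.mul_eq_mul_twist _ (B.list_prod_mem hη (List.ofFn f)), ← i.map_twist, map_smul,
      adjoin_coeff_eq_zero hη hη2 hκ hf, smul_zero]
    exact ⟨rfl, rfl⟩
  · have hprod : (List.ofFn η).prod ∈
        B.gr ((List.ofFn id).map fun j => p (s j) + p (t j)).sum := by
      have h1 := B.list_prod_mem hη (List.ofFn id)
      have h2 : (List.ofFn id).map η = List.ofFn η := List.map_ofFn ..
      rwa [h2] at h1
    rw [wordMat_units_self, Matrix.single_apply]
    split_ifs
    · rw [smul_mul_assoc, map_smul, hφ, mul_smul_comm, B.mul_eq_mul_twist _ hprod, ← i.map_twist,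
        map_smul, hφ]
      exact ⟨rfl, rfl⟩
    · rw [zero_mul, mul_zero, map_zero]
      exact ⟨rfl, rfl⟩

theorem sum_sum_ite {M : Type*} [AddCommMonoid M] {W : Type*} [Fintype W] [DecidableEq W]
    (s t : W) (F : W → W → M) :
    ∑ l, ∑ r, (if s = l ∧ t = r then F l r else 0) = F s t := by
  rw [Finset.sum_eq_single s]
  · rw [Finset.sum_eq_single t]
    · rw [if_pos ⟨rfl, rfl⟩]
    · exact fun r _ hr => if_neg fun h => hr h.2.symm
    · exact fun h => absurd (Finset.mem_univ _) h
  · exact fun l _ hl => Finset.sum_eq_zero fun r _ => if_neg fun h => hl h.1.symm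
  · exact fun h => absurd (Finset.mem_univ _) h

/-- The symmetrized coefficients intertwine multiplication by `ρ` on the right with multiplication
by the matrix of the word representation. This is the part of `ρ (z * g) = ρ z * ρ g` that is
multilinear in the entries of the generic matrix `z`. -/
theorem wordSym_mul_right [CharZero k]
    (hχ : ∀ {A B : SCommAlg.{u, a} k} (f : A.Hom B) (g : G.pts A),
      χ B (G.map f g) = superMat.map p f (χ A g))
    (hL : ∀ (x y : κ) (A : SCommAlg.{u, a} k) (g : G.pts A), ρ.coef (bV.coord x) (bV y) A g =
      ∑ e ∈ S, ∑ s, ∑ t, L x y e s t • wordMat p (fun _ : Fin e => (χ A g).1) s t)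
    {d : ℕ} (hd : d ∈ S) {s t : Fin d → ι}
    (hst : ∀ (B : SCommAlg.{u, a} k) (y : Fin d → B),
      (∀ j, y j ∈ B.gr (p (s j) + p (t j))) →
      ∃ g : G.pts B, (χ B g).1 = ∑ j, Matrix.single (s j) (t j) (y j))
    (x y : κ) {A : SCommAlg.{u, a} k} (g : G.pts A) :
    ∑ r, wordSym k p (L x y d) s r • wordMat p (fun _ => (χ A g).1) t r =
      ∑ z, wordSym k p (L x z d) s t • ρ.coef (bV.coord z) (bV y) A g := by
  obtain ⟨B, i, Z, h, φ, q, hh, hvan, hself⟩ := exists_multilinear hst A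
  have hXw : ∀ {e : ℕ} (f : Fin e → Fin d) (l r : Fin e → ι), wordMat p (fun j =>
      (Z (f j)).1 * (superMat.map p i (χ A g)).1) l r =
      ∑ r', wordMat p (fun j => (Z (f j)).1) l r' *
        i.toAlgHom (wordMat p (fun _ => (χ A g).1) r' r) := by
    intro e f l r
    rw [wordMat_mul (fun j => (Z (f j)).2) fun _ => (superMat.map p i (χ A g)).2,
      Matrix.mul_apply]
    exact Finset.sum_congr rfl fun r' _ => by rw [map_wordMat]; rfl
  have h1 : φ (ρ.coef (bV.coord x) (bV y) B (h * G.map i g)) =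
      wordSgn k p s t •
        ∑ r, wordSym k p (L x y d) s r • wordMat p (fun _ => (χ A g).1) t r := by
    have h2 : (χ B (h * G.map i g)).1 = ∑ j, (Z j).1 * (superMat.map p i (χ A g)).1 := by
      rw [map_mul, ← Finset.sum_mul, ← hh, hχ]
      rfl
    rw [hL, h2, polarization (X := fun j => (Z j).1 * (superMat.map p i (χ A g)).1)
      (fun j => (Z j * superMat.map p i (χ A g)).2) φ (fun f l r hf => ?_) S hd]
    · simp only [hXw fun j => j, map_sum, (hself _ _ _).1, Finset.smul_sum]
      rw [← sum_sum_ite s t fun l r' => ∑ r, wordSgn k p s t • wordSym k p (L x y d) l r •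
        wordMat p (fun _ => (χ A g).1) r' r]
      refine Finset.sum_congr rfl fun l _ => ?_
      rw [Finset.sum_comm]
      refine Finset.sum_congr rfl fun r' _ => ?_
      split_ifs
      · exact Finset.sum_congr rfl fun r _ => smul_comm _ _ _
      · exact Finset.sum_eq_zero fun r _ => smul_zero _
    · rw [hXw, map_sum]
      exact Finset.sum_eq_zero fun r' _ => (hvan f l r' _ hf).1
  have h3 : φ (ρ.coef (bV.coord x) (bV y) B (h * G.map i g)) =
      wordSgn k p s t •
        ∑ z, wordSym k p (L x z d) s t • ρ.coef (bV.coord z) (bV y) A g := by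
    rw [ρ.coef_mul bV, map_sum, Finset.smul_sum]
    refine Finset.sum_congr rfl fun z _ => ?_
    rw [← ρ.coef_mem (bV.coord z) (bV y) i g, hL, hh, ← LinearMap.mulRight_apply (R := k),
      ← LinearMap.comp_apply,
      polarization (fun j => (Z j).2) _ (fun f l r hf => (hvan f l r _ hf).1) S hd]
    simp only [LinearMap.comp_apply, LinearMap.mulRight_apply, (hself _ _ _).1, smul_ite,
      smul_zero]
    rw [sum_sum_ite s t fun l r => wordSym k p (L x z d) l r • wordSgn k p s t •
      ρ.coef (bV.coord z) (bV y) A g, smul_comm]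
  have h4 := congrArg (wordSgn k p s t • ·) (h1.symm.trans h3)
  simpa only [smul_smul, wordSgn_mul_self, one_smul] using h4

/-- The analogue of `wordSym_mul_right` for `ρ (g * z) = ρ g * ρ z`. -/
theorem wordSym_mul_left [CharZero k]
    (hχ : ∀ {A B : SCommAlg.{u, a} k} (f : A.Hom B) (g : G.pts A),
      χ B (G.map f g) = superMat.map p f (χ A g))
    (hL : ∀ (x y : κ) (A : SCommAlg.{u, a} k) (g : G.pts A), ρ.coef (bV.coord x) (bV y) A g =
      ∑ e ∈ S, ∑ s, ∑ t, L x y e s t • wordMat p (fun _ : Fin e => (χ A g).1) s t)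
    {d : ℕ} (hd : d ∈ S) {s t : Fin d → ι}
    (hst : ∀ (B : SCommAlg.{u, a} k) (y : Fin d → B),
      (∀ j, y j ∈ B.gr (p (s j) + p (t j))) →
      ∃ g : G.pts B, (χ B g).1 = ∑ j, Matrix.single (s j) (t j) (y j))
    (x y : κ) {A : SCommAlg.{u, a} k} (g : G.pts A) :
    ∑ l, wordSym k p (L x y d) l t • wordMat p (fun _ => (χ A g).1) l s =
      ∑ z, wordSym k p (L z y d) s t • ρ.coef (bV.coord x) (bV z) A g := by
  obtain ⟨B, i, Z, h, φ, q, hh, hvan, hself⟩ := exists_multilinear hst A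
  have hXw : ∀ {e : ℕ} (f : Fin e → Fin d) (l r : Fin e → ι), wordMat p (fun j =>
      (superMat.map p i (χ A g)).1 * (Z (f j)).1) l r =
      ∑ l', i.toAlgHom (wordMat p (fun _ => (χ A g).1) l l') *
        wordMat p (fun j => (Z (f j)).1) l' r := by
    intro e f l r
    rw [wordMat_mul (fun _ => (superMat.map p i (χ A g)).2) fun j => (Z (f j)).2,
      Matrix.mul_apply]
    exact Finset.sum_congr rfl fun r' _ => by rw [map_wordMat]; rfl
  have h1 : φ (ρ.coef (bV.coord x) (bV y) B (G.map i g * h)) =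
      wordSgn k p s t • (A.twist q).toAlgHom
        (∑ l, wordSym k p (L x y d) l t • wordMat p (fun _ => (χ A g).1) l s) := by
    have h2 : (χ B (G.map i g * h)).1 = ∑ j, (superMat.map p i (χ A g)).1 * (Z j).1 := by
      rw [map_mul, ← Finset.mul_sum, ← hh, hχ]
      rfl
    rw [hL, h2, polarization (X := fun j => (superMat.map p i (χ A g)).1 * (Z j).1)
      (fun j => (superMat.map p i (χ A g) * Z j).2) φ (fun f l r hf => ?_) S hd]
    · simp only [hXw fun j => j, map_sum, (hself _ _ _).2, map_smul, Finset.smul_sum]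
      refine Finset.sum_congr rfl fun l _ => ?_
      rw [← sum_sum_ite s t fun l' r => wordSgn k p s t • wordSym k p (L x y d) l r •
        (A.twist q).toAlgHom (wordMat p (fun _ => (χ A g).1) l l'), Finset.sum_comm]
      refine Finset.sum_congr rfl fun l' _ => Finset.sum_congr rfl fun r _ => ?_
      split_ifs
      · exact smul_comm _ _ _
      · exact smul_zero _
    · rw [hXw, map_sum]
      exact Finset.sum_eq_zero fun l' _ => (hvan f l' r _ hf).2
  have h3 : φ (ρ.coef (bV.coord x) (bV y) B (G.map i g * h)) =
      wordSgn k p s t • (A.twist q).toAlgHom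
        (∑ z, wordSym k p (L z y d) s t • ρ.coef (bV.coord x) (bV z) A g) := by
    rw [ρ.coef_mul bV, map_sum, map_sum, Finset.smul_sum]
    refine Finset.sum_congr rfl fun z _ => ?_
    rw [← ρ.coef_mem (bV.coord x) (bV z) i g, hL z y, hh, ← LinearMap.mulLeft_apply (R := k),
      ← LinearMap.comp_apply,
      polarization (fun j => (Z j).2) _ (fun f l r hf => (hvan f l r _ hf).2) S hd]
    simp only [LinearMap.comp_apply, LinearMap.mulLeft_apply, (hself _ _ _).2, smul_ite,
      smul_zero]
    rw [sum_sum_ite s t fun l r => wordSym k p (L z y d) l r • wordSgn k p s t •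
      (A.twist q).toAlgHom (ρ.coef (bV.coord x) (bV z) A g), smul_comm, map_smul]
  have h4 := congrArg (fun x => (A.twist q).toAlgHom (wordSgn k p s t • x)) (h1.symm.trans h3)
  simpa only [smul_smul, wordSgn_mul_self, one_smul, A.twist_twist] using h4

end polarized

/-! ### Detecting representations by homomorphisms -/

section detected

variable {k : Type u} [Field k] {G : SuperMonoid.{u, a, b} k} {V : SuperSpace.{u, w} k}
  {I : Type*} {X : I → SuperSpace.{u, w'} k}

/-- The representation `ρ` is detected by the family `R` if its nonzero vectors are seen by the
homomorphisms to members of `R`, and its nonzero linear forms by the homomorphisms from members of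
`R`. Since `ρ` is finite-dimensional, this means that it is a subrepresentation and a quotient of
finite direct sums of members of `R`. -/
structure Rep.DetectedBy (ρ : Rep G V) (R : ∀ i, Rep G (X i)) : Prop where
  cogen : ∀ v : V, v ≠ 0 → ∃ i, ∃ F : ρ.Hom (R i), F.toLinearMap v ≠ 0
  gen : ∀ ξ : Module.Dual k V, ξ ≠ 0 → ∃ i, ∃ F : (R i).Hom ρ, ξ ∘ₗ F.toLinearMap ≠ 0

variable {ρ : Rep G V} {R : ∀ i, Rep G (X i)}

theorem Rep.DetectedBy.trans {J : Type*} {Y : J → SuperSpace.{u, b'} k} {S : ∀ j, Rep G (Y j)}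
    (h : ρ.DetectedBy R) (h' : ∀ i, (R i).DetectedBy S) : ρ.DetectedBy S where
  cogen v hv := by
    obtain ⟨i, F, hF⟩ := h.cogen v hv
    obtain ⟨j, F', hF'⟩ := (h' i).cogen _ hF
    exact ⟨j, F'.comp F, hF'⟩
  gen ξ hξ := by
    obtain ⟨i, F, hF⟩ := h.gen ξ hξ
    obtain ⟨j, F', hF'⟩ := (h' i).gen _ hF
    exact ⟨j, F.comp F', hF'⟩

theorem Rep.detectedBy_of_bijective {i : I} (F : ρ.Hom (R i))
    (hF : Function.Bijective F.toLinearMap) : ρ.DetectedBy R where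
  cogen v hv := ⟨i, F, (map_ne_zero_iff _ hF.1).2 hv⟩
  gen ξ hξ := by
    refine ⟨i, F.inv hF, fun h => hξ (LinearMap.ext fun v => ?_)⟩
    have h1 := LinearMap.congr_fun h (F.toLinearMap v)
    have h2 : (F.inv hF).toLinearMap (F.toLinearMap v) = v :=
      (LinearEquiv.ofBijective F.toLinearMap hF).symm_apply_apply v
    rwa [LinearMap.comp_apply, h2] at h1

theorem Rep.detectedBy_self (i : I) : (R i).DetectedBy R :=
  Rep.detectedBy_of_bijective (Rep.Hom.id _) Function.bijective_id

/-- Restriction along a homomorphism of super monoids preserves detection. -/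
theorem Rep.DetectedBy.res {G' : SuperMonoid.{u, a, b'} k} (h : ρ.DetectedBy R)
    (f : G'.Hom G) : (ρ.res f).DetectedBy fun i => (R i).res f where
  cogen v hv := by
    obtain ⟨i, F, hF⟩ := h.cogen v hv
    exact ⟨i, F.res f, hF⟩
  gen ξ hξ := by
    obtain ⟨i, F, hF⟩ := h.gen ξ hξ
    exact ⟨i, F.res f, hF⟩

end detected

section words

variable {k : Type u} [Field k] {ι : Type} {p : ι → ZMod 2} {κ : Type*} {β : ι → κ}

theorem wordMat_eq_zero_of_block {A : SCommAlg.{u, a} k} {Z : Matrix ι ι A}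
    (hZ : ∀ s t, β s ≠ β t → Z s t = 0) {d : ℕ} {s t : Fin d → ι}
    (h : ¬ ∀ j, β (s j) = β (t j)) : wordMat p (fun _ => Z) s t = 0 := by
  push Not at h
  obtain ⟨j, hj⟩ := h
  rw [wordMat_apply, List.prod_eq_zero, smul_zero]
  rw [List.mem_ofFn]
  exact ⟨j, hZ _ _ hj⟩

variable [Fintype ι]

variable (p β) in
/-- The symmetrization of a function on the pairs of words whose letters belong to the same
blocks. -/
def blockSym [DecidableEq κ] {d : ℕ} (L : (Fin d → ι) → (Fin d → ι) → k) (s t : Fin d → ι) : k :=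
  if ∀ j, β (s j) = β (t j) then wordSym k p L s t else 0

variable [DecidableEq ι]

/-- A surjective homomorphism from a super monoid to the super monoid of block diagonal matrices,
where the block of the index `s` is `β s`. -/
structure BlockHom (G : SuperMonoid.{u, a, b} k) (p : ι → ZMod 2) (β : ι → κ) where
  app : ∀ A : SCommAlg.{u, a} k, G.pts A →* superMat p A
  app_map : ∀ {A B : SCommAlg.{u, a} k} (f : A.Hom B) (g : G.pts A),
    app B (G.map f g) = superMat.map p f (app A g)
  app_eps : ∀ A, app A (G.eps A) = superMat.eps p A
  app_block : ∀ (A : SCommAlg.{u, a} k) (g : G.pts A) s t, β s ≠ β t → (app A g).1 s t = 0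
  surj : ∀ (A : SCommAlg.{u, a} k) (Z : superMat p A), (∀ s t, β s ≠ β t → Z.1 s t = 0) →
    ∃ g : G.pts A, app A g = Z

variable {G : SuperMonoid.{u, a, b} k} (χ : BlockHom G p β)

/-- The `d`-th tensor power of the representation given by block diagonal matrices. -/
noncomputable def BlockHom.wordRep (d : ℕ) :
    Rep G (SuperSpace.free k fun s : Fin d → ι => wpar p s) :=
  SuperGL.wordRep d χ.app χ.app_map χ.app_eps

theorem BlockHom.wordRep_act (A : SCommAlg.{u, a} k) (g : G.pts A) {d : ℕ} (t : Fin d → ι) :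
    ((χ.wordRep d).act A g).1 ((Pi.single t 1 : (Fin d → ι) → k) ⊗ₜ[k] 1) =
      ∑ s, (Pi.single s 1 : (Fin d → ι) → k) ⊗ₜ[k] wordMat p (fun _ => (χ.app A g).1) s t :=
  SuperGL.wordRep_act d χ.app χ.app_map χ.app_eps A g t

theorem BlockHom.wordRep_act_vec (A : SCommAlg.{u, a} k) (g : G.pts A) {d : ℕ}
    (f : (Fin d → ι) → k) :
    ((χ.wordRep d).act A g).1 (f ⊗ₜ[k] 1) = ∑ s, (Pi.single s 1 : (Fin d → ι) → k) ⊗ₜ[k]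
      ∑ t, f t • wordMat p (fun _ => (χ.app A g).1) s t := by
  have hf : f = ∑ t, f t • (Pi.single t 1 : (Fin d → ι) → k) := by
    rw [← Finset.univ_sum_single f]
    simp [← Pi.single_smul]
  rw [hf, TensorProduct.sum_tmul, map_sum, ← hf]
  simp only [TensorProduct.tmul_sum]
  rw [Finset.sum_comm]
  refine Finset.sum_congr rfl fun t _ => ?_
  rw [← TensorProduct.smul_tmul', map_smul]
  refine (congrArg (f t • ·) (χ.wordRep_act A g t)).trans ?_
  rw [Finset.smul_sum]
  exact Finset.sum_congr rfl fun s _ => (TensorProduct.tmul_smul _ _ _).symm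

/-- A sum of matrix units inside the blocks, with coefficients of the right degrees, comes from a
point of the super monoid. -/
theorem BlockHom.exists_units {d : ℕ} {s t : Fin d → ι} (hst : ∀ j, β (s j) = β (t j))
    (B : SCommAlg.{u, a} k) (y : Fin d → B) (hy : ∀ j, y j ∈ B.gr (p (s j) + p (t j))) :
    ∃ g : G.pts B, (χ.app B g).1 = ∑ j, Matrix.single (s j) (t j) (y j) := by
  have h1 : ∀ l r, (∑ j, Matrix.single (s j) (t j) (y j)) l r ∈ B.gr (p l + p r) := by
    intro l r
    rw [Matrix.sum_apply]
    refine Submodule.sum_mem _ fun j _ => ?_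
    rw [Matrix.single_apply]
    split_ifs with h
    · rw [← h.1, ← h.2]; exact hy j
    · exact zero_mem _
  have h2 : ∀ l r, β l ≠ β r → (∑ j, Matrix.single (s j) (t j) (y j)) l r = 0 := by
    intro l r hlr
    rw [Matrix.sum_apply]
    refine Finset.sum_eq_zero fun j _ => ?_
    rw [Matrix.single_apply, if_neg]
    rintro ⟨rfl, rfl⟩
    exact hlr (hst j)
  obtain ⟨g, hg⟩ := χ.surj B ⟨_, h1⟩ h2
  exact ⟨g, by rw [hg]⟩

variable {V : SuperSpace.{u, w} k} {ρ : Rep G V} {J : Type*} [Fintype J]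
  {L : J → J → ∀ e : ℕ, (Fin e → ι) → (Fin e → ι) → k} {bV : Module.Basis J k V} {S : Finset ℕ}

variable (ρ L bV S) in
/-- The matrix coefficients of `ρ` are the given combinations of the matrix coefficients of the
tensor powers of degrees in `S` of the representation defined by `χ`. -/
def BlockHom.Expands : Prop :=
  ∀ (x y : J) (A : SCommAlg.{u, a} k) (g : G.pts A), ρ.coef (bV.coord x) (bV y) A g =
    ∑ e ∈ S, ∑ s, ∑ t, L x y e s t • wordMat p (fun _ : Fin e => (χ.app A g).1) s t

variable {χ} [DecidableEq κ]

/-- The version of `wordSym_mul_right` for block diagonal matrices, where pairs of words with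
letters in different blocks are discarded. -/
theorem BlockHom.Expands.mul_right [CharZero k] (hL : χ.Expands ρ L bV S) {d : ℕ} (hd : d ∈ S)
    (s t : Fin d → ι) (x y : J) {A : SCommAlg.{u, a} k} (g : G.pts A) :
    ∑ r, blockSym p β (L x y d) s r • wordMat p (fun _ => (χ.app A g).1) t r =
      ∑ z, blockSym p β (L x z d) s t • ρ.coef (bV.coord z) (bV y) A g := by
  by_cases hst : ∀ j, β (s j) = β (t j)
  · simp only [blockSym, if_pos hst]
    rw [← wordSym_mul_right χ.app_map hL hd (χ.exists_units hst)]
    refine Finset.sum_congr rfl fun r _ => ?_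
    split_ifs with h
    · rfl
    · rw [wordMat_eq_zero_of_block (χ.app_block A g), smul_zero, smul_zero]
      exact fun h' => h fun j => (hst j).trans (h' j)
  · simp only [blockSym, if_neg hst, zero_smul, Finset.sum_const_zero]
    refine Finset.sum_eq_zero fun r _ => ?_
    split_ifs with h
    · rw [wordMat_eq_zero_of_block (χ.app_block A g), smul_zero]
      exact fun h' => hst fun j => (h j).trans (h' j).symm
    · exact zero_smul _ _

/-- The version of `wordSym_mul_left` for block diagonal matrices. -/
theorem BlockHom.Expands.mul_left [CharZero k] (hL : χ.Expands ρ L bV S) {d : ℕ} (hd : d ∈ S)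
    (s t : Fin d → ι) (x y : J) {A : SCommAlg.{u, a} k} (g : G.pts A) :
    ∑ l, blockSym p β (L x y d) l t • wordMat p (fun _ => (χ.app A g).1) l s =
      ∑ z, blockSym p β (L z y d) s t • ρ.coef (bV.coord x) (bV z) A g := by
  by_cases hst : ∀ j, β (s j) = β (t j)
  · simp only [blockSym, if_pos hst]
    rw [← wordSym_mul_left χ.app_map hL hd (χ.exists_units hst)]
    refine Finset.sum_congr rfl fun l _ => ?_
    split_ifs with h
    · rfl
    · rw [wordMat_eq_zero_of_block (χ.app_block A g), smul_zero, smul_zero]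
      exact fun h' => h fun j => (h' j).trans (hst j)
  · simp only [blockSym, if_neg hst, zero_smul, Finset.sum_const_zero]
    refine Finset.sum_eq_zero fun l _ => ?_
    split_ifs with h
    · rw [wordMat_eq_zero_of_block (χ.app_block A g), smul_zero]
      exact fun h' => hst fun j => (h' j).symm.trans (h j)
    · exact zero_smul _ _

end words

section words_homs

variable {k : Type u} [Field k] {ι : Type} {p : ι → ZMod 2} {κ : Type*} {β : ι → κ} [Fintype ι]
  [DecidableEq ι] [DecidableEq κ] {G : SuperMonoid.{u, max u v, b} k} {χ : BlockHom G p β}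
  {V : SuperSpace.{u, w} k} {ρ : Rep G V} {S : Finset ℕ} [CharZero k]

/-- The symmetrized coefficients of the identity matrices add up to the identity. -/
theorem BlockHom.Expands.sum_self {J : Type*} [DecidableEq J]
    {L : J → J → ∀ e : ℕ, (Fin e → ι) → (Fin e → ι) → k} {bV : Module.Basis J k V}
    (hL : χ.Expands ρ L bV S) (x y : J) :
    ∑ d ∈ S, (d.factorial : k)⁻¹ * ∑ s, blockSym p β (L x y d) s s = if x = y then 1 else 0 := by
  have h1 : ∀ d, (d.factorial : k)⁻¹ * ∑ s, blockSym p β (L x y d) s s = ∑ s, L x y d s s := by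
    intro d
    simp only [blockSym, implies_true, if_true]
    rw [sum_wordSym_self, ← mul_assoc, inv_mul_cancel₀, one_mul]
    exact Nat.cast_ne_zero.2 (Nat.factorial_ne_zero d)
  rw [Finset.sum_congr rfl fun d _ => h1 d]
  have h2 := hL x y (SCommAlg.base.{u, v} k) 1
  have h3 : ∀ e : ℕ, wordMat p (fun _ : Fin e => (χ.app (SCommAlg.base.{u, v} k) 1).1) = 1 := by
    intro e
    rw [map_one]
    exact congrArg Subtype.val (map_one (wordHom p e (SCommAlg.base.{u, v} k)))
  rw [ρ.coef_one, bV.coord_apply, bV.repr_self] at h2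
  simp only [h3, Matrix.one_apply, smul_ite, smul_zero, Finset.sum_ite_eq, Finset.mem_univ,
    if_true, ← Finset.sum_smul] at h2
  have h4 := congrArg ULift.down h2
  simp only [ULift.smul_down, ULift.one_down, smul_eq_mul, mul_one] at h4
  rw [← h4, Finsupp.single_apply]
  simp only [eq_comm]

variable {J : Type*} [Fintype J] {L : J → J → ∀ e : ℕ, (Fin e → ι) → (Fin e → ι) → k}
  {bV : Module.Basis J k V}

/-- The symmetrized coefficients in a row are the components of a homomorphism to a tensor power:
this is the meaning of `BlockHom.Expands.mul_right`. -/
theorem BlockHom.Expands.exists_hom_to_words (hL : χ.Expands ρ L bV S) {d : ℕ} (hd : d ∈ S)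
    (s : Fin d → ι) (x : J) : ∃ F : ρ.Hom (χ.wordRep d),
      ∀ v t, F.toLinearMap v t = ∑ y, bV.coord y v * blockSym p β (L x y d) s t := by
  let F : V →ₗ[k] (Fin d → ι) → k := bV.constr k fun y t => blockSym p β (L x y d) s t
  have hF : ∀ y, F (bV y) = fun t => blockSym p β (L x y d) s t := bV.constr_basis k _
  refine ⟨Rep.Hom.ofBasis bV F fun A g y => ?_, fun v t => ?_⟩
  · rw [hF, χ.wordRep_act_vec, ρ.act_eq_sum bV, map_sum]
    have h1 : ∀ z, LinearMap.rTensor A F (bV z ⊗ₜ[k] ρ.coef (bV.coord z) (bV y) A g) =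
        ∑ t, (Pi.single t 1 : (Fin d → ι) → k) ⊗ₜ[k]
          (blockSym p β (L x z d) s t • ρ.coef (bV.coord z) (bV y) A g) := by
      intro z
      rw [LinearMap.rTensor_tmul, hF]
      conv_lhs => rw [← Finset.univ_sum_single (fun t => blockSym p β (L x z d) s t)]
      rw [TensorProduct.sum_tmul]
      refine Finset.sum_congr rfl fun t _ => ?_
      rw [← TensorProduct.smul_tmul, ← Pi.single_smul, smul_eq_mul, mul_one]
    rw [Finset.sum_congr rfl fun z _ => h1 z, Finset.sum_comm]
    refine Finset.sum_congr rfl fun t _ => ?_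
    rw [← TensorProduct.tmul_sum, ← hL.mul_right hd]
  · change F v t = _
    conv_lhs => rw [← bV.sum_repr v]
    rw [map_sum, Finset.sum_apply]
    refine Finset.sum_congr rfl fun y _ => ?_
    rw [map_smul, hF]
    rfl

/-- The symmetrized coefficients in a column are the components of a homomorphism from a tensor
power: this is the meaning of `BlockHom.Expands.mul_left`. -/
theorem BlockHom.Expands.exists_hom_from_words (hL : χ.Expands ρ L bV S) {d : ℕ} (hd : d ∈ S)
    (t : Fin d → ι) (y : J) : ∃ F : (χ.wordRep d).Hom ρ,
      ∀ s, F.toLinearMap (Pi.single s 1) = ∑ x, blockSym p β (L x y d) s t • bV x := by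
  let F : ((Fin d → ι) → k) →ₗ[k] V :=
    (Pi.basisFun k _).constr k fun s => ∑ x, blockSym p β (L x y d) s t • bV x
  have hF : ∀ s, F (Pi.single s 1) = ∑ x, blockSym p β (L x y d) s t • bV x := by
    intro s
    rw [← Pi.basisFun_apply]
    exact (Pi.basisFun k _).constr_basis k _ s
  refine ⟨Rep.Hom.ofBasis (Pi.basisFun k _) F fun A g s => ?_, hF⟩
  rw [Pi.basisFun_apply, χ.wordRep_act, hF, map_sum, TensorProduct.sum_tmul, map_sum]
  simp only [LinearMap.rTensor_tmul, hF, ← TensorProduct.smul_tmul', map_smul, ρ.act_eq_sum bV]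
  simp only [TensorProduct.sum_tmul, Finset.smul_sum]
  refine (Finset.sum_comm.trans (Finset.sum_congr rfl fun x _ => ?_)).trans Finset.sum_comm
  simp only [TensorProduct.smul_tmul', TensorProduct.smul_tmul]
  rw [← TensorProduct.tmul_sum, ← TensorProduct.tmul_sum, ← hL.mul_left hd]

/-- A representation with polynomial matrix coefficients is detected by tensor powers. -/
theorem BlockHom.Expands.detectedBy (hL : χ.Expands ρ L bV S) : ρ.DetectedBy χ.wordRep where
  cogen v hv := by
    classical
    by_contra! h
    -- The coordinates of `v` are combinations of values of the homomorphisms given by the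
    -- symmetrized coefficients, by `BlockHom.Expands.sum_self`.
    refine hv (bV.repr.map_eq_zero_iff.1 (Finsupp.ext fun x => ?_))
    have h1 : ∀ d ∈ S, ∀ s, ∑ y, bV.coord y v * blockSym p β (L x y d) s s = 0 := by
      intro d hd s
      obtain ⟨F, hF⟩ := hL.exists_hom_to_words hd s x
      rw [← hF, h]
      rfl
    have h2 : bV.coord x v = ∑ y, bV.coord y v * if x = y then 1 else 0 := by simp
    change bV.coord x v = 0
    rw [h2]
    simp only [← hL.sum_self, Finset.mul_sum]
    rw [Finset.sum_comm]
    refine Finset.sum_eq_zero fun d hd => ?_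
    rw [Finset.sum_comm]
    refine Finset.sum_eq_zero fun s _ => ?_
    simp only [mul_left_comm (bV.coord _ v), ← Finset.mul_sum, h1 d hd s, mul_zero]
  gen ξ hξ := by
    classical
    by_contra! h
    refine hξ (bV.ext fun y => ?_)
    have h1 : ∀ d ∈ S, ∀ s, ∑ x, ξ (bV x) * blockSym p β (L x y d) s s = 0 := by
      intro d hd s
      obtain ⟨F, hF⟩ := hL.exists_hom_from_words hd s y
      have h3 := LinearMap.congr_fun (h d F) (Pi.single s 1)
      rw [LinearMap.comp_apply, hF, map_sum, LinearMap.zero_apply] at h3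
      rw [← h3]
      exact Finset.sum_congr rfl fun x _ => by rw [map_smul, smul_eq_mul, mul_comm]
    have h2 : ξ (bV y) = ∑ x, ξ (bV x) * if x = y then 1 else 0 := by simp
    rw [h2, LinearMap.zero_apply]
    simp only [← hL.sum_self, Finset.mul_sum]
    rw [Finset.sum_comm]
    refine Finset.sum_eq_zero fun d hd => ?_
    rw [Finset.sum_comm]
    refine Finset.sum_eq_zero fun s _ => ?_
    simp only [mul_left_comm (ξ _), ← Finset.mul_sum, h1 d hd s, mul_zero]

end words_homs

/-! ### Homomorphisms of tensor products and of duals -/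

section hom_tensor

variable {k : Type u} [Field k] {G : SuperMonoid.{u, a, b} k}

theorem rTensor_superMul {V : SuperSpace.{u, w} k} {W : SuperSpace.{u, w'} k}
    {V' : SuperSpace.{u, b} k} {W' : SuperSpace.{u, b'} k} (A : SCommAlg.{u, a} k) (F : V →ₗ[k] V')
    {F' : W →ₗ[k] W'} (hF' : ∀ i, ∀ t ∈ W.gr i, F' t ∈ W'.gr i) (z : V ⊗[k] A) (t : W ⊗[k] A) :
    LinearMap.rTensor A (TensorProduct.map F F') (superMul V W A (z ⊗ₜ[k] t)) =
      superMul V' W' A (LinearMap.rTensor A F z ⊗ₜ[k] LinearMap.rTensor A F' t) := by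
  have h : LinearMap.rTensor A (TensorProduct.map F F') ∘ₗ superMul V W A = superMul V' W' A ∘ₗ
      TensorProduct.map (LinearMap.rTensor A F) (LinearMap.rTensor A F') := by
    refine TensorProduct.ext (superMul_gr_ext V A fun i j v hv x hx =>
      superMul_gr_ext W A fun l q t ht y hy => ?_)
    simp only [LinearMap.compr₂ₛₗ_apply, TensorProduct.mk_apply, LinearMap.comp_apply,
      TensorProduct.map_tmul, LinearMap.rTensor_tmul]
    rw [superMul_tmul V W A v hx ht, superMul_tmul V' W' A (F v) hx (hF' _ _ ht), map_smul,
      LinearMap.rTensor_tmul, TensorProduct.map_tmul]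
  exact LinearMap.congr_fun h (z ⊗ₜ[k] t)

variable {V : SuperSpace.{u, w} k} {W : SuperSpace.{u, w'} k} {I J : Type*}
  {X : I → SuperSpace.{u, u} k} {Y : J → SuperSpace.{u, u} k}

/-- The tensor product of homomorphisms of representations. -/
noncomputable def Rep.Hom.tensor {V' : SuperSpace.{u, b'} k} {W' : SuperSpace.{u, v} k}
    {ρ : Rep G V} {σ : Rep G W} {ρ' : Rep G V'} {σ' : Rep G W'} (F : ρ.Hom ρ') (F' : σ.Hom σ') :
    (ρ.tensor σ).Hom (ρ'.tensor σ') where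
  toLinearMap := TensorProduct.map F.toLinearMap F'.toLinearMap
  map_gr d z hz := by
    induction hz using Submodule.span_induction with
    | zero => rw [map_zero]; exact zero_mem _
    | add p q _ _ hp hq => rw [map_add]; exact Submodule.add_mem _ hp hq
    | smul c p _ hp => rw [map_smul]; exact Submodule.smul_mem _ _ hp
    | mem z hz =>
      obtain ⟨i, j, rfl, v, hv, t, ht, rfl⟩ := hz
      exact tmul_mem (F.map_gr _ _ hv) (F'.map_gr _ _ ht)
  map_act A g z := by
    have h : LinearMap.rTensor A (TensorProduct.map F.toLinearMap F'.toLinearMap) ∘ₗ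
        ((ρ.tensor σ).act A g).1 = ((ρ'.tensor σ').act A g).1 ∘ₗ
        LinearMap.rTensor A (TensorProduct.map F.toLinearMap F'.toLinearMap) := by
      refine superMul_ext fun z t => ?_
      rw [LinearMap.comp_apply, LinearMap.comp_apply, Rep.tensor_act,
        rTensor_superMul A _ F'.map_gr, rTensor_superMul A _ F'.map_gr, Rep.tensor_act, F.map_act,
        F'.map_act]
    exact LinearMap.congr_fun h z

/-- A nonzero tensor is not killed by all maps `id ⊗ η`. -/
theorem exists_lTensor_ne_zero {E F : Type*} [AddCommGroup E] [Module k E] [AddCommGroup F]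
    [Module k F] {z : E ⊗[k] F} (hz : z ≠ 0) :
    ∃ η : Module.Dual k F, TensorProduct.rid k E (LinearMap.lTensor E η z) ≠ 0 := by
  by_contra! h
  classical
  refine hz ((TensorProduct.equivFinsuppOfBasisRight (M := E)
    (Module.Basis.ofVectorSpace k F)).map_eq_zero_iff.1 (Finsupp.ext fun i => ?_))
  rw [TensorProduct.equivFinsuppOfBasisRight_apply, h, Finsupp.zero_apply]

/-- Detection is compatible with tensor products. -/
theorem Rep.DetectedBy.tensor {ρ : Rep G V} {σ : Rep G W} {R : ∀ i, Rep G (X i)}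
    {S : ∀ j, Rep G (Y j)} (h : ρ.DetectedBy R) (h' : σ.DetectedBy S) :
    (ρ.tensor σ).DetectedBy fun i : I × J => (R i.1).tensor (S i.2) where
  cogen z hz := by
    obtain ⟨η, hη⟩ := exists_lTensor_ne_zero hz
    obtain ⟨i, F, hF⟩ := h.cogen _ hη
    have h1 : LinearMap.rTensor W F.toLinearMap z ≠ 0 := by
      intro h0
      refine hF ?_
      have h2 : F.toLinearMap ∘ₗ (TensorProduct.rid k V).toLinearMap ∘ₗ LinearMap.lTensor V η =
          (TensorProduct.rid k (X i)).toLinearMap ∘ₗ LinearMap.lTensor (X i) η ∘ₗ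
            LinearMap.rTensor W F.toLinearMap := TensorProduct.ext' fun v t => by simp
      refine (LinearMap.congr_fun h2 z).trans ?_
      rw [LinearMap.comp_apply, LinearMap.comp_apply, h0, map_zero, map_zero]
    obtain ⟨η, hη⟩ := exists_lTensor_ne_zero (z := TensorProduct.comm k _ _ _)
      ((TensorProduct.comm k (X i) W).map_ne_zero_iff.2 h1)
    obtain ⟨j, F', hF'⟩ := h'.cogen _ hη
    refine ⟨(i, j), F.tensor F', fun h0 => hF' ?_⟩
    have h2 : F'.toLinearMap ∘ₗ (TensorProduct.rid k W).toLinearMap ∘ₗ LinearMap.lTensor W η ∘ₗ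
        (TensorProduct.comm k (X i) W).toLinearMap ∘ₗ LinearMap.rTensor W F.toLinearMap =
        (TensorProduct.rid k (Y j)).toLinearMap ∘ₗ LinearMap.lTensor (Y j) η ∘ₗ
          (TensorProduct.comm k (X i) (Y j)).toLinearMap ∘ₗ
          TensorProduct.map F.toLinearMap F'.toLinearMap :=
      TensorProduct.ext' fun v t => by simp
    refine (LinearMap.congr_fun h2 z).trans ?_
    have h3 : TensorProduct.map F.toLinearMap F'.toLinearMap z = 0 := h0
    simp only [LinearMap.comp_apply, h3, map_zero]
  gen ζ hζ := by
    have h1 : ∃ v t, ζ (v ⊗ₜ[k] t) ≠ 0 := by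
      by_contra! h1
      exact hζ (TensorProduct.ext' h1)
    obtain ⟨v, t, hvt⟩ := h1
    obtain ⟨i, F, hF⟩ := h.gen (ζ ∘ₗ (TensorProduct.mk k V W).flip t) fun h0 =>
      hvt (LinearMap.congr_fun h0 v)
    obtain ⟨x, hx⟩ : ∃ x, ζ (F.toLinearMap x ⊗ₜ[k] t) ≠ 0 := by
      by_contra! h1
      exact hF (LinearMap.ext h1)
    obtain ⟨j, F', hF'⟩ := h'.gen (ζ ∘ₗ TensorProduct.mk k V W (F.toLinearMap x)) fun h0 =>
      hx (LinearMap.congr_fun h0 t)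
    refine ⟨(i, j), F.tensor F', fun h0 => hF' (LinearMap.ext fun y => ?_)⟩
    exact LinearMap.congr_fun h0 (x ⊗ₜ[k] y)

end hom_tensor

section hom_dual

variable {k : Type u} [Field k] {G : SuperMonoid.{u, a, b} k} {V : SuperSpace.{u, w} k}
  {W : SuperSpace.{u, w'} k}

theorem superPair_rTensor_dualMap (A : SCommAlg.{u, a} k) {F : V →ₗ[k] W}
    (hF : ∀ i, ∀ v ∈ V.gr i, F v ∈ W.gr i) (s : W.dual ⊗[k] A) (t : V ⊗[k] A) :
    superPair V A (LinearMap.rTensor A F.dualMap s ⊗ₜ[k] t) =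
      superPair W A (s ⊗ₜ[k] LinearMap.rTensor A F t) := by
  have h : superPair V A ∘ₗ LinearMap.rTensor _ (LinearMap.rTensor A F.dualMap) =
      superPair W A ∘ₗ LinearMap.lTensor _ (LinearMap.rTensor A F) := by
    refine TensorProduct.ext (superMul_gr_ext W.dual A fun i j ξ hξ x hx =>
      superMul_gr_ext V A fun l m v hv y hy => ?_)
    simp only [LinearMap.compr₂ₛₗ_apply, TensorProduct.mk_apply, LinearMap.comp_apply,
      LinearMap.rTensor_tmul, LinearMap.lTensor_tmul]
    rw [superPair_tmul V A _ hx hv, superPair_tmul W A ξ hx (hF _ _ hv)]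
    rfl
  exact LinearMap.congr_fun h (s ⊗ₜ[k] t)

/-- The pairing of a representation with its dual is invariant. -/
theorem Rep.superPair_dual_act (hG : G.IsGroup) (ρ : Rep G V) {A : SCommAlg.{u, a} k} (g : G.pts A)
    (s : V.dual ⊗[k] A) (t : V ⊗[k] A) :
    superPair V A (((ρ.dual hG).act A g).1 s ⊗ₜ[k] (ρ.act A g).1 t) =
      superPair V A (s ⊗ₜ[k] t) := by
  have := ρ.finite
  change superPair V A (dualEnd V A (ρ.act A (hG.inv g)) s ⊗ₜ[k] (ρ.act A g).1 t) = _
  rw [superPair_dualEnd]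
  change superPair V A (s ⊗ₜ[k] (ρ.act A (hG.inv g) * ρ.act A g).1 t) = _
  have h : hG.inv g * g = 1 := IsUnit.val_inv_mul (hG A g)
  rw [← map_mul, h, map_one]
  rfl

theorem Rep.act_surjective (hG : G.IsGroup) (ρ : Rep G V) {A : SCommAlg.{u, a} k} (g : G.pts A)
    (t : V ⊗[k] A) : ∃ t', (ρ.act A g).1 t' = t := by
  refine ⟨(ρ.act A (hG.inv g)).1 t, ?_⟩
  change (ρ.act A g * ρ.act A (hG.inv g)).1 t = t
  rw [← map_mul, hG.mul_inv, map_one]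
  rfl

/-- The transpose of a homomorphism of representations. -/
noncomputable def Rep.Hom.dual (hG : G.IsGroup) {ρ : Rep G V} {σ : Rep G W} (F : ρ.Hom σ) :
    (σ.dual hG).Hom (ρ.dual hG) where
  toLinearMap := F.toLinearMap.dualMap
  map_gr i ξ hξ := by
    refine (Submodule.mem_dualAnnihilator _).2 fun v hv => ?_
    exact (Submodule.mem_dualAnnihilator ξ).1 hξ _ (F.map_gr _ _ hv)
  map_act A g s := by
    have := ρ.finite
    refine superPair_ext fun t => ?_
    obtain ⟨t, rfl⟩ := Rep.act_surjective hG ρ g t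
    rw [superPair_rTensor_dualMap A F.map_gr, F.map_act, Rep.superPair_dual_act,
      Rep.superPair_dual_act, superPair_rTensor_dualMap A F.map_gr]

/-- Detection is compatible with duals: homomorphisms to and from the representations are exchanged
by transposition. -/
theorem Rep.DetectedBy.dual (hG : G.IsGroup) {I : Type*} {X : I → SuperSpace.{u, u} k} {ρ : Rep G V}
    {R : ∀ i, Rep G (X i)} (h : ρ.DetectedBy R) :
    (ρ.dual hG).DetectedBy fun i => (R i).dual hG where
  cogen ξ hξ := by
    obtain ⟨i, F, hF⟩ := h.gen ξ hξ
    exact ⟨i, F.dual hG, hF⟩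
  gen ζ hζ := by
    have := ρ.finite
    obtain ⟨v, rfl⟩ := (Module.evalEquiv k V).surjective ζ
    have hv : v ≠ 0 := by
      rintro rfl
      exact hζ (map_zero _)
    obtain ⟨i, F, hF⟩ := h.cogen v hv
    refine ⟨i, F.dual hG, fun h0 => hF ?_⟩
    rw [← Module.forall_dual_apply_eq_zero_iff k]
    intro η
    exact LinearMap.congr_fun h0 η

end hom_dual

section direct_sum

variable {k : Type u} [Field k] {G : SuperMonoid.{u, a, b} k} {V : SuperSpace.{u, w} k}
  {ρ : Rep G V}

/-- The homomorphism to a direct sum with given components. -/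
noncomputable def Rep.Hom.pi {N : ℕ} {X : Fin N → SuperSpace.{u, w'} k} {σ : ∀ i, Rep G (X i)}
    (F : ∀ i, ρ.Hom (σ i)) : ρ.Hom (Rep.directSum σ) where
  toLinearMap := LinearMap.pi fun i => (F i).toLinearMap
  map_gr d v hv i _ := (F i).map_gr d v hv
  map_act A g z := by
    have h : ∀ z : V ⊗[k] A, LinearMap.rTensor A (LinearMap.pi fun i => (F i).toLinearMap) z =
        ∑ i, LinearMap.rTensor A (LinearMap.single k (fun i => (X i : Type w')) i)
          (LinearMap.rTensor A (F i).toLinearMap z) := by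
      intro z
      have h1 : (LinearMap.pi fun i => (F i).toLinearMap) =
          ∑ i, LinearMap.single k (fun i => (X i : Type w')) i ∘ₗ (F i).toLinearMap := by
        ext v i
        simp [LinearMap.sum_apply, Finset.sum_apply]
      rw [h1, ← LinearMap.coe_rTensorHom, map_sum, LinearMap.sum_apply]
      exact Finset.sum_congr rfl fun i _ => LinearMap.rTensor_comp_apply ..
    rw [h, h, map_sum]
    refine Finset.sum_congr rfl fun i _ => ?_
    rw [(F i).map_act]
    exact (sumEnd_single X A (fun i => (σ i).act A g) i _).symm

/-- The homomorphism from a direct sum with given components. -/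
noncomputable def Rep.Hom.desc {N : ℕ} {X : Fin N → SuperSpace.{u, w'} k} {σ : ∀ i, Rep G (X i)}
    (F : ∀ i, (σ i).Hom ρ) : (Rep.directSum σ).Hom ρ where
  toLinearMap := ∑ i, (F i).toLinearMap ∘ₗ LinearMap.proj i
  map_gr d x hx := by
    rw [LinearMap.sum_apply]
    exact Submodule.sum_mem _ fun i _ => (F i).map_gr d _ (hx i trivial)
  map_act A g z := by
    have h : ∀ i (z : X i ⊗[k] A), LinearMap.rTensor A (∑ i, (F i).toLinearMap ∘ₗ LinearMap.proj i)
        (LinearMap.rTensor A (LinearMap.single k (fun i => (X i : Type w')) i) z) =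
        LinearMap.rTensor A (F i).toLinearMap z := by
      intro i z
      rw [← LinearMap.rTensor_comp_apply]
      congr 2
      ext x
      rw [LinearMap.comp_apply, LinearMap.sum_apply, Finset.sum_eq_single i]
      · simp
      · intro j _ hj
        simp [hj]
      · exact fun h => absurd (Finset.mem_univ i) h
    have h1 : LinearMap.rTensor A (∑ i, (F i).toLinearMap ∘ₗ LinearMap.proj i) ∘ₗ
        sumEnd X A (fun i => (σ i).act A g) = (ρ.act A g).1 ∘ₗ
        LinearMap.rTensor A (∑ i, (F i).toLinearMap ∘ₗ LinearMap.proj i) := by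
      refine sum_hom_ext fun i z => ?_
      rw [LinearMap.comp_apply, LinearMap.comp_apply, sumEnd_single, h, h, (F i).map_act]
    exact LinearMap.congr_fun h1 z

variable {I : Type*} {X : I → SuperSpace.{u, w'} k} {R : ∀ i, Rep G (X i)}

/-- A detected representation embeds in a finite direct sum. -/
theorem Rep.DetectedBy.exists_injective (h : ρ.DetectedBy R) :
    ∃ (N : ℕ) (i : Fin N → I) (F : ρ.Hom (Rep.directSum fun j => R (i j))),
      Function.Injective F.toLinearMap := by
  classical
  have := ρ.finite
  let K : Finset (Σ i, ρ.Hom (R i)) → Submodule k V := fun s =>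
    ⨅ q ∈ s, LinearMap.ker q.2.toLinearMap
  -- A finite set of homomorphisms whose common kernel is minimal; this kernel vanishes.
  obtain ⟨s, -, hs⟩ := (InvImage.wf K (wellFounded_lt (α := Submodule k V))).has_min Set.univ
    ⟨∅, trivial⟩
  refine ⟨s.card, fun j => (s.equivFin.symm j).1.1,
    Rep.Hom.pi fun j => (s.equivFin.symm j).1.2, ?_⟩
  rw [← LinearMap.ker_eq_bot, Submodule.eq_bot_iff]
  intro v hv
  by_contra hv0
  obtain ⟨i, F, hF⟩ := h.cogen v hv0
  have hvK : v ∈ K s := by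
    simp only [K, Submodule.mem_iInf, LinearMap.mem_ker]
    intro q hq
    have h1 := congrFun (LinearMap.mem_ker.1 hv) (s.equivFin ⟨q, hq⟩)
    have h2 : (s.equivFin.symm (s.equivFin ⟨q, hq⟩)).1.2.toLinearMap v = 0 := h1
    rwa [Equiv.symm_apply_apply] at h2
  refine hs (insert ⟨i, F⟩ s) trivial (lt_of_le_of_ne ?_ ?_)
  · exact biInf_mono fun q hq => Finset.mem_insert_of_mem hq
  · intro h1
    have h2 : v ∈ K (insert ⟨i, F⟩ s) := h1 ▸ hvK
    simp only [K, Submodule.mem_iInf, LinearMap.mem_ker] at h2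
    exact hF (h2 ⟨i, F⟩ (Finset.mem_insert_self _ _))

/-- A detected representation is a quotient of a finite direct sum. -/
theorem Rep.DetectedBy.exists_surjective (h : ρ.DetectedBy R) :
    ∃ (N : ℕ) (i : Fin N → I) (F : (Rep.directSum fun j => R (i j)).Hom ρ),
      Function.Surjective F.toLinearMap := by
  classical
  have := ρ.finite
  let K : Finset (Σ i, (R i).Hom ρ) → Submodule k V := fun s =>
    ⨆ q ∈ s, LinearMap.range q.2.toLinearMap
  -- A finite set of homomorphisms for which the sum of the images is maximal.
  obtain ⟨s, -, hs⟩ := (InvImage.wf K (wellFounded_gt (α := Submodule k V))).has_min Set.univ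
    ⟨∅, trivial⟩
  refine ⟨s.card, fun j => (s.equivFin.symm j).1.1,
    Rep.Hom.desc fun j => (s.equivFin.symm j).1.2, ?_⟩
  rw [← LinearMap.range_eq_top]
  by_contra hne
  have hK : K s ≤ LinearMap.range (Rep.Hom.desc fun j => (s.equivFin.symm j).1.2).toLinearMap := by
    refine iSup₂_le fun q hq => ?_
    obtain ⟨j, rfl⟩ : ∃ j, (s.equivFin.symm j).1 = q :=
      ⟨s.equivFin ⟨q, hq⟩, by rw [Equiv.symm_apply_apply]⟩
    rintro _ ⟨x, rfl⟩
    refine ⟨Pi.single j x, ?_⟩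
    change (∑ i, (s.equivFin.symm i).1.2.toLinearMap ∘ₗ LinearMap.proj i) (Pi.single j x) = _
    rw [LinearMap.sum_apply, Finset.sum_eq_single j]
    · simp
    · intro i _ hi
      simp [hi]
    · exact fun h => absurd (Finset.mem_univ j) h
  obtain ⟨ξ, hξ, hξK⟩ := Submodule.exists_le_ker_of_lt_top (K s)
    (lt_of_le_of_ne le_top fun h1 => hne (top_le_iff.1 (h1 ▸ hK)))
  obtain ⟨i, F, hF⟩ := h.gen ξ hξ
  refine hs (insert ⟨i, F⟩ s) trivial (lt_of_le_of_ne ?_ ?_)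
  · exact biSup_mono fun q hq => Finset.mem_insert_of_mem hq
  · intro h1
    refine hF (LinearMap.ext fun x => LinearMap.mem_ker.1 (hξK (h1 ▸ ?_)))
    exact Submodule.mem_iSup_of_mem ⟨i, F⟩
      (Submodule.mem_iSup_of_mem (Finset.mem_insert_self _ _) ⟨x, rfl⟩)

end direct_sum

/-! ### Representations of `M` and tensor powers of the standard representations -/

section word_algebra

variable {k : Type u} [Field k] {ι : Type} [Fintype ι] [DecidableEq ι] {p : ι → ZMod 2}
  {κ : Type*} {β : ι → κ} {G : SuperMonoid.{u, a, b} k} (χ : BlockHom G p β)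

/-- The entries of the tensor powers of the matrices given by `χ`, as functions. -/
def BlockHom.wordFn (x : Σ d : ℕ, (Fin d → ι) × (Fin d → ι)) : G.Fn := fun A g =>
  wordMat p (fun _ : Fin x.1 => (χ.app A g).1) x.2.1 x.2.2

theorem BlockHom.wordFn_mul {d d' : ℕ} (s t : Fin d → ι) (s' t' : Fin d' → ι) :
    ∃ c : k, χ.wordFn ⟨d, s, t⟩ * χ.wordFn ⟨d', s', t'⟩ =
      c • χ.wordFn ⟨d + d', Fin.append s s', Fin.append t t'⟩ := by
  refine ⟨wordSgn k p s t * wordSgn k p s' t' *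
    wordSgn k p (Fin.append s s') (Fin.append t t'), ?_⟩
  ext A g
  have h : (List.ofFn fun i => (χ.app A g).1 (Fin.append s s' i) (Fin.append t t' i)) =
      (List.ofFn fun i => (χ.app A g).1 (s i) (t i)) ++
        List.ofFn fun i => (χ.app A g).1 (s' i) (t' i) := by
    rw [← List.ofFn_fin_append]
    congr 1
    funext i
    refine Fin.addCases (fun i => ?_) (fun i => ?_) i <;> simp
  change wordMat p (fun _ => (χ.app A g).1) s t * wordMat p (fun _ => (χ.app A g).1) s' t' =
    (_ : k) • wordMat p (fun _ => (χ.app A g).1) (Fin.append s s') (Fin.append t t')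
  rw [wordMat_apply, wordMat_apply, wordMat_apply, smul_smul, h, List.prod_append, mul_assoc,
    wordSgn_mul_self, mul_one, smul_mul_smul_comm]

/-- The entries of the tensor powers span the algebra generated by the entries of the matrices. -/
theorem BlockHom.adjoin_le_span :
    Subalgebra.toSubmodule (Algebra.adjoin k
      (Set.range fun (x : ι × ι) A g => (χ.app A g).1 x.1 x.2)) ≤
      Submodule.span k (Set.range χ.wordFn) := by
  intro f hf
  rw [Subalgebra.mem_toSubmodule] at hf
  induction hf using Algebra.adjoin_induction with
  | mem f hf' =>
    obtain ⟨⟨s, t⟩, rfl⟩ := hf'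
    have h : (fun A g => (χ.app A g).1 s t : G.Fn) =
        wordSgn k p (fun _ : Fin 1 => s) (fun _ => t) • χ.wordFn ⟨1, fun _ => s, fun _ => t⟩ := by
      ext A g
      change _ = (_ : k) • wordMat p (fun _ : Fin 1 => (χ.app A g).1) (fun _ => s) (fun _ => t)
      rw [wordMat_apply, smul_smul, wordSgn_mul_self, one_smul]
      simp
    exact (congrArg (· ∈ _) h).mpr (Submodule.smul_mem _ _ (Submodule.subset_span ⟨_, rfl⟩))
  | algebraMap c =>
    rw [Algebra.algebraMap_eq_smul_one]
    exact Submodule.smul_mem _ _ (Submodule.subset_span ⟨⟨0, Fin.elim0, Fin.elim0⟩, rfl⟩)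
  | add f f' hf hf' h h' => exact Submodule.add_mem _ h h'
  | mul f f' hf hf' h h' =>
    have h1 := Submodule.mul_mem_mul h h'
    rw [Submodule.span_mul_span] at h1
    refine Submodule.span_le.2 ?_ h1
    rintro _ ⟨_, ⟨⟨d, s, t⟩, rfl⟩, _, ⟨⟨d', s', t'⟩, rfl⟩, rfl⟩
    obtain ⟨c, hc⟩ := χ.wordFn_mul s t s' t'
    refine (congrArg (· ∈ _) hc).mpr ?_
    exact Submodule.smul_mem _ _ (Submodule.subset_span ⟨_, rfl⟩)

/-- If the matrix coefficients of `ρ` are polynomials in the entries of the matrices given by `χ`,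
they are combinations of the entries of the tensor powers. -/
theorem BlockHom.exists_expands {V : SuperSpace.{u, w} k} (ρ : Rep G V) {J : Type*} [Fintype J]
    (bV : Module.Basis J k V)
    (h : ∀ x y, ρ.coef (bV.coord x) (bV y) ∈ Algebra.adjoin k
      (Set.range fun (x : ι × ι) A g => (χ.app A g).1 x.1 x.2)) :
    ∃ L S, χ.Expands ρ L bV S := by
  classical
  choose c hc using fun x y => (Finsupp.mem_span_range_iff_exists_finsupp.1
    (χ.adjoin_le_span (h x y)))
  refine ⟨fun x y d s t => c x y ⟨d, s, t⟩, Finset.univ.biUnion fun x : J =>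
    Finset.univ.biUnion fun y : J => (c x y).support.image Sigma.fst, fun x y A g => ?_⟩
  rw [← hc]
  generalize hS : (Finset.univ.biUnion fun x : J =>
    Finset.univ.biUnion fun y : J => (c x y).support.image Sigma.fst) = S
  have h1 : (c x y).support ⊆ S.sigma fun _ => Finset.univ := by
    intro q hq
    rw [Finset.mem_sigma, ← hS]
    exact ⟨Finset.mem_biUnion.2 ⟨x, Finset.mem_univ _, Finset.mem_biUnion.2 ⟨y, Finset.mem_univ _,
      Finset.mem_image_of_mem _ hq⟩⟩, Finset.mem_univ _⟩
  have h2 := Finsupp.sum_of_support_subset (c x y) h1 (fun q r => r • χ.wordFn q)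
    fun _ _ => zero_smul _ _
  rw [Finset.sum_sigma] at h2
  refine (congrFun (congrFun h2 A) g).trans ?_
  rw [Finset.sum_apply, Finset.sum_apply]
  refine Finset.sum_congr rfl fun d _ => ?_
  rw [Finset.sum_apply, Finset.sum_apply, Fintype.sum_prod_type]
  rfl

end word_algebra

section blocks

variable (k : Type u) [Field k] {Γ : Type v} (m n : Γ → ℕ) {N : ℕ} (e : Fin N → Γ)

/-- The indices of the block diagonal matrices whose blocks are indexed by the `e i`. -/
abbrev BlockIdx : Type := Σ i : Fin N, Fin (m (e i)) ⊕ Fin (n (e i))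

/-- The degrees of the indices of block diagonal matrices. -/
def blockPar (s : BlockIdx m n e) : ZMod 2 := par (m (e s.1)) (n (e s.1)) s.2

/-- A family on the values of an injective map extends to all indices. -/
theorem exists_extend {P : Γ → Type*} (d : ∀ γ, P γ) {e : Fin N → Γ}
    (he : Function.Injective e) (f : ∀ i, P (e i)) : ∃ g : ∀ γ, P γ, ∀ i, g (e i) = f i := by
  classical
  refine ⟨fun γ => if h : ∃ i, e i = γ then h.choose_spec ▸ f h.choose else d γ, fun i => ?_⟩
  have h : ∃ j, e j = e i := ⟨i, rfl⟩
  refine (dif_pos h).trans ?_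
  have h1 : h.choose = i := he h.choose_spec
  generalize h.choose_spec = h2
  revert h2
  generalize h.choose = j at h1 ⊢
  subst h1
  intro _
  rfl

variable {m n e} in
theorem superMat_ext_block {A : SCommAlg.{u, a} k} {Y Z : Matrix (BlockIdx m n e) (BlockIdx m n e) A}
    (h : ∀ i s t, Y ⟨i, s⟩ ⟨i, t⟩ = Z ⟨i, s⟩ ⟨i, t⟩)
    (hY : ∀ s t, s.1 ≠ t.1 → Y s t = 0) (hZ : ∀ s t, s.1 ≠ t.1 → Z s t = 0) : Y = Z := by
  ext ⟨i, s⟩ ⟨j, t⟩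
  by_cases hij : i = j
  · subst hij
    exact h i s t
  · rw [hY _ _ hij, hZ _ _ hij]

/-- The block diagonal matrices given by finitely many components of a point of `M_{m|n}`. -/
noncomputable def blockMat (A : SCommAlg.{u, a} k) :
    (∀ γ, superMat (par (m γ) (n γ)) A) →* superMat (blockPar m n e) A where
  toFun h := ⟨Matrix.blockDiagonal' fun i => (h (e i)).1, by
    rintro ⟨i, s⟩ ⟨j, t⟩
    by_cases hij : i = j
    · subst hij
      rw [Matrix.blockDiagonal'_apply_eq]
      exact (h (e i)).2 s t
    · rw [Matrix.blockDiagonal'_apply_ne _ _ _ hij]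
      exact zero_mem _⟩
  map_one' := Subtype.ext Matrix.blockDiagonal'_one
  map_mul' g h := Subtype.ext
    (Matrix.blockDiagonal'_mul (fun i => (g (e i)).1) (fun i => (h (e i)).1))

theorem blockMat_apply (A : SCommAlg.{u, a} k) (h : ∀ γ, superMat (par (m γ) (n γ)) A) (i : Fin N)
    (s t : Fin (m (e i)) ⊕ Fin (n (e i))) :
    (blockMat k m n e A h).1 ⟨i, s⟩ ⟨i, t⟩ = (h (e i)).1 s t :=
  Matrix.blockDiagonal'_apply_eq (fun i => (h (e i)).1) i s t

theorem blockMat_apply_ne (A : SCommAlg.{u, a} k) (h : ∀ γ, superMat (par (m γ) (n γ)) A)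
    (s t : BlockIdx m n e) (hst : s.1 ≠ t.1) : (blockMat k m n e A h).1 s t = 0 :=
  Matrix.blockDiagonal'_apply_ne (fun i => (h (e i)).1) _ _ hst

/-- The homomorphism from `M_{m|n}` to block diagonal matrices given by finitely many components. -/
noncomputable def blockHom {e : Fin N → Γ} (he : Function.Injective e) :
    BlockHom (superM.{u, v, a} k m n) (blockPar m n e) (Sigma.fst : BlockIdx m n e → Fin N) where
  app A := blockMat k m n e A
  app_map {A B} f g := by
    refine Subtype.ext (superMat_ext_block k (fun i s t => ?_) (blockMat_apply_ne k m n e B _) ?_)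
    · exact (blockMat_apply k m n e B _ i s t).trans
        (congrArg f.toAlgHom (blockMat_apply k m n e A g i s t).symm)
    · intro s t hst
      exact (congrArg f.toAlgHom (blockMat_apply_ne k m n e A g s t hst)).trans (map_zero _)
  app_eps A := by
    refine Subtype.ext (superMat_ext_block k (fun i s t => ?_) (blockMat_apply_ne k m n e A _) ?_)
    · refine (blockMat_apply k m n e A _ i s t).trans ?_
      change Matrix.diagonal _ s t = Matrix.diagonal _ _ _
      by_cases h : s = t
      · subst h
        rw [Matrix.diagonal_apply_eq, Matrix.diagonal_apply_eq]
        rfl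
      · rw [Matrix.diagonal_apply_ne _ h, Matrix.diagonal_apply_ne]
        simpa using h
    · intro s t hst
      exact Matrix.diagonal_apply_ne _ fun h => hst (congrArg Sigma.fst h)
  app_block A g s t hst := blockMat_apply_ne k m n e A g s t hst
  surj A Z hZ := by
    obtain ⟨g, hg⟩ := exists_extend (P := fun γ => superMat (par (m γ) (n γ)) A) (fun _ => 1) he
      fun i => ⟨fun s t => Z.1 ⟨i, s⟩ ⟨i, t⟩, fun s t => Z.2 ⟨i, s⟩ ⟨i, t⟩⟩
    refine ⟨g, Subtype.ext (superMat_ext_block k (fun i s t => ?_)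
      (blockMat_apply_ne k m n e A _) hZ)⟩
    exact (blockMat_apply k m n e A g i s t).trans (by rw [hg])

end blocks

/-! ### Representations of `M` are detected by tensor products of standard representations -/

section letters

variable {k : Type u} [Field k] {ι : Type} [Fintype ι] [DecidableEq ι] {p : ι → ZMod 2}
  {κ : Type*} {β : ι → κ}

/-- The representation given by the matrices of `χ`. -/
noncomputable def BlockHom.letterRep {G : SuperMonoid.{u, a, b} k} (χ : BlockHom G p β) :
    Rep G (SuperSpace.free k p) :=
  matRep (V := SuperSpace.free k p) (p := p) (Pi.basisFun k ι)
    (fun s => by rw [Pi.basisFun_apply]; exact single_mem_free p s) χ.app χ.app_map χ.app_eps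

theorem BlockHom.letterRep_act {G : SuperMonoid.{u, a, b} k} (χ : BlockHom G p β)
    (A : SCommAlg.{u, a} k) (g : G.pts A) (t : ι) :
    (χ.letterRep.act A g).1 ((Pi.single t 1 : ι → k) ⊗ₜ[k] 1) =
      ∑ s, (Pi.single s 1 : ι → k) ⊗ₜ[k] (χ.app A g).1 s t := by
  have h := matRep_act (V := SuperSpace.free k p) (p := p) (Pi.basisFun k ι)
    (fun s => by rw [Pi.basisFun_apply]; exact single_mem_free p s) χ.app χ.app_map χ.app_eps A g t
  simp only [Pi.basisFun_apply] at h
  exact h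

variable [CharZero k] {G : SuperMonoid.{u, max u v, b} k} (χ : BlockHom G p β)

/-- The words of length `0` give the trivial representation. -/
theorem BlockHom.exists_hom_unit :
    ∃ F : (χ.wordRep 0).Hom (Rep.unit G), Function.Bijective F.toLinearMap := by
  refine ⟨Rep.Hom.ofBasis (Pi.basisFun k _) (LinearMap.proj (default : Fin 0 → ι)) fun A g t => ?_,
    fun f f' h => funext fun s => ?_, fun c => ⟨fun _ => c, rfl⟩⟩
  · obtain rfl := Subsingleton.elim t default
    rw [Pi.basisFun_apply, χ.wordRep_act, Fintype.sum_unique]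
    rfl
  · obtain rfl := Subsingleton.elim s default
    exact h

/-- The words of length `d + 1` give the tensor product of the letters with the words of length `d`.
-/
theorem BlockHom.exists_hom_succ (d : ℕ) :
    ∃ F : (χ.letterRep.tensor (χ.wordRep d)).Hom (χ.wordRep (d + 1)),
      Function.Bijective F.toLinearMap := by
  let b := (Pi.basisFun k ι).tensorProduct (Pi.basisFun k (Fin d → ι))
  let F := b.equiv (Pi.basisFun k (Fin (d + 1) → ι)) (Fin.consEquiv fun _ => ι)
  have hF : ∀ r l, F ((Pi.single r 1 : ι → k) ⊗ₜ[k] (Pi.single l 1 : (Fin d → ι) → k)) =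
      (Pi.single (Fin.cons r l) 1 : (Fin (d + 1) → ι) → k) := by
    intro r l
    have h := b.equiv_apply (r, l) (Pi.basisFun k (Fin (d + 1) → ι)) (Fin.consEquiv fun _ => ι)
    rw [Module.Basis.tensorProduct_apply, Pi.basisFun_apply, Pi.basisFun_apply,
      Pi.basisFun_apply] at h
    exact h
  refine ⟨Rep.Hom.ofBasis b F.toLinearMap fun A g ⟨r, l⟩ => ?_, F.bijective⟩
  have h1 : b (r, l) = (Pi.single r 1 : ι → k) ⊗ₜ[k] (Pi.single l 1 : (Fin d → ι) → k) := by
    rw [Module.Basis.tensorProduct_apply, Pi.basisFun_apply, Pi.basisFun_apply]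
  have h3 : ((χ.letterRep.tensor (χ.wordRep d)).act A g).1
      (((Pi.single r 1 : ι → k) ⊗ₜ[k] (Pi.single l 1 : (Fin d → ι) → k)) ⊗ₜ[k] 1) =
      superMul _ _ A ((χ.letterRep.act A g).1 ((Pi.single r 1 : ι → k) ⊗ₜ[k] 1) ⊗ₜ[k]
        ((χ.wordRep d).act A g).1 ((Pi.single l 1 : (Fin d → ι) → k) ⊗ₜ[k] 1)) := by
    rw [← Rep.tensor_act]
    exact congrArg _ (superMul_one (SuperSpace.free k p) _ A _ _ 1).symm
  rw [χ.letterRep_act, χ.wordRep_act] at h3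
  rw [h1, LinearEquiv.coe_coe, hF, χ.wordRep_act, sum_words]
  refine (congrArg _ h3).trans ?_
  simp only [TensorProduct.sum_tmul, TensorProduct.tmul_sum, map_sum]
  refine Finset.sum_comm.trans (Finset.sum_congr rfl fun x _ => Finset.sum_congr rfl fun s _ => ?_)
  have h2 := superMul_tmul (SuperSpace.free k p) (SuperSpace.free k fun s : Fin d → ι => wpar p s) A
    (Pi.single x 1 : ι → k) ((χ.app A g).2 x r)
    (single_mem_free (fun s : Fin d → ι => wpar p s) s)
    (wordMat p (fun _ => (χ.app A g).1) s l)
  refine (congrArg _ h2).trans ?_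
  rw [map_smul, LinearMap.rTensor_tmul, LinearEquiv.coe_coe, hF, wordMat_succ,
    TensorProduct.tmul_smul]
  rfl

theorem BlockHom.wordRep_detectedBy {I : Type*} {X : I → SuperSpace.{u, u} k}
    {R : ∀ i, Rep G (X i)} (h : χ.letterRep.DetectedBy R) (d : ℕ) :
    (χ.wordRep d).DetectedBy (Rep.tensorList R) := by
  induction d with
  | zero =>
    obtain ⟨F, hF⟩ := χ.exists_hom_unit
    exact Rep.detectedBy_of_bijective (R := Rep.tensorList R) (i := []) F hF
  | succ d ih =>
    obtain ⟨F, hF⟩ := χ.exists_hom_succ d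
    have h1 := (Rep.detectedBy_of_bijective (R := fun _ : Unit => χ.letterRep.tensor (χ.wordRep d))
      (i := ()) (F.inv hF) (LinearEquiv.ofBijective F.toLinearMap hF).symm.bijective)
    refine (h1.trans fun _ => h.tensor ih).trans fun i => ?_
    exact Rep.detectedBy_self (R := Rep.tensorList R) (i.1 :: i.2)

end letters

section standard

variable {k : Type u} [Field k] {Γ : Type v} {m n : Γ → ℕ}

theorem stdRep_act (γ : Γ) (A : SCommAlg.{u, a} k) (g : (superM.{u, v, a} k m n).pts A)
    (t : Fin (m γ) ⊕ Fin (n γ)) :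
    ((stdRep k m n γ).act A g).1 ((Pi.single t 1 : Fin (m γ) ⊕ Fin (n γ) → k) ⊗ₜ[k] 1) =
      ∑ s, (Pi.single s 1 : Fin (m γ) ⊕ Fin (n γ) → k) ⊗ₜ[k] (g γ).1 s t := by
  refine (matEnd_single _ A _ t 1).trans ?_
  simp only [mul_one]
  rfl

section inclusion

variable [CharZero k] {N : ℕ} {e : Fin N → Γ} (he : Function.Injective e)

/-- The inclusion of a block is a homomorphism from the standard representation. -/
theorem blockHom_exists_incl (i : Fin N) :
    ∃ F : (stdRep k m n (e i)).Hom (blockHom.{u, v, max u v} k m n he).letterRep,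
      ∀ a, F.toLinearMap (Pi.single a 1) = (Pi.single ⟨i, a⟩ 1 : BlockIdx m n e → k) := by
  let F : (Fin (m (e i)) ⊕ Fin (n (e i)) → k) →ₗ[k] BlockIdx m n e → k :=
    (Pi.basisFun k _).constr k fun a => Pi.single ⟨i, a⟩ 1
  have hF : ∀ a, F (Pi.single a 1) = (Pi.single ⟨i, a⟩ 1 : BlockIdx m n e → k) := by
    intro a
    rw [← Pi.basisFun_apply]
    exact (Pi.basisFun k _).constr_basis k _ a
  refine ⟨Rep.Hom.ofBasis (Pi.basisFun k _) F fun A g a => ?_, hF⟩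
  rw [Pi.basisFun_apply, stdRep_act, hF, BlockHom.letterRep_act, map_sum, Fintype.sum_sigma,
    Finset.sum_eq_single i]
  · refine Finset.sum_congr rfl fun s _ => ?_
    rw [LinearMap.rTensor_tmul, hF]
    exact congrArg _ (blockMat_apply k m n e A g i s a).symm
  · intro j _ hj
    refine Finset.sum_eq_zero fun s _ => ?_
    refine (congrArg _ (blockMat_apply_ne k m n e A g ⟨j, s⟩ ⟨i, a⟩ hj)).trans ?_
    exact TensorProduct.tmul_zero _ _
  · exact fun h => absurd (Finset.mem_univ i) h

/-- The projection to a block is a homomorphism to the standard representation. -/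
theorem blockHom_exists_proj (i : Fin N) :
    ∃ F : (blockHom.{u, v, max u v} k m n he).letterRep.Hom (stdRep k m n (e i)),
      ∀ (f : BlockIdx m n e → k) a, F.toLinearMap f a = f ⟨i, a⟩ := by
  let F : (BlockIdx m n e → k) →ₗ[k] Fin (m (e i)) ⊕ Fin (n (e i)) → k :=
    LinearMap.funLeft k k fun a => ⟨i, a⟩
  have h1 : ∀ a, F (Pi.single ⟨i, a⟩ 1) = Pi.single a 1 := by
    intro a
    ext b
    simp [F, LinearMap.funLeft_apply, Pi.single_apply]
  have h2 : ∀ j a, j ≠ i → F (Pi.single ⟨j, a⟩ 1) = 0 := by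
    intro j a hj
    ext b
    exact Pi.single_eq_of_ne (fun h => hj (congrArg Sigma.fst h).symm) _
  refine ⟨Rep.Hom.ofBasis (Pi.basisFun k _) F fun A g ⟨j, a⟩ => ?_, fun f a => rfl⟩
  rw [Pi.basisFun_apply, BlockHom.letterRep_act, map_sum, Fintype.sum_sigma,
    Finset.sum_eq_single i]
  · by_cases hj : j = i
    · subst hj
      rw [h1, stdRep_act]
      refine Finset.sum_congr rfl fun s _ => ?_
      rw [LinearMap.rTensor_tmul, h1]
      exact congrArg _ (blockMat_apply k m n e A g j s a)
    · rw [h2 j a hj, TensorProduct.zero_tmul, map_zero]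
      refine Finset.sum_eq_zero fun s _ => ?_
      rw [LinearMap.rTensor_tmul]
      refine (congrArg _ (blockMat_apply_ne k m n e A g ⟨i, s⟩ ⟨j, a⟩ (Ne.symm hj))).trans ?_
      exact TensorProduct.tmul_zero _ _
  · intro l _ hl
    refine Finset.sum_eq_zero fun s _ => ?_
    rw [LinearMap.rTensor_tmul, h2 l s hl, TensorProduct.zero_tmul]
  · exact fun h => absurd (Finset.mem_univ i) h

theorem blockHom_letterRep_detectedBy :
    (blockHom.{u, v, max u v} k m n he).letterRep.DetectedBy (stdRep k m n) where
  cogen f hf := by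
    obtain ⟨⟨i, a⟩, h⟩ := Function.ne_iff.1 hf
    obtain ⟨F, hF⟩ := blockHom_exists_proj (k := k) (m := m) (n := n) he i
    exact ⟨e i, F, fun h0 => h ((hF f a).symm.trans (congrFun h0 a))⟩
  gen ξ hξ := by
    obtain ⟨⟨i, a⟩, h⟩ : ∃ s, ξ (Pi.single s 1) ≠ 0 := by
      by_contra! h
      exact hξ ((Pi.basisFun k _).ext fun s => by rw [Pi.basisFun_apply, h]; rfl)
    obtain ⟨F, hF⟩ := blockHom_exists_incl (k := k) (m := m) (n := n) he i
    refine ⟨e i, F, fun h0 => h ?_⟩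
    rw [← hF]
    exact LinearMap.congr_fun h0 _

end inclusion

/-- A polynomial in the entries of the matrices involves finitely many indices `γ`. -/
theorem exists_finset_adjoin {f : (superM.{u, v, a} k m n).Fn}
    (hf : f ∈ Algebra.adjoin k (Set.range (entryFn k m n))) :
    ∃ T : Finset Γ, f ∈ Algebra.adjoin k (entryFn k m n '' {x | x.1 ∈ T}) := by
  classical
  have hmono : ∀ {T T' : Finset Γ}, T ⊆ T' → Algebra.adjoin k (entryFn k m n '' {x | x.1 ∈ T}) ≤
      Algebra.adjoin k (entryFn.{u, v, a} k m n '' {x | x.1 ∈ T'}) := fun h =>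
    Algebra.adjoin_mono (Set.image_mono fun x hx => h hx)
  induction hf using Algebra.adjoin_induction with
  | mem f hf =>
    obtain ⟨x, rfl⟩ := hf
    exact ⟨{x.1}, Algebra.subset_adjoin ⟨x, Finset.mem_singleton_self _, rfl⟩⟩
  | algebraMap c => exact ⟨∅, Subalgebra.algebraMap_mem _ c⟩
  | add f f' _ _ h h' =>
    obtain ⟨T, h⟩ := h
    obtain ⟨T', h'⟩ := h'
    exact ⟨T ∪ T', Subalgebra.add_mem _ (hmono Finset.subset_union_left h)
      (hmono Finset.subset_union_right h')⟩
  | mul f f' _ _ h h' =>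
    obtain ⟨T, h⟩ := h
    obtain ⟨T', h'⟩ := h'
    exact ⟨T ∪ T', Subalgebra.mul_mem _ (hmono Finset.subset_union_left h)
      (hmono Finset.subset_union_right h')⟩

/-- The representations of `M_{m|n}` are detected by the tensor products of standard
representations. -/
theorem superM_detectedBy [CharZero k] {V : SuperSpace.{u, w} k}
    (ρ : Rep (superM.{u, v, max u v} k m n) V) :
    ρ.DetectedBy (Rep.tensorList (stdRep k m n)) := by
  classical
  have := ρ.finite
  let bV := Module.finBasis k V
  choose T hT using fun x y =>
    exists_finset_adjoin (superM_natFn_le k m n (ρ.coef_mem (bV.coord x) (bV y)))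
  let S : Finset Γ := Finset.univ.biUnion fun x => Finset.univ.biUnion fun y => T x y
  let e : Fin S.card → Γ := fun i => (S.equivFin.symm i).1
  have he : Function.Injective e := Subtype.val_injective.comp S.equivFin.symm.injective
  let χ := blockHom.{u, v, max u v} k m n he
  obtain ⟨L, S', hL⟩ := χ.exists_expands ρ bV fun x y => by
    refine Algebra.adjoin_mono ?_ (hT x y)
    rintro _ ⟨⟨γ, s, t⟩, hγ, rfl⟩
    obtain ⟨i, rfl⟩ : ∃ i, e i = γ := by
      have hS : γ ∈ S := Finset.mem_biUnion.2 ⟨x, Finset.mem_univ _,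
        Finset.mem_biUnion.2 ⟨y, Finset.mem_univ _, hγ⟩⟩
      exact ⟨S.equivFin ⟨γ, hS⟩, by simp only [e, Equiv.symm_apply_apply]⟩
    refine ⟨(⟨i, s⟩, ⟨i, t⟩), ?_⟩
    funext A g
    exact blockMat_apply k m n e A g i s t
  exact hL.detectedBy.trans fun d =>
    χ.wordRep_detectedBy (blockHom_letterRep_detectedBy he) d

end standard

/-! ### Evaluation and coevaluation, and duals of tensor products -/

section ext

variable {k : Type u} [Field k] {V : SuperSpace.{u, w} k} {W : SuperSpace.{u, w'} k}
  {A : SCommAlg.{u, a} k}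

/-- Linear maps on `(V ⊗ W) ⊗ A` agree if they agree on products of homogeneous elements of `V ⊗ A`
and `W ⊗ A`. -/
theorem superMul_hom_ext {X : Type b} [AddCommGroup X] [Module k X]
    {f g : (V ⊗[k] W) ⊗[k] A →ₗ[k] X}
    (h : ∀ i j, ∀ z ∈ tensorGr V A.toSuperSpace i, ∀ t ∈ tensorGr W A.toSuperSpace j,
      f (superMul V W A (z ⊗ₜ[k] t)) = g (superMul V W A (z ⊗ₜ[k] t))) : f = g := by
  refine TensorProduct.ext (tensor_hom_ext fun i j v hv t ht =>
    A.toSuperSpace.hom_ext fun l x hx => ?_)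
  simp only [LinearMap.compr₂ₛₗ_apply, TensorProduct.mk_apply]
  rw [← superMul_one]
  exact h i (j + l) _ (tmul_mem_zero hv A.one_mem) _ (tmul_mem (W := A.toSuperSpace) ht hx)

theorem dual_apply_eq_zero {i j : ZMod 2} (hij : j ≠ i) {ξ : V.dual} (hξ : ξ ∈ V.dual.gr i) {v : V}
    (hv : v ∈ V.gr j) : ξ v = 0 := by
  have h : i + 1 = j := zmod2_succ fun h' => hij h'.symm
  exact (Submodule.mem_dualAnnihilator ξ).1 hξ v (by rwa [h])

/-- Bilinear maps agree on homogeneous elements of given degrees if they agree on pure tensors of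
these degrees. -/
theorem tensorGr_ext₂ {X : Type b} [AddCommGroup X] [Module k X]
    {f g : V ⊗[k] A →ₗ[k] W ⊗[k] A →ₗ[k] X} {i j : ZMod 2}
    (h : ∀ i₁ i₂, i₁ + i₂ = i → ∀ v ∈ V.gr i₁, ∀ x ∈ A.gr i₂, ∀ j₁ j₂, j₁ + j₂ = j →
      ∀ t ∈ W.gr j₁, ∀ y ∈ A.gr j₂, f (v ⊗ₜ[k] x) (t ⊗ₜ[k] y) = g (v ⊗ₜ[k] x) (t ⊗ₜ[k] y))
    {z : V ⊗[k] A} (hz : z ∈ tensorGr V A.toSuperSpace i) {t : W ⊗[k] A}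
    (ht : t ∈ tensorGr W A.toSuperSpace j) : f z t = g z t := by
  have h1 : Set.EqOn (f.flip t) (g.flip t) (tensorGr V A.toSuperSpace i) := by
    refine LinearMap.eqOn_span ?_
    rintro _ ⟨i₁, i₂, hi, v, hv, x, hx, rfl⟩
    have h2 : Set.EqOn (f (v ⊗ₜ[k] x)) (g (v ⊗ₜ[k] x)) (tensorGr W A.toSuperSpace j) := by
      refine LinearMap.eqOn_span ?_
      rintro _ ⟨j₁, j₂, hj, t, ht, y, hy, rfl⟩
      exact h i₁ i₂ hi v hv x hx j₁ j₂ hj t ht y hy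
    exact h2 ht
  exact h1 hz

end ext

section coev

variable {k : Type u} [Field k] (V : SuperSpace.{u, w} k) (W : SuperSpace.{u, w'} k)
  (A : SCommAlg.{u, a} k)

/-- The contraction `(v ⊗ ω) ⊗ t ↦ ω(t) v`. -/
noncomputable def evRight : (V ⊗[k] W.dual) ⊗[k] W →ₗ[k] V :=
  (TensorProduct.rid k V).toLinearMap ∘ₗ LinearMap.lTensor V (contractLeft k W) ∘ₗ
    (TensorProduct.assoc k V W.dual W).toLinearMap

theorem evRight_tmul (v : V) (ω : W.dual) (t : W) :
    evRight V W ((v ⊗ₜ[k] ω) ⊗ₜ[k] t) = ω t • v := by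
  simp [evRight]

/-- Over `A`, the contraction `evRight` multiplies by the pairing. -/
theorem rTensor_evRight (z : V ⊗[k] A) (s : W.dual ⊗[k] A) (t : W ⊗[k] A) :
    LinearMap.rTensor A (evRight V W)
      (superMul (V.tensor W.dual) W A (superMul V W.dual A (z ⊗ₜ[k] s) ⊗ₜ[k] t)) =
      rmul V A (superPair W A (s ⊗ₜ[k] t)) z := by
  induction z using TensorProduct.induction_on with
  | zero => simp
  | add z z' h h' => simp only [TensorProduct.add_tmul, map_add, h, h']
  | tmul v x =>
    have h : ∀ i, ∀ x ∈ A.gr i, LinearMap.rTensor A (evRight V W) ∘ₗ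
        superMul (V.tensor W.dual) W A ∘ₗ LinearMap.rTensor (W ⊗[k] A)
        (superMul V W.dual A ∘ₗ TensorProduct.mk k _ _ (v ⊗ₜ[k] x)) =
        TensorProduct.mk k V A v ∘ₗ LinearMap.mulLeft k x ∘ₗ superPair W A := by
      intro i x hx
      refine TensorProduct.ext (superMul_gr_ext W.dual A fun j l ω hω y hy =>
        superMul_gr_ext W A fun j' l' t ht c hc => ?_)
      simp only [LinearMap.compr₂ₛₗ_apply, TensorProduct.mk_apply, LinearMap.comp_apply,
        LinearMap.rTensor_tmul, LinearMap.mulLeft_apply]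
      rw [superMul_tmul V W.dual A v hx hω, ← TensorProduct.smul_tmul', map_smul,
        superMul_tmul (V.tensor W.dual) W A _ (A.mul_mem hx hy) ht, map_smul, map_smul,
        LinearMap.rTensor_tmul, evRight_tmul, superPair_tmul W A ω hy ht]
      by_cases hj : j' = j
      · subst hj
        rw [smul_smul, ← sgn_add, mul_smul_comm, TensorProduct.tmul_smul, mul_smul_comm,
          TensorProduct.tmul_smul, TensorProduct.smul_tmul', mul_assoc]
        have h2 : ∀ i l j : ZMod 2, i * j + (i + l) * j = l * j := by decide
        rw [h2]
        simp only [TensorProduct.smul_tmul']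
      · rw [dual_apply_eq_zero hj hω ht]
        simp
    rw [rmul_tmul, ← A.toSuperSpace.pr_add_pr x]
    have h0 := LinearMap.congr_fun (h 0 _ (A.toSuperSpace.pr_mem 0 x)) (s ⊗ₜ[k] t)
    have h1 := LinearMap.congr_fun (h 1 _ (A.toSuperSpace.pr_mem 1 x)) (s ⊗ₜ[k] t)
    simp only [LinearMap.comp_apply, LinearMap.rTensor_tmul, TensorProduct.mk_apply,
      LinearMap.mulLeft_apply] at h0 h1
    simp only [TensorProduct.tmul_add, TensorProduct.add_tmul, map_add, h0, h1, add_mul]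

/-- The contraction `(v ⊗ t) ⊗ ω ↦ (-1) ^ i ω(t) v` for `t` of degree `i`. -/
noncomputable def evParity : (V ⊗[k] W) ⊗[k] W.dual →ₗ[k] V :=
  (TensorProduct.rid k V).toLinearMap ∘ₗ LinearMap.lTensor V (contractRight k W) ∘ₗ
    (TensorProduct.assoc k V W W.dual).toLinearMap ∘ₗ
    LinearMap.rTensor W.dual (LinearMap.lTensor V W.parity)

theorem evParity_tmul (v : V) (ω : W.dual) (t : W) :
    evParity V W ((v ⊗ₜ[k] t) ⊗ₜ[k] ω) = ω (W.parity t) • v := by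
  simp [evParity]

variable {W A} in
/-- Over `A`, the contraction `evParity` multiplies by the pairing of `s` and `t`, which have to be
exchanged. -/
theorem rTensor_evParity {i j : ZMod 2} (z : V ⊗[k] A) {t : W ⊗[k] A}
    (ht : t ∈ tensorGr W A.toSuperSpace i) {s : W.dual ⊗[k] A}
    (hs : s ∈ tensorGr W.dual A.toSuperSpace j) :
    LinearMap.rTensor A (evParity V W)
      (superMul (V.tensor W) W.dual A (superMul V W A (z ⊗ₜ[k] t) ⊗ₜ[k] s)) =
      sgn k (i * j) • rmul V A (superPair W A (s ⊗ₜ[k] t)) z := by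
  induction z using TensorProduct.induction_on with
  | zero => simp
  | add z z' h h' => simp only [TensorProduct.add_tmul, map_add, h, h', smul_add]
  | tmul v x =>
    have h : ∀ l, ∀ x ∈ A.gr l, LinearMap.rTensor A (evParity V W)
        (superMul (V.tensor W) W.dual A (superMul V W A ((v ⊗ₜ[k] x) ⊗ₜ[k] t) ⊗ₜ[k] s)) =
        sgn k (i * j) • (v ⊗ₜ[k] (x * superPair W A (s ⊗ₜ[k] t))) := by
      intro l x hx
      refine tensorGr_ext₂ (f := ((TensorProduct.mk k _ _) ∘ₗ superMul V W A ∘ₗ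
          TensorProduct.mk k _ _ (v ⊗ₜ[k] x)).compr₂ (LinearMap.rTensor A (evParity V W) ∘ₗ
          superMul (V.tensor W) W.dual A)) (g := sgn k (i * j) • ((TensorProduct.mk k _ _).flip.compr₂
          (TensorProduct.mk k V A v ∘ₗ LinearMap.mulLeft k x ∘ₗ superPair W A))) ?_ ht hs
      intro i₁ i₂ hi t ht y hy j₁ j₂ hj ω hω c hc
      simp only [LinearMap.compr₂_apply, TensorProduct.mk_apply, LinearMap.comp_apply,
        LinearMap.smul_apply, LinearMap.flip_apply, LinearMap.mulLeft_apply]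
      rw [superMul_tmul V W A v hx ht, ← TensorProduct.smul_tmul', map_smul,
        superMul_tmul (V.tensor W) W.dual A _ (A.mul_mem hx hy) hω, map_smul, map_smul,
        LinearMap.rTensor_tmul, evParity_tmul, superPair_tmul W A ω hc ht, W.parity_of_mem ht,
        map_smul]
      by_cases hij : i₁ = j₁
      · subst hij
        rw [A.super_comm hc hy]
        simp only [smul_smul, mul_smul_comm, TensorProduct.tmul_smul, ← TensorProduct.smul_tmul',
          smul_eq_mul, mul_assoc]
        have h2 : sgn k (l * i₁) * (sgn k ((l + i₂) * i₁) * sgn k i₁) =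
            sgn k (i * j) * (sgn k (j₂ * i₁) * sgn k (j₂ * i₂)) := by
          have h3 : ∀ l i₁ i₂ j₂ : ZMod 2, l * i₁ + ((l + i₂) * i₁ + i₁) =
              (i₁ + i₂) * (i₁ + j₂) + (j₂ * i₁ + j₂ * i₂) := by decide
          rw [← hi, ← hj, ← sgn_add, ← sgn_add, ← sgn_add, ← sgn_add, h3 l i₁ i₂ j₂]
        congr 1
        linear_combination ω t * h2
      · rw [dual_apply_eq_zero hij hω ht]
        simp
    rw [rmul_tmul, ← A.toSuperSpace.pr_add_pr x]
    simp only [TensorProduct.tmul_add, TensorProduct.add_tmul, map_add, add_mul, smul_add,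
      h 0 _ (A.toSuperSpace.pr_mem 0 x), h 1 _ (A.toSuperSpace.pr_mem 1 x)]

end coev

section dual_tensor

variable {k : Type u} [Field k] (V : SuperSpace.{u, w} k) (W : SuperSpace.{u, w'} k)
  (A : SCommAlg.{u, a} k)

/-- The sign twist `v ⊗ t ↦ (-1) ^ (i * j) v ⊗ t` for `v` of degree `i` and `t` of degree `j`. -/
noncomputable def tensorTwist : V ⊗[k] W →ₗ[k] V ⊗[k] W :=
  LinearMap.rTensor W (V.pr 0) + TensorProduct.map (V.pr 1) W.parity

variable {V W} in
theorem tensorTwist_tmul {i j : ZMod 2} {v : V} (hv : v ∈ V.gr i) {t : W} (ht : t ∈ W.gr j) :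
    tensorTwist V W (v ⊗ₜ[k] t) = sgn k (i * j) • (v ⊗ₜ[k] t) := by
  rw [tensorTwist, LinearMap.add_apply, LinearMap.rTensor_tmul, TensorProduct.map_tmul,
    V.pr_of_mem 0 hv, V.pr_of_mem 1 hv, W.parity_of_mem ht]
  rcases zmod2_cases i with rfl | rfl
  · simp [sgn_zero]
  · simp

theorem tensorTwist_involutive : Function.Involutive (tensorTwist V W) := by
  have h : tensorTwist V W ∘ₗ tensorTwist V W = LinearMap.id := by
    refine tensor_hom_ext fun i j v hv t ht => ?_
    rw [LinearMap.comp_apply, tensorTwist_tmul hv ht, map_smul, tensorTwist_tmul hv ht, smul_smul,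
      sgn_mul_self, one_smul, LinearMap.id_apply]
  exact LinearMap.congr_fun h

/-- The map from the tensor product of the duals of `V` and `W` to the dual of their tensor product,
with `(ξ ⊗ η)(v ⊗ t) = (-1) ^ (i * j) ξ(v) η(t)` for `ξ` of degree `i` and `η` of degree `j`. -/
noncomputable def dualTensor : V.dual ⊗[k] W.dual →ₗ[k] Module.Dual k (V ⊗[k] W) :=
  TensorProduct.dualDistrib k V W ∘ₗ tensorTwist V.dual W.dual

variable {V W} in
theorem dualTensor_tmul {i j : ZMod 2} {ξ : V.dual} (hξ : ξ ∈ V.dual.gr i) {η : W.dual}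
    (hη : η ∈ W.dual.gr j) (v : V) (t : W) :
    dualTensor V W (ξ ⊗ₜ[k] η) (v ⊗ₜ[k] t) = sgn k (i * j) * (ξ v * η t) := by
  rw [dualTensor, LinearMap.comp_apply, tensorTwist_tmul hξ hη, map_smul, LinearMap.smul_apply,
    TensorProduct.dualDistrib_apply, smul_eq_mul]

theorem dualTensor_bijective [Module.Finite k V] [Module.Finite k W] :
    Function.Bijective (dualTensor V W) :=
  (TensorProduct.dualDistribEquiv k V W).bijective.comp
    (tensorTwist_involutive V.dual W.dual).bijective

variable {V W A}

theorem superPair_dualTensor_tmul {i₁ i₂ j₁ j₂ : ZMod 2} {η : W.dual} (hη : η ∈ W.dual.gr i₁) {y : A}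
    (hy : y ∈ A.gr i₂) {v : V} (hv : v ∈ V.gr j₁) {c : A} (hc : c ∈ A.gr j₂) (s : V.dual ⊗[k] A)
    (t : W ⊗[k] A) :
    superPair (V.tensor W) A (LinearMap.rTensor A (dualTensor V W)
      (superMul V.dual W.dual A (s ⊗ₜ[k] (η ⊗ₜ[k] y))) ⊗ₜ[k]
        superMul V W A ((v ⊗ₜ[k] c) ⊗ₜ[k] t)) =
      sgn k ((i₁ + i₂) * (j₁ + j₂)) • (superPair V A (s ⊗ₜ[k] (v ⊗ₜ[k] c)) *
        superPair W A ((η ⊗ₜ[k] y) ⊗ₜ[k] t)) := by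
  have h : superPair (V.tensor W) A ∘ₗ TensorProduct.map
      (LinearMap.rTensor A (dualTensor V W) ∘ₗ superMul V.dual W.dual A ∘ₗ
        (TensorProduct.mk k _ _).flip (η ⊗ₜ[k] y))
      (superMul V W A ∘ₗ TensorProduct.mk k _ _ (v ⊗ₜ[k] c)) =
      sgn k ((i₁ + i₂) * (j₁ + j₂)) • LinearMap.mul' k A ∘ₗ TensorProduct.map
        (superPair V A ∘ₗ (TensorProduct.mk k _ _).flip (v ⊗ₜ[k] c))
        (superPair W A ∘ₗ TensorProduct.mk k _ _ (η ⊗ₜ[k] y)) := by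
    refine TensorProduct.ext (superMul_gr_ext V.dual A fun i l ξ hξ x hx =>
      superMul_gr_ext W A fun i' l' t ht z hz => ?_)
    simp only [LinearMap.compr₂ₛₗ_apply, TensorProduct.mk_apply, LinearMap.comp_apply,
      TensorProduct.map_tmul, LinearMap.flip_apply, LinearMap.smul_apply, LinearMap.mul'_apply]
    rw [superMul_tmul V.dual W.dual A ξ hx hη, superMul_tmul V W A v hc ht, map_smul,
      LinearMap.rTensor_tmul, TensorProduct.tmul_smul, ← TensorProduct.smul_tmul', map_smul,
      map_smul, superPair_tmul (V.tensor W) A _ (A.mul_mem hx hy) (tmul_mem hv ht),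
      dualTensor_tmul hξ hη, superPair_tmul V A ξ hx hv, superPair_tmul W A η hy ht]
    by_cases hi : j₁ = i
    · by_cases hi' : i' = i₁
      · subst hi hi'
        rw [mul_assoc x, ← mul_assoc y, A.super_comm hy hc]
        simp only [smul_smul, mul_smul_comm, smul_mul_assoc, mul_assoc]
        have h2 : sgn k (l * i') * (sgn k (j₂ * i') * (sgn k ((l + i₂) * (j₁ + i')) *
            (sgn k (j₁ * i') * sgn k (i₂ * j₂)))) = sgn k ((i' + i₂) * (j₁ + j₂)) *
            (sgn k (l * j₁) * sgn k (i₂ * i')) := by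
          have h3 : ∀ l i' i₂ j₁ j₂ : ZMod 2, l * i' + (j₂ * i' + ((l + i₂) * (j₁ + i') +
              (j₁ * i' + i₂ * j₂))) = (i' + i₂) * (j₁ + j₂) + (l * j₁ + i₂ * i') := by decide
          simp only [← sgn_add, h3]
        congr 1
        linear_combination ξ v * η t * h2
      · rw [dual_apply_eq_zero hi' hη ht]
        simp
    · rw [dual_apply_eq_zero hi hξ hv]
      simp
  exact LinearMap.congr_fun h (s ⊗ₜ[k] t)

theorem superPair_dualTensor (s : V.dual ⊗[k] A) (t : W ⊗[k] A) {i j : ZMod 2} {r : W.dual ⊗[k] A}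
    (hr : r ∈ tensorGr W.dual A.toSuperSpace i) {z : V ⊗[k] A}
    (hz : z ∈ tensorGr V A.toSuperSpace j) :
    superPair (V.tensor W) A (LinearMap.rTensor A (dualTensor V W)
      (superMul V.dual W.dual A (s ⊗ₜ[k] r)) ⊗ₜ[k] superMul V W A (z ⊗ₜ[k] t)) =
      sgn k (i * j) • (superPair V A (s ⊗ₜ[k] z) * superPair W A (r ⊗ₜ[k] t)) := by
  refine tensorGr_ext₂ (V := W.dual) (W := V) (f := ((TensorProduct.mk k _ _).compl₁₂
    (LinearMap.rTensor A (dualTensor V W) ∘ₗ superMul V.dual W.dual A ∘ₗ TensorProduct.mk k _ _ s)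
    (superMul V W A ∘ₗ (TensorProduct.mk k _ _).flip t)).compr₂ (superPair (V.tensor W) A))
    (g := sgn k (i * j) • (LinearMap.mul k A).flip.compl₁₂
      (superPair W A ∘ₗ (TensorProduct.mk k _ _).flip t)
      (superPair V A ∘ₗ TensorProduct.mk k _ _ s)) ?_ hr hz
  rintro i₁ i₂ rfl η hη y hy j₁ j₂ rfl v hv c hc
  exact superPair_dualTensor_tmul hη hy hv hc s t

end dual_tensor

/-! ### Representations of super groups: `V` and `V ⊗ W ⊗ W^∨`, and duals -/

section coev_hom

variable {k : Type u} [Field k] {V : SuperSpace.{u, w} k} {W : SuperSpace.{u, w'} k}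
  {A : SCommAlg.{u, a} k}

theorem contr_evRight (η : Module.Dual k V) {l : ZMod 2} {t : W} (ht : t ∈ W.gr l)
    (z : (V ⊗[k] W.dual) ⊗[k] A) :
    contr A η (LinearMap.rTensor A (evRight V W)
      (superMul (V.tensor W.dual) W A (z ⊗ₜ[k] (t ⊗ₜ[k] 1)))) =
      (A.twist l).toAlgHom (contr A (V := V.tensor W.dual)
        (TensorProduct.dualDistrib k V W.dual (η ⊗ₜ[k] Module.Dual.eval k W t)) z) := by
  have h : contr A η ∘ₗ LinearMap.rTensor A (evRight V W) ∘ₗ superMul (V.tensor W.dual) W A ∘ₗ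
      (TensorProduct.mk k _ _).flip (t ⊗ₜ[k] 1) = (A.twist l).toAlgHom.toLinearMap ∘ₗ
      contr A (V := V.tensor W.dual)
        (TensorProduct.dualDistrib k V W.dual (η ⊗ₜ[k] Module.Dual.eval k W t)) := by
    refine TensorProduct.ext (TensorProduct.ext' fun v ω => A.toSuperSpace.hom_ext fun i x hx => ?_)
    simp only [LinearMap.compr₂ₛₗ_apply, TensorProduct.mk_apply, LinearMap.comp_apply,
      LinearMap.flip_apply, AlgHom.toLinearMap_apply]
    rw [superMul_tmul (V.tensor W.dual) W A _ hx ht, map_smul, map_smul, LinearMap.rTensor_tmul,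
      evRight_tmul, contr_tmul]
    refine Eq.trans ?_ (congrArg _ (contr_tmul (V := V.tensor W.dual)
      (TensorProduct.dualDistrib k V W.dual (η ⊗ₜ[k] Module.Dual.eval k W t))
      (v ⊗ₜ[k] ω) x).symm)
    refine Eq.trans ?_ (map_smul (A.twist l).toAlgHom _ x).symm
    rw [A.twist_of_mem l hx, TensorProduct.dualDistrib_apply, mul_one, map_smul,
      Module.Dual.eval_apply, smul_smul, smul_smul, mul_comm i l]
    congr 1
    simp only [smul_eq_mul]
    ring
  exact LinearMap.congr_fun h z

/-- The elements of `V ⊗ W^∨ ⊗ A` are determined by their contractions with those of `W ⊗ A`. -/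
theorem evRight_ext [Module.Finite k V] [Module.Finite k W] {z z' : (V ⊗[k] W.dual) ⊗[k] A}
    (h : ∀ t : W ⊗[k] A, LinearMap.rTensor A (evRight V W)
      (superMul (V.tensor W.dual) W A (z ⊗ₜ[k] t)) = LinearMap.rTensor A (evRight V W)
      (superMul (V.tensor W.dual) W A (z' ⊗ₜ[k] t))) : z = z' := by
  have h1 : ∀ (η : Module.Dual k V) (l : ZMod 2), ∀ t ∈ W.gr l, contr A (V := V.tensor W.dual)
      (TensorProduct.dualDistrib k V W.dual (η ⊗ₜ[k] Module.Dual.eval k W t)) z =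
      contr A (V := V.tensor W.dual)
      (TensorProduct.dualDistrib k V W.dual (η ⊗ₜ[k] Module.Dual.eval k W t)) z' := by
    intro η l t ht
    rw [← A.twist_twist l (contr A (V := V.tensor W.dual) _ z), ← contr_evRight η ht, h,
      contr_evRight η ht, A.twist_twist]
  refine contr_ext (V := V.tensor W.dual) fun ξ => ?_
  obtain ⟨ξ, rfl⟩ := (TensorProduct.dualDistribEquiv k V W.dual).surjective ξ
  induction ξ using TensorProduct.induction_on with
  | zero => rw [map_zero]; simp [contr]
  | add ξ ξ' h2 h3 => rw [map_add, contr_add, contr_add, h2, h3]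
  | tmul η θ =>
    obtain ⟨t, rfl⟩ := (Module.evalEquiv k W).surjective θ
    have h2 : ∀ z, contr A (V := V.tensor W.dual) (TensorProduct.dualDistrib k V W.dual
        (η ⊗ₜ[k] Module.Dual.eval k W t)) z = contr A (V := V.tensor W.dual)
        (TensorProduct.dualDistrib k V W.dual (η ⊗ₜ[k] Module.Dual.eval k W (W.pr 0 t))) z +
        contr A (V := V.tensor W.dual) (TensorProduct.dualDistrib k V W.dual
        (η ⊗ₜ[k] Module.Dual.eval k W (W.pr 1 t))) z := by
      intro z
      rw [← contr_add, ← map_add, ← TensorProduct.tmul_add, ← map_add, W.pr_add_pr]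
    exact (h2 z).trans ((congrArg₂ _ (h1 η 0 _ (W.pr_mem 0 t)) (h1 η 1 _ (W.pr_mem 1 t))).trans
      (h2 z').symm)

variable (V W) in
/-- The map `v ↦ ∑ (v ⊗ t i) ⊗ ω i`, where `t i` and `ω i` are dual bases of `W` and its dual. -/
noncomputable def coevRight [Module.Finite k W] : V →ₗ[k] (V ⊗[k] W) ⊗[k] W.dual :=
  ∑ i, (TensorProduct.mk k _ _).flip ((Module.finBasis k W).coord i) ∘ₗ
    (TensorProduct.mk k V W).flip (Module.finBasis k W i)

theorem coevRight_apply [Module.Finite k W] (v : V) : coevRight V W v =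
    ∑ i, (v ⊗ₜ[k] Module.finBasis k W i) ⊗ₜ[k] (Module.finBasis k W).coord i := by
  rw [coevRight, LinearMap.sum_apply]
  rfl

theorem evRight_coevRight [Module.Finite k W] (v : V) (t : W) :
    evRight (V.tensor W) W (coevRight V W v ⊗ₜ[k] t) = v ⊗ₜ[k] t := by
  rw [coevRight_apply, TensorProduct.sum_tmul, map_sum]
  conv_rhs => rw [← (Module.finBasis k W).sum_repr t, TensorProduct.tmul_sum]
  refine Finset.sum_congr rfl fun i _ => ?_
  rw [evRight_tmul, TensorProduct.tmul_smul]
  rfl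

/-- Over `A`, the contraction of `coevRight` with `t` is the product with `t`. -/
theorem rTensor_evRight_coevRight [Module.Finite k W] (z : V ⊗[k] A) (t : W ⊗[k] A) :
    LinearMap.rTensor A (evRight (V.tensor W) W) (superMul ((V.tensor W).tensor W.dual) W A
      (LinearMap.rTensor A (coevRight V W) z ⊗ₜ[k] t)) = superMul V W A (z ⊗ₜ[k] t) := by
  have h : LinearMap.rTensor A (evRight (V.tensor W) W) ∘ₗ
      superMul ((V.tensor W).tensor W.dual) W A ∘ₗ
      LinearMap.rTensor (W ⊗[k] A) (LinearMap.rTensor A (coevRight V W)) = superMul V W A := by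
    refine TensorProduct.ext (superMul_gr_ext V A fun i j v hv x hx =>
      superMul_gr_ext W A fun l l' t ht y hy => ?_)
    simp only [LinearMap.compr₂ₛₗ_apply, TensorProduct.mk_apply, LinearMap.comp_apply,
      LinearMap.rTensor_tmul]
    rw [superMul_tmul ((V.tensor W).tensor W.dual) W A _ hx ht, map_smul, LinearMap.rTensor_tmul,
      evRight_coevRight, superMul_tmul V W A v hx ht]
  exact LinearMap.congr_fun h (z ⊗ₜ[k] t)

end coev_hom

section group

variable {k : Type u} [Field k] {V : SuperSpace.{u, w} k} {W : SuperSpace.{u, w'} k}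

section
variable {G : SuperMonoid.{u, a, b} k} (hG : G.IsGroup) (ρ : Rep G V) (σ : Rep G W)
  {A : SCommAlg.{u, a} k} (g : G.pts A)

theorem evRight_act (z : (V ⊗[k] W.dual) ⊗[k] A) (t : W ⊗[k] A) :
    LinearMap.rTensor A (evRight V W) (superMul (V.tensor W.dual) W A
      (((ρ.tensor (σ.dual hG)).act A g).1 z ⊗ₜ[k] (σ.act A g).1 t)) =
      (ρ.act A g).1 (LinearMap.rTensor A (evRight V W)
        (superMul (V.tensor W.dual) W A (z ⊗ₜ[k] t))) := by
  have h : LinearMap.rTensor A (evRight V W) ∘ₗ superMul (V.tensor W.dual) W A ∘ₗ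
      (TensorProduct.mk k _ _).flip ((σ.act A g).1 t) ∘ₗ ((ρ.tensor (σ.dual hG)).act A g).1 =
      (ρ.act A g).1 ∘ₗ LinearMap.rTensor A (evRight V W) ∘ₗ superMul (V.tensor W.dual) W A ∘ₗ
      (TensorProduct.mk k _ _).flip t := by
    refine superMul_ext fun z s => ?_
    simp only [LinearMap.comp_apply, LinearMap.flip_apply, TensorProduct.mk_apply]
    rw [Rep.tensor_act, rTensor_evRight, rTensor_evRight, Rep.superPair_dual_act,
      (ρ.act A g).2.1]
  exact LinearMap.congr_fun h z

theorem evParity_act (z : ((V ⊗[k] W) ⊗[k] W.dual) ⊗[k] A) :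
    LinearMap.rTensor A (evParity V W) ((((ρ.tensor σ).tensor (σ.dual hG)).act A g).1 z) =
      (ρ.act A g).1 (LinearMap.rTensor A (evParity V W) z) := by
  have h : LinearMap.rTensor A (evParity V W) ∘ₗ
      (((ρ.tensor σ).tensor (σ.dual hG)).act A g).1 =
      (ρ.act A g).1 ∘ₗ LinearMap.rTensor A (evParity V W) := by
    refine superMul_hom_ext fun i j z' _ s hs => ?_
    have h1 : LinearMap.rTensor A (evParity V W) ∘ₗ
        (((ρ.tensor σ).tensor (σ.dual hG)).act A g).1 ∘ₗ superMul (V.tensor W) W.dual A ∘ₗ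
        (TensorProduct.mk k _ _).flip s = (ρ.act A g).1 ∘ₗ LinearMap.rTensor A (evParity V W) ∘ₗ
        superMul (V.tensor W) W.dual A ∘ₗ (TensorProduct.mk k _ _).flip s := by
      refine superMul_hom_ext fun i j z _ t ht => ?_
      simp only [LinearMap.comp_apply, LinearMap.flip_apply, TensorProduct.mk_apply]
      rw [Rep.tensor_act, Rep.tensor_act, rTensor_evParity V z ht hs,
        rTensor_evParity V _ ((σ.act A g).2.2 _ _ ht) (((σ.dual hG).act A g).2.2 _ _ hs),
        Rep.superPair_dual_act, map_smul, (ρ.act A g).2.1]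
    exact LinearMap.congr_fun h1 z'
  exact LinearMap.congr_fun h z

/-- The map `coevRight` is equivariant, since it is determined by its contractions (`evRight_ext`),
which are equivariant. -/
theorem coevRight_act [Module.Finite k V] [Module.Finite k W] (z : V ⊗[k] A) :
    LinearMap.rTensor A (coevRight V W) ((ρ.act A g).1 z) =
      (((ρ.tensor σ).tensor (σ.dual hG)).act A g).1 (LinearMap.rTensor A (coevRight V W) z) := by
  have : Module.Finite k (V.tensor W) := inferInstanceAs (Module.Finite k (V ⊗[k] W))
  refine evRight_ext (V := V.tensor W) fun t => ?_
  obtain ⟨t, rfl⟩ := Rep.act_surjective hG σ g t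
  rw [rTensor_evRight_coevRight, evRight_act, rTensor_evRight_coevRight, Rep.tensor_act]

end

variable [CharZero k] {G : SuperMonoid.{u, max u v, b} k} (hG : G.IsGroup) (ρ : Rep G V)
  (σ : Rep G W)

/-- For `W ≠ 0`, the representation `V` is a subrepresentation and a quotient of
`V ⊗ W ⊗ W^∨`. -/
theorem Rep.detectedBy_tensor_dual [Nontrivial W] :
    ρ.DetectedBy fun _ : Unit => (ρ.tensor σ).tensor (σ.dual hG) where
  cogen v hv := by
    have := ρ.finite
    have := σ.finite
    refine ⟨(), Rep.Hom.mk' (coevRight V W) fun A g v => ?_, fun h => ?_⟩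
    · rw [coevRight_act hG ρ σ g, LinearMap.rTensor_tmul]
    · obtain ⟨t, ht⟩ := exists_ne (0 : W)
      have h1 := evRight_coevRight v t
      have h2 : coevRight V W v = 0 := h
      rw [h2, TensorProduct.zero_tmul, map_zero] at h1
      obtain ⟨ω, hω⟩ := Module.Projective.exists_dual_ne_zero k ht
      have h3 := congrArg (TensorProduct.rid k V ∘ LinearMap.lTensor V ω) h1
      rw [Function.comp_apply, Function.comp_apply, map_zero, map_zero, LinearMap.lTensor_tmul,
        TensorProduct.rid_tmul] at h3
      exact (smul_ne_zero hω hv) h3.symm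
  gen ξ hξ := by
    refine ⟨(), Rep.Hom.mk' (evParity V W) fun A g z => ?_, fun h => hξ (LinearMap.ext fun v => ?_)⟩
    · rw [evParity_act hG ρ σ g, LinearMap.rTensor_tmul]
    · obtain ⟨t, ht⟩ := exists_ne (0 : W)
      obtain ⟨ω, hω⟩ := Module.Projective.exists_dual_ne_zero k ht
      have h1 := LinearMap.congr_fun h ((v ⊗ₜ[k] W.parity t) ⊗ₜ[k] ω)
      have h2 : ξ (evParity V W ((v ⊗ₜ[k] W.parity t) ⊗ₜ[k] ω)) = 0 := h1
      rw [evParity_tmul, W.parity_parity, map_smul, smul_eq_mul] at h2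
      exact (mul_eq_zero.1 h2).resolve_left hω

variable {I : Type*} {X : I → SuperSpace.{u, u} k} {R : ∀ i, Rep G (X i)}

/-- The trivial representation is its own dual. -/
theorem Rep.exists_hom_dual_unit :
    ∃ F : ((Rep.unit G).dual hG).Hom (Rep.unit G), Function.Bijective F.toLinearMap := by
  refine ⟨Rep.Hom.mk' (Module.Dual.eval k k 1) fun A g ξ => ?_,
    (LinearMap.ringLmapEquivSelf k k k).bijective⟩
  have h : ((Rep.unit G).dual hG).act A g = 1 := Subtype.ext dualEnd_one
  rw [h]
  rfl

/-- The dual of a tensor product is the tensor product of the duals. -/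
theorem Rep.exists_hom_dual_tensor :
    ∃ F : ((ρ.dual hG).tensor (σ.dual hG)).Hom ((ρ.tensor σ).dual hG),
      Function.Bijective F.toLinearMap := by
  have := ρ.finite
  have := σ.finite
  refine ⟨Rep.Hom.mk' (dualTensor V W) fun A g ζ => ?_, dualTensor_bijective V W⟩
  have h : LinearMap.rTensor A (dualTensor V W) ∘ₗ
      (((ρ.dual hG).tensor (σ.dual hG)).act A g).1 =
      (((ρ.tensor σ).dual hG).act A g).1 ∘ₗ LinearMap.rTensor A (dualTensor V W) := by
    refine superMul_hom_ext (V := V.dual) (W := W.dual) (X := (V.tensor W).dual ⊗[k] A)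
      fun i j s _ r hr => ?_
    have : Module.Finite k (V.tensor W) := inferInstanceAs (Module.Finite k (V ⊗[k] W))
    refine superPair_ext (V := V.tensor W) fun q => ?_
    obtain ⟨q, rfl⟩ := Rep.act_surjective hG (ρ.tensor σ) g q
    simp only [LinearMap.comp_apply]
    rw [Rep.superPair_dual_act, Rep.tensor_act]
    have h1 : superPair (V.tensor W) A ∘ₗ
        TensorProduct.mk k ((V.tensor W).dual ⊗[k] A) ((V ⊗[k] W) ⊗[k] A)
          (LinearMap.rTensor A (dualTensor V W) (superMul V.dual W.dual A (((ρ.dual hG).act A g).1 s ⊗ₜ[k]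
            ((σ.dual hG).act A g).1 r))) ∘ₗ
        ((ρ.tensor σ).act A g).1 = superPair (V.tensor W) A ∘ₗ
        TensorProduct.mk k ((V.tensor W).dual ⊗[k] A) ((V ⊗[k] W) ⊗[k] A)
          (LinearMap.rTensor A (dualTensor V W) (superMul V.dual W.dual A (s ⊗ₜ[k] r))) := by
      refine superMul_hom_ext fun i j z hz t _ => ?_
      simp only [LinearMap.comp_apply, TensorProduct.mk_apply]
      rw [Rep.tensor_act, superPair_dualTensor _ _ hr hz, superPair_dualTensor _ _
        (((σ.dual hG).act A g).2.2 _ _ hr) ((ρ.act A g).2.2 _ _ hz), Rep.superPair_dual_act,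
        Rep.superPair_dual_act]
    exact LinearMap.congr_fun h1 q
  exact LinearMap.congr_fun h (ζ ⊗ₜ[k] 1)

theorem Rep.dual_tensorList_detectedBy (l : List I) :
    ((Rep.tensorList R l).dual hG).DetectedBy (Rep.tensorList fun i => (R i).dual hG) := by
  induction l with
  | nil =>
    obtain ⟨F, hF⟩ := Rep.exists_hom_dual_unit (k := k) hG
    exact Rep.detectedBy_of_bijective (R := Rep.tensorList fun i => (R i).dual hG) (i := []) F hF
  | cons i l ih =>
    obtain ⟨F, hF⟩ := Rep.exists_hom_dual_tensor hG (R i) (Rep.tensorList R l)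
    have h1 := Rep.detectedBy_of_bijective
      (R := fun _ : Unit => ((R i).dual hG).tensor ((Rep.tensorList R l).dual hG)) (i := ())
      (F.inv hF) (LinearEquiv.ofBijective F.toLinearMap hF).symm.bijective
    refine (h1.trans fun _ =>
      (Rep.detectedBy_self (R := fun i => (R i).dual hG) i).tensor ih).trans fun j => ?_
    exact Rep.detectedBy_self (R := Rep.tensorList fun i => (R i).dual hG) (j.1 :: j.2)

end group

section families

variable {k : Type u} [Field k] {Γ : Type v} {m n : Γ → ℕ}

theorem Rep.tensorList_res {M : SuperMonoid.{u, a, b} k} {M' : SuperMonoid.{u, a, b'} k}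
    {X : Γ → SuperSpace.{u, u} k} (ρ : ∀ γ, Rep M' (X γ)) (h : M.Hom M') (l : List Γ) :
    (Rep.tensorList ρ l).res h = Rep.tensorList (fun γ => (ρ γ).res h) l := by
  induction l with
  | nil => rfl
  | cons γ l ih =>
    change ((ρ γ).res h).tensor ((Rep.tensorList ρ l).res h) = _
    rw [ih]
    rfl

/-- The representations of `GL_{m|n}` are detected by the mixed tensor representations. -/
theorem superGL_detectedBy [CharZero k] {V : SuperSpace.{u, w} k}
    (ρ : Rep (superGL.{u, v, max u v} k m n) V) :
    ρ.DetectedBy fun i : List Γ × List Γ => mixedRep k m n i.1 i.2 := by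
  obtain ⟨W, σ, hW, τ, hτ⟩ := exists_tensor_extension ρ
  have hG := superGL_isGroup.{u, v, max u v} k m n
  have hres : ∀ {U : SuperSpace.{u, max u w} k} (τ : Rep (superM.{u, v, max u v} k m n) U),
      (τ.res (superGL.toM k m n)).DetectedBy (Rep.tensorList (stdRepGL k m n)) := by
    intro U τ
    have h := (superM_detectedBy τ).res (superGL.toM k m n)
    simp only [Rep.tensorList_res] at h
    exact h
  have hres' := (superM_detectedBy σ).res (superGL.toM k m n)
  simp only [Rep.tensorList_res] at hres'
  have h1 := hres τ
  rw [hτ] at h1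
  have h2 := (hres'.dual hG).trans fun l => Rep.dual_tensorList_detectedBy hG l
  exact (ρ.detectedBy_tensor_dual hG (σ.res (superGL.toM k m n))).trans fun _ => h1.tensor h2

end families

end SuperGL

theorem theoremt {k : Type u} [Field k] [CharZero k] {Γ : Type v} (m n : Γ → ℕ)
    (V : SuperGL.SuperSpace.{u, w} k) (ρ : SuperGL.Rep (SuperGL.superGL.{u, v, max u v} k m n) V) :
    (∃ (W : SuperGL.SuperSpace.{u, u} k) (σ : SuperGL.Rep (SuperGL.superM.{u, v, max u v} k m n) W),
      Nontrivial W ∧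
      ∃ τ : SuperGL.Rep (SuperGL.superM.{u, v, max u v} k m n) (V.tensor W),
        τ.res (SuperGL.superGL.toM k m n) = ρ.tensor (σ.res (SuperGL.superGL.toM k m n))) ∧
    (∃ (N : ℕ) (r s : Fin N → List Γ)
      (f : ρ.Hom (SuperGL.Rep.directSum fun i => SuperGL.mixedRep k m n (r i) (s i))),
      Function.Injective f.toLinearMap) ∧
    (∃ (N : ℕ) (r s : Fin N → List Γ)
      (f : (SuperGL.Rep.directSum fun i => SuperGL.mixedRep k m n (r i) (s i)).Hom ρ),
      Function.Surjective f.toLinearMap) := by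
  refine ⟨SuperGL.exists_tensor_extension ρ, ?_, ?_⟩
  · obtain ⟨N, i, F, hF⟩ := (SuperGL.superGL_detectedBy ρ).exists_injective
    exact ⟨N, fun j => (i j).1, fun j => (i j).2, F, hF⟩
  · obtain ⟨N, i, F, hF⟩ := (SuperGL.superGL_detectedBy ρ).exists_surjective
    exact ⟨N, fun j => (i j).1, fun j => (i j).2, F, hF⟩
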